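/- Let $\mathbb K$ be a field of characteristic $0$ and $N\ge 1$; write $[N]=\{1,\dots,N\}$. Parities lie in $\mathbb Z/2$; $p(x)$ is the parity of a homogeneous element, and formulas are extended linearly. **Supermodules and polynomials.** Let $V=(V,\nabla)=(V,T,S^1,\dots,S^N)$ be a left supermodule over the superalgebra $\mathcal H_K$ generated by an even $T$ and odd $S^i$ with $TS^i=S^iT$, $S^iS^j+S^jS^i=2\delta_{ij}T$. $\Pi^qV$ denotes $V$ with the parity shifted by $q$ and the same operators. $\mathbb K[\Lambda_k]_{k=1}^n$ is the superalgebra generated by even central $\lambda_k$ and odd $\theta_k^i$ with $\theta_k^i\theta_l^j+\theta_l^j\theta_k^i=-2\delta_{kl}\delta_{ij}\lambda_k$. It has the basis of ordered monomials $\prod_k\lambda_k^{m_k}\prod_{(k,i)\in I}\theta_k^i$ (the $\theta$'s in increasing lexicographic order of $(k,i)$); $\partial_{\lambda_k}$ and $\partial_{\theta_k^i}$ are the partial (left) derivatives in this basis. For one supervariable $\Lambda=(\lambda,\theta^1,\dots,\theta^N)$ the monomials are written $\Lambda^{m|I}=\lambda^m\theta^I$. Put $V[\Lambda_k]_{k=1}^n=\mathbb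 K[\Lambda_k]_{k=1}^n\otimes V$; here $T$ acts by $T(av)=a\,Tv$ and $S^i$ by $S^i(av)=[-\sum_k\theta^i_k,a]\,v+(-1)^{p(a)}a\,S^iv$ (supercommutator). Let $V_\nabla[\Lambda_k]_{k=1}^n=\mathbb K[\Lambda_k]_{k=1}^n\otimes_{\mathcal H_K}V$, where $a\cdot T=-a\sum_k\lambda_k$, $a\cdot S^i=-a\sum_k\theta_k^i$; the substitution $\Lambda_n=-\Lambda_1-\dots-\Lambda_{n-1}-\nabla$ identifies it with $V[\Lambda_k]_{k=1}^{n-1}$ for $n\ge1$. **Non-unital $N_K=N$ SUSY vertex algebras.** Such a structure on $(V,\nabla)$ is a linear map $[\cdot_\Lambda\cdot]\colon V\otimes V\to V[\Lambda]$ of parity $\overline N$ and an even linear map $V\otimes V\to V$, $a\otimes b\mapsto ab$, such that for homogeneous $a,b,c\in V$ and $i\in[N]$: * $[S^ia_\Lambda b]=-(-1)^N\theta^i[a_\Lambda b]$ and $[a_\Lambda S^ib]=(-1)^{p(a)+N}(\theta^i+S^i)[a_\Lambda b]$; * $[b_\Lambda a]=-(-1)^{p(a)p(b)+N}[a_{-\Lambda-\nabla}b]$;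 * $[a_{\Lambda_1}[b_{\Lambda_2}c]]=(-1)^{p(a)N+N}[[a_{\Lambda_1}b]_{\Lambda_1+\Lambda_2}c]+(-1)^{(p(a)+N)(p(b)+N)}[b_{\Lambda_2}[a_{\Lambda_1}c]]$; * $S^i(ab)=(S^ia)b+(-1)^{p(a)}a(S^ib)$; * $ab-(-1)^{p(a)p(b)}ba=\int_{-T}^0d\Lambda\,[a_\Lambda b]$; * $(ab)c-a(bc)=\bigl(\int_0^Td\Lambda\,a\bigr)[b_\Lambda c]+(-1)^{p(a)p(b)}\bigl(\int_0^Td\Lambda\,b\bigr)[a_\Lambda c]$; * $[a_\Lambda bc]=[a_\Lambda b]c+(-1)^{(p(a)+N)p(b)}b[a_\Lambda c]+\int_0^\lambda d\Gamma\,[[a_\Lambda b]_\Gamma c]$. Here $\int_F^Gd\Lambda\,\Lambda^{m|I}v=\frac{\delta_{I,[N]}}{m+1}(G^{m+1}v-F^{m+1}v)$, $\bigl(\int_0^Td\Lambda\,a\bigr)\Lambda^{m|I}v=\bigl(\int_0^Td\Lambda\,\Lambda^{m|I}a\bigr)v$, and brackets (of parity $\overline N$), products (even) and integrals over $d\Gamma$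 (of parity $\overline N$) are extended to polynomial coefficients with the Koszul sign rule: $[a_{\Lambda_1}\alpha c]=(-1)^{(p(a)+N)p(\alpha)}\alpha[a_{\Lambda_1}c]$, $[(\alpha a)_\Gamma c]=(-1)^{Np(\alpha)}\alpha[a_\Gamma c]$, $b(\alpha c)=(-1)^{p(b)p(\alpha)}\alpha(bc)$, $(\alpha b)c=\alpha(bc)$. **The $N_K=N$ SUSY chiral operad.** For supercommuting variables $z_k$ (even), $\zeta_k^i$ (odd), $k=1,\dots,n$, put $$z_{k,l}=z_k-z_l+\sum_i\zeta_k^i\zeta_l^i,\quad \zeta_{k,l}^i=\zeta_k^i-\zeta_l^i,\quad D_{\zeta_k^i}=\partial_{\zeta_k^i}-\zeta_k^i\partial_{z_k}.$$ Let $\mathcal O_n^{\star\mathrm T}=\mathbb K[z_{k,l}^{\pm1},\zeta_{k,l}^i]$, a subalgebra of $\mathbb K[z_k,\zeta_k^i][z_{k,l}^{-1}]$, and let $\mathcal D_n^{\mathrm T}$ be the algebra of differential operators generated by all $z_{k,l},\zeta_{k,l}^i,\partial_{z_k},D_{\zeta_k^i}$. It acts from the right on $V^{\otimes n}\otimes\mathcal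 O_n^{\star\mathrm T}$ by right multiplication by $z_{k,l},\zeta_{k,l}^i$ and $$(v\otimes f)\cdot\partial_{z_k}=T^{(k)}v\otimes f-v\otimes\partial_{z_k}f,\qquad (v\otimes f)\cdot D_{\zeta_k^i}=(-1)^{p(v)+p(f)}(S^i)^{(k)}v\otimes f-(-1)^{p(f)}v\otimes D_{\zeta_k^i}f,$$ where $\varphi^{(k)}$ is $\varphi$ acting on the $k$-th tensor factor (with Koszul sign), and on $V_\nabla[\Lambda_k]_{k=1}^n$ by $$x\cdot z_{k,l}=\bigl(\partial_{\lambda_l}-\partial_{\lambda_k}+\textstyle\sum_i\partial_{\theta_k^i}\partial_{\theta_l^i}\bigr)x,\quad x\cdot\zeta_{k,l}^i=(-1)^{p(x)}(\partial_{\theta_k^i}-\partial_{\theta_l^i})x,\quad x\cdot\partial_{z_k}=-\lambda_kx,\quad x\cdot D_{\zeta_k^i}=-(-1)^{p(x)}\theta_k^ix .$$ Let $P^{\mathrm{ch},K}_V(n)=\operatorname{Hom}_{\mathcal D_n^{\mathrm T}}\bigl(V^{\otimes n}\otimes\mathcal O_n^{\star\mathrm T},V_\nabla[\Lambda_k]_{k=1}^n\bigr)$,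 a superspace, on which $\sigma\in\mathfrak S_n$ acts from the right by $X^\sigma(v\otimes f)=X_{\sigma(\Lambda_1,\dots,\Lambda_n)}(\sigma v\otimes\sigma f)$ with $\sigma(\Lambda_1,\dots,\Lambda_n)=(\Lambda_{\sigma^{-1}(1)},\dots,\Lambda_{\sigma^{-1}(n)})$, $\sigma v$ the permutation $v_{\sigma^{-1}(1)}\otimes\dots\otimes v_{\sigma^{-1}(n)}$ with Koszul sign, and $(\sigma f)(Z_1,\dots,Z_n)=f(Z_{\sigma(1)},\dots,Z_{\sigma(n)})$. For a homogeneous $X\in P^{\mathrm{ch},K}_V(m+1)$ and $Y\in P^{\mathrm{ch},K}_V(n+1)$, the composition $X\circ_1Y\in P^{\mathrm{ch},K}_V(n+1+m)$ is the linear map with the following values. Let $w\in V^{\otimes(n+1)}$, $v'\in V^{\otimes m}$, and $f=f_0f_1\in\mathcal O^{\star\mathrm T}_{n+1+m}$, where $f_0$ has no pole at $z_{k,l}=0$ for $k,l\le n+1$ and $f_1$ is a product of $z_{k,l}^{-1}$ with $k,l\le n+1$. Expand $Y_{\Lambda_1,\dots,\Lambda_n,-\Lambda_1-\dots-\Lambda_n-\nabla}(w\otimes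 f_1)$ in ordered monomials $\prod\lambda_k^{m_k}\prod\theta_k^i\,c$ with $c\in V$; in each of them replace $\lambda_k$ by $\lambda_k-\partial_{z_k}$ and $\theta_k^i$ by $\theta_k^i-D_{\zeta_k^i}$ and apply the resulting operator, with Koszul signs, to $1\otimes(c\otimes v')\otimes f_0$; in the result replace every term $a\otimes u\otimes g$ by $(-1)^{p(a)p(X)}a\,X_{\Lambda_1+\dots+\Lambda_{n+1},\Lambda_{n+2},\dots,\Lambda_{n+1+m}}(u\otimes g')$, where $g'$ is $g$ with $Z_1,\dots,Z_{n+1}$ identified to one variable. Put $X\square Y=\sum_\sigma(X\circ_1Y)^{\sigma^{-1}}$ over the $(n+1,m)$-shuffles $\sigma$. The set $\mathrm{MC}\bigl(L(P^{\mathrm{ch},K}_{V})\bigr)_{\bar1}$ of odd Maurer–Cartan elements consists of the odd $X\in P^{\mathrm{ch},K}_{V}(2)$ with $X^\sigma=X$ for all $\sigma\in\mathfrak S_2$ and $X\square X=0$. **Theorem.** 1. For $X\in\mathrm{MC}\bigl(L(P^{\mathrm{ch},K}_{\Pi^{N+1}V})\bigr)_{\bar1}$, the maps $$[a_\Lambda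 b]_X=(-1)^{p(a)(N+1)}X_{\Lambda,-\Lambda-\nabla}(a\otimes b\otimes1),\qquad \mu_X(a\otimes b)=(-1)^{p(a)(N+1)+1}\operatorname{Res}_\Lambda\bigl(\lambda^{-1}X_{\Lambda,-\Lambda-\nabla}(a\otimes b\otimes z_{1,2}^{-1})\bigr)$$ ($p(a)$ the parity of $a$ in $V$, and $\operatorname{Res}_\Lambda\Lambda^{m|I}v=\delta_{m,-1}\delta_{I,[N]}v$) are a non-unital $N_K=N$ SUSY vertex algebra structure on $(V,\nabla)$. 2. The map $X\mapsto([\cdot_\Lambda\cdot]_X,\mu_X)$ is a bijection from $\mathrm{MC}\bigl(L(P^{\mathrm{ch},K}_{\Pi^{N+1}V})\bigr)_{\bar1}$ onto the set of non-unital $N_K=N$ SUSY vertex algebra structures on $(V,\nabla)$. -/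

import Mathlib

open scoped TensorProduct

namespace SusyK

/-- Letters for the supervariables `Λ_k = (λ_k, θ_k^1, …, θ_k^N)`, `k ∈ Fin n`. -/
inductive LamGen (n N : ℕ) : Type
  | lam (k : Fin n)
  | theta (k : Fin n) (i : Fin N)

/-- The defining relations of the polynomial superalgebra. -/
inductive KPolyRel (K : Type*) [Field K] (n N : ℕ) :
    FreeAlgebra K (LamGen n N) → FreeAlgebra K (LamGen n N) → Prop
  | lam_lam (k l : Fin n) : KPolyRel K n N
      (FreeAlgebra.ι K (LamGen.lam k) * FreeAlgebra.ι K (LamGen.lam l))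
      (FreeAlgebra.ι K (LamGen.lam l) * FreeAlgebra.ι K (LamGen.lam k))
  | lam_theta (k l : Fin n) (i : Fin N) : KPolyRel K n N
      (FreeAlgebra.ι K (LamGen.lam k) * FreeAlgebra.ι K (LamGen.theta l i))
      (FreeAlgebra.ι K (LamGen.theta l i) * FreeAlgebra.ι K (LamGen.lam k))
  | theta_theta (k l : Fin n) (i j : Fin N) : KPolyRel K n N
      (FreeAlgebra.ι K (LamGen.theta k i) * FreeAlgebra.ι K (LamGen.theta l j) +
        FreeAlgebra.ι K (LamGen.theta l j) * FreeAlgebra.ι K (LamGen.theta k i))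
      (if k = l ∧ i = j then (-2 : K) • FreeAlgebra.ι K (LamGen.lam k) else 0)

/-- The `N_K = N` polynomial superalgebra `K[Λ_k]_{k=1}^n`: even generators `λ_k` and odd generators
`θ_k^i`, where the `λ_k` are central and `θ_k^i θ_l^j + θ_l^j θ_k^i = -2 δ_{kl} δ_{ij} λ_k`. -/
def KPoly (K : Type*) [Field K] (n N : ℕ) : Type _ := RingQuot (KPolyRel K n N)

noncomputable section

namespace KPoly

variable {K : Type*} [Field K] {n m N : ℕ}

instance : Ring (KPoly K n N) := inferInstanceAs (Ring (RingQuot (KPolyRel K n N)))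

instance : Algebra K (KPoly K n N) := inferInstanceAs (Algebra K (RingQuot (KPolyRel K n N)))

def lam (k : Fin n) : KPoly K n N :=
  RingQuot.mkAlgHom K (KPolyRel K n N) (FreeAlgebra.ι K (LamGen.lam k))

def theta (k : Fin n) (i : Fin N) : KPoly K n N :=
  RingQuot.mkAlgHom K (KPolyRel K n N) (FreeAlgebra.ι K (LamGen.theta k i))

theorem lam_lam (k l : Fin n) : (lam k * lam l : KPoly K n N) = lam l * lam k := by
  have := RingQuot.mkAlgHom_rel K (KPolyRel.lam_lam (K := K) (N := N) k l)
  rw [map_mul, map_mul] at this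
  exact this

theorem lam_theta (k l : Fin n) (i : Fin N) :
    (lam k * theta l i : KPoly K n N) = theta l i * lam k := by
  have := RingQuot.mkAlgHom_rel K (KPolyRel.lam_theta (K := K) k l i)
  rw [map_mul, map_mul] at this
  exact this

theorem theta_theta (k l : Fin n) (i j : Fin N) :
    (theta k i * theta l j + theta l j * theta k i : KPoly K n N) =
      if k = l ∧ i = j then (-2 : K) • lam k else 0 := by
  have := RingQuot.mkAlgHom_rel K (KPolyRel.theta_theta (K := K) k l i j)
  rw [map_add, map_mul, map_mul, apply_ite (RingQuot.mkAlgHom K (KPolyRel K n N)), map_smul,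
    map_zero] at this
  exact this

/-- The universal property: a family of elements of a `K`-algebra that satisfies the relations of
a family of supervariables defines an algebra homomorphism. -/
def lift {A : Type*} [Ring A] [Algebra K A] (l : Fin n → A) (t : Fin n → Fin N → A)
    (h₁ : ∀ k k', l k * l k' = l k' * l k) (h₂ : ∀ k k' i, l k * t k' i = t k' i * l k)
    (h₃ : ∀ k k' i j, t k i * t k' j + t k' j * t k i =
      if k = k' ∧ i = j then (-2 : K) • l k else 0) : KPoly K n N →ₐ[K] A :=
  RingQuot.liftAlgHom K ⟨FreeAlgebra.lift K (fun g => LamGen.rec l t g), by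
    intro x y h
    cases h with
    | lam_lam k k' => simpa using h₁ k k'
    | lam_theta k k' i => simpa using h₂ k k' i
    | theta_theta k k' i j =>
      have := h₃ k k' i j
      split_ifs at this ⊢ with h <;> simpa using this⟩

section
variable {A : Type*} [Ring A] [Algebra K A] (l : Fin n → A) (t : Fin n → Fin N → A)
    (h₁ : ∀ k k', l k * l k' = l k' * l k) (h₂ : ∀ k k' i, l k * t k' i = t k' i * l k)
    (h₃ : ∀ k k' i j, t k i * t k' j + t k' j * t k i =
      if k = k' ∧ i = j then (-2 : K) • l k else 0)

@[simp] theorem lift_lam (k : Fin n) : lift l t h₁ h₂ h₃ (lam k) = l k := by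
  exact (RingQuot.liftAlgHom_mkAlgHom_apply K _ _ _).trans (by simp)

@[simp] theorem lift_theta (k : Fin n) (i : Fin N) : lift l t h₁ h₂ h₃ (theta k i) = t k i := by
  exact (RingQuot.liftAlgHom_mkAlgHom_apply K _ _ _).trans (by simp)
end

@[elab_as_elim]
theorem induction {C : KPoly K n N → Prop} (h0 : ∀ r, C (algebraMap K _ r))
    (hl : ∀ k, C (lam k)) (ht : ∀ k i, C (theta k i))
    (hm : ∀ a b, C a → C b → C (a * b)) (ha : ∀ a b, C a → C b → C (a + b)) (a) : C a := by
  obtain ⟨x, rfl⟩ := RingQuot.mkAlgHom_surjective K (KPolyRel K n N) a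
  induction x using FreeAlgebra.induction with
  | grade0 r => rw [AlgHom.commutes]; exact h0 r
  | grade1 g => cases g with
    | lam k => exact hl k
    | theta k i => exact ht k i
  | mul a b iha ihb => rw [map_mul]; exact hm _ _ iha ihb
  | add a b iha ihb => rw [map_add]; exact ha _ _ iha ihb

theorem lam_comm (k : Fin n) (a : KPoly K n N) : lam k * a = a * lam k := by
  induction a using KPoly.induction with
  | h0 r => exact (Algebra.commutes r _).symm
  | hl l => exact lam_lam k l
  | ht l i => exact lam_theta k l i
  | hm a b iha ihb => rw [← mul_assoc, iha, mul_assoc, ihb, mul_assoc]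
  | ha a b iha ihb => rw [mul_add, add_mul, iha, ihb]

/-- The parity automorphism `a ↦ (-1)^{p(a)} a`. -/
def inv : KPoly K n N →ₐ[K] KPoly K n N :=
  lift lam (fun k i => -theta k i) lam_lam (fun k l i => by rw [mul_neg, neg_mul, lam_theta])
    (fun k l i j => by rw [neg_mul_neg, neg_mul_neg, theta_theta])

theorem inv_inv (a : KPoly K n N) : inv (inv a) = a := by
  induction a using KPoly.induction with
  | h0 r => simp
  | hl l => simp [inv]
  | ht l i => simp [inv]
  | hm a b iha ihb => simp [iha, ihb]
  | ha a b iha ihb => simp [iha, ihb]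

/-- The substitution `Λ_j ↦ ∑_{k ∈ P j} Λ_k` for pairwise disjoint sets `P j`. -/
def subst (P : Fin m → Finset (Fin n)) (hP : ∀ j j', j ≠ j' → Disjoint (P j) (P j')) :
    KPoly K m N →ₐ[K] KPoly K n N :=
  lift (fun j => ∑ k ∈ P j, lam k) (fun j i => ∑ k ∈ P j, theta k i)
    (fun j j' => by
      rw [Finset.sum_mul_sum, Finset.sum_mul_sum, Finset.sum_comm]
      simp only [lam_lam])
    (fun j j' i => by
      rw [Finset.sum_mul_sum, Finset.sum_mul_sum, Finset.sum_comm]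
      simp only [lam_theta])
    (fun j j' i i' => by
      rw [Finset.sum_mul_sum, Finset.sum_mul_sum, Finset.sum_comm (s := P j'),
        ← Finset.sum_add_distrib]
      simp only [← Finset.sum_add_distrib, theta_theta]
      by_cases h : j = j'
      · subst h
        by_cases hi : i = i'
        · subst hi
          simp [Finset.smul_sum]
        · simp [hi]
      · rw [if_neg (fun h' => h h'.1)]
        refine Finset.sum_eq_zero fun k hk => Finset.sum_eq_zero fun k' hk' => if_neg ?_
        rintro ⟨rfl, -⟩
        exact Finset.disjoint_left.mp (hP j j' h) hk hk')

end KPoly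

namespace KPoly

variable {K : Type*} [Field K] {n m N : ℕ}

/-- `Λ_j ↦ ∑_{c k = j} Λ_k`. -/
def fib (c : Fin n → Fin m) : KPoly K m N →ₐ[K] KPoly K n N :=
  subst (fun j => Finset.univ.filter fun k => c k = j) fun j j' h => by
    rw [Finset.disjoint_left]
    intro k hk hk'
    rw [Finset.mem_filter] at hk hk'
    exact h (hk.2.symm.trans hk'.2)

/-- `Λ ↦ Λ_k`. -/
def var (k : Fin n) : KPoly K 1 N →ₐ[K] KPoly K n N :=
  subst (fun _ => {k}) fun j j' h => absurd (Subsingleton.elim j j') h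

end KPoly

/-- Exponents `(m | I)` of the ordered monomials `∏ λ_k ^ (m k) * ∏_{(k, i) ∈ I} θ_k^i`. -/
abbrev Mon (n N : ℕ) : Type := (Fin n → ℕ) × Finset (Fin n ×ₗ Fin N)

/-- The ordered monomial with exponent `μ` in given elements of an algebra; the odd factors are
multiplied in increasing (lexicographic) order of their indices. -/
def monoIn {A : Type*} [Monoid A] {n N : ℕ} (l : Fin n → A) (t : Fin n → Fin N → A)
    (μ : Mon n N) : A :=
  (List.ofFn fun k => l k ^ μ.1 k).prod *
    (μ.2.sort.map fun j => t (ofLex j).1 (ofLex j).2).prod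

section PBW

variable (K : Type*) [Field K] {n N : ℕ}

/-- Left multiplication by `λ_k` in the basis of ordered monomials. -/
def lamOp (k : Fin n) : Module.End K (Mon n N →₀ K) :=
  Finsupp.lmapDomain K K fun μ => (μ.1 + Pi.single k 1, μ.2)

/-- `(-1)` to the number of elements of `I` below `j`. -/
def posSign (j : Fin n ×ₗ Fin N) (I : Finset (Fin n ×ₗ Fin N)) : K :=
  (-1) ^ (I.filter fun j' => j' < j).card

/-- Left multiplication by `θ_k^i`, `j = (k, i)`, in the basis of ordered monomials. -/
def thetaOp (j : Fin n ×ₗ Fin N) : Module.End K (Mon n N →₀ K) :=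
  Finsupp.linearCombination K fun μ => posSign K j μ.2 •
    if j ∈ μ.2 then -Finsupp.single (μ.1 + Pi.single (ofLex j).1 1, μ.2.erase j) 1
    else Finsupp.single (μ.1, insert j μ.2) 1

variable {K}

theorem posSign_mul_self (j : Fin n ×ₗ Fin N) (I : Finset (Fin n ×ₗ Fin N)) :
    posSign K j I * posSign K j I = 1 := by
  rw [posSign, ← mul_pow, neg_one_mul, neg_neg, one_pow]

theorem posSign_insert_self (j : Fin n ×ₗ Fin N) (I : Finset (Fin n ×ₗ Fin N)) :
    posSign K j (insert j I) = posSign K j I := by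
  rw [posSign, posSign, Finset.filter_insert, if_neg (lt_irrefl j)]

theorem posSign_erase_self (j : Fin n ×ₗ Fin N) (I : Finset (Fin n ×ₗ Fin N)) :
    posSign K j (I.erase j) = posSign K j I := by
  rw [posSign, posSign, Finset.filter_erase, Finset.erase_eq_of_notMem (by simp)]

theorem posSign_insert {j j' : Fin n ×ₗ Fin N} {I : Finset (Fin n ×ₗ Fin N)} (h : j' ∉ I) :
    posSign K j (insert j' I) = (if j' < j then -1 else 1) * posSign K j I := by
  rw [posSign, posSign, Finset.filter_insert]
  split_ifs with h'
  · rw [Finset.card_insert_of_notMem (by simp [h]), pow_succ']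
  · rw [one_mul]

theorem posSign_erase {j j' : Fin n ×ₗ Fin N} {I : Finset (Fin n ×ₗ Fin N)} (h : j' ∈ I) :
    posSign K j (I.erase j') = (if j' < j then -1 else 1) * posSign K j I := by
  have := posSign_insert (K := K) (j := j) (Finset.notMem_erase j' I)
  rw [Finset.insert_erase h] at this
  rw [this, ← mul_assoc]
  split_ifs <;> simp

theorem lamOp_single (k : Fin n) (μ : Mon n N) (r : K) :
    lamOp K k (Finsupp.single μ r) = Finsupp.single (μ.1 + Pi.single k 1, μ.2) r := by
  simp [lamOp]

theorem thetaOp_single_mem {j : Fin n ×ₗ Fin N} {a : Fin n → ℕ} {I : Finset (Fin n ×ₗ Fin N)}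
    (h : j ∈ I) (r : K) : thetaOp K j (Finsupp.single (a, I) r) =
      -((r * posSign K j I) • Finsupp.single (a + Pi.single (ofLex j).1 1, I.erase j) 1) := by
  simp [thetaOp, h, mul_comm]

theorem thetaOp_single_notMem {j : Fin n ×ₗ Fin N} {a : Fin n → ℕ}
    {I : Finset (Fin n ×ₗ Fin N)} (h : j ∉ I) (r : K) :
    thetaOp K j (Finsupp.single (a, I) r) =
      (r * posSign K j I) • Finsupp.single (a, insert j I) 1 := by
  simp [thetaOp, h, mul_comm]

theorem thetaOp_sq (j : Fin n ×ₗ Fin N) :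
    thetaOp K j * thetaOp K j = -lamOp K (N := N) (ofLex j).1 := by
  refine Finsupp.lhom_ext fun ⟨a, I⟩ r => ?_
  rw [Module.End.mul_apply, LinearMap.neg_apply, lamOp_single]
  by_cases h : j ∈ I
  · rw [thetaOp_single_mem h, map_neg, map_smul, thetaOp_single_notMem (Finset.notMem_erase j I),
      posSign_erase_self, Finset.insert_erase h, one_mul, smul_smul, mul_assoc, posSign_mul_self,
      mul_one, Finsupp.smul_single, smul_eq_mul, mul_one]
  · rw [thetaOp_single_notMem h, map_smul, thetaOp_single_mem (Finset.mem_insert_self j I),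
      posSign_insert_self, Finset.erase_insert h, one_mul, smul_neg, smul_smul, mul_assoc,
      posSign_mul_self, mul_one, Finsupp.smul_single, smul_eq_mul, mul_one]

theorem thetaOp_anti {j j' : Fin n ×ₗ Fin N} (hj : j ≠ j') :
    thetaOp K j * thetaOp K j' + thetaOp K j' * thetaOp K j = 0 := by
  refine Finsupp.lhom_ext fun ⟨a, I⟩ r => ?_
  have hs : (if j' < j then (-1 : K) else 1) = -(if j < j' then (-1 : K) else 1) := by
    rcases lt_or_gt_of_ne hj with h | h <;> simp [h, h.not_gt]
  rw [LinearMap.add_apply, Module.End.mul_apply, Module.End.mul_apply, LinearMap.zero_apply]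
  by_cases h : j ∈ I <;> by_cases h' : j' ∈ I
  · have e1 : j ∈ I.erase j' := Finset.mem_erase.2 ⟨hj, h⟩
    have e2 : j' ∈ I.erase j := Finset.mem_erase.2 ⟨hj.symm, h'⟩
    rw [thetaOp_single_mem h, thetaOp_single_mem h', map_neg, map_neg, map_smul, map_smul,
      thetaOp_single_mem e1, thetaOp_single_mem e2, posSign_erase h, posSign_erase h', hs,
      Finset.erase_right_comm, add_right_comm a]
    module
  · have e1 : j ∈ insert j' I := Finset.mem_insert_of_mem h
    have e2 : j' ∉ I.erase j := fun e => h' (Finset.mem_of_mem_erase e)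
    rw [thetaOp_single_mem h, thetaOp_single_notMem h', map_neg, map_smul, map_smul,
      thetaOp_single_mem e1, thetaOp_single_notMem e2, posSign_erase h, posSign_insert h', hs,
      Finset.erase_insert_of_ne hj.symm]
    module
  · have e1 : j ∉ I.erase j' := fun e => h (Finset.mem_of_mem_erase e)
    have e2 : j' ∈ insert j I := Finset.mem_insert_of_mem h'
    rw [thetaOp_single_notMem h, thetaOp_single_mem h', map_neg, map_smul, map_smul,
      thetaOp_single_notMem e1, thetaOp_single_mem e2, posSign_insert h, posSign_erase h', hs,
      Finset.erase_insert_of_ne hj]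
    module
  · have e1 : j ∉ insert j' I := by simp [hj, h]
    have e2 : j' ∉ insert j I := by simp [hj.symm, h']
    rw [thetaOp_single_notMem h, thetaOp_single_notMem h', map_smul, map_smul,
      thetaOp_single_notMem e1, thetaOp_single_notMem e2, posSign_insert h, posSign_insert h', hs,
      Finset.insert_comm]
    module

theorem lamOp_thetaOp (k : Fin n) (j : Fin n ×ₗ Fin N) :
    lamOp K k * thetaOp K j = thetaOp K j * lamOp K k := by
  refine Finsupp.lhom_ext fun ⟨a, I⟩ r => ?_
  rw [Module.End.mul_apply, Module.End.mul_apply, lamOp_single]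
  by_cases h : j ∈ I
  · rw [thetaOp_single_mem h, thetaOp_single_mem h, map_neg, map_smul, lamOp_single,
      add_right_comm a]
  · rw [thetaOp_single_notMem h, thetaOp_single_notMem h, map_smul, lamOp_single]

variable (K) in
/-- The action of `K[Λ_k]` on itself in terms of the basis of ordered monomials. -/
def pbwAct : KPoly K n N →ₐ[K] Module.End K (Mon n N →₀ K) :=
  KPoly.lift (fun k => lamOp K k) (fun k i => thetaOp K (toLex (k, i)))
    (fun k l => by
      refine Finsupp.lhom_ext fun ⟨a, I⟩ r => ?_
      simp only [Module.End.mul_apply, lamOp_single]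
      rw [add_right_comm])
    (fun k l i => lamOp_thetaOp k _)
    (fun k l i j => by
      split_ifs with h
      · obtain ⟨rfl, rfl⟩ := h
        rw [thetaOp_sq]
        simp only [ofLex_toLex]
        module
      · exact thetaOp_anti fun e => h ⟨congrArg (fun x => (ofLex x).1) e,
          congrArg (fun x => (ofLex x).2) e⟩)

namespace KPoly

/-- The coordinates of a polynomial in the basis of ordered monomials. -/
def coord : KPoly K n N →ₗ[K] (Mon n N →₀ K) where
  toFun a := pbwAct K a (Finsupp.single (0, ∅) 1)
  map_add' a b := by rw [map_add, LinearMap.add_apply]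
  map_smul' r a := by rw [map_smul, LinearMap.smul_apply, RingHom.id_apply]

/-- The ordered monomial `Λ^{m | I}`. -/
def mono (μ : Mon n N) : KPoly K n N := monoIn lam theta μ

/-- The partial derivative `∂_{λ_k}` on ordered monomials. -/
def dLam (k : Fin n) : Module.End K (KPoly K n N) :=
  (Finsupp.linearCombination K fun μ : Mon n N =>
    (μ.1 k : K) • (mono (μ.1 - Pi.single k 1, μ.2) : KPoly K n N)) ∘ₗ coord

/-- The partial derivative `∂_{θ_k^i}` on ordered monomials. -/
def dTheta (k : Fin n) (i : Fin N) : Module.End K (KPoly K n N) :=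
  (Finsupp.linearCombination K fun μ : Mon n N =>
    if toLex (k, i) ∈ μ.2 then
      posSign K (toLex (k, i)) μ.2 • (mono (μ.1, μ.2.erase (toLex (k, i))) : KPoly K n N)
    else 0) ∘ₗ coord

/-- The linear map `V[Λ_k] → W` that sends `Λ^{m | I} v` to `w (m | I) v`. -/
def onMon {V W : Type*} [AddCommGroup V] [Module K V] [AddCommGroup W] [Module K W]
    (w : Mon n N → V →ₗ[K] W) : KPoly K n N ⊗[K] V →ₗ[K] W :=
  TensorProduct.lift (Finsupp.linearCombination K w ∘ₗ coord)

end KPoly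

end PBW

/-- A left supermodule `(V, T, S^1, …, S^N)` over the superalgebra generated by an even `T` and
odd `S^i` with `T S^i = S^i T` and `S^i S^j + S^j S^i = 2 δ_{ij} T`, on a vector space `V` with the
`ℤ/2`-grading `V = gr 0 ⊕ gr 1`. -/
structure HKMod (K : Type*) [Field K] (N : ℕ) (V : Type*) [AddCommGroup V] [Module K V] where
  gr : ZMod 2 → Submodule K V
  isCompl : IsCompl (gr 0) (gr 1)
  T : Module.End K V
  S : Fin N → Module.End K V
  T_mem : ∀ p v, v ∈ gr p → T v ∈ gr p
  S_mem : ∀ i p v, v ∈ gr p → S i v ∈ gr (p + 1)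
  T_S : ∀ i, T * S i = S i * T
  S_S : ∀ i j, S i * S j + S j * S i = if i = j then (2 : K) • T else 0

/-- The sign `(-1)^p`. -/
def sg (K : Type*) [Field K] (p : ZMod 2) : K := (-1) ^ p.val

namespace HKMod

variable {K : Type*} [Field K] {n m N : ℕ} {V : Type*} [AddCommGroup V] [Module K V]
variable (M : HKMod K N V)

/-- The parity shift `Π^q V`, with the same operators `T`, `S^i`. -/
def shift (q : ZMod 2) : HKMod K N V where
  gr p := M.gr (p + q)
  isCompl := by
    have h : ∀ q : ZMod 2, q = 0 ∨ q = 1 := by decide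
    rcases h q with rfl | rfl
    · exact M.isCompl
    · exact M.isCompl.symm
  T := M.T
  S := M.S
  T_mem p v h := M.T_mem _ v h
  S_mem i p v h := by rw [add_right_comm]; exact M.S_mem i _ v h
  T_S := M.T_S
  S_S := M.S_S

/-- The projection of `V` onto its component of parity `p`. -/
def proj (p : ZMod 2) : Module.End K V :=
  if p = 0 then (M.gr 0).projection (M.gr 1) M.isCompl
  else (M.gr 1).projection (M.gr 0) M.isCompl.symm

/-- The parity operator `v ↦ (-1)^{p(v)} v`. -/
def eps : Module.End K V := M.proj 0 - M.proj 1

/-- The parity operator of `V[Λ_k]`. -/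
def epsL : Module.End K (KPoly K n N ⊗[K] V) := TensorProduct.map KPoly.inv.toLinearMap M.eps

/-- Left multiplication by a polynomial on `V[Λ_k]`. -/
def lmul (a : KPoly K n N) : Module.End K (KPoly K n N ⊗[K] V) :=
  Algebra.lsmul K K (KPoly K n N ⊗[K] V) a

/-- The action of `T` on `V[Λ_k]`: it commutes with all polynomials. -/
def TL : Module.End K (KPoly K n N ⊗[K] V) := TensorProduct.map LinearMap.id M.T

/-- The action of `S^i` on `V[Λ_k]`: one has `S^i θ_k^j + θ_k^j S^i = 2 δ_{ij} λ_k`, that is, `S^i`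
acts on polynomials as the supercommutator with `-∑_k θ_k^i`. -/
def SL (i : Fin N) : Module.End K (KPoly K n N ⊗[K] V) :=
  TensorProduct.map (LinearMap.mulRight K (∑ k, KPoly.theta k i) ∘ₗ KPoly.inv.toLinearMap
      - LinearMap.mulLeft K (∑ k, KPoly.theta k i)) LinearMap.id
    + TensorProduct.map KPoly.inv.toLinearMap (M.S i)

/-- `-∑ λ_k - T`. -/
def lastLam : Module.End K (KPoly K n N ⊗[K] V) := -lmul (∑ k, KPoly.lam k) - M.TL

/-- `-∑ θ_k^i - S^i`. -/
def lastTheta (i : Fin N) : Module.End K (KPoly K n N ⊗[K] V) :=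
  -lmul (∑ k, KPoly.theta k i) - M.SL i

theorem lmul_tmul (a b : KPoly K n N) (v : V) : lmul a (b ⊗ₜ[K] v) = (a * b) ⊗ₜ[K] v := by
  rfl

theorem lastLam_tmul (a : KPoly K n N) (v : V) :
    M.lastLam (a ⊗ₜ[K] v) = -(((∑ k, KPoly.lam k) * a) ⊗ₜ[K] v + a ⊗ₜ[K] M.T v) := by
  rw [lastLam, LinearMap.sub_apply, LinearMap.neg_apply, lmul_tmul, TL, TensorProduct.map_tmul,
    LinearMap.id_apply]
  abel

theorem lastTheta_tmul (i : Fin N) (a : KPoly K n N) (v : V) :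
    M.lastTheta i (a ⊗ₜ[K] v) = -((KPoly.inv a * ∑ k, KPoly.theta k i) ⊗ₜ[K] v
      + KPoly.inv a ⊗ₜ[K] M.S i v) := by
  rw [lastTheta, LinearMap.sub_apply, LinearMap.neg_apply, lmul_tmul, SL, LinearMap.add_apply,
    TensorProduct.map_tmul, TensorProduct.map_tmul]
  simp only [LinearMap.sub_apply, LinearMap.comp_apply, LinearMap.mulRight_apply,
    LinearMap.mulLeft_apply, AlgHom.toLinearMap_apply, LinearMap.id_apply, TensorProduct.sub_tmul]
  abel

theorem sumLam_comm (a : KPoly K n N) :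
    (∑ k, KPoly.lam k) * a = a * ∑ k, KPoly.lam k := by
  rw [Finset.sum_mul, Finset.mul_sum]
  exact Finset.sum_congr rfl fun k _ => KPoly.lam_comm k a

theorem sumTheta_anti (i j : Fin N) :
    ((∑ k, KPoly.theta k i) * (∑ k, KPoly.theta k j) +
      (∑ k, KPoly.theta k j) * (∑ k, KPoly.theta k i) : KPoly K n N) =
      if i = j then (-2 : K) • ∑ k, KPoly.lam k else 0 := by
  rw [Finset.sum_mul_sum, Finset.sum_mul_sum, Finset.sum_comm (f := fun k l =>
    (KPoly.theta k j * KPoly.theta l i : KPoly K n N)), ← Finset.sum_add_distrib]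
  simp only [← Finset.sum_add_distrib, KPoly.theta_theta]
  split_ifs with h
  · simp [h, Finset.smul_sum]
  · simp [h]

theorem inv_lam (k : Fin n) : KPoly.inv (KPoly.lam k : KPoly K n N) = KPoly.lam k := by
  simp [KPoly.inv]

theorem inv_theta (k : Fin n) (i : Fin N) :
    KPoly.inv (KPoly.theta k i : KPoly K n N) = -KPoly.theta k i := by
  simp [KPoly.inv]

theorem lmul_lastLam (a : KPoly K n N) : lmul a * M.lastLam = M.lastLam * lmul a := by
  refine TensorProduct.ext' fun b v => ?_
  simp only [Module.End.mul_apply, lmul_tmul, lastLam_tmul, map_neg, map_add]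
  rw [← mul_assoc, ← sumLam_comm, mul_assoc]

theorem lastLam_lastTheta (i : Fin N) :
    (M.lastLam * M.lastTheta i : Module.End K (KPoly K n N ⊗[K] V)) =
      M.lastTheta i * M.lastLam := by
  refine TensorProduct.ext' fun b v => ?_
  have h := LinearMap.congr_fun (M.T_S i) v
  simp only [Module.End.mul_apply] at h
  simp only [Module.End.mul_apply, lastLam_tmul, lastTheta_tmul, map_neg, map_add, h, map_mul,
    map_sum, inv_lam, mul_assoc]
  abel

theorem lmul_theta_lastTheta (k : Fin n) (i j : Fin N) :
    (lmul (KPoly.theta k i) * M.lastTheta j + M.lastTheta j * lmul (KPoly.theta k i) :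
      Module.End K (KPoly K n N ⊗[K] V)) = 0 := by
  refine TensorProduct.ext' fun b v => ?_
  simp only [LinearMap.add_apply, Module.End.mul_apply, lmul_tmul, lastTheta_tmul, map_neg,
    map_add, map_mul, inv_theta, neg_mul, TensorProduct.neg_tmul, mul_assoc, LinearMap.zero_apply]
  abel

theorem lastTheta_lastTheta (i j : Fin N) :
    (M.lastTheta i * M.lastTheta j + M.lastTheta j * M.lastTheta i :
      Module.End K (KPoly K n N ⊗[K] V)) = if i = j then (-2 : K) • M.lastLam else 0 := by
  refine TensorProduct.ext' fun b v => ?_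
  have h := LinearMap.congr_fun (M.S_S i j) v
  have h' := sumTheta_anti (K := K) (n := n) i j
  simp only [Module.End.mul_apply, LinearMap.add_apply] at h
  simp only [LinearMap.add_apply, Module.End.mul_apply, lastTheta_tmul, map_neg,
    map_add, map_mul, map_sum, inv_theta, KPoly.inv_inv, Finset.sum_neg_distrib, mul_neg, neg_mul,
    TensorProduct.neg_tmul, mul_assoc]
  have h1 : (b * ((∑ k, KPoly.theta k i) * ∑ k, KPoly.theta k j)) ⊗ₜ[K] v +
      (b * ((∑ k, KPoly.theta k j) * ∑ k, KPoly.theta k i)) ⊗ₜ[K] v =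
      (b * if i = j then (-2 : K) • ∑ k, KPoly.lam k else 0) ⊗ₜ[K] v := by
    rw [← TensorProduct.add_tmul, ← mul_add, h']
  have h2 : b ⊗ₜ[K] M.S i (M.S j v) + b ⊗ₜ[K] M.S j (M.S i v) =
      b ⊗ₜ[K] ((if i = j then (2 : K) • M.T else 0 : Module.End K V) v) := by
    rw [← TensorProduct.tmul_add, h]
  refine Eq.trans (b := (b ⊗ₜ[K] M.S i (M.S j v) + b ⊗ₜ[K] M.S j (M.S i v)) -
    ((b * ((∑ k, KPoly.theta k i) * ∑ k, KPoly.theta k j)) ⊗ₜ[K] v +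
      (b * ((∑ k, KPoly.theta k j) * ∑ k, KPoly.theta k i)) ⊗ₜ[K] v)) (by abel) ?_
  rw [h1, h2]
  split_ifs
  · rw [mul_smul_comm, ← sumLam_comm, ← TensorProduct.smul_tmul', LinearMap.smul_apply,
      TensorProduct.tmul_smul, LinearMap.smul_apply, lastLam_tmul]
    module
  · simp

end HKMod

namespace HKMod

variable {K : Type*} [Field K] {n m N : ℕ} {V : Type*} [AddCommGroup V] [Module K V]
variable (M : HKMod K N V)

/-- The substitution `Λ_{n+1} = -Λ_1 - ⋯ - Λ_n - ∇`: a polynomial in `n + 1` supervariables as an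
operator on `V[Λ_k]_{k=1}^n`. -/
def redHom : KPoly K (n + 1) N →ₐ[K] Module.End K (KPoly K n N ⊗[K] V) :=
  KPoly.lift
    (Fin.snoc (α := fun _ => Module.End K (KPoly K n N ⊗[K] V))
      (fun k => lmul (KPoly.lam k)) M.lastLam)
    (fun k i => Fin.snoc (α := fun _ => Module.End K (KPoly K n N ⊗[K] V))
      (fun k => lmul (KPoly.theta k i)) (M.lastTheta i) k)
    (fun k l => by
      induction k using Fin.lastCases with
      | last =>
        induction l using Fin.lastCases with
        | last => rfl
        | cast l => simp only [Fin.snoc_last, Fin.snoc_castSucc, lmul_lastLam]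
      | cast k =>
        induction l using Fin.lastCases with
        | last => simp only [Fin.snoc_last, Fin.snoc_castSucc, lmul_lastLam]
        | cast l =>
          simp only [Fin.snoc_castSucc, lmul]
          rw [← map_mul, ← map_mul, KPoly.lam_lam])
    (fun k l i => by
      induction k using Fin.lastCases with
      | last =>
        induction l using Fin.lastCases with
        | last => simp only [Fin.snoc_last, lastLam_lastTheta]
        | cast l => simp only [Fin.snoc_last, Fin.snoc_castSucc, lmul_lastLam]
      | cast k =>
        induction l using Fin.lastCases with
        | last =>
          simp only [Fin.snoc_last, Fin.snoc_castSucc]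
          refine TensorProduct.ext' fun b v => ?_
          simp only [Module.End.mul_apply, lmul_tmul, lastTheta_tmul, map_neg, map_add, map_mul,
            inv_lam, mul_assoc]
        | cast l =>
          simp only [Fin.snoc_castSucc, lmul]
          rw [← map_mul, ← map_mul, KPoly.lam_theta])
    (fun k l i j => by
      induction k using Fin.lastCases with
      | last =>
        induction l using Fin.lastCases with
        | last => simp only [Fin.snoc_last, true_and, lastTheta_lastTheta]
        | cast l =>
          rw [if_neg fun h => (Fin.castSucc_lt_last l).ne h.1.symm]
          simp only [Fin.snoc_last, Fin.snoc_castSucc]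
          rw [add_comm, lmul_theta_lastTheta]
      | cast k =>
        induction l using Fin.lastCases with
        | last =>
          rw [if_neg fun h => (Fin.castSucc_lt_last k).ne h.1]
          simp only [Fin.snoc_last, Fin.snoc_castSucc]
          rw [lmul_theta_lastTheta]
        | cast l =>
          simp only [Fin.snoc_castSucc, lmul, Fin.castSucc_inj]
          rw [← map_mul, ← map_mul, ← map_add, KPoly.theta_theta]
          split_ifs
          · rw [map_smul]
          · rw [map_zero])

/-- The relations `a T ⊗ v = a ⊗ T v` and `a S^i ⊗ v = a ⊗ S^i v`, where `T` and `S^i` act on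
polynomials from the right as multiplication by `-∑ λ_k` and `-∑ θ_k^i`. -/
def nablaRel (n : ℕ) : Submodule (KPoly K n N) (KPoly K n N ⊗[K] V) :=
  Submodule.span (KPoly K n N)
    ({x | ∃ v, x = (∑ k, KPoly.lam k) ⊗ₜ[K] v + 1 ⊗ₜ[K] M.T v} ∪
     {x | ∃ i v, x = (∑ k, KPoly.theta k i) ⊗ₜ[K] v + 1 ⊗ₜ[K] M.S i v})

/-- The space `V_∇[Λ_k]_{k=1}^n`: the tensor product over the algebra of `T` and `S^i` of the
polynomials in `n` supervariables with `V`. -/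
abbrev VNabla (n : ℕ) : Type _ := (KPoly K n N ⊗[K] V) ⧸ M.nablaRel n

/-- The class of an element of `V[Λ_k]` in `V_∇[Λ_k]`. -/
def cls (n : ℕ) : KPoly K n N ⊗[K] V →ₗ[K] M.VNabla n := (M.nablaRel n).mkQ.restrictScalars K

/-- A `K`-linear map on `V_∇[Λ_k]`, from a `K`-linear map on `V[Λ_k]` that kills the relations. -/
def desc {W : Type*} [AddCommGroup W] [Module K W] (f : KPoly K n N ⊗[K] V →ₗ[K] W)
    (h : ∀ x ∈ M.nablaRel n, f x = 0) : M.VNabla n →ₗ[K] W where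
  toFun := QuotientAddGroup.lift (M.nablaRel n).toAddSubgroup f.toAddMonoidHom h
  map_add' := map_add _
  map_smul' r x := by
    obtain ⟨x, rfl⟩ := Submodule.mkQ_surjective _ x
    exact f.map_smul r x

theorem desc_cls {W : Type*} [AddCommGroup W] [Module K W] (f : KPoly K n N ⊗[K] V →ₗ[K] W)
    (h : ∀ x ∈ M.nablaRel n, f x = 0) (x) : M.desc f h (M.cls n x) = f x := rfl

/-- `a ⊗ v ↦ φ(a) v` for an algebra homomorphism `φ` to the operators on a space containing `V`. -/
def evalOp {W : Type*} [AddCommGroup W] [Module K W] (φ : KPoly K n N →ₐ[K] Module.End K W)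
    (e : V →ₗ[K] W) : KPoly K n N ⊗[K] V →ₗ[K] W :=
  TensorProduct.lift (LinearMap.lcomp K W e ∘ₗ φ.toLinearMap)

theorem evalOp_tmul {W : Type*} [AddCommGroup W] [Module K W]
    (φ : KPoly K n N →ₐ[K] Module.End K W) (e : V →ₗ[K] W) (a : KPoly K n N) (v : V) :
    evalOp φ e (a ⊗ₜ[K] v) = φ a (e v) := rfl

theorem evalOp_smul {W : Type*} [AddCommGroup W] [Module K W]
    (φ : KPoly K n N →ₐ[K] Module.End K W) (e : V →ₗ[K] W) (a : KPoly K n N)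
    (x : KPoly K n N ⊗[K] V) : evalOp φ e (a • x) = φ a (evalOp φ e x) := by
  induction x with
  | zero => simp
  | add x y hx hy => rw [smul_add, map_add, map_add, map_add, hx, hy]
  | tmul b v =>
    rw [TensorProduct.smul_tmul', smul_eq_mul, evalOp_tmul, evalOp_tmul, map_mul,
      Module.End.mul_apply]

theorem evalOp_nablaRel {W : Type*} [AddCommGroup W] [Module K W]
    (φ : KPoly K n N →ₐ[K] Module.End K W) (e : V →ₗ[K] W)
    (hT : ∀ v, φ (∑ k, KPoly.lam k) (e v) + e (M.T v) = 0)
    (hS : ∀ i v, φ (∑ k, KPoly.theta k i) (e v) + e (M.S i v) = 0) :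
    ∀ x ∈ M.nablaRel n, evalOp φ e x = 0 := by
  intro x hx
  induction hx using Submodule.span_induction with
  | mem x h =>
    rcases h with ⟨v, rfl⟩ | ⟨i, v, rfl⟩
    · rw [map_add, evalOp_tmul, evalOp_tmul, map_one, Module.End.one_apply, hT]
    · rw [map_add, evalOp_tmul, evalOp_tmul, map_one, Module.End.one_apply, hS]
  | zero => exact map_zero _
  | add x y _ _ hx hy => rw [map_add, hx, hy, add_zero]
  | smul a x _ hx => rw [evalOp_smul, hx, map_zero]

/-- The map `V_∇[Λ_k]_{k=1}^{n+1} → V[Λ_k]_{k=1}^n`,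
`a(Λ_1, …, Λ_{n+1}) ⊗ v ↦ a(Λ_1, …, Λ_n, -Λ_1 - ⋯ - Λ_n - ∇) v`. -/
def red (n : ℕ) : M.VNabla (n + 1) →ₗ[K] KPoly K n N ⊗[K] V :=
  M.desc (evalOp M.redHom (TensorProduct.mk K (KPoly K n N) V 1)) <| by
    refine M.evalOp_nablaRel _ _ (fun v => ?_) fun i v => ?_
    · rw [map_sum, Fin.sum_univ_castSucc]
      simp only [redHom, KPoly.lift_lam, Fin.snoc_castSucc, Fin.snoc_last, lastLam, lmul, map_sum]
      simp only [LinearMap.add_apply, LinearMap.sub_apply, LinearMap.neg_apply, TL,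
        TensorProduct.mk_apply, TensorProduct.map_tmul, LinearMap.id_apply]
      abel
    · rw [map_sum, Fin.sum_univ_castSucc]
      simp only [redHom, KPoly.lift_theta, Fin.snoc_castSucc, Fin.snoc_last, lastTheta, lmul,
        map_sum]
      simp [SL]
      abel

/-- `a ⊗ v ↦ a(-Λ - ∇) v` on `V[Λ]`. -/
def negSubst : KPoly K 1 N ⊗[K] V →ₗ[K] KPoly K 1 N ⊗[K] V :=
  evalOp (M.redHom.comp (KPoly.var (Fin.last 1))) (TensorProduct.mk K (KPoly K 1 N) V 1)

/-- The substitution `Λ_j ↦ ∑_{c k = j} Λ_k` on `V_∇[Λ_j]`. -/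
def fibQ (c : Fin n → Fin m) : M.VNabla m →ₗ[K] M.VNabla n :=
  M.desc (M.cls n ∘ₗ TensorProduct.map (KPoly.fib c).toLinearMap LinearMap.id) <| by
    let φ : KPoly K m N →ₐ[K] Module.End K (M.VNabla n) :=
      (Algebra.lsmul K K (M.VNabla n)).comp (KPoly.fib c)
    have hφ : M.cls n ∘ₗ TensorProduct.map (KPoly.fib c).toLinearMap LinearMap.id =
        evalOp φ (M.cls n ∘ₗ TensorProduct.mk K (KPoly K n N) V 1) := by
      refine TensorProduct.ext' fun a v => ?_
      rw [evalOp_tmul, LinearMap.comp_apply, LinearMap.comp_apply, TensorProduct.map_tmul,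
        TensorProduct.mk_apply]
      change _ = KPoly.fib c a • (M.nablaRel n).mkQ _
      rw [← map_smul, TensorProduct.smul_tmul', smul_eq_mul, mul_one]
      rfl
    have hs : ∀ f : Fin n → KPoly K n N,
        ∑ j, ∑ k ∈ Finset.univ.filter (fun k => c k = j), f k = ∑ k, f k := fun f =>
      Finset.sum_fiberwise_of_maps_to (fun _ _ => Finset.mem_univ _) f
    have key : ∀ (a : KPoly K n N) (v w : V),
        a ⊗ₜ[K] v + 1 ⊗ₜ[K] w ∈ M.nablaRel n →
        a • M.cls n (1 ⊗ₜ[K] v) + M.cls n (1 ⊗ₜ[K] w) = 0 := by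
      intro a v w h
      change a • (M.nablaRel n).mkQ _ + (M.nablaRel n).mkQ _ = 0
      rw [← map_smul, TensorProduct.smul_tmul', smul_eq_mul, mul_one, ← map_add]
      exact (Submodule.Quotient.mk_eq_zero _).2 h
    rw [hφ]
    refine M.evalOp_nablaRel _ _ (fun v => ?_) fun i v => ?_
    · refine key (KPoly.fib c (∑ k, KPoly.lam k)) v (M.T v) ?_
      rw [map_sum]
      simp only [KPoly.fib, KPoly.subst, KPoly.lift_lam]
      rw [hs]
      exact Submodule.subset_span (Or.inl ⟨v, rfl⟩)
    · refine key (KPoly.fib c (∑ k, KPoly.theta k i)) v (M.S i v) ?_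
      rw [map_sum]
      simp only [KPoly.fib, KPoly.subst, KPoly.lift_theta]
      rw [hs]
      exact Submodule.subset_span (Or.inr ⟨i, v, rfl⟩)

end HKMod

/-- Letters for the supervariables `Z_k = (z_k, ζ_k^1, …, ζ_k^N)` and for the inverses of
`z_{k,l}`, where `E k l` tells which of them are inverted. -/
inductive ZGen (n N : ℕ) (E : Fin n → Fin n → Prop) : Type
  | z (k : Fin n)
  | zeta (k : Fin n) (i : Fin N)
  | u (k l : Fin n) (h : E k l)

/-- The relations: `z_k` and the inverses are even, `ζ_k^i` are odd, all of them supercommute, and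
the letter `u k l` is the inverse of `z_{k,l} = z_k - z_l + ∑ ζ_k^i ζ_l^i`. -/
inductive OAlgRel (K : Type*) [Field K] (n N : ℕ) (E : Fin n → Fin n → Prop) :
    FreeAlgebra K (ZGen n N E) → FreeAlgebra K (ZGen n N E) → Prop
  | z_z (k l : Fin n) : OAlgRel K n N E
      (FreeAlgebra.ι K (ZGen.z k) * FreeAlgebra.ι K (ZGen.z l))
      (FreeAlgebra.ι K (ZGen.z l) * FreeAlgebra.ι K (ZGen.z k))
  | z_zeta (k l : Fin n) (i : Fin N) : OAlgRel K n N E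
      (FreeAlgebra.ι K (ZGen.z k) * FreeAlgebra.ι K (ZGen.zeta l i))
      (FreeAlgebra.ι K (ZGen.zeta l i) * FreeAlgebra.ι K (ZGen.z k))
  | zeta_zeta (k l : Fin n) (i j : Fin N) : OAlgRel K n N E
      (FreeAlgebra.ι K (ZGen.zeta k i) * FreeAlgebra.ι K (ZGen.zeta l j) +
        FreeAlgebra.ι K (ZGen.zeta l j) * FreeAlgebra.ι K (ZGen.zeta k i)) 0
  | u_comm (k l : Fin n) (h : E k l) (g : ZGen n N E) : OAlgRel K n N E
      (FreeAlgebra.ι K (ZGen.u k l h) * FreeAlgebra.ι K g)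
      (FreeAlgebra.ι K g * FreeAlgebra.ι K (ZGen.u k l h))
  | u_mul (k l : Fin n) (h : E k l) : OAlgRel K n N E
      (FreeAlgebra.ι K (ZGen.u k l h) * (FreeAlgebra.ι K (ZGen.z k) - FreeAlgebra.ι K (ZGen.z l) +
        ∑ i, FreeAlgebra.ι K (ZGen.zeta k i) * FreeAlgebra.ι K (ZGen.zeta l i))) 1

/-- The localization `K[Z_k]_{k=1}^n[z_{k,l}⁻¹]`, where `z_{k,l}` is inverted for `E k l`. -/
def OAlg (K : Type*) [Field K] (N : ℕ) {n : ℕ} (E : Fin n → Fin n → Prop) : Type _ :=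
  RingQuot (OAlgRel K n N E)

namespace OAlg

variable {K : Type*} [Field K] {N n m : ℕ} {E : Fin n → Fin n → Prop}
  {E' : Fin m → Fin m → Prop}

instance : Ring (OAlg K N E) := inferInstanceAs (Ring (RingQuot (OAlgRel K n N E)))

instance : Algebra K (OAlg K N E) := inferInstanceAs (Algebra K (RingQuot (OAlgRel K n N E)))

def gen (g : ZGen n N E) : OAlg K N E :=
  RingQuot.mkAlgHom K (OAlgRel K n N E) (FreeAlgebra.ι K g)

def z (k : Fin n) : OAlg K N E := gen (ZGen.z k)

def zeta (k : Fin n) (i : Fin N) : OAlg K N E := gen (ZGen.zeta k i)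

/-- `z_{k,l}⁻¹`. -/
def u (k l : Fin n) (h : E k l) : OAlg K N E := gen (ZGen.u k l h)

/-- `z_{k,l} = z_k - z_l + ∑ ζ_k^i ζ_l^i`. -/
def zz (k l : Fin n) : OAlg K N E := z k - z l + ∑ i, zeta k i * zeta l i

/-- `ζ_{k,l}^i = ζ_k^i - ζ_l^i`. -/
def zetaz (k l : Fin n) (i : Fin N) : OAlg K N E := zeta k i - zeta l i

theorem z_z (k l : Fin n) : (z k * z l : OAlg K N E) = z l * z k := by
  have := RingQuot.mkAlgHom_rel K (OAlgRel.z_z (K := K) (N := N) (E := E) k l)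
  rw [map_mul, map_mul] at this
  exact this

theorem z_zeta (k l : Fin n) (i : Fin N) : (z k * zeta l i : OAlg K N E) = zeta l i * z k := by
  have := RingQuot.mkAlgHom_rel K (OAlgRel.z_zeta (K := K) (E := E) k l i)
  rw [map_mul, map_mul] at this
  exact this

theorem zeta_zeta (k l : Fin n) (i j : Fin N) :
    (zeta k i * zeta l j + zeta l j * zeta k i : OAlg K N E) = 0 := by
  have := RingQuot.mkAlgHom_rel K (OAlgRel.zeta_zeta (K := K) (E := E) k l i j)
  rw [map_add, map_mul, map_mul, map_zero] at this
  exact this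

theorem u_comm (k l : Fin n) (h : E k l) (g : ZGen n N E) :
    (u k l h * gen g : OAlg K N E) = gen g * u k l h := by
  have := RingQuot.mkAlgHom_rel K (OAlgRel.u_comm (K := K) k l h g)
  rw [map_mul, map_mul] at this
  exact this

theorem u_mul (k l : Fin n) (h : E k l) : (u k l h * zz k l : OAlg K N E) = 1 := by
  have := RingQuot.mkAlgHom_rel K (OAlgRel.u_mul (K := K) (N := N) k l h)
  rw [map_mul, map_add, map_sub, map_sum, map_one] at this
  simp only [map_mul] at this
  exact this

/-- The universal property. -/
def lift {A : Type*} [Ring A] [Algebra K A] (a : Fin n → A) (b : Fin n → Fin N → A)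
    (c : ∀ k l, E k l → A)
    (h₁ : ∀ k l, a k * a l = a l * a k) (h₂ : ∀ k l i, a k * b l i = b l i * a k)
    (h₃ : ∀ k l i j, b k i * b l j + b l j * b k i = 0)
    (h₄ : ∀ k l h j, c k l h * a j = a j * c k l h)
    (h₅ : ∀ k l h j i, c k l h * b j i = b j i * c k l h)
    (h₆ : ∀ k l h k' l' h', c k l h * c k' l' h' = c k' l' h' * c k l h)
    (h₇ : ∀ k l h, c k l h * (a k - a l + ∑ i, b k i * b l i) = 1) : OAlg K N E →ₐ[K] A :=
  RingQuot.liftAlgHom K ⟨FreeAlgebra.lift K (fun g => ZGen.rec a b c g), by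
    intro x y h
    cases h with
    | z_z k l => simpa using h₁ k l
    | z_zeta k l i => simpa using h₂ k l i
    | zeta_zeta k l i j => simpa using h₃ k l i j
    | u_comm k l h g =>
      cases g with
      | z j => simpa using h₄ k l h j
      | zeta j i => simpa using h₅ k l h j i
      | u k' l' h' => simpa using h₆ k l h k' l' h'
    | u_mul k l h => simpa using h₇ k l h⟩

section
variable {A : Type*} [Ring A] [Algebra K A] {a : Fin n → A} {b : Fin n → Fin N → A}
    {c : ∀ k l, E k l → A}
    {h₁ : ∀ k l, a k * a l = a l * a k} {h₂ : ∀ k l i, a k * b l i = b l i * a k}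
    {h₃ : ∀ k l i j, b k i * b l j + b l j * b k i = 0}
    {h₄ : ∀ k l h j, c k l h * a j = a j * c k l h}
    {h₅ : ∀ k l h j i, c k l h * b j i = b j i * c k l h}
    {h₆ : ∀ k l h k' l' h', c k l h * c k' l' h' = c k' l' h' * c k l h}
    {h₇ : ∀ k l h, c k l h * (a k - a l + ∑ i, b k i * b l i) = 1}

@[simp] theorem lift_z (k : Fin n) : lift (K := K) a b c h₁ h₂ h₃ h₄ h₅ h₆ h₇ (z k) = a k :=
  (RingQuot.liftAlgHom_mkAlgHom_apply K _ _ _).trans (by simp)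

@[simp] theorem lift_zeta (k : Fin n) (i : Fin N) :
    lift (K := K) a b c h₁ h₂ h₃ h₄ h₅ h₆ h₇ (zeta k i) = b k i :=
  (RingQuot.liftAlgHom_mkAlgHom_apply K _ _ _).trans (by simp)

@[simp] theorem lift_u (k l : Fin n) (h : E k l) :
    lift (K := K) a b c h₁ h₂ h₃ h₄ h₅ h₆ h₇ (u k l h) = c k l h :=
  (RingQuot.liftAlgHom_mkAlgHom_apply K _ _ _).trans (by simp)
end

@[elab_as_elim]
theorem induction {C : OAlg K N E → Prop} (h0 : ∀ r, C (algebraMap K _ r))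
    (hz : ∀ k, C (z k)) (ht : ∀ k i, C (zeta k i)) (hu : ∀ k l h, C (u k l h))
    (hm : ∀ a b, C a → C b → C (a * b)) (ha : ∀ a b, C a → C b → C (a + b)) (a) : C a := by
  obtain ⟨x, rfl⟩ := RingQuot.mkAlgHom_surjective K (OAlgRel K n N E) a
  induction x using FreeAlgebra.induction with
  | grade0 r => rw [AlgHom.commutes]; exact h0 r
  | grade1 g => cases g with
    | z k => exact hz k
    | zeta k i => exact ht k i
    | u k l h => exact hu k l h
  | mul a b iha ihb => rw [map_mul]; exact hm _ _ iha ihb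
  | add a b iha ihb => rw [map_add]; exact ha _ _ iha ihb

/-- `Z_k ↦ Z_{c k}`. -/
def map (c : Fin n → Fin m) (hc : ∀ k l, E k l → E' (c k) (c l)) : OAlg K N E →ₐ[K] OAlg K N E' :=
  lift (fun k => z (c k)) (fun k i => zeta (c k) i) (fun k l h => u (c k) (c l) (hc k l h))
    (fun _ _ => z_z _ _) (fun _ _ _ => z_zeta _ _ _) (fun _ _ _ _ => zeta_zeta _ _ _ _)
    (fun _ _ _ _ => u_comm _ _ _ _) (fun _ _ _ _ _ => u_comm _ _ _ _)
    (fun _ _ _ _ _ _ => u_comm _ _ _ _) (fun _ _ _ => u_mul _ _ _)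

/-- The parity automorphism `f ↦ (-1)^{p(f)} f`. -/
def inv : OAlg K N E →ₐ[K] OAlg K N E :=
  lift z (fun k i => -zeta k i) u z_z
    (fun k l i => by rw [mul_neg, neg_mul, z_zeta])
    (fun k l i j => by rw [neg_mul_neg, neg_mul_neg, zeta_zeta])
    (fun _ _ _ _ => u_comm _ _ _ _)
    (fun k l h j i => by rw [mul_neg, neg_mul]; exact congrArg _ (u_comm _ _ _ _))
    (fun _ _ _ _ _ _ => u_comm _ _ _ _)
    (fun k l h => by simp only [neg_mul_neg]; exact u_mul _ _ _)

@[simp] theorem inv_z (k : Fin n) : inv (z k : OAlg K N E) = z k := by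
  rw [inv]; exact lift_z k

@[simp] theorem inv_zeta (k : Fin n) (i : Fin N) :
    inv (zeta k i : OAlg K N E) = -zeta k i := by
  rw [inv]; exact lift_zeta k i

@[simp] theorem inv_u (k l : Fin n) (h : E k l) : inv (u k l h : OAlg K N E) = u k l h := by
  rw [inv]; exact lift_u k l h

@[simp] theorem inv_zz (k l : Fin n) : inv (zz k l : OAlg K N E) = zz k l := by simp [zz]

theorem z_central (k : Fin n) (a : OAlg K N E) : z k * a = a * z k := by
  induction a using OAlg.induction with
  | h0 r => exact (Algebra.commutes r _).symm
  | hz l => exact z_z k l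
  | ht l i => exact z_zeta k l i
  | hu l l' h => exact (u_comm _ _ _ _).symm
  | hm a b iha ihb => rw [← mul_assoc, iha, mul_assoc, ihb, mul_assoc]
  | ha a b iha ihb => rw [mul_add, add_mul, iha, ihb]

theorem u_central (k l : Fin n) (h : E k l) (a : OAlg K N E) : u k l h * a = a * u k l h := by
  induction a using OAlg.induction with
  | h0 r => exact (Algebra.commutes r _).symm
  | hz l => exact u_comm _ _ _ _
  | ht l i => exact u_comm _ _ _ _
  | hu l l' h => exact u_comm _ _ _ _
  | hm a b iha ihb => rw [← mul_assoc, iha, mul_assoc, ihb, mul_assoc]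
  | ha a b iha ihb => rw [mul_add, add_mul, iha, ihb]

theorem zeta_super (k : Fin n) (i : Fin N) (a : OAlg K N E) :
    zeta k i * a = inv a * zeta k i := by
  induction a using OAlg.induction with
  | h0 r => rw [AlgHom.commutes]; exact (Algebra.commutes r _).symm
  | hz l => rw [inv_z]; exact (z_zeta _ _ _).symm
  | ht l j => rw [inv_zeta, neg_mul]; exact eq_neg_of_add_eq_zero_left (zeta_zeta _ _ _ _)
  | hu l l' h => rw [inv_u]; exact (u_comm _ _ _ _).symm
  | hm a b iha ihb => rw [← mul_assoc, iha, mul_assoc, ihb, map_mul, mul_assoc]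
  | ha a b iha ihb => rw [mul_add, map_add, add_mul, iha, ihb]


/-- Upper triangular matrices. -/
def tri (a d x : OAlg K N E) : Matrix (Fin 2) (Fin 2) (OAlg K N E) := !![a, d; 0, x]

theorem tri_mul (a d x a' d' x' : OAlg K N E) :
    tri a d x * tri a' d' x' = tri (a * a') (a * d' + d * x') (x * x') := by
  rw [tri, tri, Matrix.mul_fin_two, tri]
  simp

theorem tri_add (a d x a' d' x' : OAlg K N E) :
    tri a d x + tri a' d' x' = tri (a + a') (d + d') (x + x') := by
  ext i j
  fin_cases i <;> fin_cases j <;> simp [tri]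

theorem tri_sub (a d x a' d' x' : OAlg K N E) :
    tri a d x - tri a' d' x' = tri (a - a') (d - d') (x - x') := by
  ext i j
  fin_cases i <;> fin_cases j <;> simp [tri]

theorem tri_zero : (tri 0 0 0 : Matrix _ _ (OAlg K N E)) = 0 := by
  ext i j
  fin_cases i <;> fin_cases j <;> simp [tri]

theorem tri_one : (tri 1 0 1 : Matrix _ _ (OAlg K N E)) = 1 := by
  ext i j
  fin_cases i <;> fin_cases j <;> simp [tri]

theorem tri_sum {ι : Type*} (t : Finset ι) (a d x : ι → OAlg K N E) :
    ∑ i ∈ t, tri (a i) (d i) (x i) = tri (∑ i ∈ t, a i) (∑ i ∈ t, d i) (∑ i ∈ t, x i) := by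
  classical
  induction t using Finset.induction_on with
  | empty => simp [tri_zero]
  | insert i t hi ih => rw [Finset.sum_insert hi, Finset.sum_insert hi, Finset.sum_insert hi,
      Finset.sum_insert hi, ih, tri_add]

/-- The homomorphism `f ↦ (s(f), δ(f); 0, f)` to upper triangular matrices that encodes a skew
derivation `δ`, that is, `δ(f g) = δ(f) g + s(f) δ(g)`, with given values on the generators. -/
def skewHom (s : OAlg K N E →ₐ[K] OAlg K N E) (dz : Fin n → OAlg K N E)
    (dzeta : Fin n → Fin N → OAlg K N E) (dzz : Fin n → Fin n → OAlg K N E)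
    (hsz : ∀ k, s (z k) = z k) (hsu : ∀ k l h, s (u k l h) = u k l h)
    (hz : ∀ k a, dz k * a = s a * dz k)
    (hzeta : ∀ k i l j, s (zeta k i) * dzeta l j + dzeta k i * zeta l j +
      (s (zeta l j) * dzeta k i + dzeta l j * zeta k i) = 0)
    (hzz : ∀ k l, dz k - dz l + ∑ i, (s (zeta k i) * dzeta l i + dzeta k i * zeta l i) = dzz k l)
    (hdzz : ∀ k l a, dzz k l * a = s a * dzz k l) :
    OAlg K N E →ₐ[K] Matrix (Fin 2) (Fin 2) (OAlg K N E) :=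
  have hd : ∀ k l h a, -(u k l h * dzz k l * u k l h) * a =
      s a * -(u k l h * dzz k l * u k l h) := fun k l h a => by
    rw [neg_mul, mul_neg, mul_assoc (u k l h * dzz k l), u_central k l h a, ← mul_assoc,
      mul_assoc (u k l h) (dzz k l) a, hdzz, ← mul_assoc, u_central k l h (s a)]
    simp only [mul_assoc]
  lift (fun k => tri (s (z k)) (dz k) (z k)) (fun k i => tri (s (zeta k i)) (dzeta k i) (zeta k i))
    (fun k l h => tri (s (u k l h)) (-(u k l h * dzz k l * u k l h)) (u k l h))
    (fun k l => by
      rw [tri_mul, tri_mul, ← map_mul, ← map_mul, z_z k l, hz k, hz l, add_comm])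
    (fun k l i => by
      rw [tri_mul, tri_mul, ← map_mul, ← map_mul, z_zeta k l i, hz k, hsz, z_central, add_comm])
    (fun k l i j => by
      rw [tri_mul, tri_mul, tri_add, ← map_mul, ← map_mul, ← map_add, zeta_zeta, hzeta, map_zero,
        tri_zero])
    (fun k l h j => by
      rw [tri_mul, tri_mul, ← map_mul, ← map_mul, u_central, hd, hsu, u_central, add_comm])
    (fun k l h j i => by
      rw [tri_mul, tri_mul, ← map_mul, ← map_mul, u_central, hd, hsu, u_central, add_comm])
    (fun k l h k' l' h' => by
      rw [tri_mul, tri_mul, ← map_mul, ← map_mul, u_central, hd, hsu, u_central, add_comm,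
        u_central k l h (-_)])
    (fun k l h => by
      simp only [tri_mul, tri_sum, tri_sub, tri_add]
      rw [hzz]
      have h1 : s (z k) - s (z l) + ∑ i, s (zeta k i) * s (zeta l i) = s (zz k l) := by
        simp [zz]
      have h2 : z k - z l + ∑ i, zeta k i * zeta l i = (zz k l : OAlg K N E) := rfl
      rw [h1, h2, ← map_mul, u_mul, map_one, hsu, neg_mul, mul_assoc (u k l h * dzz k l), u_mul,
        mul_one, add_neg_cancel, tri_one])

section
variable {s : OAlg K N E →ₐ[K] OAlg K N E} {dz : Fin n → OAlg K N E}
    {dzeta : Fin n → Fin N → OAlg K N E} {dzz : Fin n → Fin n → OAlg K N E}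
    {hsz : ∀ k, s (z k) = z k} {hsu : ∀ k l h, s (u k l h) = u k l h}
    {hz : ∀ k a, dz k * a = s a * dz k}
    {hzeta : ∀ k i l j, s (zeta k i) * dzeta l j + dzeta k i * zeta l j +
      (s (zeta l j) * dzeta k i + dzeta l j * zeta k i) = 0}
    {hzz : ∀ k l, dz k - dz l + ∑ i, (s (zeta k i) * dzeta l i + dzeta k i * zeta l i) = dzz k l}
    {hdzz : ∀ k l a, dzz k l * a = s a * dzz k l}

theorem skewHom_eq (a : OAlg K N E) :
    skewHom s dz dzeta dzz hsz hsu hz hzeta hzz hdzz a =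
      tri (s a) (skewHom s dz dzeta dzz hsz hsu hz hzeta hzz hdzz a 0 1) a := by
  induction a using OAlg.induction with
  | h0 r =>
    rw [AlgHom.commutes, AlgHom.commutes]
    ext i j
    fin_cases i <;> fin_cases j <;> simp [tri, Matrix.algebraMap_matrix_apply]
  | hz k => simp [skewHom, tri]
  | ht k i => simp [skewHom, tri]
  | hu k l h => simp [skewHom, tri]
  | hm a b ha hb =>
    rw [map_mul, ha, hb, tri_mul, map_mul]
    simp [tri]
  | ha a b ha hb =>
    rw [map_add, ha, hb, tri_add, map_add]
    simp [tri]
end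

/-- The linear map `δ` encoded by a homomorphism to triangular matrices. -/
def upper (φ : OAlg K N E →ₐ[K] Matrix (Fin 2) (Fin 2) (OAlg K N E)) :
    Module.End K (OAlg K N E) where
  toFun a := φ a 0 1
  map_add' a b := by rw [map_add, Matrix.add_apply]
  map_smul' r a := by rw [map_smul, Matrix.smul_apply, RingHom.id_apply]

/-- The even derivation `∂_{z_j}` encoded as a homomorphism. -/
def dzHom (j : Fin n) : OAlg K N E →ₐ[K] Matrix (Fin 2) (Fin 2) (OAlg K N E) :=
  skewHom (AlgHom.id K _) (fun k => if k = j then 1 else 0) (fun _ _ => 0)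
    (fun k l => (if k = j then 1 else 0) - (if l = j then 1 else 0))
    (fun _ => rfl) (fun _ _ _ => rfl)
    (fun k a => by split_ifs <;> simp)
    (fun k i l j => by simp) (fun k l => by simp)
    (fun k l a => by split_ifs <;> simp)

/-- The derivation `∂_{z_j}`. -/
def dz (j : Fin n) : Module.End K (OAlg K N E) := upper (dzHom j)

/-- The odd derivation `D_{ζ_j^i} = ∂_{ζ_j^i} - ζ_j^i ∂_{z_j}` encoded as a homomorphism. -/
def dzetaHom (j : Fin n) (i : Fin N) : OAlg K N E →ₐ[K] Matrix (Fin 2) (Fin 2) (OAlg K N E) :=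
  skewHom inv (fun k => if k = j then -zeta j i else 0)
    (fun k i' => if k = j ∧ i' = i then 1 else 0)
    (fun k l => if k = j ∧ l = j then 0 else if k = j ∨ l = j then -zetaz k l i else 0)
    inv_z inv_u
    (fun k a => by
      split_ifs
      · rw [neg_mul, zeta_super, mul_neg]
      · simp)
    (fun k i' l j' => by
      split_ifs <;> simp)
    (fun k l => by
      by_cases hk : k = j <;> by_cases hl : l = j
      · subst hk hl
        simp only [if_true, true_and, and_self, sub_self, zero_add]
        refine Finset.sum_eq_zero fun x _ => ?_
        split_ifs <;> simp
      · subst hk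
        simp [hl, zetaz]
        abel
      · subst hl
        simp [hk, zetaz]
        abel
      · simp [hk, hl])
    (fun k l a => by
      split_ifs
      · simp
      · rw [zetaz, neg_mul, sub_mul, zeta_super, zeta_super, mul_neg, mul_sub]
      · simp)

/-- The odd derivation `D_{ζ_j^i} = ∂_{ζ_j^i} - ζ_j^i ∂_{z_j}`. -/
def dzeta (j : Fin n) (i : Fin N) : Module.End K (OAlg K N E) := upper (dzetaHom j i)

theorem dz_mul (j : Fin n) (a b : OAlg K N E) : dz j (a * b) = a * dz j b + dz j a * b := by
  change dzHom j (a * b) 0 1 = a * dzHom j b 0 1 + dzHom j a 0 1 * b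
  rw [map_mul, Matrix.mul_apply, Fin.sum_univ_two]
  congr 2
  · exact congrFun (congrFun (skewHom_eq a) 0) 0
  · exact congrFun (congrFun (skewHom_eq b) 1) 1

theorem dzeta_mul (j : Fin n) (i : Fin N) (a b : OAlg K N E) :
    dzeta j i (a * b) = inv a * dzeta j i b + dzeta j i a * b := by
  change dzetaHom j i (a * b) 0 1 = inv a * dzetaHom j i b 0 1 + dzetaHom j i a 0 1 * b
  rw [map_mul, Matrix.mul_apply, Fin.sum_univ_two]
  congr 2
  · exact congrFun (congrFun (skewHom_eq a) 0) 0
  · exact congrFun (congrFun (skewHom_eq b) 1) 1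

end OAlg

namespace OAlg

variable {K : Type*} [Field K] {N n m : ℕ} {E : Fin n → Fin n → Prop}
  {E' : Fin m → Fin m → Prop}

variable (K N E) in
/-- The subalgebra `K[z_{k,l}^{±1}, ζ_{k,l}^i]` of translation invariant functions. -/
def tSub : Subalgebra K (OAlg K N E) :=
  Algebra.adjoin K ({x | ∃ k l, x = zz k l} ∪ {x | ∃ k l i, x = zetaz k l i} ∪
    {x | ∃ k l h, x = u k l h})

theorem zz_mem (k l : Fin n) : zz k l ∈ tSub K N E :=
  Algebra.subset_adjoin (Or.inl (Or.inl ⟨k, l, rfl⟩))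

theorem zetaz_mem (k l : Fin n) (i : Fin N) : zetaz k l i ∈ tSub K N E :=
  Algebra.subset_adjoin (Or.inl (Or.inr ⟨k, l, i, rfl⟩))

theorem u_mem (k l : Fin n) (h : E k l) : u k l h ∈ tSub K N E :=
  Algebra.subset_adjoin (Or.inr ⟨k, l, h, rfl⟩)

theorem map_z (c : Fin n → Fin m) (hc : ∀ k l, E k l → E' (c k) (c l)) (k : Fin n) :
    map c hc (z k : OAlg K N E) = z (c k) := by
  rw [map]; exact lift_z k

theorem map_zeta (c : Fin n → Fin m) (hc : ∀ k l, E k l → E' (c k) (c l)) (k : Fin n)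
    (i : Fin N) : map c hc (zeta k i : OAlg K N E) = zeta (c k) i := by
  rw [map]; exact lift_zeta k i

theorem map_u (c : Fin n → Fin m) (hc : ∀ k l, E k l → E' (c k) (c l)) (k l : Fin n)
    (h : E k l) : map c hc (u k l h : OAlg K N E) = u (c k) (c l) (hc k l h) := by
  rw [map]; exact lift_u k l h

theorem map_tSub (c : Fin n → Fin m) (hc : ∀ k l, E k l → E' (c k) (c l)) :
    tSub K N E ≤ (tSub K N E').comap (map c hc) := by
  refine Algebra.adjoin_le ?_
  rintro x ((⟨k, l, rfl⟩ | ⟨k, l, i, rfl⟩) | ⟨k, l, h, rfl⟩)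
  · change map c hc (zz k l) ∈ tSub K N E'
    rw [zz, map_add, map_sub, map_sum, map_z, map_z]
    simp only [map_mul, map_zeta]
    exact zz_mem _ _
  · change map c hc (zetaz k l i) ∈ tSub K N E'
    rw [zetaz, map_sub, map_zeta, map_zeta]
    exact zetaz_mem _ _ _
  · change map c hc (u k l h) ∈ tSub K N E'
    rw [map_u]
    exact u_mem _ _ _

theorem inv_tSub : tSub K N E ≤ (tSub K N E).comap inv := by
  refine Algebra.adjoin_le ?_
  rintro x ((⟨k, l, rfl⟩ | ⟨k, l, i, rfl⟩) | ⟨k, l, h, rfl⟩)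
  · change inv (zz k l) ∈ tSub K N E
    rw [inv_zz]
    exact zz_mem _ _
  · change inv (zetaz k l i) ∈ tSub K N E
    rw [zetaz, map_sub, inv_zeta, inv_zeta, neg_sub_neg]
    exact zetaz_mem _ _ _
  · change inv (u k l h) ∈ tSub K N E
    rw [inv_u]
    exact u_mem _ _ _

theorem skew_tSub (s : OAlg K N E →ₐ[K] OAlg K N E) (d : Module.End K (OAlg K N E))
    (hs : tSub K N E ≤ (tSub K N E).comap s) (hd : ∀ a b, d (a * b) = s a * d b + d a * b)
    (h₁ : ∀ k l, d (zz k l) ∈ tSub K N E) (h₂ : ∀ k l i, d (zetaz k l i) ∈ tSub K N E)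
    (h₃ : ∀ k l h, d (u k l h) ∈ tSub K N E) : ∀ a ∈ tSub K N E, d a ∈ tSub K N E := by
  have d1 : d 1 = 0 := by
    have := hd 1 1
    rwa [mul_one, map_one s, one_mul, mul_one, left_eq_add] at this
  intro a ha
  induction ha using Algebra.adjoin_induction with
  | mem x hx =>
    rcases hx with (⟨k, l, rfl⟩ | ⟨k, l, i, rfl⟩) | ⟨k, l, h, rfl⟩
    exacts [h₁ k l, h₂ k l i, h₃ k l h]
  | algebraMap r =>
    rw [Algebra.algebraMap_eq_smul_one, map_smul, d1, smul_zero]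
    exact zero_mem _
  | add x y _ _ hx hy => rw [map_add]; exact add_mem hx hy
  | mul x y hx' hy' hx hy =>
    rw [hd]
    exact add_mem (mul_mem (hs hx') hy) (mul_mem hx hy')

theorem dz_tSub (j : Fin n) : ∀ a ∈ tSub K N E, dz j a ∈ tSub K N E := by
  have e1 : ∀ k, dz j (z k : OAlg K N E) = if k = j then 1 else 0 := fun k => by
    simp [dz, upper, dzHom, skewHom, tri]
  have e2 : ∀ k i, dz j (zeta k i : OAlg K N E) = 0 := fun k i => by
    simp [dz, upper, dzHom, skewHom, tri]
  have e3 : ∀ k l h, dz j (u k l h : OAlg K N E) = -(u k l h *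
      ((if k = j then 1 else 0) - (if l = j then 1 else 0)) * u k l h) := fun k l h => by
    simp [dz, upper, dzHom, skewHom, tri]
  have e4 : ∀ k : Fin n, (if k = j then (1 : OAlg K N E) else 0) ∈ tSub K N E := fun k => by
    split_ifs
    exacts [one_mem _, zero_mem _]
  refine skew_tSub (AlgHom.id K _) (dz j) le_rfl (dz_mul j) (fun k l => ?_) (fun k l i => ?_)
    (fun k l h => ?_)
  · simp only [zz, map_add, map_sub, map_sum, dz_mul, e1, e2, mul_zero, zero_mul, add_zero,
      Finset.sum_const_zero]
    exact sub_mem (e4 k) (e4 l)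
  · rw [zetaz, map_sub, e2, e2, sub_zero]
    exact zero_mem _
  · rw [e3]
    exact neg_mem (mul_mem (mul_mem (u_mem _ _ _) (sub_mem (e4 k) (e4 l))) (u_mem _ _ _))

theorem dzeta_tSub (j : Fin n) (i : Fin N) : ∀ a ∈ tSub K N E, dzeta j i a ∈ tSub K N E := by
  have e1 : ∀ k, dzeta j i (z k : OAlg K N E) = if k = j then -zeta j i else 0 := fun k => by
    simp [dzeta, upper, dzetaHom, skewHom, tri]
  have e2 : ∀ k i', dzeta j i (zeta k i' : OAlg K N E) = if k = j ∧ i' = i then 1 else 0 :=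
    fun k i => by simp [dzeta, upper, dzetaHom, skewHom, tri]
  have e3 : ∀ k l h, dzeta j i (u k l h : OAlg K N E) = -(u k l h *
      (if k = j ∧ l = j then 0 else if k = j ∨ l = j then -zetaz k l i else 0) * u k l h) :=
    fun k l h => by simp [dzeta, upper, dzetaHom, skewHom, tri]
  have e4 : ∀ k l : Fin n, (if k = j ∧ l = j then 0 else if k = j ∨ l = j then -zetaz k l i
      else 0 : OAlg K N E) ∈ tSub K N E := fun k l => by
    split_ifs
    exacts [zero_mem _, neg_mem (zetaz_mem _ _ _), zero_mem _]
  have e5 : ∀ k, (if k = j then (1 : OAlg K N E) else 0) ∈ tSub K N E := fun k => by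
    split_ifs
    exacts [one_mem _, zero_mem _]
  refine skew_tSub inv (dzeta j i) inv_tSub (dzeta_mul j i) (fun k l => ?_) (fun k l i' => ?_)
    (fun k l h => ?_)
  · have : dzeta j i (zz k l : OAlg K N E) =
        if k = j ∧ l = j then 0 else if k = j ∨ l = j then -zetaz k l i else 0 := by
      simp only [zz, map_add, map_sub, map_sum, dzeta_mul, e1, e2, inv_zeta]
      by_cases hk : k = j <;> by_cases hl : l = j
      · subst hk hl
        simp only [if_true, true_and, and_self, sub_self, zero_add]
        refine Finset.sum_eq_zero fun x _ => ?_
        split_ifs <;> simp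
      · subst hk
        simp [hl, zetaz]
        abel
      · subst hl
        simp [hk, zetaz]
        abel
      · simp [hk, hl]
    rw [this]
    exact e4 k l
  · rw [zetaz, map_sub, e2, e2]
    by_cases hi : i' = i
    · simp only [hi, and_true]
      exact sub_mem (e5 k) (e5 l)
    · simp only [hi, and_false, if_false, sub_zero]
      exact zero_mem _
  · rw [e3]
    exact neg_mem (mul_mem (mul_mem (u_mem _ _ _) (e4 k l)) (u_mem _ _ _))

end OAlg

/-- The superalgebra of translation invariant functions `K[z_{k,l}, ζ_{k,l}^i, z_{k,l}⁻¹]`, where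
`z_{k,l}` is inverted for `E k l`. -/
abbrev OT (K : Type*) [Field K] (N : ℕ) {n : ℕ} (E : Fin n → Fin n → Prop) : Type _ :=
  ↥(OAlg.tSub K N E)

/-- All `z_{k,l}` with `k ≠ l` are inverted. -/
def Star (n : ℕ) (k l : Fin n) : Prop := k ≠ l

namespace OT

variable {K : Type*} [Field K] {N n m : ℕ} {E : Fin n → Fin n → Prop}
  {E' : Fin m → Fin m → Prop}

def zz (k l : Fin n) : OT K N E := ⟨OAlg.zz k l, OAlg.zz_mem k l⟩

def zetaz (k l : Fin n) (i : Fin N) : OT K N E := ⟨OAlg.zetaz k l i, OAlg.zetaz_mem k l i⟩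

def u (k l : Fin n) (h : E k l) : OT K N E := ⟨OAlg.u k l h, OAlg.u_mem k l h⟩

/-- `f(Z_1, …, Z_n) ↦ f(Z_{c 1}, …, Z_{c n})`. -/
def map (c : Fin n → Fin m) (hc : ∀ k l, E k l → E' (c k) (c l)) : OT K N E →ₐ[K] OT K N E' :=
  ((OAlg.map c hc).comp (OAlg.tSub K N E).val).codRestrict _ fun a => OAlg.map_tSub c hc a.2

/-- The parity operator `f ↦ (-1)^{p(f)} f`. -/
def inv : OT K N E →ₐ[K] OT K N E :=
  (OAlg.inv.comp (OAlg.tSub K N E).val).codRestrict _ fun a => OAlg.inv_tSub a.2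

def dz (j : Fin n) : Module.End K (OT K N E) :=
  (OAlg.dz j).restrict (p := (OAlg.tSub K N E).toSubmodule) (q := (OAlg.tSub K N E).toSubmodule)
    (OAlg.dz_tSub j)

def dzeta (j : Fin n) (i : Fin N) : Module.End K (OT K N E) :=
  (OAlg.dzeta j i).restrict (p := (OAlg.tSub K N E).toSubmodule)
    (q := (OAlg.tSub K N E).toSubmodule) (OAlg.dzeta_tSub j i)

end OT

namespace HKMod

variable {K : Type*} [Field K] {n m N : ℕ} {V : Type*} [AddCommGroup V] [Module K V]
variable (M : HKMod K N V)

/-- The tensor power `V^{⊗ n}`. -/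
abbrev Tens (K : Type*) [Field K] (V : Type*) [AddCommGroup V] [Module K V] (n : ℕ) : Type _ :=
  ⨂[K] _ : Fin n, V

/-- The parity operator of `V^{⊗ n}`. -/
def epsT (n : ℕ) : Module.End K (Tens K V n) := PiTensorProduct.map fun _ => M.eps

/-- `T` acting on the `k`-th tensor factor. -/
def TAt (k : Fin n) : Module.End K (Tens K V n) :=
  PiTensorProduct.map fun l => if l = k then M.T else LinearMap.id

/-- `S^i` acting on the `k`-th tensor factor, with the sign of moving it past the factors before. -/
def SAt (k : Fin n) (i : Fin N) : Module.End K (Tens K V n) :=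
  PiTensorProduct.map fun l => if l < k then M.eps else if l = k then M.S i else LinearMap.id

/-- The superspace `V^{⊗ n} ⊗ 𝒪`. -/
abbrev Src (_ : HKMod K N V) {n : ℕ} (E : Fin n → Fin n → Prop) : Type _ :=
  Tens K V n ⊗[K] OT K N E

/-- The parity operator of `V^{⊗ n} ⊗ 𝒪`. -/
def srcEps {E : Fin n → Fin n → Prop} : Module.End K (M.Src E) :=
  TensorProduct.map (M.epsT n) OT.inv.toLinearMap

/-- The right action of a function `g` on `V^{⊗ n} ⊗ 𝒪`. -/
def srcMul {E : Fin n → Fin n → Prop} (g : OT K N E) : Module.End K (M.Src E) :=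
  TensorProduct.map LinearMap.id (LinearMap.mulRight K g)

/-- The right action of `∂_{z_k}`: `(v ⊗ f) ∂_{z_k} = T^{(k)} v ⊗ f - v ⊗ ∂_{z_k} f`. -/
def srcDz {E : Fin n → Fin n → Prop} (k : Fin n) : Module.End K (M.Src E) :=
  TensorProduct.map (M.TAt k) LinearMap.id - TensorProduct.map LinearMap.id (OT.dz k)

/-- The right action of `D_{ζ_k^i}`:
`(v ⊗ f) D = (-1)^{p(v) + p(f)} (S^i)^{(k)} v ⊗ f - (-1)^{p(f)} v ⊗ D f`. -/
def srcDzeta {E : Fin n → Fin n → Prop} (k : Fin n) (i : Fin N) : Module.End K (M.Src E) :=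
  TensorProduct.map (M.SAt k i ∘ₗ M.epsT n) OT.inv.toLinearMap
    - TensorProduct.map LinearMap.id (OT.dzeta k i ∘ₗ OT.inv.toLinearMap)

/-- The right action of `z_{k,l}` on `V_∇[Λ_k]`, on representatives:
`x z_{k,l} = (∂_{λ_l} - ∂_{λ_k} + ∑_i ∂_{θ_k^i} ∂_{θ_l^i}) x`. -/
def tgtZz (k l : Fin n) : Module.End K (KPoly K n N ⊗[K] V) :=
  TensorProduct.map (KPoly.dLam l - KPoly.dLam k +
    ∑ i, KPoly.dTheta k i ∘ₗ KPoly.dTheta l i) LinearMap.id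

/-- The right action of `ζ_{k,l}^i` on `V_∇[Λ_k]`, on representatives:
`x ζ_{k,l}^i = (-1)^{p(x)} (∂_{θ_k^i} - ∂_{θ_l^i}) x`. -/
def tgtZetaz (k l : Fin n) (i : Fin N) : Module.End K (KPoly K n N ⊗[K] V) :=
  TensorProduct.map (KPoly.dTheta k i - KPoly.dTheta l i) LinearMap.id ∘ₗ M.epsL

/-- The right action of `∂_{z_k}` on `V_∇[Λ_k]`, on representatives: `x ∂_{z_k} = -λ_k x`. -/
def tgtDz (k : Fin n) : Module.End K (KPoly K n N ⊗[K] V) := -lmul (KPoly.lam k)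

/-- The right action of `D_{ζ_k^i}` on `V_∇[Λ_k]`, on representatives:
`x D_{ζ_k^i} = -(-1)^{p(x)} θ_k^i x`. -/
def tgtDzeta (k : Fin n) (i : Fin N) : Module.End K (KPoly K n N ⊗[K] V) :=
  -(lmul (KPoly.theta k i) ∘ₗ M.epsL)

/-- The map `X` carries the operator `φ` to the operator induced by `ψ` on classes. -/
def Intertwines {E : Fin n → Fin n → Prop} (X : M.Src E →ₗ[K] M.VNabla n)
    (φ : Module.End K (M.Src E)) (ψ : Module.End K (KPoly K n N ⊗[K] V)) : Prop :=
  ∀ x y, M.cls n y = X x → X (φ x) = M.cls n (ψ y)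

/-- `X` belongs to the space `P(n)` of the chiral operad: it is a homomorphism
`V^{⊗ n} ⊗ 𝒪 → V_∇[Λ_k]` of right modules over the algebra of differential operators generated by
`z_{k,l}`, `ζ_{k,l}^i`, `∂_{z_k}` and `D_{ζ_k^i}`. -/
structure IsOp (X : M.Src (Star n) →ₗ[K] M.VNabla n) : Prop where
  zz : ∀ k l, M.Intertwines X (M.srcMul (OT.zz k l)) (tgtZz k l)
  zetaz : ∀ k l i, M.Intertwines X (M.srcMul (OT.zetaz k l i)) (M.tgtZetaz k l i)
  dz : ∀ k, M.Intertwines X (M.srcDz k) (tgtDz k)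
  dzeta : ∀ k i, M.Intertwines X (M.srcDzeta k i) (M.tgtDzeta k i)

/-- `X` is homogeneous of parity `p`. -/
def HasParity (p : ZMod 2) (X : M.Src (Star n) →ₗ[K] M.VNabla n) : Prop :=
  M.Intertwines X M.srcEps (sg K p • M.epsL)

/-- The action of a permutation on `V^{⊗ n}`,
`v_1 ⊗ ⋯ ⊗ v_n ↦ ± v_{σ⁻¹ 1} ⊗ ⋯ ⊗ v_{σ⁻¹ n}`, with the product of the signs
`(-1)^{p(v_k) p(v_l)}` over the inversions `k < l`, `σ k > σ l`. -/
def koszulPerm (σ : Equiv.Perm (Fin n)) : Module.End K (Tens K V n) :=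
  ∑ p : Fin n → ZMod 2,
    (∏ x : Fin n × Fin n, if x.1 < x.2 ∧ σ x.2 < σ x.1 then sg K (p x.1 * p x.2) else 1) •
      ((PiTensorProduct.reindex K (fun _ => V) σ).toLinearMap ∘ₗ
        PiTensorProduct.map fun k => M.proj (p k))

/-- The right action of a permutation on `n`-ary operations,
`X^σ(v ⊗ f) = X_{σ(Λ_1, …, Λ_n)}(σ v ⊗ σ f)`. -/
def symAct (σ : Equiv.Perm (Fin n)) (X : M.Src (Star n) →ₗ[K] M.VNabla n) :
    M.Src (Star n) →ₗ[K] M.VNabla n :=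
  M.fibQ σ ∘ₗ X ∘ₗ TensorProduct.map (M.koszulPerm σ)
    (OT.map σ fun _ _ h => σ.injective.ne h).toLinearMap

/-- The map of indices that collapses the first `n + 1` of them to the first one. -/
def collapse (n m : ℕ) : Fin (n + 1 + m) → Fin (m + 1) := Fin.addCases (fun _ => 0) Fin.succ

/-- `z_{k,l}` is inverted unless `k` and `l` both belong to the first `n + 1` indices. -/
def Apart (n m : ℕ) (k l : Fin (n + 1 + m)) : Prop := collapse n m k ≠ collapse n m l

/-- The place among all variables of the `k`-th variable of the first block. -/
def blk (m : ℕ) (k : Fin n) : Fin (n + 1 + m) := Fin.castAdd m k.castSucc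

/-- The space `K[Λ_k] ⊗ (V^{⊗ (m+1)} ⊗ 𝒪')` on which the operators `Λ_k - ∂_{Z_k}` act; here `𝒪'`
consists of the functions without poles inside the first block of variables. -/
abbrev Work (_ : HKMod K N V) (n m : ℕ) : Type _ :=
  KPoly K (n + 1 + m) N ⊗[K] (Tens K V (m + 1) ⊗[K] OT K N (Apart n m))

/-- `λ_k - ∂_{z_k}`. -/
def gLam (m : ℕ) (k : Fin n) : Module.End K (M.Work n m) :=
  Algebra.lsmul K K (M.Work n m) (KPoly.lam (blk m k) : KPoly K (n + 1 + m) N) -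
    TensorProduct.map LinearMap.id (TensorProduct.map LinearMap.id (OT.dz (blk m k)))

/-- `θ_k^i - D_{ζ_k^i}`. -/
def gTheta (m : ℕ) (k : Fin n) (i : Fin N) : Module.End K (M.Work n m) :=
  Algebra.lsmul K K (M.Work n m) (KPoly.theta (blk m k) i : KPoly K (n + 1 + m) N) -
    TensorProduct.map KPoly.inv.toLinearMap
      (TensorProduct.map (M.epsT (m + 1)) (OT.dzeta (blk m k) i))

/-- `a ⊗ v ⊗ f ↦ (-1)^{p(a) p} a X_{Λ'_1, …, Λ'_{m+1}}(v ⊗ f')`, where `Λ'_1` is the sum of the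
`Λ_k` of the first block, the other `Λ'_j` are the remaining variables, `f'` is obtained from `f` by
identifying the variables `Z_k` of the first block, and `p` is the parity of `X`. -/
def contract (n : ℕ) (p : ZMod 2) (X : M.Src (Star (m + 1)) →ₗ[K] M.VNabla (m + 1)) :
    M.Work n m →ₗ[K] M.VNabla (n + 1 + m) :=
  TensorProduct.lift
    ((LinearMap.lcomp K _ (M.fibQ (collapse n m) ∘ₗ X ∘ₗ
        TensorProduct.map LinearMap.id (OT.map (collapse n m) fun _ _ h => h).toLinearMap)) ∘ₗ
      (Algebra.lsmul K K (M.VNabla (n + 1 + m))).toLinearMap ∘ₗ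
      (KPoly.inv (K := K) (n := n + 1 + m) (N := N)).toLinearMap ^ p.val)

/-- `c ↦ 1 ⊗ (c ⊗ v_1 ⊗ ⋯ ⊗ v_m) ⊗ f`. -/
def insertFirst (v : Fin m → V) (f : OT K N (Apart n m)) : V →ₗ[K] M.Work n m where
  toFun c := 1 ⊗ₜ[K] (PiTensorProduct.tprod K (Fin.cons c v : Fin (m + 1) → V) ⊗ₜ[K] f)
  map_add' c c' := by
    rw [(PiTensorProduct.tprod K).cons_add, TensorProduct.add_tmul, TensorProduct.tmul_add]
  map_smul' r c := by
    rw [(PiTensorProduct.tprod K).cons_smul, ← TensorProduct.smul_tmul', TensorProduct.tmul_smul,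
      RingHom.id_apply]

/-- `W` is the infinitesimal composition `X ∘_1 Y`, where `p` is the parity of `X`: for
`f = f_0 f_1`, where `f_0` has no pole inside the first block of variables and `f_1` is a product of
inverses of `z_{k,l}` for `k`, `l` in that block, one writes
`Y_{Λ_1, …, Λ_n, -Λ_1 - ⋯ - Λ_n - ∇}(w ⊗ f_1)` as a combination of ordered monomials, replaces
`Λ_k` by `Λ_k - ∂_{Z_k}`, where the derivatives act on `f_0`, then identifies the variables `Z_k` of
the block, and applies `X`. -/
def IsInfComp (p : ZMod 2) (X : M.Src (Star (m + 1)) →ₗ[K] M.VNabla (m + 1))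
    (Y : M.Src (Star (n + 1)) →ₗ[K] M.VNabla (n + 1))
    (W : M.Src (Star (n + 1 + m)) →ₗ[K] M.VNabla (n + 1 + m)) : Prop :=
  ∀ (w : Fin (n + 1) → V) (v : Fin m → V) (f₀ : OT K N (Apart n m)),
    ∀ f₁ ∈ Submonoid.closure {f : OT K N (Star (n + 1)) | ∃ k l h, f = OT.u k l h},
      W (PiTensorProduct.tprod K (Fin.append w v) ⊗ₜ[K]
          (OT.map id (fun _ _ h h' => h (congrArg (collapse n m) h')) f₀ *
            OT.map (Fin.castAdd m) (fun _ _ h => (Fin.castAdd_injective (n + 1) m).ne h) f₁)) =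
        KPoly.onMon (fun μ : Mon n N => M.contract n p X ∘ₗ
            monoIn (M.gLam m) (M.gTheta m) μ ∘ₗ M.insertFirst v f₀)
          (M.red n (Y (PiTensorProduct.tprod K w ⊗ₜ[K] f₁)))

open Classical in
/-- The infinitesimal composition `X ∘_1 Y`, where `p` is the parity of `X`. (The products
`f_0 f_1` span all functions, so that it is unique.) -/
def infComp (p : ZMod 2) (X : M.Src (Star (m + 1)) →ₗ[K] M.VNabla (m + 1))
    (Y : M.Src (Star (n + 1)) →ₗ[K] M.VNabla (n + 1)) :
    M.Src (Star (n + 1 + m)) →ₗ[K] M.VNabla (n + 1 + m) :=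
  if h : ∃ W, M.IsInfComp p X Y W then h.choose else 0

/-- The product `X □ Y = ∑ (X ∘_1 Y)^{σ⁻¹}` over the shuffles `σ`, where `p` is the parity
of `X`. -/
def box (p : ZMod 2) (X : M.Src (Star (m + 1)) →ₗ[K] M.VNabla (m + 1))
    (Y : M.Src (Star (n + 1)) →ₗ[K] M.VNabla (n + 1)) :
    M.Src (Star (n + 1 + m)) →ₗ[K] M.VNabla (n + 1 + m) :=
  ∑ σ : Equiv.Perm (Fin (n + 1 + m)) with
    (∀ k l : Fin (n + 1), k < l → σ (Fin.castAdd m k) < σ (Fin.castAdd m l)) ∧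
    (∀ k l : Fin m, k < l → σ (Fin.natAdd (n + 1) k) < σ (Fin.natAdd (n + 1) l)),
    M.symAct σ⁻¹ (M.infComp p X Y)

/-- The odd Maurer-Cartan solutions: the odd symmetric binary operations `X` of the chiral operad
of `V` with `X □ X = 0`. -/
def MCodd : Set (M.Src (Star 2) →ₗ[K] M.VNabla 2) :=
  {X | M.IsOp X ∧ M.HasParity 1 X ∧ (∀ σ, M.symAct σ X = X) ∧ M.box (n := 1) (m := 1) 1 X X = 0}

/-- The linear map `∫_F^G dΛ : V[Λ] → V`. -/
def integral (F G : Module.End K V) : KPoly K 1 N ⊗[K] V →ₗ[K] V :=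
  KPoly.onMon fun μ => if μ.2 = Finset.univ then
    ((μ.1 0 : K) + 1)⁻¹ • (G ^ (μ.1 0 + 1) - F ^ (μ.1 0 + 1)) else 0

/-- The linear map `∫_0^T dΛ a : V[Λ] → V`, which sends `Λ^{m | I} v` to the product of
`∫_0^T dΛ Λ^{m | I} a` with `v`. -/
def integralMul (mu : V →ₗ[K] V →ₗ[K] V) (a : V) : KPoly K 1 N ⊗[K] V →ₗ[K] V :=
  KPoly.onMon fun μ => mu (integral 0 M.T (KPoly.mono μ ⊗ₜ[K] a))

/-- The linear map `∫_0^λ dΓ : V[Γ] → V[λ]`. -/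
def integralLam : KPoly K 1 N ⊗[K] V →ₗ[K] KPoly K 1 N ⊗[K] V :=
  KPoly.onMon fun μ => if μ.2 = Finset.univ then
    ((μ.1 0 : K) + 1)⁻¹ • TensorProduct.mk K (KPoly K 1 N) V (KPoly.lam 0 ^ (μ.1 0 + 1)) else 0

/-- The extension of a linear map `f` of parity `q` to polynomials with coefficients in `V`,
`a v ↦ (-1)^{q p(a)} a f(v)`. -/
def extPoly (q : ZMod 2) (f : V →ₗ[K] KPoly K n N ⊗[K] V) :
    KPoly K n N ⊗[K] V →ₗ[K] KPoly K n N ⊗[K] V :=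
  TensorProduct.lift (LinearMap.lcomp K _ f ∘ₗ
    (Algebra.lsmul K K (KPoly K n N ⊗[K] V)).toLinearMap ∘ₗ
    (KPoly.inv (K := K) (n := n) (N := N)).toLinearMap ^ q.val)

/-- `V[Λ] → V[Λ_1, Λ_2]`, `Λ ↦ Λ_k`. -/
def inVar (k : Fin 2) : KPoly K 1 N ⊗[K] V →ₗ[K] KPoly K 2 N ⊗[K] V :=
  TensorProduct.map (KPoly.var k).toLinearMap LinearMap.id

/-- `V[Λ] → V[Λ_1, Λ_2]`, `Λ ↦ Λ_1 + Λ_2`. -/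
def inSum : KPoly K 1 N ⊗[K] V →ₗ[K] KPoly K 2 N ⊗[K] V :=
  TensorProduct.map (KPoly.fib fun _ : Fin 2 => 0).toLinearMap LinearMap.id

/-- `br`, `(a, b) ↦ [a_Λ b]`, is the bracket of an `N_K = N` SUSY Lie conformal algebra on `V`: it has
parity `N` and satisfies sesquilinearity, skew-symmetry and the Jacobi identity. -/
structure IsLieConformal (br : V →ₗ[K] V →ₗ[K] KPoly K 1 N ⊗[K] V) : Prop where
  parity : ∀ p q, ∀ a ∈ M.gr p, ∀ b ∈ M.gr q, M.epsL (br a b) = sg K (p + q + N) • br a b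
  sesq_left : ∀ i a b, br (M.S i a) b = -(sg K N • lmul (KPoly.theta 0 i) (br a b))
  sesq_right : ∀ i p, ∀ a ∈ M.gr p, ∀ b,
    br a (M.S i b) = sg K (p + N) • (lmul (KPoly.theta 0 i) (br a b) + M.SL i (br a b))
  skew : ∀ p q, ∀ a ∈ M.gr p, ∀ b ∈ M.gr q,
    br b a = -(sg K (p * q + N) • M.negSubst (br a b))
  jacobi : ∀ p q, ∀ a ∈ M.gr p, ∀ b ∈ M.gr q, ∀ c,
    extPoly (p + N) (inVar 0 ∘ₗ br a) (inVar 1 (br b c)) =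
      sg K (p * N + N) • extPoly N (inSum ∘ₗ br.flip c) (inVar 0 (br a b)) +
      sg K ((p + N) * (q + N)) • extPoly (q + N) (inVar 1 ∘ₗ br b) (inVar 0 (br a c))

/-- The bracket `br` and the even product `mu` make `V` a non-unital `N_K = N` SUSY vertex algebra. -/
structure IsNonunitalVA (br : V →ₗ[K] V →ₗ[K] KPoly K 1 N ⊗[K] V) (mu : V →ₗ[K] V →ₗ[K] V) :
    Prop where
  lie : M.IsLieConformal br
  mul_mem : ∀ p q, ∀ a ∈ M.gr p, ∀ b ∈ M.gr q, mu a b ∈ M.gr (p + q)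
  der : ∀ i p, ∀ a ∈ M.gr p, ∀ b, M.S i (mu a b) = mu (M.S i a) b + sg K p • mu a (M.S i b)
  quasi_comm : ∀ p q, ∀ a ∈ M.gr p, ∀ b ∈ M.gr q,
    mu a b - sg K (p * q) • mu b a = integral (-M.T) 0 (br a b)
  quasi_assoc : ∀ p q, ∀ a ∈ M.gr p, ∀ b ∈ M.gr q, ∀ c,
    mu (mu a b) c - mu a (mu b c) =
      M.integralMul mu a (br b c) + sg K (p * q) • M.integralMul mu b (br a c)
  wick : ∀ p q, ∀ a ∈ M.gr p, ∀ b ∈ M.gr q, ∀ c,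
    br a (mu b c) = TensorProduct.map LinearMap.id (mu.flip c) (br a b) +
      sg K ((p + N) * q) •
        TensorProduct.map (KPoly.inv.toLinearMap ^ q.val) (mu b) (br a c) +
      extPoly 0 (integralLam ∘ₗ br.flip c) (br a b)

/-- `(a, b) ↦ (-1)^{p(a) (N + 1)} a ⊗ b ⊗ f`, where `p` is the parity of `V`. -/
def pairF (f : OT K N (Star 2)) : V →ₗ[K] V →ₗ[K] M.Src (Star 2) :=
  LinearMap.mk₂ K
    (fun a b => PiTensorProduct.tprod K ![(M.eps ^ (N + 1)) a, b] ⊗ₜ[K] f)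
    (fun a a' b => by
      rw [map_add, ← TensorProduct.add_tmul]
      exact congrArg (· ⊗ₜ[K] f)
        ((PiTensorProduct.tprod K (s := fun _ : Fin 2 => V)).cons_add ![b] _ _))
    (fun r a b => by
      rw [map_smul, TensorProduct.smul_tmul']
      exact congrArg (· ⊗ₜ[K] f)
        ((PiTensorProduct.tprod K (s := fun _ : Fin 2 => V)).cons_smul ![b] _ _))
    (fun a b b' => by
      have e : ∀ x y : V, Function.update ![x, 0] 1 y = ![x, y] := fun x y => by
        ext i; fin_cases i <;> rfl
      have := (PiTensorProduct.tprod K (s := fun _ : Fin 2 => V)).map_update_add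
        ![(M.eps ^ (N + 1)) a, 0] 1 b b'
      rw [e, e, e] at this
      rw [← TensorProduct.add_tmul, this])
    (fun r a b => by
      have e : ∀ x y : V, Function.update ![x, 0] 1 y = ![x, y] := fun x y => by
        ext i; fin_cases i <;> rfl
      have := (PiTensorProduct.tprod K (s := fun _ : Fin 2 => V)).map_update_smul
        ![(M.eps ^ (N + 1)) a, 0] 1 r b
      rw [e, e] at this
      rw [TensorProduct.smul_tmul', this])

/-- The bracket `[a_Λ b]_X = (-1)^{p(a) (N + 1)} X_{Λ, -Λ-∇}(a ⊗ b ⊗ 1)`. -/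
def bracketOf (X : (M.shift (N + 1)).Src (Star 2) →ₗ[K] (M.shift (N + 1)).VNabla 2) :
    V →ₗ[K] V →ₗ[K] KPoly K 1 N ⊗[K] V :=
  (M.pairF 1).compr₂ ((M.shift (N + 1)).red 1 ∘ₗ X)

/-- The linear map `x ↦ Res_Λ(λ⁻¹ x)`, where `Res_Λ` takes the coefficient of
`λ⁻¹ θ^1 ⋯ θ^N`. -/
def resLam : KPoly K 1 N ⊗[K] V →ₗ[K] V :=
  KPoly.onMon fun μ => if μ.1 0 = 0 ∧ μ.2 = Finset.univ then LinearMap.id else 0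

/-- The product
`μ_X(a ⊗ b) = (-1)^{p(a) (N + 1) + 1} Res_Λ(λ⁻¹ X_{Λ, -Λ-∇}(a ⊗ b ⊗ z_{1,2}⁻¹))`. -/
def mulOf (X : (M.shift (N + 1)).Src (Star 2) →ₗ[K] (M.shift (N + 1)).VNabla 2) :
    V →ₗ[K] V →ₗ[K] V :=
  -(M.pairF (OT.u 0 1 (by decide : (0 : Fin 2) ≠ 1))).compr₂
    (resLam ∘ₗ (M.shift (N + 1)).red 1 ∘ₗ X)

end HKMod

end

end SusyK

open scoped TensorProduct
namespace SusyK
noncomputable section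

section
namespace KPoly

variable {K : Type*} [Field K] {n m N : ℕ}

/-- Induction by left multiplication with generators. -/
@[elab_as_elim]
theorem ind_left {C : KPoly K n N → Prop} (h1 : C 1) (hs : ∀ (r : K) a, C a → C (r • a))
    (ha : ∀ a b, C a → C b → C (a + b)) (hl : ∀ k a, C a → C (lam k * a))
    (ht : ∀ k i a, C a → C (theta k i * a)) (a) : C a := by
  have : ∀ a b : KPoly K n N, C b → C (a * b) := by
    intro a
    induction a using KPoly.induction with
    | h0 r => intro b hb; rw [← Algebra.smul_def]; exact hs r b hb
    | hl k => exact hl k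
    | ht k i => exact ht k i
    | hm a b iha ihb => intro c hc; rw [mul_assoc]; exact iha _ (ihb _ hc)
    | ha a b iha ihb => intro c hc; rw [add_mul]; exact ha _ _ (iha c hc) (ihb c hc)
  simpa using this a 1 h1

/-- The even part of an ordered monomial. -/
def lamPart (a : Fin n → ℕ) : KPoly K n N := (List.ofFn fun k => lam k ^ a k).prod

/-- The odd part of an ordered monomial. -/
def thetaPart (I : Finset (Fin n ×ₗ Fin N)) : KPoly K n N :=
  (I.sort.map fun j => theta (ofLex j).1 (ofLex j).2).prod

theorem mono_eq (μ : Mon n N) : (mono μ : KPoly K n N) = lamPart μ.1 * thetaPart μ.2 := rfl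

theorem lamPart_zero : (lamPart 0 : KPoly K n N) = 1 := by
  simp [lamPart]

theorem thetaPart_empty : (thetaPart ∅ : KPoly K n N) = 1 := by
  simp [thetaPart]

theorem mono_zero : (mono (0, ∅) : KPoly K n N) = 1 := by
  rw [mono_eq, lamPart_zero, thetaPart_empty, one_mul]

theorem lamPart_add_single (a : Fin n → ℕ) (k : Fin n) :
    (lamPart (a + Pi.single k 1) : KPoly K n N) = lam k * lamPart a := by
  let c : Fin n → Subalgebra.center K (KPoly K n N) := fun k =>
    ⟨lam k, Subalgebra.mem_center_iff.2 fun b => (lam_comm k b).symm⟩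
  have h : ∀ a : Fin n → ℕ, (lamPart a : KPoly K n N) =
      ((∏ k, c k ^ a k : Subalgebra.center K (KPoly K n N)) : KPoly K n N) := fun a => by
    rw [← List.prod_ofFn, lamPart, ← Subalgebra.coe_val, map_list_prod, List.map_ofFn]
    rfl
  rw [h, h]
  have : ∏ l, c l ^ (a + Pi.single k 1 : Fin n → ℕ) l = c k * ∏ l, c l ^ a l := by
    simp only [Pi.add_apply, pow_add, Finset.prod_mul_distrib]
    rw [mul_comm]
    congr 1
    rw [Finset.prod_eq_single k]
    · simp
    · intro b _ hb; simp [hb]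
    · simp
  rw [this]
  rfl

theorem thetaPart_insert {h : Fin n ×ₗ Fin N} {t : Finset (Fin n ×ₗ Fin N)}
    (hh : ∀ x ∈ t, h < x) :
    (thetaPart (insert h t) : KPoly K n N) = theta (ofLex h).1 (ofLex h).2 * thetaPart t := by
  rw [thetaPart, Finset.sort_insert _ (fun b hb => (hh b hb).le)
    (fun e => lt_irrefl _ (hh h e)), List.map_cons, List.prod_cons, thetaPart]

theorem theta_anti {k l : Fin n} {i j : Fin N} (h : ¬(k = l ∧ i = j)) :
    (theta k i * theta l j : KPoly K n N) = -(theta l j * theta k i) := by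
  have := theta_theta (K := K) k l i j
  rw [if_neg h] at this
  exact eq_neg_of_add_eq_zero_left this

theorem theta_sq [CharZero K] (k : Fin n) (i : Fin N) :
    (theta k i * theta k i : KPoly K n N) = -lam k := by
  have := theta_theta (K := K) k k i i
  rw [if_pos ⟨rfl, rfl⟩, ← two_smul K, neg_smul, ← smul_neg] at this
  exact smul_right_injective _ (two_ne_zero' K) this

theorem inv_mul_lam (k : Fin n) (a : KPoly K n N) : inv (lam k * a) = lam k * inv a := by
  rw [map_mul, HKMod.inv_lam]

theorem inv_mul_theta (k : Fin n) (i : Fin N) (a : KPoly K n N) :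
    inv (theta k i * a) = -(theta k i * inv a) := by
  rw [map_mul, HKMod.inv_theta, neg_mul]

theorem coord_one : coord (1 : KPoly K n N) = Finsupp.single (0, ∅) 1 := by
  simp [coord]

theorem coord_lam_mul (k : Fin n) (a : KPoly K n N) : coord (lam k * a) = lamOp K k (coord a) := by
  simp [coord, pbwAct]

theorem coord_theta_mul (k : Fin n) (i : Fin N) (a : KPoly K n N) :
    coord (theta k i * a) = thetaOp K (toLex (k, i)) (coord a) := by
  simp [coord, pbwAct]

theorem coord_lamPart_mul (a : Fin n → ℕ) (b : KPoly K n N) (c : Fin n → ℕ)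
    (I : Finset (Fin n ×ₗ Fin N)) (h : coord b = Finsupp.single (c, I) 1) :
    coord (lamPart a * b) = Finsupp.single (a + c, I) 1 := by
  obtain ⟨d, hd⟩ : ∃ d, d = ∑ k, a k := ⟨_, rfl⟩
  induction d generalizing a with
  | zero =>
    have : a = 0 := by
      funext k
      exact (Finset.sum_eq_zero_iff.1 hd.symm) k (Finset.mem_univ k)
    subst this
    rw [lamPart_zero, one_mul, h, zero_add]
  | succ d ih =>
    obtain ⟨k, hk⟩ : ∃ k, a k ≠ 0 := by
      by_contra! hc
      simp [hc] at hd
    have ha : a = (a - Pi.single k 1) + Pi.single k 1 := by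
      funext l
      by_cases hl : l = k
      · subst hl; simp; omega
      · simp [hl]
    have hs : d = ∑ l, (a - Pi.single k 1 : Fin n → ℕ) l := by
      have : ∑ l, a l = ∑ l, (a - Pi.single k 1 : Fin n → ℕ) l + 1 := by
        conv_lhs => rw [ha]
        simp [Finset.sum_add_distrib]
      omega
    rw [ha, lamPart_add_single, mul_assoc, coord_lam_mul, ih _ hs, lamOp_single, add_right_comm]

theorem coord_thetaPart (I : Finset (Fin n ×ₗ Fin N)) :
    coord (thetaPart I : KPoly K n N) = Finsupp.single (0, I) 1 := by
  induction I using Finset.induction_on_min with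
  | empty => rw [thetaPart_empty, coord_one]
  | insert h t hh ih =>
    have hn : h ∉ t := fun e => lt_irrefl _ (hh h e)
    have hp : posSign K h t = 1 := by
      rw [posSign, Finset.filter_eq_empty_iff.2 fun x hx => (hh x hx).not_gt]
      simp
    rw [thetaPart_insert hh, coord_theta_mul, ih]
    change thetaOp K h _ = _
    rw [thetaOp_single_notMem hn, hp]
    simp

theorem coord_mono (μ : Mon n N) : coord (mono μ : KPoly K n N) = Finsupp.single μ 1 := by
  rw [mono_eq, coord_lamPart_mul _ _ _ _ (coord_thetaPart μ.2), add_zero]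

theorem lamPart_comm (a : Fin n → ℕ) (b : KPoly K n N) : lamPart a * b = b * lamPart a := by
  have : (lamPart a : KPoly K n N) ∈ Subalgebra.center K (KPoly K n N) := by
    refine list_prod_mem fun x hx => ?_
    obtain ⟨k, rfl⟩ := (List.mem_ofFn' _ _).1 hx
    exact pow_mem (Subalgebra.mem_center_iff.2 fun b => (lam_comm k b).symm) _
  exact (Subalgebra.mem_center_iff.1 this b).symm

theorem lam_mul_mono (k : Fin n) (μ : Mon n N) :
    (lam k * mono μ : KPoly K n N) = mono (μ.1 + Pi.single k 1, μ.2) := by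
  rw [mono_eq, mono_eq, lamPart_add_single, mul_assoc]

variable [CharZero K]

theorem theta_mul_thetaPart (j : Fin n ×ₗ Fin N) (I : Finset (Fin n ×ₗ Fin N)) :
    (theta (ofLex j).1 (ofLex j).2 * thetaPart I : KPoly K n N) = posSign K j I •
      if j ∈ I then -(lam (ofLex j).1 * thetaPart (I.erase j)) else thetaPart (insert j I) := by
  induction I using Finset.induction_on_min with
  | empty =>
    have := thetaPart_insert (K := K) (h := j) (t := ∅) (by simp)
    rw [this]; simp [posSign]
  | insert h t hh ih =>
    have hn : h ∉ t := fun e => lt_irrefl _ (hh h e)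
    have hp : ∀ x, x ≤ h → posSign K x (insert h t) = 1 := by
      intro x hx
      rw [posSign, Finset.filter_eq_empty_iff.2]
      · simp
      · intro y hy
        rcases Finset.mem_insert.1 hy with rfl | hy
        · exact hx.not_gt
        · exact (hx.trans (hh y hy).le).not_gt
    rcases lt_trichotomy j h with hj | rfl | hj
    · have hjm : ∀ x ∈ insert h t, j < x := by
        intro y hy
        rcases Finset.mem_insert.1 hy with rfl | hy
        · exact hj
        · exact hj.trans (hh y hy)
      rw [if_neg fun e => lt_irrefl _ (hjm j e), hp j hj.le, one_smul, ← thetaPart_insert hjm]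
    · rw [if_pos (Finset.mem_insert_self _ _), hp j le_rfl, one_smul, thetaPart_insert hh,
        ← mul_assoc, theta_sq, Finset.erase_insert hn, neg_mul]
    · have hne : ¬((ofLex j).1 = (ofLex h).1 ∧ (ofLex j).2 = (ofLex h).2) := fun e =>
        hj.ne' (by
          apply ofLex.injective
          exact Prod.ext e.1 e.2)
      rw [thetaPart_insert hh, ← mul_assoc, theta_anti hne, neg_mul, mul_assoc, ih,
        posSign_insert hn, if_pos hj]
      by_cases hjt : j ∈ t
      · rw [if_pos hjt, if_pos (Finset.mem_insert_of_mem hjt), Finset.erase_insert_of_ne hj.ne,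
          thetaPart_insert (fun x hx => hh x (Finset.mem_of_mem_erase hx))]
        rw [mul_smul_comm, mul_neg, ← mul_assoc, ← mul_assoc, lam_comm]
        simp
      · rw [if_neg hjt, if_neg (by simp [hj.ne', hjt]), Finset.insert_comm, thetaPart_insert
          (h := h) (t := insert j t) (by
            intro y hy
            rcases Finset.mem_insert.1 hy with rfl | hy
            · exact hj
            · exact hh y hy)]
        rw [mul_smul_comm]
        simp

theorem theta_mul_mono_mem {j : Fin n ×ₗ Fin N} {a : Fin n → ℕ} {I : Finset (Fin n ×ₗ Fin N)}
    (h : j ∈ I) : (theta (ofLex j).1 (ofLex j).2 * mono (a, I) : KPoly K n N) =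
      -(posSign K j I • mono (a + Pi.single (ofLex j).1 1, I.erase j)) := by
  rw [mono_eq, ← mul_assoc, ← lamPart_comm, mul_assoc, theta_mul_thetaPart, if_pos h, mono_eq]
  simp only [lamPart_add_single, smul_neg, mul_neg, mul_smul_comm]
  rw [← mul_assoc, ← lam_comm]

theorem theta_mul_mono_notMem {j : Fin n ×ₗ Fin N} {a : Fin n → ℕ}
    {I : Finset (Fin n ×ₗ Fin N)} (h : j ∉ I) :
    (theta (ofLex j).1 (ofLex j).2 * mono (a, I) : KPoly K n N) =
      posSign K j I • mono (a, insert j I) := by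
  rw [mono_eq, ← mul_assoc, ← lamPart_comm, mul_assoc, theta_mul_thetaPart, if_neg h, mono_eq,
    mul_smul_comm]

/-- The ordered monomials span. -/
@[elab_as_elim]
theorem ind_mono {C : KPoly K n N → Prop} (hm : ∀ μ, C (mono μ))
    (hs : ∀ (r : K) a, C a → C (r • a)) (ha : ∀ a b, C a → C b → C (a + b)) (a) : C a := by
  suffices h : ∀ a : KPoly K n N, a ∈ Submodule.span K (Set.range (mono (K := K) (n := n) (N := N))) by
    induction h a using Submodule.span_induction with
    | mem x h => obtain ⟨μ, rfl⟩ := h; exact hm μ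
    | zero => simpa using hs 0 _ (hm (0, ∅))
    | add x y _ _ hx hy => exact ha x y hx hy
    | smul r x _ hx => exact hs r x hx
  intro a
  have hμ : ∀ μ, (mono μ : KPoly K n N) ∈ Submodule.span K (Set.range (mono (K := K))) :=
    fun μ => Submodule.subset_span ⟨μ, rfl⟩
  induction a using KPoly.ind_left with
  | h1 => rw [← mono_zero]; exact hμ _
  | hs r a h => exact Submodule.smul_mem _ r h
  | ha a b ha hb => exact add_mem ha hb
  | hl k a h =>
    induction h using Submodule.span_induction with
    | mem x h => obtain ⟨μ, rfl⟩ := h; rw [lam_mul_mono]; exact hμ _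
    | zero => rw [mul_zero]; exact zero_mem _
    | add x y _ _ hx hy => rw [mul_add]; exact add_mem hx hy
    | smul r x _ hx => rw [mul_smul_comm]; exact Submodule.smul_mem _ r hx
  | ht k i a h =>
    induction h using Submodule.span_induction with
    | mem x h =>
      obtain ⟨⟨c, I⟩, rfl⟩ := h
      by_cases h : toLex (k, i) ∈ I
      · have := theta_mul_mono_mem (K := K) (a := c) h
        simp only [ofLex_toLex] at this
        rw [this]
        exact neg_mem (Submodule.smul_mem _ _ (hμ _))
      · have := theta_mul_mono_notMem (K := K) (a := c) h
        simp only [ofLex_toLex] at this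
        rw [this]
        exact Submodule.smul_mem _ _ (hμ _)
    | zero => rw [mul_zero]; exact zero_mem _
    | add x y _ _ hx hy => rw [mul_add]; exact add_mem hx hy
    | smul r x _ hx => rw [mul_smul_comm]; exact Submodule.smul_mem _ r hx

theorem dLam_mono (k : Fin n) (μ : Mon n N) : dLam k (mono μ : KPoly K n N) =
    (μ.1 k : K) • mono (μ.1 - Pi.single k 1, μ.2) := by
  simp [dLam, coord_mono]

theorem dTheta_mono (k : Fin n) (i : Fin N) (μ : Mon n N) : dTheta k i (mono μ : KPoly K n N) =
    if toLex (k, i) ∈ μ.2 then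
      posSign K (toLex (k, i)) μ.2 • mono (μ.1, μ.2.erase (toLex (k, i))) else 0 := by
  simp only [dTheta, LinearMap.comp_apply, coord_mono, Finsupp.linearCombination_single, one_smul]

theorem onMon_mono {V W : Type*} [AddCommGroup V] [Module K V] [AddCommGroup W] [Module K W]
    (w : Mon n N → V →ₗ[K] W) (μ : Mon n N) (v : V) : onMon w (mono μ ⊗ₜ[K] v) = w μ v := by
  simp [onMon, coord_mono]

theorem dLam_one (k : Fin n) : dLam k (1 : KPoly K n N) = 0 := by
  simp [dLam, coord_one]

theorem dTheta_one (k : Fin n) (i : Fin N) : dTheta k i (1 : KPoly K n N) = 0 := by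
  simp [dTheta, coord_one]

theorem dLam_lam (k l : Fin n) (a : KPoly K n N) :
    dLam k (lam l * a) = lam l * dLam k a + if k = l then a else 0 := by
  induction a using KPoly.ind_mono with
  | hs r a h => rw [mul_smul_comm, map_smul, h, map_smul, mul_smul_comm, smul_add]; split_ifs <;> simp
  | ha a b ha hb => rw [mul_add, map_add, ha, hb, map_add, mul_add]; split_ifs <;> abel
  | hm μ =>
    rw [lam_mul_mono, dLam_mono, dLam_mono, mul_smul_comm, lam_mul_mono]
    by_cases h : k = l
    · subst h
      rw [if_pos rfl]
      have e1 : μ.1 + Pi.single k 1 - Pi.single k 1 = μ.1 := by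
        funext x; simp
      by_cases h0 : μ.1 k = 0
      · simp [h0, e1]
      · have e2 : μ.1 - Pi.single k 1 + Pi.single k 1 = μ.1 := by
          funext x
          by_cases hx : x = k
          · subst hx; simp; omega
          · simp [hx]
        simp only [e1, e2, Pi.add_apply, Pi.single_eq_same, Nat.cast_add, Nat.cast_one, add_smul,
          one_smul]
    · have e : μ.1 + Pi.single l 1 - Pi.single k 1 = μ.1 - Pi.single k 1 + Pi.single l 1 := by
        funext x
        by_cases hx : x = k
        · subst hx; simp [h]
        · simp [hx]
      simp [h, e]

theorem dTheta_lam (k l : Fin n) (i : Fin N) (a : KPoly K n N) :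
    dTheta k i (lam l * a) = lam l * dTheta k i a := by
  induction a using KPoly.ind_mono with
  | hs r a h => rw [mul_smul_comm, map_smul, h, map_smul, mul_smul_comm]
  | ha a b ha hb => rw [mul_add, map_add, ha, hb, map_add, mul_add]
  | hm μ =>
    rw [lam_mul_mono, dTheta_mono, dTheta_mono]
    split_ifs with h
    · rw [mul_smul_comm, lam_mul_mono]
    · rw [mul_zero]

theorem dTheta_theta (k l : Fin n) (i i' : Fin N) (a : KPoly K n N) :
    dTheta k i (theta l i' * a) = (if k = l ∧ i = i' then a else 0) - theta l i' * dTheta k i a := by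
  induction a using KPoly.ind_mono with
  | hs r a h => rw [mul_smul_comm, map_smul, h, map_smul, mul_smul_comm, smul_sub]; split_ifs <;> simp
  | ha a b ha hb => rw [mul_add, map_add, ha, hb, map_add, mul_add]; split_ifs <;> abel
  | hm μ =>
    obtain ⟨c, I⟩ := μ
    obtain ⟨j, hj⟩ : ∃ j, j = toLex (k, i) := ⟨_, rfl⟩
    obtain ⟨j', hj'⟩ : ∃ j', j' = toLex (l, i') := ⟨_, rfl⟩
    have m1 := @theta_mul_mono_mem K _ n N _ j'
    have m2 := @theta_mul_mono_notMem K _ n N _ j'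
    have hjj : (k = l ∧ i = i') ↔ j = j' := by
      rw [hj, hj', toLex_inj, Prod.mk.injEq]
    rw [hj'] at m1 m2
    simp only [ofLex_toLex] at m1 m2
    rw [← hj'] at m1 m2
    simp only [hjj]
    rw [dTheta_mono, ← hj]
    by_cases e : j = j'
    · subst e
      rw [if_pos rfl]
      by_cases h : j ∈ I
      · rw [if_pos h, m1 h, map_neg, map_smul, dTheta_mono, ← hj]
        simp only [Finset.mem_erase, ne_eq, not_true_eq_false, false_and, if_false, smul_zero,
          neg_zero]
        rw [mul_smul_comm, m2 (Finset.notMem_erase _ _), Finset.insert_erase h, posSign_erase_self,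
          smul_smul, posSign_mul_self, one_smul, sub_self]
      · rw [if_neg h, m2 h, map_smul, dTheta_mono, ← hj]
        simp only [Finset.mem_insert_self, if_true, posSign_insert_self, Finset.erase_insert h,
          smul_smul, posSign_mul_self, one_smul, mul_zero, sub_zero]
    · have hs : (if j' < j then (-1 : K) else 1) = -(if j < j' then (-1 : K) else 1) := by
        rcases lt_or_gt_of_ne e with h | h <;> simp [h, h.not_gt]
      rw [if_neg e]
      by_cases h' : j' ∈ I <;> by_cases h : j ∈ I
      · have e2 : j' ∈ I.erase j := Finset.mem_erase.2 ⟨Ne.symm e, h'⟩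
        rw [if_pos h, m1 h', map_neg, map_smul, dTheta_mono, ← hj]
        simp only [Finset.mem_erase, ne_eq, e, h, not_false_eq_true, and_self, if_true]
        rw [mul_smul_comm, m1 e2, posSign_erase h, posSign_erase h', hs, Finset.erase_right_comm]
        module
      · rw [if_neg h, m1 h', map_neg, map_smul, dTheta_mono, ← hj]
        simp [h]
      · have e2 : j' ∉ I.erase j := fun x => h' (Finset.mem_of_mem_erase x)
        rw [if_pos h, m2 h', map_smul, dTheta_mono, ← hj]
        simp only [Finset.mem_insert, h, or_true, if_true]
        rw [mul_smul_comm, m2 e2, posSign_erase h, posSign_insert h', hs,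
          Finset.erase_insert_of_ne (Ne.symm e)]
        module
      · rw [if_neg h, m2 h', map_smul, dTheta_mono, ← hj]
        simp [h, e]

theorem dLam_theta (k l : Fin n) (i : Fin N) (a : KPoly K n N) :
    dLam k (theta l i * a) = theta l i * dLam k a - if k = l then dTheta l i a else 0 := by
  induction a using KPoly.ind_mono with
  | hs r a h => rw [mul_smul_comm, map_smul, h, map_smul, mul_smul_comm, smul_sub]; split_ifs <;> simp
  | ha a b ha hb => rw [mul_add, map_add, ha, hb, map_add, mul_add]; split_ifs <;> (try rw [map_add]) <;> abel
  | hm μ =>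
    obtain ⟨c, I⟩ := μ
    obtain ⟨j, hj⟩ : ∃ j, j = toLex (l, i) := ⟨_, rfl⟩
    have m1 := @theta_mul_mono_mem K _ n N _ j
    have m2 := @theta_mul_mono_notMem K _ n N _ j
    rw [hj] at m1 m2
    simp only [ofLex_toLex] at m1 m2
    rw [← hj] at m1 m2
    rw [dTheta_mono, ← hj, dLam_mono, mul_smul_comm]
    by_cases h : j ∈ I
    · rw [if_pos h, m1 h, m1 h, ← lam_mul_mono l (c, I.erase j), map_neg, map_smul, dLam_lam,
        dLam_mono, ← lam_mul_mono l (c - Pi.single k 1, I.erase j), mul_smul_comm]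
      split_ifs <;> module
    · rw [if_neg h, m2 h, m2 h, map_smul, dLam_mono]
      simp only [ite_self, sub_zero]
      rw [smul_comm]

/-- The action of `z_{k,l}` on polynomials. -/
def Zp (k l : Fin n) : Module.End K (KPoly K n N) :=
  dLam l - dLam k + ∑ i, dTheta k i ∘ₗ dTheta l i

/-- The difference `∂_{θ_k^i} - ∂_{θ_l^i}`. -/
def Zt (k l : Fin n) (i : Fin N) : Module.End K (KPoly K n N) := dTheta k i - dTheta l i

theorem Zp_one (k l : Fin n) : Zp k l (1 : KPoly K n N) = 0 := by
  simp [Zp, dLam_one, dTheta_one]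

theorem Zt_one (k l : Fin n) (i : Fin N) : Zt k l i (1 : KPoly K n N) = 0 := by
  simp [Zt, dTheta_one]

/-- The Kronecker symbol. -/
def dl (K : Type*) [Field K] {ι : Type*} [DecidableEq ι] (a b : ι) : K := if a = b then 1 else 0

theorem Zp_lam (k l m : Fin n) (a : KPoly K n N) :
    Zp k l (lam m * a) = lam m * Zp k l a + (dl K l m - dl K k m) • a := by
  simp only [Zp, LinearMap.add_apply, LinearMap.sub_apply, LinearMap.sum_apply,
    LinearMap.comp_apply, dLam_lam, dTheta_lam, mul_add, mul_sub, Finset.mul_sum, dl]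
  split_ifs <;> simp <;> abel

theorem Zt_lam (k l m : Fin n) (i : Fin N) (a : KPoly K n N) :
    Zt k l i (lam m * a) = lam m * Zt k l i a := by
  simp only [Zt, LinearMap.sub_apply, dTheta_lam, mul_sub]

theorem Zt_theta (k l m : Fin n) (i j : Fin N) (a : KPoly K n N) :
    Zt k l i (theta m j * a) = (dl K i j * (dl K k m - dl K l m)) • a - theta m j * Zt k l i a := by
  simp only [Zt, LinearMap.sub_apply, dTheta_theta, mul_sub, dl]
  by_cases h : i = j <;> by_cases h1 : k = m <;> by_cases h2 : l = m <;> simp [h, h1, h2] <;> abel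

theorem Zp_theta (k l m : Fin n) (j : Fin N) (a : KPoly K n N) :
    Zp k l (theta m j * a) = theta m j * Zp k l a + (dl K k m + dl K l m) • Zt k l j a := by
  have e : ∀ i, dTheta k i (dTheta l i (theta m j * a)) =
      theta m j * dTheta k i (dTheta l i a) +
        (if i = j then (dl K l m) • dTheta k i a - dl K k m • dTheta l i a else 0) := by
    intro i
    rw [dTheta_theta, map_sub, dTheta_theta]
    by_cases h : i = j <;> by_cases h1 : k = m <;> by_cases h2 : l = m <;> simp [h, h1, h2, dl] <;>
      abel
  simp only [Zp, Zt, LinearMap.add_apply, LinearMap.sub_apply, LinearMap.sum_apply,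
    LinearMap.comp_apply, e, dLam_theta, Finset.sum_add_distrib, Finset.sum_ite_eq',
    Finset.mem_univ, if_true, mul_add, mul_sub, Finset.mul_sum]
  by_cases h1 : k = m <;> by_cases h2 : l = m <;> simp [h1, h2, dl] <;> abel

end KPoly

end

section
namespace OAlg

variable {K : Type*} [Field K] {N n m : ℕ} {E : Fin n → Fin n → Prop}
  {E' : Fin m → Fin m → Prop}

theorem dz_z (j k : Fin n) : dz j (z k : OAlg K N E) = if k = j then 1 else 0 := by
  simp [dz, upper, dzHom, skewHom, tri]

theorem dz_zeta (j k : Fin n) (i : Fin N) : dz j (zeta k i : OAlg K N E) = 0 := by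
  simp [dz, upper, dzHom, skewHom, tri]

theorem dz_u (j k l : Fin n) (h : E k l) : dz j (u k l h : OAlg K N E) = -(u k l h *
    ((if k = j then 1 else 0) - (if l = j then 1 else 0)) * u k l h) := by
  simp [dz, upper, dzHom, skewHom, tri]

theorem dzeta_z (j k : Fin n) (i : Fin N) :
    dzeta j i (z k : OAlg K N E) = if k = j then -zeta j i else 0 := by
  simp [dzeta, upper, dzetaHom, skewHom, tri]

theorem dzeta_zeta (j k : Fin n) (i i' : Fin N) :
    dzeta j i (zeta k i' : OAlg K N E) = if k = j ∧ i' = i then 1 else 0 := by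
  simp [dzeta, upper, dzetaHom, skewHom, tri]

theorem dzeta_u (j k l : Fin n) (i : Fin N) (h : E k l) : dzeta j i (u k l h : OAlg K N E) =
    -(u k l h * (if k = j ∧ l = j then 0 else if k = j ∨ l = j then -zetaz k l i else 0) *
      u k l h) := by
  simp [dzeta, upper, dzetaHom, skewHom, tri]

theorem zz_u (k l : Fin n) (h : E k l) : (zz k l * u k l h : OAlg K N E) = 1 := by
  rw [← u_central, u_mul]

/-- A skew derivation that vanishes on `z_k` and `ζ_k^i` is zero. -/
theorem skew_zero {B : Type*} [Ring B] [Algebra K B] (φ ψ : OAlg K N E →ₐ[K] B)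
    (d : OAlg K N E →ₗ[K] B) (hd : ∀ a b, d (a * b) = φ a * d b + d a * ψ b)
    (hz : ∀ k, d (z k) = 0) (ht : ∀ k i, d (zeta k i) = 0) (a) : d a = 0 := by
  have d1 : d 1 = 0 := by
    have := hd 1 1
    rwa [mul_one, map_one φ, map_one ψ, one_mul, mul_one, left_eq_add] at this
  induction a using OAlg.induction with
  | h0 r => rw [Algebra.algebraMap_eq_smul_one, map_smul, d1, smul_zero]
  | hz k => exact hz k
  | ht k i => exact ht k i
  | hu k l h =>
    have h0 : d (zz k l) = 0 := by
      rw [zz, map_add, map_sub, hz, hz, map_sum, sub_zero, zero_add]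
      refine Finset.sum_eq_zero fun i _ => ?_
      rw [hd, ht, ht, mul_zero, zero_mul, add_zero]
    have h1 := hd (u k l h) (zz k l)
    rw [u_mul, d1, h0, mul_zero, zero_add] at h1
    have h2 := congrArg (· * ψ (u k l h)) h1
    simp only [zero_mul, mul_assoc, ← map_mul, zz_u, map_one, mul_one] at h2
    exact h2.symm
  | hm a b ha hb => rw [hd, ha, hb, mul_zero, zero_mul, add_zero]
  | ha a b ha hb => rw [map_add, ha, hb, add_zero]

theorem inv_inv (a : OAlg K N E) : inv (inv a) = a := by
  induction a using OAlg.induction with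
  | h0 r => simp
  | hz l => simp
  | ht l i => simp
  | hu k l h => simp
  | hm a b iha ihb => simp [iha, ihb]
  | ha a b iha ihb => simp [iha, ihb]

theorem inv_dz (j : Fin n) (a : OAlg K N E) : inv (dz j a) = dz j (inv a) := by
  have := skew_zero (inv (K := K) (N := N) (E := E)) inv
    (inv.toLinearMap ∘ₗ dz j - dz j ∘ₗ inv.toLinearMap)
    (fun a b => by
      simp only [LinearMap.sub_apply, LinearMap.comp_apply, AlgHom.toLinearMap_apply, dz_mul,
        map_mul, map_add, mul_sub, sub_mul]
      abel)
    (fun k => by simp [dz_z]) (fun k i => by simp [dz_zeta]) a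
  exact sub_eq_zero.1 this

theorem inv_dzeta (j : Fin n) (i : Fin N) (a : OAlg K N E) :
    inv (dzeta j i a) = -dzeta j i (inv a) := by
  have := skew_zero (AlgHom.id K (OAlg K N E)) inv
    (inv.toLinearMap ∘ₗ dzeta j i + dzeta j i ∘ₗ inv.toLinearMap)
    (fun a b => by
      simp only [LinearMap.add_apply, LinearMap.comp_apply, AlgHom.toLinearMap_apply, dzeta_mul,
        map_mul, map_add, mul_add, add_mul, inv_inv, AlgHom.id_apply]
      abel)
    (fun k => by simp [dzeta_z]; try (split_ifs <;> simp))
    (fun k i => by simp [dzeta_zeta]) a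
  exact eq_neg_of_add_eq_zero_left this

theorem dz_dz (j k : Fin n) (a : OAlg K N E) : dz j (dz k a) = dz k (dz j a) := by
  have := skew_zero (AlgHom.id K (OAlg K N E)) (AlgHom.id K _) (dz j ∘ₗ dz k - dz k ∘ₗ dz j)
    (fun a b => by
      simp only [LinearMap.sub_apply, LinearMap.comp_apply, dz_mul, map_add, mul_sub, sub_mul,
        AlgHom.id_apply]
      abel)
    (fun l => by
      have e : ∀ j, dz j (1 : OAlg K N E) = 0 := fun j => by
        have := dz_mul j (1 : OAlg K N E) 1
        rwa [mul_one, one_mul, mul_one, left_eq_add] at this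
      simp only [LinearMap.sub_apply, LinearMap.comp_apply, dz_z]
      split_ifs <;> simp [e])
    (fun k i => by simp [dz_zeta]) a
  exact sub_eq_zero.1 this

theorem dz_one (j : Fin n) : dz j (1 : OAlg K N E) = 0 := by
  have := dz_mul j (1 : OAlg K N E) 1
  rwa [mul_one, one_mul, mul_one, left_eq_add] at this

theorem dzeta_one (j : Fin n) (i : Fin N) : dzeta j i (1 : OAlg K N E) = 0 := by
  have := dzeta_mul j i (1 : OAlg K N E) 1
  rwa [mul_one, map_one inv, one_mul, mul_one, left_eq_add] at this

theorem dz_dzeta (j k : Fin n) (i : Fin N) (a : OAlg K N E) :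
    dz j (dzeta k i a) = dzeta k i (dz j a) := by
  have := skew_zero (inv (K := K) (N := N) (E := E)) (AlgHom.id K _)
    (dz j ∘ₗ dzeta k i - dzeta k i ∘ₗ dz j)
    (fun a b => by
      simp only [LinearMap.sub_apply, LinearMap.comp_apply, dz_mul, dzeta_mul, map_add, mul_sub,
        sub_mul, AlgHom.id_apply, inv_dz]
      abel)
    (fun l => by
      simp only [LinearMap.sub_apply, LinearMap.comp_apply, dz_z, dzeta_z]
      split_ifs <;> simp [dz_zeta, dzeta_one])
    (fun k i => by
      simp only [LinearMap.sub_apply, LinearMap.comp_apply, dz_zeta, dzeta_zeta]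
      split_ifs <;> simp [dz_one]) a
  exact sub_eq_zero.1 this

theorem dzeta_dzeta (k l : Fin n) (i j : Fin N) (a : OAlg K N E) :
    dzeta k i (dzeta l j a) + dzeta l j (dzeta k i a) =
      if k = l ∧ i = j then (-2 : K) • dz k a else 0 := by
  have := skew_zero (AlgHom.id K (OAlg K N E)) (AlgHom.id K _)
    (dzeta k i ∘ₗ dzeta l j + dzeta l j ∘ₗ dzeta k i
      - if k = l ∧ i = j then (-2 : K) • dz k else 0)
    (fun a b => by
      split_ifs <;>
      simp only [LinearMap.sub_apply, LinearMap.add_apply, LinearMap.comp_apply, dz_mul, dzeta_mul,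
        map_add, mul_sub, sub_mul, mul_add, add_mul, AlgHom.id_apply, inv_inv, inv_dzeta,
        LinearMap.smul_apply, LinearMap.zero_apply, smul_add, mul_smul_comm, smul_mul_assoc,
        neg_mul, mul_neg, mul_zero, zero_mul] <;> abel)
    (fun m => by
      by_cases h : k = l ∧ i = j
      · obtain ⟨rfl, rfl⟩ := h
        by_cases hm : m = k
        · simp [dzeta_z, dzeta_zeta, dz_z, hm, two_smul]
        · simp [dzeta_z, dzeta_zeta, dz_z, hm]
      · have h' : ¬(l = k ∧ j = i) := fun e => h ⟨e.1.symm, e.2.symm⟩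
        simp only [LinearMap.sub_apply, LinearMap.add_apply, LinearMap.comp_apply, dzeta_z, if_neg h]
        by_cases h1 : m = l <;> by_cases h2 : m = k
        · subst h1; subst h2; simp at h h'; simp [dzeta_zeta, h, h']
        · subst h1; simp [h2, dzeta_zeta]; try tauto
        · subst h2; simp [h1, dzeta_zeta]; try tauto
        · simp [h1, h2])
    (fun m i' => by
      simp only [LinearMap.sub_apply, LinearMap.add_apply, LinearMap.comp_apply, dzeta_zeta]
      split_ifs <;> simp [dz_zeta, dzeta_one]) a
  rw [LinearMap.sub_apply, LinearMap.add_apply, sub_eq_zero] at this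
  simp only [LinearMap.comp_apply] at this
  rw [this]
  split_ifs <;> rfl

theorem map_inv (c : Fin n → Fin m) (hc : ∀ k l, E k l → E' (c k) (c l)) (a : OAlg K N E) :
    map c hc (inv a) = inv (map c hc a) := by
  induction a using OAlg.induction with
  | h0 r => simp
  | hz l => simp [map_z]
  | ht l i => simp [map_zeta]
  | hu k l h => simp [map_u]
  | hm a b iha ihb => simp [iha, ihb]
  | ha a b iha ihb => simp [iha, ihb]

theorem dz_map (c : Fin n → Fin m) (hc : ∀ k l, E k l → E' (c k) (c l)) (j : Fin m)
    (a : OAlg K N E) : dz j (map c hc a) = ∑ k with c k = j, map c hc (dz k a) := by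
  have := skew_zero (map (K := K) (N := N) c hc) (map c hc)
    (dz j ∘ₗ (map c hc).toLinearMap - ∑ k with c k = j, (map c hc).toLinearMap ∘ₗ dz k)
    (fun a b => by
      simp only [LinearMap.sub_apply, LinearMap.comp_apply, AlgHom.toLinearMap_apply, dz_mul,
        map_mul, map_add, mul_sub, sub_mul, LinearMap.sum_apply, Finset.sum_add_distrib,
        Finset.mul_sum, Finset.sum_mul]
      abel)
    (fun l => by
      simp only [LinearMap.sub_apply, LinearMap.comp_apply, AlgHom.toLinearMap_apply,
        LinearMap.sum_apply, map_z, dz_z, apply_ite (map c hc), map_one, map_zero]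
      rw [Finset.sum_ite_eq]
      simp)
    (fun l i => by
      simp [map_zeta, dz_zeta]) a
  rw [LinearMap.sub_apply, LinearMap.sum_apply, sub_eq_zero] at this
  exact this

theorem dzeta_map (c : Fin n → Fin m) (hc : ∀ k l, E k l → E' (c k) (c l)) (j : Fin m) (i : Fin N)
    (a : OAlg K N E) : dzeta j i (map c hc a) = ∑ k with c k = j, map c hc (dzeta k i a) := by
  have := skew_zero (inv.comp (map (K := K) (N := N) c hc)) (map c hc)
    (dzeta j i ∘ₗ (map c hc).toLinearMap - ∑ k with c k = j, (map c hc).toLinearMap ∘ₗ dzeta k i)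
    (fun a b => by
      simp only [LinearMap.sub_apply, LinearMap.comp_apply, AlgHom.toLinearMap_apply, dzeta_mul,
        map_mul, map_add, mul_sub, sub_mul, LinearMap.sum_apply, Finset.sum_add_distrib,
        Finset.mul_sum, Finset.sum_mul, AlgHom.comp_apply, map_inv]
      abel)
    (fun l => by
      simp only [LinearMap.sub_apply, LinearMap.comp_apply, AlgHom.toLinearMap_apply,
        LinearMap.sum_apply, map_z, dzeta_z, apply_ite (map c hc), map_neg, map_zero]
      rw [Finset.sum_ite_eq]
      by_cases h : c l = j
      · simp [h, map_zeta]
      · simp [h])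
    (fun l i' => by
      simp only [LinearMap.sub_apply, LinearMap.comp_apply, AlgHom.toLinearMap_apply,
        LinearMap.sum_apply, map_zeta, dzeta_zeta, apply_ite (map c hc), map_one, map_zero]
      by_cases h : i' = i
      · simp only [h, and_true]
        rw [Finset.sum_ite_eq]
        simp
      · simp [h]) a
  rw [LinearMap.sub_apply, LinearMap.sum_apply, sub_eq_zero] at this
  exact this

end OAlg

namespace OT

variable {K : Type*} [Field K] {N n m : ℕ} {E : Fin n → Fin n → Prop}
  {E' : Fin m → Fin m → Prop}

@[elab_as_elim]
theorem induction {C : OT K N E → Prop} (h0 : ∀ r, C (algebraMap K _ r))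
    (hz : ∀ k l, C (zz k l)) (ht : ∀ k l i, C (zetaz k l i)) (hu : ∀ k l h, C (u k l h))
    (hm : ∀ a b, C a → C b → C (a * b)) (ha : ∀ a b, C a → C b → C (a + b)) (f) : C f := by
  obtain ⟨f, hf⟩ := f
  induction hf using Algebra.adjoin_induction with
  | mem x hx =>
    rcases hx with (⟨k, l, rfl⟩ | ⟨k, l, i, rfl⟩) | ⟨k, l, h, rfl⟩
    exacts [hz k l, ht k l i, hu k l h]
  | algebraMap r => exact h0 r
  | add x y _ _ hx hy => exact ha _ _ hx hy
  | mul x y _ _ hx hy => exact hm _ _ hx hy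

theorem coe_zz (k l : Fin n) : ((zz k l : OT K N E) : OAlg K N E) = OAlg.zz k l := rfl
theorem coe_zetaz (k l : Fin n) (i : Fin N) :
    ((zetaz k l i : OT K N E) : OAlg K N E) = OAlg.zetaz k l i := rfl
theorem coe_u (k l : Fin n) (h : E k l) : ((u k l h : OT K N E) : OAlg K N E) = OAlg.u k l h := rfl
theorem dz_mul (j : Fin n) (a b : OT K N E) : dz j (a * b) = a * dz j b + dz j a * b :=
  Subtype.ext (OAlg.dz_mul j a.1 b.1)

theorem dzeta_mul (j : Fin n) (i : Fin N) (a b : OT K N E) :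
    dzeta j i (a * b) = inv a * dzeta j i b + dzeta j i a * b :=
  Subtype.ext (OAlg.dzeta_mul j i a.1 b.1)

theorem inv_inv (a : OT K N E) : inv (inv a) = a := Subtype.ext (OAlg.inv_inv a.1)

theorem inv_dz (j : Fin n) (a : OT K N E) : inv (dz j a) = dz j (inv a) :=
  Subtype.ext (OAlg.inv_dz j a.1)

theorem inv_dzeta (j : Fin n) (i : Fin N) (a : OT K N E) : inv (dzeta j i a) = -dzeta j i (inv a) :=
  Subtype.ext (OAlg.inv_dzeta j i a.1)

theorem dz_dz (j k : Fin n) (a : OT K N E) : dz j (dz k a) = dz k (dz j a) :=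
  Subtype.ext (OAlg.dz_dz j k a.1)

theorem dz_dzeta (j k : Fin n) (i : Fin N) (a : OT K N E) :
    dz j (dzeta k i a) = dzeta k i (dz j a) := Subtype.ext (OAlg.dz_dzeta j k i a.1)

theorem dzeta_dzeta (k l : Fin n) (i j : Fin N) (a : OT K N E) :
    dzeta k i (dzeta l j a) + dzeta l j (dzeta k i a) =
      if k = l ∧ i = j then (-2 : K) • dz k a else 0 := by
  apply Subtype.ext
  have := OAlg.dzeta_dzeta k l i j (a : OAlg K N E)
  split_ifs at this ⊢ <;> exact this

theorem map_inv (c : Fin n → Fin m) (hc : ∀ k l, E k l → E' (c k) (c l)) (a : OT K N E) :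
    map c hc (inv a) = inv (map c hc a) := Subtype.ext (OAlg.map_inv c hc a.1)

theorem dz_map (c : Fin n → Fin m) (hc : ∀ k l, E k l → E' (c k) (c l)) (j : Fin m)
    (a : OT K N E) : dz j (map c hc a) = ∑ k with c k = j, map c hc (dz k a) := by
  apply Subtype.ext
  rw [AddSubmonoidClass.coe_finset_sum]
  exact OAlg.dz_map c hc j a.1

theorem dzeta_map (c : Fin n → Fin m) (hc : ∀ k l, E k l → E' (c k) (c l)) (j : Fin m) (i : Fin N)
    (a : OT K N E) : dzeta j i (map c hc a) = ∑ k with c k = j, map c hc (dzeta k i a) := by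
  apply Subtype.ext
  rw [AddSubmonoidClass.coe_finset_sum]
  exact OAlg.dzeta_map c hc j i a.1

theorem zz_comm (k l : Fin n) (f : OT K N E) : zz k l * f = f * zz k l := by
  have hs : ∀ (k : Fin n) (i : Fin N) (a : OAlg K N E), OAlg.zeta k i * a = OAlg.inv a * OAlg.zeta k i :=
    OAlg.zeta_super
  apply Subtype.ext
  change OAlg.zz k l * f.1 = f.1 * OAlg.zz k l
  rw [OAlg.zz, add_mul, mul_add, sub_mul, mul_sub, OAlg.z_central, OAlg.z_central, Finset.sum_mul,
    Finset.mul_sum]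
  congr 1
  refine Finset.sum_congr rfl fun i _ => ?_
  rw [mul_assoc, hs l, ← mul_assoc, hs k, OAlg.inv_inv, mul_assoc]

theorem u_comm (k l : Fin n) (h : E k l) (f : OT K N E) : u k l h * f = f * u k l h :=
  Subtype.ext (OAlg.u_central k l h f.1)

theorem zetaz_mul (k l : Fin n) (i : Fin N) (f : OT K N E) :
    zetaz k l i * f = inv f * zetaz k l i := by
  apply Subtype.ext
  change OAlg.zetaz k l i * (f : OAlg K N E) = OAlg.inv f * OAlg.zetaz k l i
  rw [OAlg.zetaz, sub_mul, mul_sub, OAlg.zeta_super, OAlg.zeta_super]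

theorem u_zz (k l : Fin n) (h : E k l) : (u k l h * zz k l : OT K N E) = 1 :=
  Subtype.ext (OAlg.u_mul k l h)

theorem zz_u (k l : Fin n) (h : E k l) : (zz k l * u k l h : OT K N E) = 1 :=
  Subtype.ext (OAlg.zz_u k l h)

@[simp] theorem inv_zz (k l : Fin n) : inv (zz k l : OT K N E) = zz k l :=
  Subtype.ext (OAlg.inv_zz k l)

@[simp] theorem inv_zetaz (k l : Fin n) (i : Fin N) : inv (zetaz k l i : OT K N E) = -zetaz k l i := by
  apply Subtype.ext
  change OAlg.inv (OAlg.zetaz k l i) = -OAlg.zetaz k l i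
  simp [OAlg.zetaz]; abel

@[simp] theorem inv_u (k l : Fin n) (h : E k l) : inv (u k l h : OT K N E) = u k l h :=
  Subtype.ext (OAlg.inv_u k l h)

@[simp] theorem map_zz (c : Fin n → Fin m) (hc : ∀ k l, E k l → E' (c k) (c l)) (k l : Fin n) :
    map c hc (zz k l : OT K N E) = zz (c k) (c l) := by
  apply Subtype.ext
  change OAlg.map c hc (OAlg.zz k l) = OAlg.zz (c k) (c l)
  simp [OAlg.zz, OAlg.map_z, OAlg.map_zeta]

@[simp] theorem map_zetaz (c : Fin n → Fin m) (hc : ∀ k l, E k l → E' (c k) (c l)) (k l : Fin n)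
    (i : Fin N) : map c hc (zetaz k l i : OT K N E) = zetaz (c k) (c l) i := by
  apply Subtype.ext
  change OAlg.map c hc (OAlg.zetaz k l i) = OAlg.zetaz (c k) (c l) i
  simp [OAlg.zetaz, OAlg.map_zeta]

@[simp] theorem map_u (c : Fin n → Fin m) (hc : ∀ k l, E k l → E' (c k) (c l)) (k l : Fin n)
    (h : E k l) : map c hc (u k l h : OT K N E) = u (c k) (c l) (hc k l h) :=
  Subtype.ext (OAlg.map_u c hc k l h)

theorem dz_one (j : Fin n) : dz j (1 : OT K N E) = 0 := Subtype.ext (OAlg.dz_one j)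

theorem dzeta_one (j : Fin n) (i : Fin N) : dzeta j i (1 : OT K N E) = 0 :=
  Subtype.ext (OAlg.dzeta_one j i)

theorem dz_zz (j k l : Fin n) : dz j (zz k l : OT K N E) =
    (if k = j then 1 else 0) - (if l = j then 1 else 0) := by
  apply Subtype.ext
  change OAlg.dz j (OAlg.zz k l) = _
  simp only [OAlg.zz, map_add, map_sub, OAlg.dz_z, map_sum, OAlg.dz_mul, OAlg.dz_zeta, mul_zero,
    zero_mul, add_zero, Finset.sum_const_zero]
  split_ifs <;> simp

theorem dz_zetaz (j k l : Fin n) (i : Fin N) : dz j (zetaz k l i : OT K N E) = 0 := by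
  apply Subtype.ext
  change OAlg.dz j (OAlg.zetaz k l i) = 0
  simp [OAlg.zetaz, OAlg.dz_zeta]

theorem dzeta_zetaz (j k l : Fin n) (i i' : Fin N) : dzeta j i (zetaz k l i' : OT K N E) =
    if i' = i then (if k = j then 1 else 0) - (if l = j then 1 else 0) else 0 := by
  apply Subtype.ext
  change OAlg.dzeta j i (OAlg.zetaz k l i') = _
  simp only [OAlg.zetaz, map_sub, OAlg.dzeta_zeta]
  by_cases h : i' = i <;> by_cases h1 : k = j <;> by_cases h2 : l = j <;> simp [h, h1, h2]

theorem zetaz_self (k : Fin n) (i : Fin N) : (zetaz k k i : OT K N E) = 0 :=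
  Subtype.ext (sub_self _)

theorem zetaz_swap (k l : Fin n) (i : Fin N) : (zetaz l k i : OT K N E) = -zetaz k l i :=
  Subtype.ext (neg_sub _ _).symm

theorem zetaz_add (k l m : Fin n) (i : Fin N) :
    (zetaz k l i + zetaz l m i : OT K N E) = zetaz k m i :=
  Subtype.ext (sub_add_sub_cancel _ _ _)

theorem zetaz_sq [CharZero K] (k l : Fin n) (i : Fin N) : (zetaz k l i * zetaz k l i : OT K N E) = 0 := by
  have := zetaz_mul k l i (zetaz k l i : OT K N E)
  rw [inv_zetaz, neg_mul, eq_neg_iff_add_eq_zero, ← two_smul K] at this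
  exact (smul_eq_zero.1 this).resolve_left two_ne_zero

theorem zetaz_anti (k l k' l' : Fin n) (i j : Fin N) :
    (zetaz k l i * zetaz k' l' j : OT K N E) = -(zetaz k' l' j * zetaz k l i) := by
  rw [zetaz_mul, inv_zetaz, neg_mul]

theorem dzeta_zz (j k l : Fin n) (i : Fin N) : dzeta j i (zz k l : OT K N E) =
    if k = j ∧ l = j then 0 else if k = j ∨ l = j then -zetaz k l i else 0 := by
  apply Subtype.ext
  change OAlg.dzeta j i (OAlg.zz k l) = _
  simp only [OAlg.zz, map_add, map_sub, map_sum, OAlg.dzeta_mul, OAlg.dzeta_z, OAlg.dzeta_zeta,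
    OAlg.inv_zeta]
  by_cases hk : k = j <;> by_cases hl : l = j
  · subst hk hl
    simp only [if_true, true_and, and_self, sub_self, zero_add]
    refine Finset.sum_eq_zero fun x _ => ?_
    split_ifs <;> simp
  · subst hk
    simp [hl, coe_zetaz, OAlg.zetaz]
    abel
  · subst hl
    simp [hk, coe_zetaz, OAlg.zetaz]
    abel
  · simp [hk, hl]

theorem dz_u (j k l : Fin n) (h : E k l) : dz j (u k l h : OT K N E) =
    ((if l = j then 1 else 0) - (if k = j then 1 else 0)) * u k l h ^ 2 := by
  apply Subtype.ext
  change OAlg.dz j (OAlg.u k l h) = _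
  rw [OAlg.dz_u]
  split_ifs <;> simp [coe_u, sq]

theorem dzeta_u (j k l : Fin n) (i : Fin N) (h : E k l) : dzeta j i (u k l h : OT K N E) =
    (if k = j ∧ l = j then 0 else if k = j ∨ l = j then zetaz k l i else 0) * u k l h ^ 2 := by
  apply Subtype.ext
  change OAlg.dzeta j i (OAlg.u k l h) = _
  rw [OAlg.dzeta_u]
  split_ifs <;> simp [coe_u, coe_zetaz, sq]
  rw [OAlg.u_central, mul_assoc]

theorem zz_swap (k l : Fin n) : (zz l k : OT K N E) = -zz k l := by
  apply Subtype.ext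
  change OAlg.zz l k = -OAlg.zz k l
  have : ∑ i, OAlg.zeta l i * OAlg.zeta k i = -∑ i, (OAlg.zeta k i * OAlg.zeta l i : OAlg K N E) := by
    rw [← Finset.sum_neg_distrib]
    exact Finset.sum_congr rfl fun i _ => eq_neg_of_add_eq_zero_left (OAlg.zeta_zeta _ _ _ _)
  rw [OAlg.zz, OAlg.zz, this]
  abel

theorem u_swap (k l : Fin n) (h : E k l) (h' : E l k) : (u l k h' : OT K N E) = -u k l h := by
  have h1 : (u l k h' : OT K N E) = u l k h' * (zz k l * u k l h) := by rw [zz_u, mul_one]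
  rw [h1, ← mul_assoc, ← neg_neg (zz k l : OT K N E), ← zz_swap, mul_neg, u_zz, neg_mul, one_mul]

theorem zz_add [CharZero K] (k l m : Fin n) : (zz k m : OT K N E) =
    zz k l + zz l m - ∑ i, zetaz k l i * zetaz l m i := by
  apply Subtype.ext
  rw [AddSubgroupClass.coe_sub, AddSubmonoidClass.coe_finset_sum]
  change OAlg.zz k m = OAlg.zz k l + OAlg.zz l m - ∑ i, OAlg.zetaz k l i * OAlg.zetaz l m i
  have : ∀ i, (OAlg.zetaz k l i * OAlg.zetaz l m i : OAlg K N E) =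
      OAlg.zeta k i * OAlg.zeta l i - OAlg.zeta k i * OAlg.zeta m i + OAlg.zeta l i * OAlg.zeta m i
        - OAlg.zeta l i * OAlg.zeta l i := fun i => by
    simp only [OAlg.zetaz, sub_mul, mul_sub]; abel
  simp only [this, OAlg.zz, Finset.sum_add_distrib, Finset.sum_sub_distrib]
  have h0 : ∑ i, (OAlg.zeta l i * OAlg.zeta l i : OAlg K N E) = 0 := by
    refine Finset.sum_eq_zero fun i _ => ?_
    have := OAlg.zeta_zeta (K := K) (E := E) l l i i
    rw [← two_smul K] at this
    exact (smul_eq_zero.1 this).resolve_left two_ne_zero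
  rw [h0]
  abel

theorem dz_sum (f : OT K N E) : ∑ k, dz k f = 0 := by
  induction f using OT.induction with
  | h0 r => simp [Algebra.algebraMap_eq_smul_one, dz_one]
  | hz k l => simp [dz_zz]
  | ht k l i => simp [dz_zetaz]
  | hu k l h => simp [dz_u, ← Finset.sum_mul]
  | hm a b ha hb => simp only [dz_mul, Finset.sum_add_distrib, ← Finset.mul_sum, ← Finset.sum_mul, ha, hb]; simp
  | ha a b ha hb => simp only [map_add, Finset.sum_add_distrib, ha, hb, add_zero]

theorem dzeta_one_eq [CharZero K] {E : Fin 2 → Fin 2 → Prop} (i : Fin N) (f : OT K N E) :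
    dzeta 1 i f = -dzeta 0 i f - (2 : K) • (zetaz 0 1 i * dz 0 f) := by
  induction f using OT.induction with
  | h0 r => simp [Algebra.algebraMap_eq_smul_one, dz_one, dzeta_one]
  | hz k l =>
    fin_cases k <;> fin_cases l <;> simp [dz_zz, dzeta_zz, zetaz_swap 0 1, two_smul]
    try abel
  | ht k l i' =>
    fin_cases k <;> fin_cases l <;> by_cases h : i' = i <;> simp [dzeta_zetaz, dz_zetaz, h]
  | hu k l h =>
    fin_cases k <;> fin_cases l <;> simp [dz_u, dzeta_u, zetaz_swap 0 1, two_smul]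
    try abel
  | hm a b ha hb =>
    rw [dzeta_mul, ha, hb, dzeta_mul, dz_mul, mul_sub, mul_neg, sub_mul, neg_mul, mul_smul_comm,
      ← mul_assoc, ← zetaz_mul, mul_add, ← mul_assoc, ← mul_assoc, smul_mul_assoc, smul_add]
    abel
  | ha a b ha hb => rw [map_add, ha, hb, map_add, map_add, mul_add, smul_add]; abel

theorem zz_base [CharZero K] (a k l : Fin n) :
    (zz k a - zz l a + ∑ i, zetaz k a i * zetaz l a i : OT K N E) = zz k l := by
  rw [zz_add k a l, zz_swap l a]
  simp only [zetaz_swap l a, mul_neg, Finset.sum_neg_distrib]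
  abel

section Extension

variable [CharZero K] {E₂ : Fin n → Fin n → Prop} {A : Type*} [AddCommGroup A] [Module K A]

/-- Sequences of linear maps on functions that are compatible with multiplication by `z_{a,b}`. -/
def seqMod (E : Fin n → Fin n → Prop) (A : Type*) [AddCommGroup A] [Module K A] (a b : Fin n) :
    Submodule K (ℕ → OT K N E →ₗ[K] A) where
  carrier := {G | ∀ j f, G (j + 1) (zz a b * f) = G j f}
  add_mem' h h' j f := by simp [h j f, h' j f]
  zero_mem' j f := by simp
  smul_mem' r G h j f := by simp [h j f]

/-- Functions act on compatible sequences by `(g G)_j(f) = G_j(f g)`. -/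
def seqAct (a b : Fin n) : OT K N E →ₐ[K] Module.End K (seqMod (K := K) (N := N) E A a b) :=
  AlgHom.ofLinearMap
    { toFun := fun g =>
        { toFun := fun G => ⟨fun j => G.1 j ∘ₗ LinearMap.mulRight K g, fun j f => by
            simp only [LinearMap.comp_apply, LinearMap.mulRight_apply, mul_assoc]
            exact G.2 j _⟩
          map_add' := fun G G' => rfl
          map_smul' := fun r G => rfl }
      map_add' := fun g g' => by
        ext G j f
        simp [mul_add]
      map_smul' := fun r g => by
        ext G j f
        simp }
    (by ext G j f; simp)
    (fun g g' => by ext G j f; simp [mul_assoc])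

/-- The shift of compatible sequences. -/
def seqShift (a b : Fin n) : Module.End K (seqMod (K := K) (N := N) E A a b) where
  toFun G := ⟨fun j => G.1 (j + 1), fun j f => G.2 (j + 1) f⟩
  map_add' G G' := rfl
  map_smul' r G := rfl

theorem seqShift_act (a b : Fin n) (g : OT K N E) :
    (seqShift a b * seqAct a b g : Module.End K (seqMod (K := K) (N := N) E A a b)) =
      seqAct a b g * seqShift a b := rfl

theorem seqShift_zz (a b : Fin n) :
    (seqShift a b * seqAct a b (zz a b) : Module.End K (seqMod (K := K) (N := N) E A a b)) = 1 := by
  ext G j f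
  change G.1 (j + 1) (f * zz a b) = G.1 j f
  rw [← zz_comm]
  exact G.2 j f

open Classical in
/-- The action of functions with additional poles on compatible sequences. -/
def seqHom (a b : Fin n) (hab' : ∀ k l, E₂ k l → E k l ∨ (k = a ∧ l = b) ∨ (k = b ∧ l = a)) :
    OAlg K N E₂ →ₐ[K] Module.End K (seqMod (K := K) (N := N) E A a b) :=
  OAlg.lift (fun k => seqAct a b (zz k a)) (fun k i => seqAct a b (zetaz k a i))
    (fun k l _ => if h : E k l then seqAct a b (u k l h) else
      (if k = a ∧ l = b then (1 : K) else -1) • seqShift a b)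
    (fun k l => by rw [← map_mul, ← map_mul, zz_comm])
    (fun k l i => by rw [← map_mul, ← map_mul, zz_comm])
    (fun k l i j => by rw [← map_mul, ← map_mul, ← map_add, zetaz_anti, neg_add_cancel, map_zero])
    (fun k l h j => by
      split_ifs <;> simp only [smul_mul_assoc, mul_smul_comm, seqShift_act, ← map_mul]
      rw [u_comm])
    (fun k l h j i => by
      split_ifs <;> simp only [smul_mul_assoc, mul_smul_comm, seqShift_act, ← map_mul]
      rw [u_comm])
    (fun k l h k' l' h' => by
      split_ifs <;> simp only [smul_mul_assoc, mul_smul_comm, seqShift_act, ← map_mul, smul_smul,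
        mul_comm]
      rw [u_comm])
    (fun k l h => by
      have e : seqAct a b (zz k a) - seqAct a b (zz l a) +
          ∑ i, seqAct a b (zetaz k a i) * seqAct a b (zetaz l a i) =
          (seqAct a b (zz k l) : Module.End K (seqMod (K := K) (N := N) E A a b)) := by
        rw [← zz_base a k l]
        simp only [map_mul, map_sub, map_sum, map_add]
      rw [e]
      split_ifs with h1 h2
      · rw [← map_mul, u_zz, map_one]
      · obtain ⟨rfl, rfl⟩ := h2
        rw [one_smul]
        exact seqShift_zz _ _
      · obtain ⟨rfl, rfl⟩ := ((hab' k l h).resolve_left h1).resolve_left h2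
        rw [zz_swap, ← neg_one_smul K (zz l k), map_smul, smul_mul_assoc, mul_smul_comm, smul_smul,
          neg_mul_neg, one_mul, one_smul]
        exact seqShift_zz _ _)

theorem seqHom_map (hE : ∀ k l, E k l → E₂ k l) (a b : Fin n)
    (hab' : ∀ k l, E₂ k l → E k l ∨ (k = a ∧ l = b) ∨ (k = b ∧ l = a)) (f : OT K N E) :
    (seqHom a b hab' (map id hE f : OT K N E₂).1 :
      Module.End K (seqMod (K := K) (N := N) E A a b)) = seqAct a b f := by
  induction f using OT.induction with
  | h0 r => simp
  | hz k l =>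
    rw [map_zz, ← zz_base a k l]
    simp [seqHom, coe_zz, OAlg.zz]
  | ht k l i =>
    rw [map_zetaz, ← zetaz_add k a l, zetaz_swap l a]
    simp [seqHom, coe_zetaz, OAlg.zetaz]
    abel
  | hu k l h =>
    rw [map_u]
    simp [seqHom, coe_u, h]
  | hm f g hf hg => rw [map_mul, map_mul, ← hf, ← hg]; simp
  | ha f g hf hg => rw [map_add, map_add, ← hf, ← hg]; simp

/-- Extension of a compatible sequence of linear maps to functions with additional poles. -/
theorem exists_ext (hE : ∀ k l, E k l → E₂ k l) (a b : Fin n) (hab : E₂ a b) (hn : ¬E a b)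
    (hab' : ∀ k l, E₂ k l → E k l ∨ (k = a ∧ l = b) ∨ (k = b ∧ l = a))
    (G : ℕ → OT K N E →ₗ[K] A) (hG : ∀ j f, G (j + 1) (zz a b * f) = G j f) :
    ∃ F : OT K N E₂ →ₗ[K] A, ∀ j f, F (map id hE f * u a b hab ^ j) = G j f := by
  let G' : seqMod (K := K) (N := N) E A a b := ⟨G, hG⟩
  refine ⟨{ toFun := fun f => (seqHom a b hab' f.1 G').1 0 1
            map_add' := fun f g => by simp
            map_smul' := fun r f => by simp }, fun j f => ?_⟩
  have hu : (seqHom a b hab' (u a b hab : OT K N E₂).1 :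
      Module.End K (seqMod (K := K) (N := N) E A a b)) = seqShift a b := by
    simp [seqHom, coe_u, hn]
  have hj : ∀ j, ((seqShift a b ^ j) G').1 = fun i => G (i + j) := by
    intro j
    induction j with
    | zero => rfl
    | succ j ih =>
      rw [pow_succ']
      funext i
      change ((seqShift a b ^ j) G').1 (i + 1) = _
      rw [ih]
      exact congrArg G (by omega)
  change (seqHom a b hab' (map id hE f * u a b hab ^ j : OT K N E₂).1 G').1 0 1 = G j f
  rw [MulMemClass.coe_mul, SubmonoidClass.coe_pow, map_mul, map_pow, hu, seqHom_map]
  change ((seqShift a b ^ j) G').1 0 (1 * f) = _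
  rw [hj, one_mul]
  simp only [zero_add]

/-- Every function with additional poles is a quotient of a function without them. -/
theorem exists_rep (hE : ∀ k l, E k l → E₂ k l) (a b : Fin n) (hab : E₂ a b)
    (hab' : ∀ k l, E₂ k l → E k l ∨ (k = a ∧ l = b) ∨ (k = b ∧ l = a)) (f : OT K N E₂) :
    ∃ j, ∃ g : OT K N E, f = map id hE g * u a b hab ^ j := by
  have key : ∀ j k, (zz a b : OT K N E₂) ^ j * u a b hab ^ (j + k) = u a b hab ^ k := by
    intro j k
    induction j with
    | zero => simp
    | succ j ih =>
      rw [pow_succ, show j + 1 + k = (j + k) + 1 by ring, pow_succ', mul_assoc,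
        ← mul_assoc (zz a b), zz_u, one_mul, ih]
  induction f using OT.induction with
  | h0 r => exact ⟨0, algebraMap K _ r, by simp⟩
  | hz k l => exact ⟨0, zz k l, by simp⟩
  | ht k l i => exact ⟨0, zetaz k l i, by simp⟩
  | hu k l h =>
    rcases hab' k l h with h' | ⟨rfl, rfl⟩ | ⟨rfl, rfl⟩
    · exact ⟨0, u k l h', by simp⟩
    · exact ⟨1, 1, by simp⟩
    · exact ⟨1, -1, by simp [u_swap l k hab h]⟩
  | hm f g hf hg =>
    obtain ⟨j, f, rfl⟩ := hf
    obtain ⟨k, g, rfl⟩ := hg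
    refine ⟨j + k, f * g, ?_⟩
    have hc : ∀ x : OT K N E₂, u a b hab ^ j * x = x * u a b hab ^ j := fun x =>
      (Commute.pow_left (u_comm a b hab x) j)
    rw [map_mul, mul_assoc, ← mul_assoc (u a b hab ^ j), hc, pow_add]
    simp only [mul_assoc]
  | ha f g hf hg =>
    obtain ⟨j, f, rfl⟩ := hf
    obtain ⟨k, g, rfl⟩ := hg
    refine ⟨j + k, f * zz a b ^ k + g * zz a b ^ j, ?_⟩
    rw [map_add, map_mul, map_mul, map_pow, map_pow, map_zz, add_mul, mul_assoc, mul_assoc, id, id,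
      key j k, add_comm j k, key k j]

end Extension

end OT

end

section
section Sign
variable (K : Type*) [Field K]

theorem zmod2_cases (p : ZMod 2) : p = 0 ∨ p = 1 := by revert p; decide

@[simp] theorem sg_zero : sg K 0 = 1 := by simp [sg]
@[simp] theorem sg_one : sg K 1 = -1 := by simp [sg, ZMod.val_one]

theorem sg_add (p q : ZMod 2) : sg K (p + q) = sg K p * sg K q := by
  rcases zmod2_cases p with rfl | rfl <;> rcases zmod2_cases q with rfl | rfl <;>
    simp [show (1 + 1 : ZMod 2) = 0 from rfl]

theorem sg_mul_self (p : ZMod 2) : sg K p * sg K p = 1 := by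
  rw [← sg_add, CharTwo.add_self_eq_zero, sg_zero]

theorem sg_natCast (n : ℕ) : sg K (n : ZMod 2) = (-1) ^ n := by
  induction n with
  | zero => simp
  | succ n ih => rw [Nat.cast_succ, sg_add, ih, sg_one, pow_succ]

theorem sg_pow (p : ZMod 2) (n : ℕ) : sg K p ^ n = sg K (n * p) := by
  induction n with
  | zero => simp
  | succ n ih => rw [pow_succ, ih, Nat.cast_succ, add_mul, sg_add, one_mul]

end Sign

namespace KPoly
variable {K : Type*} [Field K] {n m N : ℕ}

/-- The inclusion of polynomials in the first `n` supervariables. -/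
def up : KPoly K n N →ₐ[K] KPoly K (n + 1) N :=
  lift (fun k => lam k.castSucc) (fun k i => theta k.castSucc i)
    (fun _ _ => lam_lam _ _) (fun _ _ _ => lam_theta _ _ _)
    (fun k l i j => by rw [theta_theta]; simp only [Fin.castSucc_inj])

@[simp] theorem up_lam (k : Fin n) : up (lam k : KPoly K n N) = lam k.castSucc := by simp [up]
@[simp] theorem up_theta (k : Fin n) (i : Fin N) :
    up (theta k i : KPoly K n N) = theta k.castSucc i := by simp [up]

theorem up_inv (a : KPoly K n N) : up (inv a) = inv (up a) := by
  induction a using KPoly.ind_left with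
  | h1 => simp
  | hs r a h => simp [h]
  | ha a b ha hb => simp [ha, hb]
  | hl l a h => simp [h, HKMod.inv_lam]
  | ht l j a h => simp [h, HKMod.inv_theta]

theorem theta_last_up (i : Fin N) (a : KPoly K n N) :
    theta (Fin.last n) i * up a = inv (up a) * theta (Fin.last n) i := by
  induction a using KPoly.ind_left with
  | h1 => simp
  | hs r a h => simp [h]
  | ha a b ha hb => simp [ha, hb, mul_add, add_mul]
  | hl l a h =>
    rw [map_mul, up_lam, ← mul_assoc, ← lam_comm, mul_assoc, h, map_mul, HKMod.inv_lam, mul_assoc]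
  | ht l j a h =>
    rw [map_mul, up_theta, ← mul_assoc, theta_anti (fun e => (Fin.castSucc_lt_last l).ne' e.1),
      neg_mul, mul_assoc, h, map_mul, HKMod.inv_theta, neg_mul, neg_mul, mul_assoc]

@[simp] theorem fib_lam (c : Fin n → Fin m) (j : Fin m) :
    fib c (lam j : KPoly K m N) = ∑ k with c k = j, lam k := by simp [fib, subst]
@[simp] theorem fib_theta (c : Fin n → Fin m) (j : Fin m) (i : Fin N) :
    fib c (theta j i : KPoly K m N) = ∑ k with c k = j, theta k i := by simp [fib, subst]
@[simp] theorem var_lam (k : Fin n) : var k (lam 0 : KPoly K 1 N) = lam k := by simp [var, subst]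
@[simp] theorem var_theta (k : Fin n) (i : Fin N) :
    var k (theta 0 i : KPoly K 1 N) = theta k i := by simp [var, subst]

end KPoly

namespace HKMod

variable {K : Type*} [Field K] [CharZero K] {n m N : ℕ} {V : Type*} [AddCommGroup V] [Module K V]
variable (M : HKMod K N V)

theorem proj_mem (p : ZMod 2) (v : V) : M.proj p v ∈ M.gr p := by
  rcases zmod2_cases p with rfl | rfl
  · simp [proj]
  · simp only [proj, one_ne_zero, if_false]
    exact Submodule.projection_apply_mem _ _

theorem proj_of_mem {p : ZMod 2} {v : V} (h : v ∈ M.gr p) (q : ZMod 2) :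
    M.proj q v = if q = p then v else 0 := by
  rcases zmod2_cases p with rfl | rfl <;> rcases zmod2_cases q with rfl | rfl
  · simp [proj, Submodule.projection_apply_of_mem_left _ h]
  · simp only [proj, one_ne_zero, if_false]
    exact Submodule.projection_apply_right M.isCompl.symm ⟨v, h⟩
  · simp only [proj, zero_ne_one, if_true, if_false]
    exact Submodule.projection_apply_right M.isCompl ⟨v, h⟩
  · simp only [proj, one_ne_zero, if_false, if_true]
    exact Submodule.projection_apply_of_mem_left _ h

theorem proj_add (v : V) : M.proj 0 v + M.proj 1 v = v := by
  simp only [proj, one_ne_zero, if_false, if_true]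
  exact Submodule.projection_add_projection_eq_self M.isCompl v

theorem eps_of_mem {p : ZMod 2} {v : V} (h : v ∈ M.gr p) : M.eps v = sg K p • v := by
  rw [eps, LinearMap.sub_apply, M.proj_of_mem h, M.proj_of_mem h]
  rcases zmod2_cases p with rfl | rfl <;> simp

/-- Linear maps that agree on homogeneous elements agree. -/
theorem hom_induction {C : V → Prop} (h : ∀ p, ∀ v ∈ M.gr p, C v)
    (ha : ∀ v w, C v → C w → C (v + w)) (v : V) : C v := by
  rw [← M.proj_add v]
  exact ha _ _ (h 0 _ (M.proj_mem 0 v)) (h 1 _ (M.proj_mem 1 v))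

theorem eps_eps (v : V) : M.eps (M.eps v) = v := by
  induction v using M.hom_induction with
  | h p v hv => rw [M.eps_of_mem hv, map_smul, M.eps_of_mem hv, smul_smul, sg_mul_self, one_smul]
  | ha v w hv hw => rw [map_add, map_add, hv, hw]

theorem eps_T (v : V) : M.eps (M.T v) = M.T (M.eps v) := by
  induction v using M.hom_induction with
  | h p v hv => rw [M.eps_of_mem hv, M.eps_of_mem (M.T_mem p v hv), map_smul]
  | ha v w hv hw => simp only [map_add, hv, hw]

theorem eps_S (i : Fin N) (v : V) : M.eps (M.S i v) = -M.S i (M.eps v) := by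
  induction v using M.hom_induction with
  | h p v hv =>
    rw [M.eps_of_mem hv, M.eps_of_mem (M.S_mem i p v hv), map_smul, sg_add, sg_one]
    simp
  | ha v w hv hw => simp only [map_add, hv, hw, neg_add]

theorem mem_gr_of_eps {p : ZMod 2} {v : V} (h : M.eps v = sg K p • v) : v ∈ M.gr p := by
  have h1 := M.proj_add v
  have h2 : M.proj 0 v - M.proj 1 v = sg K p • v := h
  have h20 : (2 : K) ≠ 0 := two_ne_zero
  rcases zmod2_cases p with rfl | rfl
  · rw [sg_zero, one_smul] at h2
    have : (2 : K) • M.proj 1 v = 0 := by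
      rw [two_smul]
      have := h1.trans h2.symm
      rw [← sub_eq_zero] at this
      rw [← this]; abel
    have h0 := (smul_eq_zero.1 this).resolve_left h20
    rw [← h1, h0, add_zero]
    exact M.proj_mem 0 v
  · rw [sg_one, neg_smul, one_smul] at h2
    have : (2 : K) • M.proj 0 v = 0 := by
      rw [two_smul]
      have h3 : M.proj 0 v = v - M.proj 1 v := eq_sub_of_add_eq h1
      have h4 : M.proj 0 v = -v + M.proj 1 v := sub_eq_iff_eq_add.1 h2
      nth_rewrite 1 [h3]
      rw [h4]; abel
    have h0 := (smul_eq_zero.1 this).resolve_left h20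
    rw [← h1, h0, zero_add]
    exact M.proj_mem 1 v

theorem smul_cls (a : KPoly K n N) (x : KPoly K n N ⊗[K] V) : a • M.cls n x = M.cls n (a • x) := rfl

theorem cls_surj (x : M.VNabla n) : ∃ y, M.cls n y = x := Submodule.mkQ_surjective _ x

theorem cls_eq_zero (x : KPoly K n N ⊗[K] V) : M.cls n x = 0 ↔ x ∈ M.nablaRel n :=
  Submodule.Quotient.mk_eq_zero _

/-- The inclusion of constants. -/
def iv (n : ℕ) : V →ₗ[K] M.VNabla n := M.cls n ∘ₗ TensorProduct.mk K (KPoly K n N) V 1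

theorem iv_apply (v : V) : M.iv n v = M.cls n (1 ⊗ₜ[K] v) := rfl

theorem cls_tmul (a : KPoly K n N) (v : V) : M.cls n (a ⊗ₜ[K] v) = a • M.iv n v := by
  rw [iv_apply, smul_cls, TensorProduct.smul_tmul', smul_eq_mul, mul_one]

theorem sum_lam_iv (v : V) : ∑ k, (KPoly.lam k : KPoly K n N) • M.iv n v = -M.iv n (M.T v) := by
  rw [eq_neg_iff_add_eq_zero, ← Finset.sum_smul, ← cls_tmul, iv_apply, ← map_add, cls_eq_zero]
  exact Submodule.subset_span (Or.inl ⟨v, rfl⟩)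

theorem sum_theta_iv (i : Fin N) (v : V) :
    ∑ k, (KPoly.theta k i : KPoly K n N) • M.iv n v = -M.iv n (M.S i v) := by
  rw [eq_neg_iff_add_eq_zero, ← Finset.sum_smul, ← cls_tmul, iv_apply, ← map_add, cls_eq_zero]
  exact Submodule.subset_span (Or.inr ⟨i, v, rfl⟩)

@[elab_as_elim]
theorem vn_induction {C : M.VNabla n → Prop} (h1 : ∀ v, C (M.iv n v))
    (ha : ∀ x y, C x → C y → C (x + y)) (hs : ∀ (r : K) x, C x → C (r • x))
    (hl : ∀ k x, C x → C ((KPoly.lam k : KPoly K n N) • x))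
    (ht : ∀ k i x, C x → C ((KPoly.theta k i : KPoly K n N) • x)) (x) : C x := by
  obtain ⟨y, rfl⟩ := M.cls_surj x
  induction y with
  | zero => simpa using hs 0 _ (h1 0)
  | add x y hx hy => rw [map_add]; exact ha _ _ hx hy
  | tmul a v =>
    rw [cls_tmul]
    induction a using KPoly.ind_left with
    | h1 => rw [one_smul]; exact h1 v
    | hs r a h => rw [smul_assoc]; exact hs r _ h
    | ha a b h h' => rw [add_smul]; exact ha _ _ h h'
    | hl k a h => rw [mul_smul]; exact hl _ _ h
    | ht k i a h => rw [mul_smul]; exact ht _ _ _ h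

section Ops

variable {M}

theorem map_smul_lam {f : Module.End K (KPoly K n N)} {k : Fin n} {r : K}
    (h : ∀ a, f (KPoly.lam k * a) = KPoly.lam k * f a + r • a) (x : KPoly K n N ⊗[K] V) :
    TensorProduct.map f LinearMap.id ((KPoly.lam k : KPoly K n N) • x) =
      (KPoly.lam k : KPoly K n N) • TensorProduct.map f LinearMap.id x + r • x := by
  induction x with
  | zero => simp
  | add x y hx hy => simp only [smul_add, map_add, hx, hy]; abel
  | tmul a v =>
    simp only [TensorProduct.smul_tmul', smul_eq_mul, TensorProduct.map_tmul, h,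
      TensorProduct.add_tmul]
    rfl

theorem ZpV_lam (k l m : Fin n) (x : KPoly K n N ⊗[K] V) :
    TensorProduct.map (KPoly.Zp k l) LinearMap.id ((KPoly.lam m : KPoly K n N) • x) =
      (KPoly.lam m : KPoly K n N) • TensorProduct.map (KPoly.Zp k l) LinearMap.id x +
        (KPoly.dl K l m - KPoly.dl K k m) • x := map_smul_lam (KPoly.Zp_lam k l m) x

theorem ZtV_lam (k l m : Fin n) (i : Fin N) (x : KPoly K n N ⊗[K] V) :
    TensorProduct.map (KPoly.Zt k l i) LinearMap.id ((KPoly.lam m : KPoly K n N) • x) =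
      (KPoly.lam m : KPoly K n N) • TensorProduct.map (KPoly.Zt k l i) LinearMap.id x := by
  have := map_smul_lam (V := V) (f := KPoly.Zt k l i) (k := m) (r := (0 : K))
    (fun a => by rw [KPoly.Zt_lam, zero_smul, add_zero]) x
  rwa [zero_smul, add_zero] at this

theorem ZtV_theta (k l m : Fin n) (i j : Fin N) (x : KPoly K n N ⊗[K] V) :
    TensorProduct.map (KPoly.Zt k l i) LinearMap.id ((KPoly.theta m j : KPoly K n N) • x) =
      (KPoly.dl K i j * (KPoly.dl K k m - KPoly.dl K l m)) • x -
      (KPoly.theta m j : KPoly K n N) • TensorProduct.map (KPoly.Zt k l i) LinearMap.id x := by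
  induction x with
  | zero => simp
  | add x y hx hy => simp only [smul_add, map_add, hx, hy]; abel
  | tmul a v =>
    simp only [TensorProduct.smul_tmul', smul_eq_mul, TensorProduct.map_tmul, KPoly.Zt_theta,
      TensorProduct.sub_tmul]
    rfl

theorem ZpV_theta (k l m : Fin n) (j : Fin N) (x : KPoly K n N ⊗[K] V) :
    TensorProduct.map (KPoly.Zp k l) LinearMap.id ((KPoly.theta m j : KPoly K n N) • x) =
      (KPoly.theta m j : KPoly K n N) • TensorProduct.map (KPoly.Zp k l) LinearMap.id x +
      (KPoly.dl K k m + KPoly.dl K l m) •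
        TensorProduct.map (KPoly.Zt k l j) LinearMap.id x := by
  induction x with
  | zero => simp
  | add x y hx hy => simp only [smul_add, map_add, hx, hy]; abel
  | tmul a v =>
    simp only [TensorProduct.smul_tmul', smul_eq_mul, TensorProduct.map_tmul, KPoly.Zp_theta,
      TensorProduct.add_tmul]

end Ops

theorem smul_mem_nablaRel {x : KPoly K n N ⊗[K] V} (r : K) (h : x ∈ M.nablaRel n) :
    r • x ∈ M.nablaRel n := by
  rw [← algebraMap_smul (KPoly K n N) r x]
  exact Submodule.smul_mem _ _ h

theorem Z_nablaRel (x : KPoly K n N ⊗[K] V) (hx : x ∈ M.nablaRel n) :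
    (∀ k l, TensorProduct.map (KPoly.Zp k l) LinearMap.id x ∈ M.nablaRel n) ∧
    (∀ k l i, TensorProduct.map (KPoly.Zt k l i) LinearMap.id x ∈ M.nablaRel n) := by
  induction hx using Submodule.span_induction with
  | mem x h =>
    rcases h with ⟨v, rfl⟩ | ⟨i, v, rfl⟩
    · constructor
      · intro k l
        have : KPoly.Zp k l (∑ k, KPoly.lam k : KPoly K n N) = 0 := by
          have : ∀ m, KPoly.Zp k l (KPoly.lam m : KPoly K n N) =
              (KPoly.dl K l m - KPoly.dl K k m) • 1 := fun m => by
            have := KPoly.Zp_lam (K := K) (N := N) k l m 1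
            rwa [mul_one, KPoly.Zp_one, mul_zero, zero_add] at this
          rw [map_sum]
          simp only [this, ← Finset.sum_smul, Finset.sum_sub_distrib, KPoly.dl]
          simp
        rw [map_add, TensorProduct.map_tmul, TensorProduct.map_tmul, this, KPoly.Zp_one]
        simp
      · intro k l i
        have : KPoly.Zt k l i (∑ k, KPoly.lam k : KPoly K n N) = 0 := by
          rw [map_sum]
          refine Finset.sum_eq_zero fun m _ => ?_
          have := KPoly.Zt_lam (K := K) k l m i 1
          rwa [mul_one, KPoly.Zt_one, mul_zero] at this
        rw [map_add, TensorProduct.map_tmul, TensorProduct.map_tmul, this, KPoly.Zt_one]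
        simp
    · constructor
      · intro k l
        have : KPoly.Zp k l (∑ k, KPoly.theta k i : KPoly K n N) = 0 := by
          rw [map_sum]
          refine Finset.sum_eq_zero fun m _ => ?_
          have := KPoly.Zp_theta (K := K) k l m i 1
          rwa [mul_one, KPoly.Zp_one, mul_zero, KPoly.Zt_one, smul_zero, add_zero] at this
        rw [map_add, TensorProduct.map_tmul, TensorProduct.map_tmul, this, KPoly.Zp_one]
        simp
      · intro k l j
        have : KPoly.Zt k l j (∑ k, KPoly.theta k i : KPoly K n N) = 0 := by
          have : ∀ m, KPoly.Zt k l j (KPoly.theta m i : KPoly K n N) =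
              (KPoly.dl K j i * (KPoly.dl K k m - KPoly.dl K l m)) • 1 := fun m => by
            have := KPoly.Zt_theta (K := K) (N := N) k l m j i 1
            rwa [mul_one, KPoly.Zt_one, mul_zero, sub_zero] at this
          rw [map_sum]
          simp only [this, ← Finset.sum_smul, ← Finset.mul_sum, Finset.sum_sub_distrib, KPoly.dl]
          simp
        rw [map_add, TensorProduct.map_tmul, TensorProduct.map_tmul, this, KPoly.Zt_one]
        simp
  | zero => simp
  | add x y _ _ hx hy =>
    simp only [map_add]
    exact ⟨fun k l => add_mem (hx.1 k l) (hy.1 k l), fun k l i => add_mem (hx.2 k l i) (hy.2 k l i)⟩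
  | smul a x hx ih =>
    have key : ∀ a : KPoly K n N, a • x ∈ M.nablaRel n := fun a => Submodule.smul_mem _ _ hx
    induction a using KPoly.ind_left with
    | h1 => simpa using ih
    | hs r a h =>
      simp only [smul_assoc, map_smul]
      exact ⟨fun k l => M.smul_mem_nablaRel r (h.1 k l),
        fun k l i => M.smul_mem_nablaRel r (h.2 k l i)⟩
    | ha a b h h' =>
      simp only [add_smul, map_add]
      exact ⟨fun k l => add_mem (h.1 k l) (h'.1 k l), fun k l i => add_mem (h.2 k l i) (h'.2 k l i)⟩
    | hl m a h =>
      simp only [mul_smul, ZpV_lam, ZtV_lam]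
      exact ⟨fun k l => add_mem (Submodule.smul_mem _ _ (h.1 k l)) (M.smul_mem_nablaRel _ (key a)),
        fun k l i => Submodule.smul_mem _ _ (h.2 k l i)⟩
    | ht m j a h =>
      simp only [mul_smul, ZpV_theta, ZtV_theta]
      exact ⟨fun k l => add_mem (Submodule.smul_mem _ _ (h.1 k l))
          (M.smul_mem_nablaRel _ (h.2 k l j)),
        fun k l i => sub_mem (M.smul_mem_nablaRel _ (M.smul_mem_nablaRel _ (key a))) (Submodule.smul_mem _ _ (h.2 k l i))⟩

theorem epsL_smul (a : KPoly K n N) (x : KPoly K n N ⊗[K] V) :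
    M.epsL (a • x) = KPoly.inv a • M.epsL x := by
  induction x with
  | zero => simp
  | add x y hx hy => simp only [smul_add, map_add, hx, hy]
  | tmul b v => simp [epsL, TensorProduct.smul_tmul']

theorem epsL_tmul (a : KPoly K n N) (v : V) :
    M.epsL (a ⊗ₜ[K] v) = KPoly.inv a ⊗ₜ[K] M.eps v := rfl

theorem eps_nablaRel (x : KPoly K n N ⊗[K] V) (hx : x ∈ M.nablaRel n) :
    M.epsL x ∈ M.nablaRel n := by
  induction hx using Submodule.span_induction with
  | mem x h =>
    rcases h with ⟨v, rfl⟩ | ⟨i, v, rfl⟩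
    · rw [map_add, epsL_tmul, epsL_tmul, map_one, map_sum, eps_T]
      simp only [inv_lam]
      exact Submodule.subset_span (Or.inl ⟨_, rfl⟩)
    · rw [map_add, epsL_tmul, epsL_tmul, map_one, map_sum, eps_S]
      simp only [inv_theta, Finset.sum_neg_distrib, TensorProduct.neg_tmul, TensorProduct.tmul_neg]
      rw [← neg_add]
      exact neg_mem (Submodule.subset_span (Or.inr ⟨_, _, rfl⟩))
  | zero => simp
  | add x y _ _ hx hy => rw [map_add]; exact add_mem hx hy
  | smul a x hx ih => rw [epsL_smul]; exact Submodule.smul_mem _ _ ih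

/-- The action of `z_{k,l}` on `V_∇[Λ_k]`. -/
def Zq (k l : Fin n) : Module.End K (M.VNabla n) :=
  M.desc (M.cls n ∘ₗ TensorProduct.map (KPoly.Zp k l) LinearMap.id) fun x hx =>
    (M.cls_eq_zero _).2 ((M.Z_nablaRel x hx).1 k l)

/-- The operator `∂_{θ_k^i} - ∂_{θ_l^i}` on `V_∇[Λ_k]`. -/
def Ztq (k l : Fin n) (i : Fin N) : Module.End K (M.VNabla n) :=
  M.desc (M.cls n ∘ₗ TensorProduct.map (KPoly.Zt k l i) LinearMap.id) fun x hx =>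
    (M.cls_eq_zero _).2 ((M.Z_nablaRel x hx).2 k l i)

/-- The parity operator of `V_∇[Λ_k]`. -/
def Pq (n : ℕ) : Module.End K (M.VNabla n) :=
  M.desc (M.cls n ∘ₗ M.epsL) fun x hx => (M.cls_eq_zero _).2 (M.eps_nablaRel x hx)

theorem Zq_cls (k l : Fin n) (x) : M.Zq k l (M.cls n x) =
    M.cls n (TensorProduct.map (KPoly.Zp k l) LinearMap.id x) := rfl
theorem Ztq_cls (k l : Fin n) (i : Fin N) (x) : M.Ztq k l i (M.cls n x) =
    M.cls n (TensorProduct.map (KPoly.Zt k l i) LinearMap.id x) := rfl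
theorem Pq_cls (x) : M.Pq n (M.cls n x) = M.cls n (M.epsL x) := rfl

theorem Zq_lam (k l m : Fin n) (x : M.VNabla n) :
    M.Zq k l ((KPoly.lam m : KPoly K n N) • x) =
      (KPoly.lam m : KPoly K n N) • M.Zq k l x + (KPoly.dl K l m - KPoly.dl K k m) • x := by
  obtain ⟨y, rfl⟩ := M.cls_surj x
  rw [smul_cls, Zq_cls, ZpV_lam, map_add, ← smul_cls, map_smul, Zq_cls]

theorem Ztq_lam (k l m : Fin n) (i : Fin N) (x : M.VNabla n) :
    M.Ztq k l i ((KPoly.lam m : KPoly K n N) • x) =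
      (KPoly.lam m : KPoly K n N) • M.Ztq k l i x := by
  obtain ⟨y, rfl⟩ := M.cls_surj x
  rw [smul_cls, Ztq_cls, ZtV_lam, ← smul_cls, Ztq_cls]

theorem Ztq_theta (k l m : Fin n) (i j : Fin N) (x : M.VNabla n) :
    M.Ztq k l i ((KPoly.theta m j : KPoly K n N) • x) =
      (KPoly.dl K i j * (KPoly.dl K k m - KPoly.dl K l m)) • x -
        (KPoly.theta m j : KPoly K n N) • M.Ztq k l i x := by
  obtain ⟨y, rfl⟩ := M.cls_surj x
  rw [smul_cls, Ztq_cls, ZtV_theta, map_sub, map_smul, ← smul_cls, Ztq_cls]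

theorem Zq_theta (k l m : Fin n) (j : Fin N) (x : M.VNabla n) :
    M.Zq k l ((KPoly.theta m j : KPoly K n N) • x) =
      (KPoly.theta m j : KPoly K n N) • M.Zq k l x +
        (KPoly.dl K k m + KPoly.dl K l m) • M.Ztq k l j x := by
  obtain ⟨y, rfl⟩ := M.cls_surj x
  rw [smul_cls, Zq_cls, ZpV_theta, map_add, ← smul_cls, map_smul, Zq_cls, Ztq_cls]

@[simp] theorem Zq_iv (k l : Fin n) (v : V) : M.Zq k l (M.iv n v) = 0 := by
  rw [iv_apply, Zq_cls, TensorProduct.map_tmul, KPoly.Zp_one, TensorProduct.zero_tmul, map_zero]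

@[simp] theorem Ztq_iv (k l : Fin n) (i : Fin N) (v : V) : M.Ztq k l i (M.iv n v) = 0 := by
  rw [iv_apply, Ztq_cls, TensorProduct.map_tmul, KPoly.Zt_one, TensorProduct.zero_tmul, map_zero]

@[simp] theorem Pq_iv (v : V) : M.Pq n (M.iv n v) = M.iv n (M.eps v) := by
  rw [iv_apply, Pq_cls, epsL_tmul, map_one, iv_apply]

theorem Pq_smul (a : KPoly K n N) (x : M.VNabla n) : M.Pq n (a • x) = KPoly.inv a • M.Pq n x := by
  obtain ⟨y, rfl⟩ := M.cls_surj x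
  rw [smul_cls, Pq_cls, epsL_smul, Pq_cls, smul_cls]

theorem Pq_lam (k : Fin n) (x : M.VNabla n) :
    M.Pq n ((KPoly.lam k : KPoly K n N) • x) = (KPoly.lam k : KPoly K n N) • M.Pq n x := by
  rw [Pq_smul, inv_lam]

theorem Pq_theta (k : Fin n) (i : Fin N) (x : M.VNabla n) :
    M.Pq n ((KPoly.theta k i : KPoly K n N) • x) = -((KPoly.theta k i : KPoly K n N) • M.Pq n x) := by
  rw [Pq_smul, inv_theta, neg_smul]

theorem Pq_Pq (x : M.VNabla n) : M.Pq n (M.Pq n x) = x := by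
  induction x using M.vn_induction with
  | h1 v => simp [eps_eps]
  | ha x y hx hy => simp [hx, hy]
  | hs r x h => simp [h]
  | hl k x h => rw [Pq_lam, Pq_lam, h]
  | ht k i x h => rw [Pq_theta, map_neg, Pq_theta, h, neg_neg]

theorem Pq_Ztq (k l : Fin n) (i : Fin N) (x : M.VNabla n) :
    M.Pq n (M.Ztq k l i x) = -M.Ztq k l i (M.Pq n x) := by
  induction x using M.vn_induction with
  | h1 v => simp
  | ha x y hx hy => simp only [map_add, hx, hy]; abel
  | hs r x h => simp [h]
  | hl k x h => rw [Pq_lam, Ztq_lam, Pq_lam, h, Ztq_lam, smul_neg]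
  | ht k i x h =>
    rw [Pq_theta, Ztq_theta, map_neg, Ztq_theta, map_sub, Pq_theta, h, map_smul, smul_neg]; abel

theorem Pq_Zq (k l : Fin n) (x : M.VNabla n) : M.Pq n (M.Zq k l x) = M.Zq k l (M.Pq n x) := by
  induction x using M.vn_induction with
  | h1 v => simp
  | ha x y hx hy => simp only [map_add, hx, hy]
  | hs r x h => simp [h]
  | hl k x h => rw [Pq_lam, Zq_lam, map_add, Pq_lam, h, Zq_lam, map_smul]
  | ht k i x h =>
    rw [Pq_theta, Zq_theta, map_add, Pq_theta, h, map_neg, Zq_theta, map_smul, Pq_Ztq, smul_neg,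
      neg_add]

theorem fibQ_smul (c : Fin n → Fin m) (a : KPoly K m N) (x : M.VNabla m) :
    M.fibQ c (a • x) = KPoly.fib c a • M.fibQ c x := by
  obtain ⟨y, rfl⟩ := M.cls_surj x
  rw [smul_cls]
  change M.cls n (TensorProduct.map (KPoly.fib c).toLinearMap LinearMap.id (a • y)) =
    KPoly.fib c a • M.cls n (TensorProduct.map (KPoly.fib c).toLinearMap LinearMap.id y)
  rw [smul_cls]
  congr 1
  induction y with
  | zero => simp
  | add x y hx hy => simp only [smul_add, map_add, hx, hy]
  | tmul b v => simp [TensorProduct.smul_tmul']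

theorem fibQ_iv (c : Fin n → Fin m) (v : V) : M.fibQ c (M.iv m v) = M.iv n v := by
  change M.cls n (TensorProduct.map (KPoly.fib c).toLinearMap LinearMap.id (1 ⊗ₜ[K] v)) = _
  simp [iv_apply]

theorem fibQ_lam (c : Fin n → Fin m) (j : Fin m) (x : M.VNabla m) :
    M.fibQ c ((KPoly.lam j : KPoly K m N) • x) =
      ∑ k with c k = j, (KPoly.lam k : KPoly K n N) • M.fibQ c x := by
  rw [fibQ_smul, KPoly.fib_lam, Finset.sum_smul]

theorem fibQ_theta (c : Fin n → Fin m) (j : Fin m) (i : Fin N) (x : M.VNabla m) :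
    M.fibQ c ((KPoly.theta j i : KPoly K m N) • x) =
      ∑ k with c k = j, (KPoly.theta k i : KPoly K n N) • M.fibQ c x := by
  rw [fibQ_smul, KPoly.fib_theta, Finset.sum_smul]

theorem sum_dl (c : Fin n → Fin m) (l : Fin n) (j : Fin m) :
    ∑ k with c k = j, KPoly.dl K l k = KPoly.dl K (c l) j := by
  simp only [KPoly.dl]
  rw [Finset.sum_ite_eq]
  simp

theorem Pq_fibQ (c : Fin n → Fin m) (x : M.VNabla m) :
    M.Pq n (M.fibQ c x) = M.fibQ c (M.Pq m x) := by
  induction x using M.vn_induction with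
  | h1 v => simp [fibQ_iv]
  | ha x y hx hy => simp only [map_add, hx, hy]
  | hs r x h => simp [h]
  | hl k x h => rw [Pq_lam, fibQ_lam, fibQ_lam, map_sum]; simp only [Pq_lam, h]
  | ht k i x h =>
    rw [Pq_theta, map_neg, fibQ_theta, fibQ_theta, map_sum]
    simp only [Pq_theta, h, Finset.sum_neg_distrib]

theorem Ztq_fibQ (c : Fin n → Fin m) (k l : Fin n) (i : Fin N) (x : M.VNabla m) :
    M.Ztq k l i (M.fibQ c x) = M.fibQ c (M.Ztq (c k) (c l) i x) := by
  induction x using M.vn_induction with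
  | h1 v => simp [fibQ_iv]
  | ha x y hx hy => simp only [map_add, hx, hy]
  | hs r x h => simp [h]
  | hl j x h => rw [Ztq_lam, fibQ_lam, fibQ_lam, map_sum]; simp only [Ztq_lam, h]
  | ht j i' x h =>
    rw [Ztq_theta, map_sub, fibQ_theta, fibQ_theta, map_sum]
    simp only [Ztq_theta, h, Finset.sum_sub_distrib, ← Finset.sum_smul, ← Finset.mul_sum, sum_dl,
      map_smul]

theorem Zq_fibQ (c : Fin n → Fin m) (k l : Fin n) (x : M.VNabla m) :
    M.Zq k l (M.fibQ c x) = M.fibQ c (M.Zq (c k) (c l) x) := by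
  induction x using M.vn_induction with
  | h1 v => simp [fibQ_iv]
  | ha x y hx hy => simp only [map_add, hx, hy]
  | hs r x h => simp [h]
  | hl j x h =>
    rw [Zq_lam, map_add, fibQ_lam, fibQ_lam, map_sum]
    simp only [Zq_lam, h, Finset.sum_add_distrib, ← Finset.sum_smul, Finset.sum_sub_distrib, sum_dl,
      map_smul]
  | ht j i' x h =>
    rw [Zq_theta, map_add, fibQ_theta, fibQ_theta, map_sum]
    simp only [Zq_theta, h, Finset.sum_add_distrib, ← Finset.sum_smul, sum_dl, map_smul, Ztq_fibQ]

theorem fibQ_comp {p : ℕ} (c : Fin n → Fin m) (d : Fin m → Fin p) (x : M.VNabla p) :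
    M.fibQ c (M.fibQ d x) = M.fibQ (d ∘ c) x := by
  have hs : ∀ (f : Fin n → KPoly K n N) (j : Fin p),
      ∑ k with d k = j, ∑ l with c l = k, f l = ∑ l with d (c l) = j, f l := by
    intro f j
    simp only [Finset.sum_filter]
    rw [← Finset.sum_fiberwise_of_maps_to (s := Finset.univ) (t := Finset.univ) (g := c)
      (fun _ _ => Finset.mem_univ _)]
    refine Finset.sum_congr rfl fun k _ => ?_
    rw [Finset.sum_filter]
    by_cases h : d k = j
    · rw [if_pos h]
      refine Finset.sum_congr rfl fun l _ => ?_
      by_cases hl : c l = k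
      · simp [hl, h]
      · simp [hl]
    · rw [if_neg h]
      symm
      refine Finset.sum_eq_zero fun l _ => ?_
      by_cases hl : c l = k
      · simp [hl, h]
      · simp [hl]
  induction x using M.vn_induction with
  | h1 v => simp [fibQ_iv]
  | ha x y hx hy => simp only [map_add, hx, hy]
  | hs r x h => simp [h]
  | hl j x h =>
    rw [fibQ_smul, fibQ_smul, fibQ_smul, h]
    congr 1
    rw [KPoly.fib_lam, map_sum]
    simp only [KPoly.fib_lam, Function.comp_apply, hs]
  | ht j i' x h =>
    rw [fibQ_smul, fibQ_smul, fibQ_smul, h]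
    congr 1
    rw [KPoly.fib_theta, map_sum]
    simp only [KPoly.fib_theta, Function.comp_apply, hs]

theorem fibQ_id (x : M.VNabla n) : M.fibQ id x = x := by
  induction x using M.vn_induction with
  | h1 v => simp [fibQ_iv]
  | ha x y hx hy => simp only [map_add, hx, hy]
  | hs r x h => simp [h]
  | hl j x h => rw [fibQ_lam, h, Finset.sum_filter]; simp
  | ht j i' x h => rw [fibQ_theta, h, Finset.sum_filter]; simp

/-- The isomorphism `V[Λ_k]_{k=1}^n → V_∇[Λ_k]_{k=1}^{n+1}`. -/
def inc (n : ℕ) : KPoly K n N ⊗[K] V →ₗ[K] M.VNabla (n + 1) :=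
  M.cls (n + 1) ∘ₗ TensorProduct.map KPoly.up.toLinearMap LinearMap.id

theorem inc_tmul (a : KPoly K n N) (v : V) :
    M.inc n (a ⊗ₜ[K] v) = KPoly.up a • M.iv (n + 1) v := by
  rw [← cls_tmul]; rfl

theorem inc_smul (a : KPoly K n N) (x : KPoly K n N ⊗[K] V) :
    M.inc n (a • x) = KPoly.up a • M.inc n x := by
  induction x with
  | zero => simp
  | add x y hx hy => simp only [smul_add, map_add, hx, hy]
  | tmul b v => rw [TensorProduct.smul_tmul', inc_tmul, inc_tmul, smul_eq_mul, map_mul, mul_smul]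

theorem red_iv (v : V) : M.red n (M.iv (n + 1) v) = 1 ⊗ₜ[K] v := by
  rw [iv_apply, red, desc_cls, evalOp_tmul, map_one]; rfl

theorem red_smul (a : KPoly K (n + 1) N) (x : M.VNabla (n + 1)) :
    M.red n (a • x) = M.redHom a (M.red n x) := by
  obtain ⟨y, rfl⟩ := M.cls_surj x
  rw [smul_cls, red, desc_cls, desc_cls, evalOp_smul]

theorem redHom_up (a : KPoly K n N) : M.redHom (KPoly.up a) = lmul (V := V) a := by
  induction a using KPoly.ind_left with
  | h1 => rw [map_one, map_one, lmul, map_one]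
  | hs r a h => rw [map_smul, map_smul, h, lmul, lmul, map_smul]
  | ha a b ha hb => rw [map_add, map_add, ha, hb, lmul, lmul, lmul, map_add]
  | hl k a h =>
    rw [map_mul, map_mul, h, lmul, lmul, map_mul]
    congr 1
    simp [redHom, lmul]
  | ht k i a h =>
    rw [map_mul, map_mul, h, lmul, lmul, map_mul]
    congr 1
    simp [redHom, lmul]

theorem red_inc (x : KPoly K n N ⊗[K] V) : M.red n (M.inc n x) = x := by
  induction x with
  | zero => simp
  | add x y hx hy => simp only [map_add, hx, hy]
  | tmul a v => rw [inc_tmul, red_smul, red_iv, redHom_up, lmul_tmul, mul_one]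

theorem inc_lastLam (y : KPoly K n N ⊗[K] V) :
    M.inc n (M.lastLam y) = (KPoly.lam (Fin.last n) : KPoly K (n + 1) N) • M.inc n y := by
  induction y with
  | zero => simp
  | add x y hx hy => simp only [map_add, smul_add, hx, hy]
  | tmul a v =>
    have h := congrArg (KPoly.up a • ·) (M.sum_lam_iv (n := n + 1) v)
    simp only [Fin.sum_univ_castSucc, smul_add, smul_neg, Finset.smul_sum] at h
    rw [lastLam_tmul, map_neg, map_add, inc_tmul, inc_tmul, inc_tmul, map_mul, map_sum,
      Finset.sum_mul, Finset.sum_smul, ← mul_smul, KPoly.lam_comm, mul_smul]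
    simp only [KPoly.up_lam, KPoly.lam_comm, mul_smul]
    rw [neg_eq_iff_add_eq_zero, add_right_comm, h]
    abel

theorem inc_lastTheta (i : Fin N) (y : KPoly K n N ⊗[K] V) :
    M.inc n (M.lastTheta i y) = (KPoly.theta (Fin.last n) i : KPoly K (n + 1) N) • M.inc n y := by
  induction y with
  | zero => simp
  | add x y hx hy => simp only [map_add, smul_add, hx, hy]
  | tmul a v =>
    have h := congrArg (KPoly.inv (KPoly.up a) • ·) (M.sum_theta_iv (n := n + 1) i v)
    simp only [Fin.sum_univ_castSucc, smul_add, smul_neg, Finset.smul_sum] at h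
    rw [lastTheta_tmul, map_neg, map_add, inc_tmul, inc_tmul, inc_tmul, map_mul, map_sum,
      Finset.mul_sum, Finset.sum_smul, ← mul_smul, KPoly.theta_last_up, mul_smul]
    simp only [KPoly.up_theta, KPoly.up_inv, mul_smul]
    rw [neg_eq_iff_add_eq_zero, add_right_comm, h]
    abel

theorem inc_redHom (a : KPoly K (n + 1) N) (y : KPoly K n N ⊗[K] V) :
    M.inc n (M.redHom a y) = a • M.inc n y := by
  induction a using KPoly.ind_left generalizing y with
  | h1 => simp
  | hs r a h => rw [map_smul, LinearMap.smul_apply, map_smul, h, smul_assoc]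
  | ha a b ha hb => rw [map_add, LinearMap.add_apply, map_add, ha, hb, add_smul]
  | hl k a h =>
    rw [map_mul, Module.End.mul_apply, mul_smul, ← h]
    induction k using Fin.lastCases with
    | last => rw [← inc_lastLam]; simp [redHom]
    | cast k =>
      have := M.inc_smul (KPoly.lam k) (M.redHom a y)
      rw [KPoly.up_lam] at this
      rw [← this]
      simp [redHom, lmul]
  | ht k i a h =>
    rw [map_mul, Module.End.mul_apply, mul_smul, ← h]
    induction k using Fin.lastCases with
    | last => rw [← inc_lastTheta]; simp [redHom]
    | cast k =>
      have := M.inc_smul (KPoly.theta k i) (M.redHom a y)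
      rw [KPoly.up_theta] at this
      rw [← this]
      simp [redHom, lmul]

theorem inc_red (x : M.VNabla (n + 1)) : M.inc n (M.red n x) = x := by
  obtain ⟨y, rfl⟩ := M.cls_surj x
  induction y with
  | zero => simp
  | add x y hx hy => simp only [map_add, hx, hy]
  | tmul a v =>
    rw [cls_tmul, red_smul, red_iv, inc_redHom, inc_tmul, map_one, one_smul]

theorem inc_injective : Function.Injective (M.inc n) := fun x y h => by
  rw [← M.red_inc x, h, red_inc]

theorem Pq_inc (x : KPoly K n N ⊗[K] V) : M.Pq (n + 1) (M.inc n x) = M.inc n (M.epsL x) := by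
  induction x with
  | zero => simp
  | add x y hx hy => simp only [map_add, hx, hy]
  | tmul a v => rw [inc_tmul, Pq_smul, Pq_iv, epsL_tmul, inc_tmul, KPoly.up_inv]

/-- The operations of parity `s = ±1` in terms of values on tensors. -/
structure OpS (s : K) (X : M.Src (Star n) →ₗ[K] M.VNabla n) : Prop where
  zz : ∀ k l v f, X (v ⊗ₜ[K] (OT.zz k l * f)) = M.Zq k l (X (v ⊗ₜ[K] f))
  zetaz : ∀ k l i v f, X (v ⊗ₜ[K] (OT.zetaz k l i * f)) =
    s • M.Ztq k l i (X (M.epsT n v ⊗ₜ[K] f))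
  eps : ∀ v f, X (M.epsT n v ⊗ₜ[K] OT.inv f) = s • M.Pq n (X (v ⊗ₜ[K] f))
  dz : ∀ k v f, X (M.TAt k v ⊗ₜ[K] f) =
    X (v ⊗ₜ[K] OT.dz k f) - (KPoly.lam k : KPoly K n N) • X (v ⊗ₜ[K] f)
  dzeta : ∀ k i v f, X (M.SAt k i v ⊗ₜ[K] f) =
    X (M.epsT n v ⊗ₜ[K] OT.dzeta k i f) - s • (KPoly.theta k i : KPoly K n N) • X (v ⊗ₜ[K] f)

theorem intertwines_iff {E : Fin n → Fin n → Prop} (X : M.Src E →ₗ[K] M.VNabla n)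
    (φ : Module.End K (M.Src E)) (ψ : Module.End K (KPoly K n N ⊗[K] V))
    (ψ' : Module.End K (M.VNabla n)) (h : ∀ y, M.cls n (ψ y) = ψ' (M.cls n y)) :
    M.Intertwines X φ ψ ↔ ∀ v f, X (φ (v ⊗ₜ[K] f)) = ψ' (X (v ⊗ₜ[K] f)) := by
  constructor
  · intro H v f
    obtain ⟨y, hy⟩ := M.cls_surj (X (v ⊗ₜ[K] f))
    rw [H _ _ hy, h, hy]
  · intro H x y hy
    rw [h, hy]
    exact LinearMap.congr_fun (TensorProduct.ext' (g := X ∘ₗ φ) (h := ψ' ∘ₗ X) H) x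

theorem epsT_epsT (v : Tens K V n) : M.epsT n (M.epsT n v) = v := by
  have : M.epsT n ∘ₗ M.epsT n = LinearMap.id := by
    rw [epsT, ← PiTensorProduct.map_comp]
    have : (fun _ : Fin n => M.eps ∘ₗ M.eps) = fun _ => LinearMap.id := by
      funext _; ext v; exact M.eps_eps v
    rw [this, PiTensorProduct.map_id]
  exact LinearMap.congr_fun this v

theorem opS_iff (p : ZMod 2) (X : M.Src (Star n) →ₗ[K] M.VNabla n) :
    M.OpS (sg K p) X ↔ M.IsOp X ∧ M.HasParity p X := by
  have hs := sg_mul_self K p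
  have i1 := fun k l => M.intertwines_iff X (M.srcMul (OT.zz k l)) (tgtZz k l) (M.Zq k l)
    fun y => rfl
  have i2 := fun k l i => M.intertwines_iff X (M.srcMul (OT.zetaz k l i)) (M.tgtZetaz k l i)
    (M.Ztq k l i ∘ₗ M.Pq n) fun y => rfl
  have i3 := fun k => M.intertwines_iff X (M.srcDz k) (tgtDz k)
    (-(Algebra.lsmul K K (M.VNabla n) (KPoly.lam k : KPoly K n N))) fun y => by
      simp [tgtDz, lmul]; rfl
  have i4 := fun k i => M.intertwines_iff X (M.srcDzeta k i) (M.tgtDzeta k i)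
    (-(Algebra.lsmul K K (M.VNabla n) (KPoly.theta k i : KPoly K n N) ∘ₗ M.Pq n)) fun y => by
      simp [tgtDzeta, lmul]; rfl
  have i5 := M.intertwines_iff X M.srcEps (sg K p • M.epsL) (sg K p • M.Pq n) fun y => rfl
  constructor
  · intro H
    refine ⟨⟨fun k l => (i1 k l).2 fun v f => ?_, fun k l i => (i2 k l i).2 fun v f => ?_,
      fun k => (i3 k).2 fun v f => ?_, fun k i => (i4 k i).2 fun v f => ?_⟩, i5.2 fun v f => ?_⟩
    · rw [← H.zz, OT.zz_comm]; rfl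
    · change X (v ⊗ₜ[K] (f * OT.zetaz k l i)) = M.Ztq k l i (M.Pq n (X (v ⊗ₜ[K] f)))
      have := OT.zetaz_mul k l i (OT.inv f)
      rw [OT.inv_inv] at this
      rw [← this, H.zetaz, H.eps, map_smul, smul_smul, hs, one_smul]
    · change X (M.TAt k v ⊗ₜ[K] f - v ⊗ₜ[K] OT.dz k f) = -((KPoly.lam k : KPoly K n N) • X (v ⊗ₜ[K] f))
      rw [map_sub, H.dz]; abel
    · change X (M.SAt k i (M.epsT n v) ⊗ₜ[K] OT.inv f - v ⊗ₜ[K] OT.dzeta k i (OT.inv f)) =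
        -((KPoly.theta k i : KPoly K n N) • M.Pq n (X (v ⊗ₜ[K] f)))
      rw [map_sub, H.dzeta, epsT_epsT, H.eps, smul_comm _ (sg K p), smul_smul, hs, one_smul]
      abel
    · exact H.eps v f
  · rintro ⟨H, H5⟩
    have h1 := fun k l => (i1 k l).1 (H.zz k l)
    have h2 := fun k l i => (i2 k l i).1 (H.zetaz k l i)
    have h3 := fun k => (i3 k).1 (H.dz k)
    have h4 := fun k i => (i4 k i).1 (H.dzeta k i)
    have h5 : ∀ v f, X (M.epsT n v ⊗ₜ[K] OT.inv f) = sg K p • M.Pq n (X (v ⊗ₜ[K] f)) := i5.1 H5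
    refine ⟨fun k l v f => ?_, fun k l i v f => ?_, h5, fun k v f => ?_, fun k i v f => ?_⟩
    · rw [← h1, OT.zz_comm]; rfl
    · have := h2 k l i v (OT.inv f)
      change X (v ⊗ₜ[K] (OT.inv f * OT.zetaz k l i)) = _ at this
      rw [OT.zetaz_mul, this]
      have h := h5 v (OT.inv f)
      rw [OT.inv_inv] at h
      rw [h, map_smul, smul_smul, hs, one_smul]
      rfl
    · have := h3 k v f
      change X (M.TAt k v ⊗ₜ[K] f - v ⊗ₜ[K] OT.dz k f) = -((KPoly.lam k : KPoly K n N) • X (v ⊗ₜ[K] f)) at this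
      rw [map_sub, sub_eq_iff_eq_add] at this
      rw [this]; abel
    · have := h4 k i (M.epsT n v) (OT.inv f)
      change X (M.SAt k i (M.epsT n (M.epsT n v)) ⊗ₜ[K] OT.inv (OT.inv f) -
        M.epsT n v ⊗ₜ[K] OT.dzeta k i (OT.inv (OT.inv f))) =
        -((KPoly.theta k i : KPoly K n N) • M.Pq n (X (M.epsT n v ⊗ₜ[K] OT.inv f))) at this
      rw [epsT_epsT, OT.inv_inv, map_sub, sub_eq_iff_eq_add, h5, map_smul, Pq_Pq] at this
      rw [this, smul_comm (sg K p)]; abel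

end HKMod

end

section
namespace HKMod

variable {K : Type*} [Field K] {n m N : ℕ} {V : Type*} [AddCommGroup V] [Module K V]
variable (M : HKMod K N V)

section Tensors
variable (K)

/-- The tensor `a ⊗ b`. -/
def t2 (a b : V) : Tens K V 2 := PiTensorProduct.tprod K ![a, b]

/-- The tensor `a ⊗ b ⊗ c`. -/
def t3 (a b c : V) : Tens K V 3 := PiTensorProduct.tprod K ![a, b, c]

variable {K} {W : Type*} [AddCommGroup W] [Module K W]

theorem t2_add_left (a a' b : V) : t2 K (a + a') b = t2 K a b + t2 K a' b :=
  (PiTensorProduct.tprod K (s := fun _ : Fin 2 => V)).cons_add ![b] a a'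
theorem t2_smul_left (r : K) (a b : V) : t2 K (r • a) b = r • t2 K a b :=
  (PiTensorProduct.tprod K (s := fun _ : Fin 2 => V)).cons_smul ![b] r a
theorem t2_add_right (a b b' : V) : t2 K a (b + b') = t2 K a b + t2 K a b' := by
  have e : ∀ y : V, Function.update ![a, 0] 1 y = ![a, y] := fun y => by
    ext i; fin_cases i <;> rfl
  have := (PiTensorProduct.tprod K (s := fun _ : Fin 2 => V)).map_update_add ![a, 0] 1 b b'
  rwa [e, e, e] at this
theorem t2_smul_right (r : K) (a b : V) : t2 K a (r • b) = r • t2 K a b := by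
  have e : ∀ y : V, Function.update ![a, 0] 1 y = ![a, y] := fun y => by
    ext i; fin_cases i <;> rfl
  have := (PiTensorProduct.tprod K (s := fun _ : Fin 2 => V)).map_update_smul ![a, 0] 1 r b
  rwa [e, e] at this

/-- `a ↦ b ↦ a ⊗ b`. -/
def t2L : V →ₗ[K] V →ₗ[K] Tens K V 2 :=
  LinearMap.mk₂ K (t2 K) t2_add_left t2_smul_left t2_add_right t2_smul_right

/-- The linear map on `V ⊗ V` defined by a bilinear map. -/
def lift2 (B : V →ₗ[K] V →ₗ[K] W) : Tens K V 2 →ₗ[K] W :=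
  PiTensorProduct.lift
    { toFun := fun v => B (v 0) (v 1)
      map_update_add' := by
        intro inst v i x y
        rw [Subsingleton.elim inst (instDecidableEqFin 2)]
        fin_cases i <;> simp [Function.update]
      map_update_smul' := by
        intro inst v i r x
        rw [Subsingleton.elim inst (instDecidableEqFin 2)]
        fin_cases i <;> simp [Function.update] }

@[simp] theorem lift2_t2 (B : V →ₗ[K] V →ₗ[K] W) (a b : V) : lift2 B (t2 K a b) = B a b := by
  rw [lift2, t2, PiTensorProduct.lift.tprod]; rfl

theorem fin3_cases (i : Fin 3) : i = 0 ∨ i = 1 ∨ i = 2 := by revert i; decide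

theorem fin3_ne : ¬((0 : Fin 3) = 1) ∧ ¬((0 : Fin 3) = 2) ∧ ¬((1 : Fin 3) = 0) ∧
    ¬((1 : Fin 3) = 2) ∧ ¬((2 : Fin 3) = 0) ∧ ¬((2 : Fin 3) = 1) := by decide

/-- The linear map on `V ⊗ V ⊗ V` defined by a trilinear map. -/
def lift3 (B : V →ₗ[K] V →ₗ[K] V →ₗ[K] W) : Tens K V 3 →ₗ[K] W :=
  PiTensorProduct.lift
    { toFun := fun v => B (v 0) (v 1) (v 2)
      map_update_add' := by
        intro inst v i x y
        rcases fin3_cases i with rfl | rfl | rfl <;>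
          simp only [Function.update_self, Function.update_of_ne, ne_eq, not_false_eq_true,
            Fin.isValue, fin3_ne, map_add, LinearMap.add_apply]
      map_update_smul' := by
        intro inst v i r x
        rcases fin3_cases i with rfl | rfl | rfl <;>
          simp only [Function.update_self, Function.update_of_ne, ne_eq, not_false_eq_true,
            Fin.isValue, fin3_ne, map_smul, LinearMap.smul_apply] }

@[simp] theorem lift3_t3 (B : V →ₗ[K] V →ₗ[K] V →ₗ[K] W) (a b c : V) :
    lift3 B (t3 K a b c) = B a b c := by
  rw [lift3, t3, PiTensorProduct.lift.tprod]; rfl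

theorem t3_eq (v : Fin 3 → V) : PiTensorProduct.tprod K v = t3 K (v 0) (v 1) (v 2) := by
  rw [t3]; congr 1; ext i; fin_cases i <;> rfl

theorem t2_eq (v : Fin 2 → V) : PiTensorProduct.tprod K v = t2 K (v 0) (v 1) := by
  rw [t2]; congr 1; ext i; fin_cases i <;> rfl

theorem ext2 {f g : Tens K V 2 →ₗ[K] W} (h : ∀ a b, f (t2 K a b) = g (t2 K a b)) : f = g := by
  refine PiTensorProduct.ext (MultilinearMap.ext fun v => ?_)
  simp only [LinearMap.compMultilinearMap_apply, t2_eq, h]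

theorem ext3 {f g : Tens K V 3 →ₗ[K] W} (h : ∀ a b c, f (t3 K a b c) = g (t3 K a b c)) : f = g := by
  refine PiTensorProduct.ext (MultilinearMap.ext fun v => ?_)
  simp only [LinearMap.compMultilinearMap_apply, t3_eq, h]

theorem t3_add (i : Fin 3) (a b c a' b' c' : V) :
    t3 K (a + a') b c = t3 K a b c + t3 K a' b c ∧ t3 K a (b + b') c = t3 K a b c + t3 K a b' c ∧
      t3 K a b (c + c') = t3 K a b c + t3 K a b c' := by
  have e0 : ∀ y : V, Function.update ![0, b, c] 0 y = ![y, b, c] := fun y => by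
    ext i; fin_cases i <;> rfl
  have e1 : ∀ y : V, Function.update ![a, 0, c] 1 y = ![a, y, c] := fun y => by
    ext i; fin_cases i <;> rfl
  have e2 : ∀ y : V, Function.update ![a, b, 0] 2 y = ![a, b, y] := fun y => by
    ext i; fin_cases i <;> rfl
  have h0 := (PiTensorProduct.tprod K (s := fun _ : Fin 3 => V)).map_update_add ![0, b, c] 0 a a'
  have h1 := (PiTensorProduct.tprod K (s := fun _ : Fin 3 => V)).map_update_add ![a, 0, c] 1 b b'
  have h2 := (PiTensorProduct.tprod K (s := fun _ : Fin 3 => V)).map_update_add ![a, b, 0] 2 c c'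
  rw [e0, e0, e0] at h0
  rw [e1, e1, e1] at h1
  rw [e2, e2, e2] at h2
  exact ⟨h0, h1, h2⟩

theorem t3_smul (r : K) (a b c : V) :
    t3 K (r • a) b c = r • t3 K a b c ∧ t3 K a (r • b) c = r • t3 K a b c ∧
      t3 K a b (r • c) = r • t3 K a b c := by
  have e0 : ∀ y : V, Function.update ![0, b, c] 0 y = ![y, b, c] := fun y => by
    ext i; fin_cases i <;> rfl
  have e1 : ∀ y : V, Function.update ![a, 0, c] 1 y = ![a, y, c] := fun y => by
    ext i; fin_cases i <;> rfl
  have e2 : ∀ y : V, Function.update ![a, b, 0] 2 y = ![a, b, y] := fun y => by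
    ext i; fin_cases i <;> rfl
  have h0 := (PiTensorProduct.tprod K (s := fun _ : Fin 3 => V)).map_update_smul ![0, b, c] 0 r a
  have h1 := (PiTensorProduct.tprod K (s := fun _ : Fin 3 => V)).map_update_smul ![a, 0, c] 1 r b
  have h2 := (PiTensorProduct.tprod K (s := fun _ : Fin 3 => V)).map_update_smul ![a, b, 0] 2 r c
  rw [e0, e0] at h0
  rw [e1, e1] at h1
  rw [e2, e2] at h2
  exact ⟨h0, h1, h2⟩

end Tensors

theorem epsT_t2 (a b : V) : M.epsT 2 (t2 K a b) = t2 K (M.eps a) (M.eps b) := by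
  rw [epsT, t2, PiTensorProduct.map_tprod, t2_eq]; rfl
theorem TAt0_t2 (a b : V) : M.TAt 0 (t2 K a b) = t2 K (M.T a) b := by
  rw [TAt, t2, PiTensorProduct.map_tprod, t2_eq]; rfl
theorem TAt1_t2 (a b : V) : M.TAt 1 (t2 K a b) = t2 K a (M.T b) := by
  rw [TAt, t2, PiTensorProduct.map_tprod, t2_eq]; rfl
theorem SAt0_t2 (i : Fin N) (a b : V) : M.SAt 0 i (t2 K a b) = t2 K (M.S i a) b := by
  rw [SAt, t2, PiTensorProduct.map_tprod, t2_eq]; rfl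
theorem SAt1_t2 (i : Fin N) (a b : V) : M.SAt 1 i (t2 K a b) = t2 K (M.eps a) (M.S i b) := by
  rw [SAt, t2, PiTensorProduct.map_tprod, t2_eq]; rfl

theorem epsT_t3 (a b c : V) : M.epsT 3 (t3 K a b c) = t3 K (M.eps a) (M.eps b) (M.eps c) := by
  rw [epsT, t3, PiTensorProduct.map_tprod, t3_eq]; rfl
theorem TAt0_t3 (a b c : V) : M.TAt 0 (t3 K a b c) = t3 K (M.T a) b c := by
  rw [TAt, t3, PiTensorProduct.map_tprod, t3_eq]; rfl
theorem TAt1_t3 (a b c : V) : M.TAt 1 (t3 K a b c) = t3 K a (M.T b) c := by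
  rw [TAt, t3, PiTensorProduct.map_tprod, t3_eq]; rfl
theorem TAt2_t3 (a b c : V) : M.TAt 2 (t3 K a b c) = t3 K a b (M.T c) := by
  rw [TAt, t3, PiTensorProduct.map_tprod, t3_eq]; rfl
theorem SAt0_t3 (i : Fin N) (a b c : V) : M.SAt 0 i (t3 K a b c) = t3 K (M.S i a) b c := by
  rw [SAt, t3, PiTensorProduct.map_tprod, t3_eq]; rfl
theorem SAt1_t3 (i : Fin N) (a b c : V) :
    M.SAt 1 i (t3 K a b c) = t3 K (M.eps a) (M.S i b) c := by
  rw [SAt, t3, PiTensorProduct.map_tprod, t3_eq]; rfl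
theorem SAt2_t3 (i : Fin N) (a b c : V) :
    M.SAt 2 i (t3 K a b c) = t3 K (M.eps a) (M.eps b) (M.S i c) := by
  rw [SAt, t3, PiTensorProduct.map_tprod, t3_eq]; rfl

variable [CharZero K]

theorem hext2 {W : Type*} [AddCommGroup W] [Module K W] {f g : Tens K V 2 →ₗ[K] W}
    (h : ∀ p q, ∀ a ∈ M.gr p, ∀ b ∈ M.gr q, f (t2 K a b) = g (t2 K a b)) : f = g := by
  refine ext2 fun a b => ?_
  induction a using M.hom_induction with
  | h p a ha =>
    induction b using M.hom_induction with
    | h q b hb => exact h p q a ha b hb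
    | ha v w hv hw => rw [t2_add_right, map_add, map_add, hv, hw]
  | ha v w hv hw => rw [t2_add_left, map_add, map_add, hv, hw]

theorem hext3 {W : Type*} [AddCommGroup W] [Module K W] {f g : Tens K V 3 →ₗ[K] W}
    (h : ∀ p q r, ∀ a ∈ M.gr p, ∀ b ∈ M.gr q, ∀ c ∈ M.gr r, f (t3 K a b c) = g (t3 K a b c)) :
    f = g := by
  refine ext3 fun a b c => ?_
  induction a using M.hom_induction with
  | h p a ha =>
    induction b using M.hom_induction with
    | h q b hb =>
      induction c using M.hom_induction with
      | h r c hc => exact h p q r a ha b hb c hc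
      | ha v w hv hw => rw [(t3_add 0 a b v a b w).2.2, map_add, map_add, hv, hw]
    | ha v w hv hw => rw [(t3_add 0 a v c a w c).2.1, map_add, map_add, hv, hw]
  | ha v w hv hw => rw [(t3_add 0 v b c w b c).1, map_add, map_add, hv, hw]

theorem koszulPerm_tprod (σ : Equiv.Perm (Fin n)) (q : Fin n → ZMod 2) (v : Fin n → V)
    (hv : ∀ k, v k ∈ M.gr (q k)) : M.koszulPerm σ (PiTensorProduct.tprod K v) =
      (∏ x : Fin n × Fin n, if x.1 < x.2 ∧ σ x.2 < σ x.1 then sg K (q x.1 * q x.2) else 1) •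
        PiTensorProduct.tprod K fun k => v (σ.symm k) := by
  rw [koszulPerm, LinearMap.sum_apply, Finset.sum_eq_single q]
  · rw [LinearMap.smul_apply, LinearMap.comp_apply, PiTensorProduct.map_tprod]
    congr 1
    have : (fun k => M.proj (q k) (v k)) = v := by
      funext k; rw [M.proj_of_mem (hv k), if_pos rfl]
    rw [this]
    exact PiTensorProduct.reindex_tprod _ _
  · intro p _ hp
    rw [LinearMap.smul_apply, LinearMap.comp_apply, PiTensorProduct.map_tprod]
    obtain ⟨k, hk⟩ := Function.ne_iff.1 hp
    have : M.proj (p k) (v k) = 0 := by rw [M.proj_of_mem (hv k), if_neg hk]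
    rw [(PiTensorProduct.tprod K).map_coord_zero (m := fun k => M.proj (p k) (v k)) k this, map_zero,
      smul_zero]
  · intro h; exact absurd (Finset.mem_univ _) h

theorem koszul_swap {p q : ZMod 2} {a b : V} (ha : a ∈ M.gr p) (hb : b ∈ M.gr q) :
    M.koszulPerm (Equiv.swap 0 1) (t2 K a b) = sg K (p * q) • t2 K b a := by
  rw [t2, M.koszulPerm_tprod _ ![p, q] ![a, b] (by intro k; fin_cases k <;> assumption), t2_eq]
  congr 1
  rw [Fintype.prod_prod_type]
  simp [Fin.prod_univ_two]

theorem koszul_one : M.koszulPerm (1 : Equiv.Perm (Fin 2)) = LinearMap.id := by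
  refine M.hext2 fun p q a ha b hb => ?_
  rw [t2, M.koszulPerm_tprod _ ![p, q] ![a, b] (by intro k; fin_cases k <;> assumption), t2_eq,
    Fintype.prod_prod_type]
  simp [Fin.prod_univ_two]
  rfl

/-- The cyclic permutation `0 ↦ 2 ↦ 1 ↦ 0`. -/
def rot : Equiv.Perm (Fin 3) := ⟨![2, 0, 1], ![1, 2, 0], by decide, by decide⟩

theorem koszul_rot {p q r : ZMod 2} {a b c : V} (ha : a ∈ M.gr p) (hb : b ∈ M.gr q)
    (hc : c ∈ M.gr r) :
    M.koszulPerm rot (t3 K a b c) = sg K (p * q + p * r) • t3 K b c a := by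
  rw [t3, M.koszulPerm_tprod _ ![p, q, r] ![a, b, c] (by intro k; fin_cases k <;> assumption),
    t3_eq]
  congr 1
  rw [Fintype.prod_prod_type]
  simp [Fin.prod_univ_three, rot, sg_add]

theorem koszul_swap01 {p q r : ZMod 2} {a b c : V} (ha : a ∈ M.gr p) (hb : b ∈ M.gr q)
    (hc : c ∈ M.gr r) :
    M.koszulPerm (Equiv.swap 0 1) (t3 K a b c) = sg K (p * q) • t3 K b a c := by
  rw [t3, M.koszulPerm_tprod _ ![p, q, r] ![a, b, c] (by intro k; fin_cases k <;> assumption),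
    t3_eq]
  congr 1
  · rw [Fintype.prod_prod_type]
    have h1 : (Equiv.swap (0 : Fin 3) 1) 2 = 2 := by decide
    simp [Fin.prod_univ_three, h1]

theorem koszul_swap12 {p q r : ZMod 2} {a b c : V} (ha : a ∈ M.gr p) (hb : b ∈ M.gr q)
    (hc : c ∈ M.gr r) :
    M.koszulPerm (Equiv.swap 1 2) (t3 K a b c) = sg K (q * r) • t3 K a c b := by
  rw [t3, M.koszulPerm_tprod _ ![p, q, r] ![a, b, c] (by intro k; fin_cases k <;> assumption),
    t3_eq]
  have h1 : (Equiv.swap (1 : Fin 3) 2) 0 = 0 := by decide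
  congr 1
  · rw [Fintype.prod_prod_type]
    simp [Fin.prod_univ_three, h1]

/-- The compatibilities of the action of `σ` on tensors with the operators on tensor factors. -/
structure KoszulCompat (σ : Equiv.Perm (Fin n)) : Prop where
  eps : ∀ v, M.koszulPerm σ (M.epsT n v) = M.epsT n (M.koszulPerm σ v)
  T : ∀ k v, M.koszulPerm σ (M.TAt k v) = M.TAt (σ k) (M.koszulPerm σ v)
  S : ∀ k i v, M.koszulPerm σ (M.SAt k i v) = M.SAt (σ k) i (M.koszulPerm σ v)

theorem sg_comm_aux (p q : ZMod 2) : sg K p * sg K q = sg K (p + q) := (sg_add K p q).symm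

theorem koszulCompat_swap : M.KoszulCompat (Equiv.swap (0 : Fin 2) 1) := by
  refine ⟨fun v => ?_, fun k v => ?_, fun k i v => ?_⟩
  · suffices h : M.koszulPerm (Equiv.swap 0 1) ∘ₗ M.epsT 2 = M.epsT 2 ∘ₗ M.koszulPerm (Equiv.swap 0 1) from
      LinearMap.congr_fun h v
    refine M.hext2 fun p q a ha b hb => ?_
    simp only [LinearMap.comp_apply, epsT_t2, M.koszul_swap ha hb, map_smul, M.eps_of_mem ha,
      M.eps_of_mem hb, t2_smul_left, t2_smul_right]
    simp only [smul_smul]; congr 1; ring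
  · suffices h : M.koszulPerm (Equiv.swap 0 1) ∘ₗ M.TAt k = M.TAt ((Equiv.swap 0 1) k) ∘ₗ M.koszulPerm (Equiv.swap 0 1) from
      LinearMap.congr_fun h v
    refine M.hext2 fun p q a ha b hb => ?_
    simp only [LinearMap.comp_apply, M.koszul_swap ha hb, map_smul]
    fin_cases k
    · simp [TAt0_t2, TAt1_t2, M.koszul_swap (M.T_mem p a ha) hb]
    · simp [TAt0_t2, TAt1_t2, M.koszul_swap ha (M.T_mem q b hb)]
  · suffices h : M.koszulPerm (Equiv.swap 0 1) ∘ₗ M.SAt k i = M.SAt ((Equiv.swap 0 1) k) i ∘ₗ M.koszulPerm (Equiv.swap 0 1) from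
      LinearMap.congr_fun h v
    refine M.hext2 fun p q a ha b hb => ?_
    simp only [LinearMap.comp_apply, M.koszul_swap ha hb, map_smul]
    fin_cases k
    · simp [SAt0_t2, SAt1_t2, M.koszul_swap (M.S_mem i p a ha) hb, M.eps_of_mem hb, t2_smul_left,
        smul_smul, sg_comm_aux, add_mul]
    · simp [SAt0_t2, SAt1_t2, M.eps_of_mem ha, t2_smul_left, M.koszul_swap ha (M.S_mem i q b hb),
        smul_smul, sg_comm_aux, mul_add]
      congr 2; clear ha hb; revert p q; decide

theorem koszulCompat_rot : M.KoszulCompat rot := by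
  refine ⟨fun v => ?_, fun k v => ?_, fun k i v => ?_⟩
  · suffices h : M.koszulPerm rot ∘ₗ M.epsT 3 = M.epsT 3 ∘ₗ M.koszulPerm rot from
      LinearMap.congr_fun h v
    refine M.hext3 fun p q r a ha b hb c hc => ?_
    simp only [LinearMap.comp_apply, epsT_t3, M.koszul_rot ha hb hc, map_smul, M.eps_of_mem ha,
      M.eps_of_mem hb, M.eps_of_mem hc, t3_smul]
    simp only [smul_smul]; congr 1; ring
  · suffices h : M.koszulPerm rot ∘ₗ M.TAt k = M.TAt (rot k) ∘ₗ M.koszulPerm rot from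
      LinearMap.congr_fun h v
    refine M.hext3 fun p q r a ha b hb c hc => ?_
    simp only [LinearMap.comp_apply, M.koszul_rot ha hb hc, map_smul]
    fin_cases k
    · simp [rot, TAt0_t3, TAt2_t3]; exact M.koszul_rot (M.T_mem p a ha) hb hc
    · simp [rot, TAt0_t3, TAt1_t3]; exact M.koszul_rot ha (M.T_mem q b hb) hc
    · simp [rot, TAt1_t3, TAt2_t3]; exact M.koszul_rot ha hb (M.T_mem r c hc)
  · suffices h : M.koszulPerm rot ∘ₗ M.SAt k i = M.SAt (rot k) i ∘ₗ M.koszulPerm rot from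
      LinearMap.congr_fun h v
    refine M.hext3 fun p q r a ha b hb c hc => ?_
    simp only [LinearMap.comp_apply, M.koszul_rot ha hb hc, map_smul]
    fin_cases k
    · change M.koszulPerm rot (M.SAt 0 i _) = _ • M.SAt 2 i _
      rw [SAt0_t3, SAt2_t3, M.koszul_rot (M.S_mem i p a ha) hb hc, M.eps_of_mem hb,
        M.eps_of_mem hc]
      simp only [t3_smul, smul_smul, sg_comm_aux]
      congr 2; clear ha hb hc; revert p q r; decide
    · change M.koszulPerm rot (M.SAt 1 i _) = _ • M.SAt 0 i _
      rw [SAt1_t3, SAt0_t3, M.eps_of_mem ha]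
      simp only [t3_smul, map_smul]
      rw [M.koszul_rot ha (M.S_mem i q b hb) hc]
      simp only [t3_smul, smul_smul, sg_comm_aux]
      congr 2; clear ha hb hc; revert p q r; decide
    · change M.koszulPerm rot (M.SAt 2 i _) = _ • M.SAt 1 i _
      rw [SAt2_t3, SAt1_t3, M.eps_of_mem ha, M.eps_of_mem hb]
      simp only [t3_smul, map_smul]
      rw [M.koszul_rot ha hb (M.S_mem i r c hc)]
      simp only [t3_smul, smul_smul, sg_comm_aux]
      congr 2; clear ha hb hc; revert p q r; decide

theorem star_perm (σ : Equiv.Perm (Fin n)) (k l : Fin n) (h : Star n k l) : Star n (σ k) (σ l) :=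
  σ.injective.ne h

theorem symAct_tmul (σ : Equiv.Perm (Fin n)) (X : M.Src (Star n) →ₗ[K] M.VNabla n)
    (v : Tens K V n) (f : OT K N (Star n)) : M.symAct σ X (v ⊗ₜ[K] f) =
      M.fibQ σ (X (M.koszulPerm σ v ⊗ₜ[K] OT.map σ (star_perm σ) f)) := rfl

variable {M}

theorem OpS.symAct {s : K} {X : M.Src (Star n) →ₗ[K] M.VNabla n} (H : M.OpS s X)
    {σ : Equiv.Perm (Fin n)} (hσ : M.KoszulCompat σ) : M.OpS s (M.symAct σ X) := by
  have hf : ∀ k : Fin n, (Finset.univ.filter fun l => σ l = σ k) = {k} := fun k => by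
    ext l; simp
  refine ⟨fun k l v f => ?_, fun k l i v f => ?_, fun v f => ?_, fun k v f => ?_,
    fun k i v f => ?_⟩
  · rw [symAct_tmul, symAct_tmul, map_mul, OT.map_zz, H.zz, Zq_fibQ]
  · rw [symAct_tmul, symAct_tmul, map_mul, OT.map_zetaz, H.zetaz, Ztq_fibQ, map_smul, hσ.eps]
  · rw [symAct_tmul, symAct_tmul, hσ.eps, OT.map_inv, H.eps, map_smul, Pq_fibQ]
  · rw [symAct_tmul, symAct_tmul, symAct_tmul, hσ.T, H.dz, map_sub, fibQ_lam, hf,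
      Finset.sum_singleton, OT.dz_map, hf, Finset.sum_singleton]
  · rw [symAct_tmul, symAct_tmul, symAct_tmul, hσ.S, H.dzeta, map_sub, map_smul, fibQ_theta, hf,
      Finset.sum_singleton, OT.dzeta_map, hf, Finset.sum_singleton, hσ.eps]

theorem OpS.add {s : K} {X Y : M.Src (Star n) →ₗ[K] M.VNabla n} (H : M.OpS s X) (H' : M.OpS s Y) :
    M.OpS s (X + Y) := by
  refine ⟨fun k l v f => ?_, fun k l i v f => ?_, fun v f => ?_, fun k v f => ?_,
    fun k i v f => ?_⟩ <;> simp only [LinearMap.add_apply]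
  · rw [H.zz, H'.zz, map_add]
  · rw [H.zetaz, H'.zetaz, map_add, smul_add]
  · rw [H.eps, H'.eps, map_add, smul_add]
  · rw [H.dz, H'.dz, smul_add]; abel
  · rw [H.dzeta, H'.dzeta, smul_add, smul_add]; abel

theorem OpS.neg {s : K} {X : M.Src (Star n) →ₗ[K] M.VNabla n} (H : M.OpS s X) : M.OpS s (-X) := by
  refine ⟨fun k l v f => ?_, fun k l i v f => ?_, fun v f => ?_, fun k v f => ?_,
    fun k i v f => ?_⟩ <;> simp only [LinearMap.neg_apply]
  · rw [H.zz, map_neg]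
  · rw [H.zetaz, map_neg, smul_neg]
  · rw [H.eps, map_neg, smul_neg]
  · rw [H.dz, smul_neg]; abel
  · rw [H.dzeta, smul_neg, smul_neg]; abel

theorem symAct_one (X : M.Src (Star 2) →ₗ[K] M.VNabla 2) : M.symAct 1 X = X := by
  refine TensorProduct.ext' fun v f => ?_
  rw [symAct_tmul, koszul_one]
  have : OT.map (1 : Equiv.Perm (Fin 2)) (star_perm 1) f
      = f := by
    induction f using OT.induction with
    | h0 r => rw [AlgHom.commutes]
    | hz k l => rw [OT.map_zz]; rfl
    | ht k l i => rw [OT.map_zetaz]; rfl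
    | hu k l h => rw [OT.map_u]; rfl
    | hm a b ha hb => rw [map_mul, ha, hb]
    | ha a b ha hb => rw [map_add, ha, hb]
  rw [this]
  exact M.fibQ_id _

theorem symAct_eq_iff (X : M.Src (Star 2) →ₗ[K] M.VNabla 2) :
    (∀ σ, M.symAct σ X = X) ↔ M.symAct (Equiv.swap 0 1) X = X := by
  refine ⟨fun h => h _, fun h σ => ?_⟩
  have : σ = 1 ∨ σ = Equiv.swap 0 1 := by revert σ; decide
  rcases this with rfl | rfl
  · exact symAct_one X
  · exact h

end HKMod

end

section
namespace OT
variable {K : Type*} [Field K] {N n : ℕ} {E : Fin n → Fin n → Prop}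

theorem dz_zz_mul (j k l : Fin n) (g : OT K N E) : dz j (zz k l * g) =
    zz k l * dz j g + (KPoly.dl K k j - KPoly.dl K l j) • g := by
  rw [dz_mul, dz_zz]
  congr 1
  simp only [KPoly.dl]
  split_ifs <;> simp

theorem dz_zetaz_mul (j k l : Fin n) (i : Fin N) (g : OT K N E) :
    dz j (zetaz k l i * g) = zetaz k l i * dz j g := by
  rw [dz_mul, dz_zetaz, zero_mul, add_zero]

theorem dzeta_zz_mul (j k l : Fin n) (i : Fin N) (g : OT K N E) : dzeta j i (zz k l * g) =
    zz k l * dzeta j i g - (KPoly.dl K k j + KPoly.dl K l j) • (zetaz k l i * g) := by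
  rw [dzeta_mul, dzeta_zz, inv_zz, sub_eq_add_neg]
  congr 1
  simp only [KPoly.dl]
  by_cases hk : k = j <;> by_cases hl : l = j
  · subst hk hl; simp [zetaz_self]
  all_goals simp [hk, hl]

theorem dzeta_zetaz_mul (j k l : Fin n) (i i' : Fin N) (g : OT K N E) :
    dzeta j i (zetaz k l i' * g) =
      (KPoly.dl K i' i * (KPoly.dl K k j - KPoly.dl K l j)) • g - zetaz k l i' * dzeta j i g := by
  rw [dzeta_mul, dzeta_zetaz, inv_zetaz, neg_mul, neg_add_eq_sub]
  congr 1
  simp only [KPoly.dl]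
  split_ifs <;> simp

end OT

namespace HKMod

variable {K : Type*} [Field K] {n m N : ℕ} {V : Type*} [AddCommGroup V] [Module K V]
variable (M : HKMod K N V)

/-- The map of indices that collapses the first two of three. -/
def c3 : Fin 3 → Fin 2 := collapse 1 1

/-- `z_{k,l}` is inverted unless `k` and `l` both belong to the first two indices. -/
def A3 : Fin 3 → Fin 3 → Prop := Apart 1 1

theorem c3_zero : c3 0 = 0 := rfl
theorem c3_one : c3 1 = 0 := rfl
theorem A3_c3 (k l : Fin 3) (h : A3 k l) : Star 2 (c3 k) (c3 l) := h

theorem A3_star (k l : Fin 3) (h : A3 k l) : Star 3 k l := fun h' => h (congrArg c3 h')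

/-- Linear maps from functions of three variables without pole at `z_{1,2} = 0`. -/
abbrev Hm : Type _ := OT K N A3 →ₗ[K] M.VNabla 3

/-- `λ_k - ∂_{z_k}` on maps. -/
def gl (k : Fin 3) : Module.End K M.Hm where
  toFun φ := Algebra.lsmul K K (M.VNabla 3) (KPoly.lam k : KPoly K 3 N) ∘ₗ φ - φ ∘ₗ OT.dz k
  map_add' φ ψ := LinearMap.ext fun g => by simp; abel
  map_smul' r φ := LinearMap.ext fun g => by simp [smul_sub, smul_comm r]

theorem gl_apply (k : Fin 3) (φ : M.Hm) (g : OT K N A3) :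
    M.gl k φ g = (KPoly.lam k : KPoly K 3 N) • φ g - φ (OT.dz k g) := rfl

variable [CharZero K]

/-- `θ_k^i - D_{ζ_k^i}` on maps, with signs. -/
def gt (k : Fin 3) (i : Fin N) : Module.End K M.Hm where
  toFun φ := M.Pq 3 ∘ₗ φ ∘ₗ OT.inv.toLinearMap ∘ₗ OT.dzeta k i -
    Algebra.lsmul K K (M.VNabla 3) (KPoly.theta k i : KPoly K 3 N) ∘ₗ φ
  map_add' φ ψ := LinearMap.ext fun g => by simp; abel
  map_smul' r φ := LinearMap.ext fun g => by simp [smul_sub, smul_comm r]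

theorem gt_apply (k : Fin 3) (i : Fin N) (φ : M.Hm) (g : OT K N A3) :
    M.gt k i φ g = M.Pq 3 (φ (OT.inv (OT.dzeta k i g))) -
      (KPoly.theta k i : KPoly K 3 N) • φ g := rfl

theorem gl_gl (k l : Fin 3) : M.gl k * M.gl l = M.gl l * M.gl k := by
  refine LinearMap.ext fun φ => LinearMap.ext fun g => ?_
  simp only [Module.End.mul_apply, gl_apply, smul_sub, ← mul_smul, KPoly.lam_lam k l,
    OT.dz_dz k l]
  abel

theorem gl_gt (k l : Fin 3) (i : Fin N) : M.gl k * M.gt l i = M.gt l i * M.gl k := by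
  refine LinearMap.ext fun φ => LinearMap.ext fun g => ?_
  simp only [Module.End.mul_apply, gl_apply, gt_apply, smul_sub, map_sub, ← mul_smul,
    KPoly.lam_theta k l, ← OT.inv_dz, OT.dz_dzeta, Pq_lam]
  abel

theorem gt_gt (k l : Fin 3) (i j : Fin N) :
    M.gt k i * M.gt l j + M.gt l j * M.gt k i =
      if k = l ∧ i = j then (-2 : K) • M.gl k else 0 := by
  refine LinearMap.ext fun φ => LinearMap.ext fun g => ?_
  have hD := congrArg φ (OT.dzeta_dzeta k l i j g)
  have ht := congrArg (· • φ g) (KPoly.theta_theta (K := K) k l i j)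
  have e : (M.gt k i * M.gt l j + M.gt l j * M.gt k i) φ g =
      (KPoly.theta k i * KPoly.theta l j + KPoly.theta l j * KPoly.theta k i : KPoly K 3 N) • φ g
        - φ (OT.dzeta k i (OT.dzeta l j g) + OT.dzeta l j (OT.dzeta k i g)) := by
    simp only [LinearMap.add_apply, Module.End.mul_apply, gt_apply, smul_sub, map_sub, Pq_theta,
      Pq_Pq, OT.inv_dzeta, map_neg, OT.inv_inv, map_add, add_smul, mul_smul, smul_neg]
    abel
  rw [e, hD]
  rw [ht]
  split_ifs with h
  · rw [LinearMap.smul_apply, LinearMap.smul_apply, gl_apply, smul_sub, map_smul, smul_assoc]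
  · simp

/-- The action of `K[Λ_1, Λ_2]` on maps, where `Λ_k` acts as `Λ_k - ∂_{Z_k}`. -/
def gam : KPoly K 2 N →ₐ[K] Module.End K M.Hm :=
  KPoly.lift (fun k => M.gl k.castSucc) (fun k i => M.gt k.castSucc i)
    (fun _ _ => M.gl_gl _ _) (fun _ _ _ => M.gl_gt _ _ _)
    (fun k l i j => by rw [gt_gt]; simp only [Fin.castSucc_inj])

@[elab_as_elim]
theorem vn_induction_Pq {C : M.VNabla n → Prop} (h1 : ∀ v, C (M.iv n v))
    (ha : ∀ x y, C x → C y → C (x + y)) (hs : ∀ (r : K) x, C x → C (r • x))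
    (hl : ∀ k x, C x → C ((KPoly.lam k : KPoly K n N) • x))
    (ht : ∀ k i x, C x → C (M.Pq n x) → C ((KPoly.theta k i : KPoly K n N) • x)) (x) : C x := by
  suffices h : C x ∧ C (M.Pq n x) from h.1
  induction x using M.vn_induction with
  | h1 v => rw [Pq_iv]; exact ⟨h1 _, h1 _⟩
  | ha x y hx hy => rw [map_add]; exact ⟨ha _ _ hx.1 hy.1, ha _ _ hx.2 hy.2⟩
  | hs r x h => rw [map_smul]; exact ⟨hs _ _ h.1, hs _ _ h.2⟩
  | hl k x h => rw [Pq_lam]; exact ⟨hl _ _ h.1, hl _ _ h.2⟩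
  | ht k i x h =>
    refine ⟨ht _ _ _ h.1 h.2, ?_⟩
    rw [Pq_theta, ← neg_one_smul K]
    exact hs _ _ (ht _ _ _ h.2 (by rw [Pq_Pq]; exact h.1))

variable {M}

/-- `x ↦ (g ↦ X(x ⊗ c ⊗ g'))`, where `g'` is `g` with the first two variables identified. -/
def phi (X : M.Src (Star 2) →ₗ[K] M.VNabla 2) : V →ₗ[K] V →ₗ[K] M.Hm :=
  LinearMap.mk₂ K (fun c x => M.fibQ c3 ∘ₗ X ∘ₗ TensorProduct.mk K _ _ (t2 K x c) ∘ₗ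
      (OT.map c3 A3_c3).toLinearMap)
    (fun c c' x => LinearMap.ext fun g => by
      simp [t2_add_right, TensorProduct.add_tmul])
    (fun r c x => LinearMap.ext fun g => by
      simp [t2_smul_right, ← TensorProduct.smul_tmul'])
    (fun c x x' => LinearMap.ext fun g => by
      simp [t2_add_left, TensorProduct.add_tmul])
    (fun r c x => LinearMap.ext fun g => by
      simp [t2_smul_left, ← TensorProduct.smul_tmul'])

theorem phi_apply (X : M.Src (Star 2) →ₗ[K] M.VNabla 2) (c x : V) (g : OT K N A3) :
    phi X c x g = M.fibQ c3 (X (t2 K x c ⊗ₜ[K] OT.map c3 A3_c3 g)) := rfl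

section Theta
variable {X : M.Src (Star 2) →ₗ[K] M.VNabla 2} (H : M.OpS (-1 : K) X)

theorem OpS.eps_neg (H : M.OpS (-1 : K) X) (v : Tens K V 2) (f : OT K N (Star 2)) :
    M.Pq 2 (X (v ⊗ₜ[K] OT.inv f)) = -X (M.epsT 2 v ⊗ₜ[K] f) := by
  have := H.eps v (OT.inv f)
  rw [OT.inv_inv] at this
  rw [this, neg_smul, one_smul, neg_neg]

theorem phi_T (H : M.OpS (-1 : K) X) (c x : V) : M.gam (∑ k, KPoly.lam k) (phi X c x) + phi X c (M.T x) = 0 := by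
  refine LinearMap.ext fun g => ?_
  have h := H.dz 0 (t2 K x c) (OT.map c3 A3_c3 g)
  rw [TAt0_t2] at h
  have e : (Finset.univ.filter fun k : Fin 3 => c3 k = 0) = {0, 1} := by decide
  rw [LinearMap.add_apply, phi_apply, h, map_sub, fibQ_lam, OT.dz_map, e, map_sum,
    Fin.sum_univ_two]
  simp only [gam, KPoly.lift_lam, LinearMap.add_apply, gl_apply, phi_apply]
  rw [Finset.sum_pair (by decide), Finset.sum_pair (by decide), TensorProduct.tmul_add, map_add,
    map_add]
  simp only [Fin.castSucc_zero, Fin.castSucc_one]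
  change _ = (0 : M.VNabla 3)
  abel

theorem phi_S (H : M.OpS (-1 : K) X) (i : Fin N) (c x : V) :
    M.gam (∑ k, KPoly.theta k i) (phi X c x) + phi X c (M.S i x) = 0 := by
  refine LinearMap.ext fun g => ?_
  have h := H.dzeta 0 i (t2 K x c) (OT.map c3 A3_c3 g)
  rw [SAt0_t2] at h
  have e : (Finset.univ.filter fun k : Fin 3 => c3 k = 0) = {0, 1} := by decide
  rw [LinearMap.add_apply, phi_apply, h, map_sub, map_smul, fibQ_theta, OT.dzeta_map, e, map_sum,
    Fin.sum_univ_two]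
  simp only [gam, KPoly.lift_theta, LinearMap.add_apply, gt_apply, phi_apply, OT.map_inv,
    Pq_fibQ, H.eps_neg]
  rw [Finset.sum_pair (by decide), Finset.sum_pair (by decide), TensorProduct.tmul_add, map_add,
    map_add]
  simp only [Fin.castSucc_zero, Fin.castSucc_one, map_neg, neg_smul, one_smul]
  change _ = (0 : M.VNabla 3)
  abel

/-- `y ↦ (g ↦ X_{Λ_1+Λ_2,Λ_3}(y_{Λ - ∂} ⊗ c ⊗ g'))`. -/
def Th (H : M.OpS (-1 : K) X) (c : V) : M.VNabla 2 →ₗ[K] M.Hm :=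
  M.desc (evalOp M.gam (phi X c)) (M.evalOp_nablaRel _ _ (phi_T H c) fun i => phi_S H i c)

theorem map_neg_Th (c : V) : Th H (-c) = -Th H c := by
  refine LinearMap.ext fun y => ?_
  obtain ⟨y, rfl⟩ := M.cls_surj y
  rw [LinearMap.neg_apply, Th, Th, desc_cls, desc_cls]
  induction y with
  | zero => simp
  | add x y hx hy => simp only [map_add, hx, hy, neg_add]
  | tmul a v => rw [evalOp_tmul, evalOp_tmul, map_neg, LinearMap.neg_apply, map_neg]

theorem Th_iv (c x : V) (g : OT K N A3) :
    Th H c (M.iv 2 x) g = M.fibQ c3 (X (t2 K x c ⊗ₜ[K] OT.map c3 A3_c3 g)) := by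
  rw [iv_apply, Th, desc_cls, evalOp_tmul, map_one]; rfl

theorem Th_smul (c : V) (a : KPoly K 2 N) (y : M.VNabla 2) :
    Th H c (a • y) = M.gam a (Th H c y) := by
  obtain ⟨y, rfl⟩ := M.cls_surj y
  rw [smul_cls, Th, desc_cls, desc_cls, evalOp_smul]

theorem Th_lam (c : V) (k : Fin 2) (y : M.VNabla 2) (g : OT K N A3) :
    Th H c ((KPoly.lam k : KPoly K 2 N) • y) g =
      (KPoly.lam k.castSucc : KPoly K 3 N) • Th H c y g - Th H c y (OT.dz k.castSucc g) := by
  rw [Th_smul, gam, KPoly.lift_lam, gl_apply]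

theorem Th_theta' (c : V) (k : Fin 2) (i : Fin N) (y : M.VNabla 2) (g : OT K N A3) :
    Th H c ((KPoly.theta k i : KPoly K 2 N) • y) g =
      M.Pq 3 (Th H c y (OT.inv (OT.dzeta k.castSucc i g))) -
      (KPoly.theta k.castSucc i : KPoly K 3 N) • Th H c y g := by
  rw [Th_smul, gam, KPoly.lift_theta, gt_apply]

theorem Th_P (c : V) (y : M.VNabla 2) (g : OT K N A3) :
    M.Pq 3 (Th H c y (OT.inv g)) = -Th H (M.eps c) (M.Pq 2 y) g := by
  induction y using M.vn_induction generalizing c g with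
  | h1 x =>
    rw [Th_iv, Pq_fibQ, OT.map_inv, H.eps_neg, map_neg, Pq_iv, Th_iv, epsT_t2]
  | ha x y hx hy => simp only [map_add, LinearMap.add_apply, hx, hy]; abel
  | hs r x h => simp only [map_smul, LinearMap.smul_apply, h, smul_neg]
  | hl k y h =>
    rw [Th_lam, map_sub, Pq_lam, h, ← OT.inv_dz, h, Pq_lam, Th_lam, smul_neg]; abel
  | ht k i y h =>
    have h' : ∀ g, M.Pq 3 (Th H (M.eps c) (M.Pq 2 y) (OT.inv g)) = -Th H c y g := fun g => by
      have := congrArg (M.Pq 3) (h c (OT.inv g))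
      rw [Pq_Pq, OT.inv_inv, map_neg] at this
      rw [this, neg_neg]
    rw [Th_theta', map_sub, Pq_Pq, Pq_theta, h, Pq_theta, map_neg, LinearMap.neg_apply, Th_theta',
      h', OT.inv_dzeta, OT.inv_inv, map_neg, smul_neg]
    abel

theorem Th_theta (c : V) (k : Fin 2) (i : Fin N) (y : M.VNabla 2) (g : OT K N A3) :
    Th H c ((KPoly.theta k i : KPoly K 2 N) • y) g =
      -Th H (M.eps c) (M.Pq 2 y) (OT.dzeta k.castSucc i g) -
      (KPoly.theta k.castSucc i : KPoly K 3 N) • Th H c y g := by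
  rw [Th_theta', Th_P]

theorem zz_self (k : Fin n) {E : Fin n → Fin n → Prop} : (OT.zz k k : OT K N E) = 0 := by
  have := OT.zz_swap (K := K) (N := N) (E := E) k k
  rw [eq_neg_iff_add_eq_zero, ← two_smul K] at this
  exact (smul_eq_zero.1 this).resolve_left two_ne_zero

theorem dl_castSucc (k m : Fin n) : KPoly.dl K k.castSucc m.castSucc = KPoly.dl K k m := by
  simp [KPoly.dl, Fin.castSucc_inj]

theorem Th_Ztq01 (c : V) (i : Fin N) (y : M.VNabla 2) (g : OT K N A3) :
    Th H c (M.Ztq 0 1 i y) g = Th H (M.eps c) (M.Pq 2 y) (OT.zetaz 0 1 i * g) := by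
  induction y using M.vn_induction_Pq generalizing c g with
  | h1 x =>
    rw [Ztq_iv, map_zero, Pq_iv, Th_iv, map_mul, OT.map_zetaz, c3_zero, c3_one, OT.zetaz_self,
      zero_mul, TensorProduct.tmul_zero, map_zero, map_zero]; rfl
  | ha x y hx hy => simp only [map_add, LinearMap.add_apply, hx, hy]
  | hs r x h => simp only [map_smul, LinearMap.smul_apply, h]
  | hl k y h => rw [Ztq_lam, Th_lam, h, h, Pq_lam, Th_lam, OT.dz_zetaz_mul]
  | ht k j y h hP =>
    rw [Ztq_theta, map_sub, LinearMap.sub_apply, Th_theta, h, Pq_theta, map_neg,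
      LinearMap.neg_apply, Th_theta, Pq_Pq, eps_eps, Pq_Ztq, map_neg, LinearMap.neg_apply, hP,
      Pq_Pq, eps_eps, OT.dzeta_zetaz_mul, map_sub, map_smul, map_smul, LinearMap.smul_apply,
      ← dl_castSucc (K := K) 0 k, ← dl_castSucc (K := K) 1 k]
    simp only [Fin.castSucc_zero, Fin.castSucc_one]
    abel

theorem Th_Zq01 (c : V) (y : M.VNabla 2) (g : OT K N A3) :
    Th H c (M.Zq 0 1 y) g = Th H c y (OT.zz 0 1 * g) := by
  induction y using M.vn_induction_Pq generalizing c g with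
  | h1 x =>
    rw [Zq_iv, map_zero, Th_iv, map_mul, OT.map_zz, c3_zero, c3_one, zz_self,
      zero_mul, TensorProduct.tmul_zero, map_zero, map_zero]; rfl
  | ha x y hx hy => simp only [map_add, LinearMap.add_apply, hx, hy]
  | hs r x h => simp only [map_smul, LinearMap.smul_apply, h]
  | hl k y h =>
    rw [Zq_lam, map_add, LinearMap.add_apply, Th_lam, h, h, Th_lam, OT.dz_zz_mul, map_smul,
      LinearMap.smul_apply, map_add, map_smul, ← dl_castSucc (K := K) 0 k,
      ← dl_castSucc (K := K) 1 k]
    simp only [Fin.castSucc_zero, Fin.castSucc_one, sub_smul]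
    abel
  | ht k j y h hP =>
    rw [Zq_theta, map_add, LinearMap.add_apply, Th_theta, h, Pq_Zq, hP, map_smul,
      LinearMap.smul_apply, Th_Ztq01, Th_theta, OT.dzeta_zz_mul, map_sub, map_smul,
      ← dl_castSucc (K := K) 0 k, ← dl_castSucc (K := K) 1 k]
    simp only [Fin.castSucc_zero, Fin.castSucc_one]
    abel

theorem Th_zetaz (c : V) (k l : Fin 3) (i : Fin N) (y : M.VNabla 2) (g : OT K N A3) :
    Th H c y (OT.zetaz k l i * g) = -M.Ztq k l i (Th H (M.eps c) (M.Pq 2 y) g) := by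
  induction y using M.vn_induction_Pq generalizing c g with
  | h1 x =>
    rw [Pq_iv, Th_iv, Th_iv, map_mul, OT.map_zetaz, H.zetaz, map_smul, epsT_t2, Ztq_fibQ, neg_smul,
      one_smul]
  | ha x y hx hy => simp only [map_add, LinearMap.add_apply, hx, hy]; abel
  | hs r x h => simp only [map_smul, LinearMap.smul_apply, h, smul_neg]
  | hl m y h =>
    rw [Th_lam, h, OT.dz_zetaz_mul, h, Pq_lam, Th_lam, map_sub, Ztq_lam, smul_neg]; abel
  | ht m j y h hP =>
    rw [Th_theta, OT.dzeta_zetaz_mul, h, map_sub, hP, map_smul, Pq_theta, map_neg,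
      LinearMap.neg_apply, Th_theta, Pq_Pq, eps_eps, map_neg, map_sub, Ztq_theta, map_neg, smul_neg]
    abel

theorem Th_zz (c : V) (k l : Fin 3) (y : M.VNabla 2) (g : OT K N A3) :
    Th H c y (OT.zz k l * g) = M.Zq k l (Th H c y g) := by
  induction y using M.vn_induction_Pq generalizing c g with
  | h1 x => rw [Th_iv, Th_iv, map_mul, OT.map_zz, H.zz, Zq_fibQ]
  | ha x y hx hy => simp only [map_add, LinearMap.add_apply, hx, hy]
  | hs r x h => simp only [map_smul, LinearMap.smul_apply, h]
  | hl m y h =>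
    rw [Th_lam, h, OT.dz_zz_mul, map_add, map_smul, h, Th_lam, map_sub, Zq_lam]
    simp only [sub_smul]
    abel
  | ht m j y h hP =>
    rw [Th_theta, OT.dzeta_zz_mul, map_sub, map_smul, hP, h, Th_zetaz, Pq_Pq, eps_eps, Th_theta,
      map_sub, map_neg, Zq_theta, smul_neg]
    abel

theorem Th_T (c : V) (y : M.VNabla 2) (g : OT K N A3) :
    Th H (M.T c) y g = Th H c y (OT.dz 2 g) - (KPoly.lam 2 : KPoly K 3 N) • Th H c y g := by
  induction y using M.vn_induction_Pq generalizing c g with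
  | h1 x =>
    have e : (Finset.univ.filter fun k : Fin 3 => c3 k = 1) = {2} := by decide
    rw [Th_iv, ← TAt1_t2, H.dz, map_sub, fibQ_lam, OT.dz_map, e, Finset.sum_singleton,
      Finset.sum_singleton, Th_iv, Th_iv]
  | ha x y hx hy => simp only [map_add, LinearMap.add_apply, hx, hy, smul_add]; abel
  | hs r x h => simp only [map_smul, LinearMap.smul_apply, h, smul_sub, smul_comm r]
  | hl m y h =>
    rw [Th_lam, h, h, Th_lam, Th_lam, OT.dz_dz]
    simp only [smul_sub, ← mul_smul, KPoly.lam_lam (2 : Fin 3)]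
    abel
  | ht m j y h hP =>
    rw [Th_theta, h, eps_T, hP, Th_theta, Th_theta, ← OT.dz_dzeta]
    simp only [smul_sub, smul_neg, ← mul_smul, KPoly.lam_theta (2 : Fin 3)]
    abel

theorem Th_S (c : V) (i : Fin N) (y : M.VNabla 2) (g : OT K N A3) :
    Th H (M.S i c) y g = Th H (M.eps c) y (OT.dzeta 2 i g) +
      (KPoly.theta 2 i : KPoly K 3 N) • Th H c (M.Pq 2 y) g := by
  induction y using M.vn_induction_Pq generalizing c g with
  | h1 x =>
    have e : (Finset.univ.filter fun k : Fin 3 => c3 k = 1) = {2} := by decide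
    have h := H.dzeta 1 i (t2 K (M.eps x) c) (OT.map c3 A3_c3 g)
    rw [SAt1_t2, eps_eps] at h
    rw [Th_iv, h, map_sub, map_smul, fibQ_theta, OT.dzeta_map, e, Finset.sum_singleton,
      Finset.sum_singleton, Th_iv, Pq_iv, Th_iv, epsT_t2, eps_eps, neg_smul, one_smul, sub_neg_eq_add]
  | ha x y hx hy => simp only [map_add, LinearMap.add_apply, hx, hy, smul_add]; abel
  | hs r x h => simp only [map_smul, LinearMap.smul_apply, h, smul_add, smul_comm r]
  | hl m y h =>
    rw [Th_lam, h, h, Th_lam, Pq_lam, Th_lam, OT.dz_dzeta]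
    simp only [smul_sub, smul_add, ← mul_smul, KPoly.lam_theta]
    abel
  | ht m j y h hP =>
    have hm : m.castSucc ≠ (2 : Fin 3) := (Fin.castSucc_lt_last m).ne
    have hD := congrArg (Th H c (M.Pq 2 y)) (OT.dzeta_dzeta 2 m.castSucc i j g)
    rw [if_neg (fun e => hm e.1.symm), map_zero, map_add, ← eq_neg_iff_add_eq_zero] at hD
    have ht := KPoly.theta_theta (K := K) 2 m.castSucc i j
    rw [if_neg (fun e => hm e.1.symm), ← eq_neg_iff_add_eq_zero] at ht
    rw [Th_theta, h, eps_S, map_neg_Th, LinearMap.neg_apply, LinearMap.neg_apply, hP, eps_eps, Pq_Pq,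
      Th_theta, Pq_theta, map_neg, LinearMap.neg_apply, Th_theta, Pq_Pq, eps_eps, hD]
    simp only [smul_sub, smul_neg, smul_add, ← mul_smul, ht, neg_smul]
    abel

end Theta

end HKMod

end

section
namespace OT
variable {K : Type*} [Field K] {N n : ℕ} {E : Fin n → Fin n → Prop}

theorem u_pow_comm (k l : Fin n) (h : E k l) (j : ℕ) (f : OT K N E) :
    u k l h ^ j * f = f * u k l h ^ j :=
  (Commute.pow_left (show Commute (u k l h) f from u_comm k l h f) j)

theorem dz_u_pow (m k l : Fin n) (h : E k l) (j : ℕ) : dz m (u k l h ^ j : OT K N E) =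
    ((j : K) * (KPoly.dl K l m - KPoly.dl K k m)) • u k l h ^ (j + 1) := by
  induction j with
  | zero => simp [dz_one]
  | succ j ih =>
    have e : dz m (u k l h : OT K N E) = (KPoly.dl K l m - KPoly.dl K k m) • u k l h ^ 2 := by
      rw [dz_u]; simp only [KPoly.dl]; split_ifs <;> simp
    rw [pow_succ, dz_mul, ih, e, mul_smul_comm, smul_mul_assoc, ← pow_add, ← pow_succ, ← add_smul]
    congr 1
    push_cast; ring

theorem dzeta_u_pow (m k l : Fin n) (i : Fin N) (h : E k l) (j : ℕ) :
    dzeta m i (u k l h ^ j : OT K N E) =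
      ((j : K) * (KPoly.dl K k m + KPoly.dl K l m)) • (zetaz k l i * u k l h ^ (j + 1)) := by
  induction j with
  | zero => simp [dzeta_one]
  | succ j ih =>
    have e : dzeta m i (u k l h : OT K N E) =
        (KPoly.dl K k m + KPoly.dl K l m) • (zetaz k l i * u k l h ^ 2) := by
      rw [dzeta_u]; simp only [KPoly.dl]
      by_cases hk : k = m <;> by_cases hl : l = m
      · subst hk hl; simp [zetaz_self]
      all_goals simp [hk, hl]
    rw [pow_succ, dzeta_mul, ih, e, mul_smul_comm, smul_mul_assoc, map_pow, inv_u, ← mul_assoc,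
      u_pow_comm, mul_assoc, ← pow_add, mul_assoc, ← pow_succ, ← add_smul]
    congr 1
    push_cast; ring

end OT

namespace HKMod

variable {K : Type*} [Field K] {n m N : ℕ} {V : Type*} [AddCommGroup V] [Module K V]
variable (M : HKMod K N V)

/-- `w ↦ w ⊗ c`. -/
def ins (c : V) : Tens K V 2 →ₗ[K] Tens K V 3 :=
  lift2 (LinearMap.mk₂ K (fun a b => t3 K a b c)
    (fun a a' b => (t3_add 0 a b c a' b c).1) (fun r a b => (t3_smul r a b c).1)
    (fun a b b' => (t3_add 0 a b c a b' c).2.1) (fun r a b => (t3_smul r a b c).2.1))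

@[simp] theorem ins_t2 (a b c : V) : ins c (t2 K a b) = t3 K a b c := by simp [ins]

theorem ins_induction {C : Tens K V 3 → Prop} (h : ∀ c w, C (ins c w))
    (ha : ∀ v w, C v → C w → C (v + w)) (v) : C v := by
  induction v using PiTensorProduct.induction_on with
  | smul_tprod r f => rw [t3_eq, ← ins_t2, ← map_smul]; exact h _ _
  | add x y hx hy => exact ha _ _ hx hy

theorem epsT_ins (c : V) (w : Tens K V 2) :
    M.epsT 3 (ins c w) = ins (M.eps c) (M.epsT 2 w) := by
  suffices h : M.epsT 3 ∘ₗ ins c = ins (M.eps c) ∘ₗ M.epsT 2 from LinearMap.congr_fun h w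
  exact ext2 fun a b => by simp [epsT_t3, epsT_t2]

theorem TAt_ins (k : Fin 2) (c : V) (w : Tens K V 2) :
    M.TAt k.castSucc (ins c w) = ins c (M.TAt k w) := by
  suffices h : M.TAt k.castSucc ∘ₗ ins c = ins c ∘ₗ M.TAt k from LinearMap.congr_fun h w
  refine ext2 fun a b => ?_
  simp only [LinearMap.comp_apply, ins_t2]
  rcases (by revert k; decide : k = 0 ∨ k = 1) with rfl | rfl
  · rw [TAt0_t2, ins_t2, ins_t2]; exact M.TAt0_t3 a b c
  · rw [TAt1_t2, ins_t2, ins_t2]; exact M.TAt1_t3 a b c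

theorem SAt_ins (k : Fin 2) (i : Fin N) (c : V) (w : Tens K V 2) :
    M.SAt k.castSucc i (ins c w) = ins c (M.SAt k i w) := by
  suffices h : M.SAt k.castSucc i ∘ₗ ins c = ins c ∘ₗ M.SAt k i from LinearMap.congr_fun h w
  refine ext2 fun a b => ?_
  simp only [LinearMap.comp_apply, ins_t2]
  rcases (by revert k; decide : k = 0 ∨ k = 1) with rfl | rfl
  · rw [SAt0_t2, ins_t2, ins_t2]; exact M.SAt0_t3 i a b c
  · rw [SAt1_t2, ins_t2, ins_t2]; exact M.SAt1_t3 i a b c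

theorem TAt2_ins (c : V) (w : Tens K V 2) : M.TAt 2 (ins c w) = ins (M.T c) w := by
  suffices h : M.TAt 2 ∘ₗ ins c = ins (M.T c) from LinearMap.congr_fun h w
  exact ext2 fun a b => by simp [TAt2_t3]

theorem SAt2_ins (i : Fin N) (c : V) (w : Tens K V 2) :
    M.SAt 2 i (ins c w) = ins (M.S i c) (M.epsT 2 w) := by
  suffices h : M.SAt 2 i ∘ₗ ins c = ins (M.S i c) ∘ₗ M.epsT 2 from LinearMap.congr_fun h w
  exact ext2 fun a b => by simp [SAt2_t3, epsT_t2]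

variable {M} [CharZero K]

theorem s01 : Star 2 0 1 := by show (0 : Fin 2) ≠ 1; decide
theorem s3 {k l : Fin 3} (h : k ≠ l) : Star 3 k l := h
theorem s301 : Star 3 0 1 := s3 (by decide)

theorem A3_cover : ∀ k l : Fin 3, Star 3 k l → A3 k l ∨ (k = 0 ∧ l = 1) ∨ (k = 1 ∧ l = 0) := by
  show ∀ k l : Fin 3, k ≠ l → c3 k ≠ c3 l ∨ (k = 0 ∧ l = 1) ∨ (k = 1 ∧ l = 0)
  decide

section Comp
variable {X : M.Src (Star 2) →ₗ[K] M.VNabla 2} (H : M.OpS (-1 : K) X)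

/-- The map `c ↦ Th c`. -/
def ThL (H : M.OpS (-1 : K) X) : V →ₗ[K] M.VNabla 2 →ₗ[K] M.Hm where
  toFun := Th H
  map_add' c c' := LinearMap.ext fun y => by
    obtain ⟨y, rfl⟩ := M.cls_surj y
    rw [LinearMap.add_apply, Th, Th, Th, desc_cls, desc_cls, desc_cls]
    induction y with
    | zero => simp
    | add x y hx hy => rw [map_add, hx, hy, map_add, map_add]; abel
    | tmul a v => simp only [evalOp_tmul, map_add, LinearMap.add_apply]
  map_smul' r c := LinearMap.ext fun y => by
    obtain ⟨y, rfl⟩ := M.cls_surj y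
    rw [LinearMap.smul_apply, Th, Th, desc_cls, desc_cls]
    induction y with
    | zero => simp
    | add x y hx hy => rw [map_add, hx, hy, map_add, smul_add]
    | tmul a v => simp only [evalOp_tmul, map_smul, LinearMap.smul_apply, RingHom.id_apply]

theorem ThL_apply (c : V) : ThL H c = Th H c := rfl

/-- `(a, b, c) ↦ Th c (X(a ⊗ b ⊗ h)) f`. -/
def compTri (H : M.OpS (-1 : K) X) (h : OT K N (Star 2)) (f : OT K N A3) :
    Tens K V 3 →ₗ[K] M.VNabla 3 :=
  lift3 ((t2L.compr₂ (X ∘ₗ (TensorProduct.mk K (Tens K V 2) (OT K N (Star 2))).flip h)).compr₂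
    (LinearMap.compRight K (LinearMap.applyₗ f : M.Hm →ₗ[K] M.VNabla 3) ∘ₗ (ThL H).flip))

theorem compTri_ins (h : OT K N (Star 2)) (f : OT K N A3) (c : V) (w : Tens K V 2) :
    compTri H h f (ins c w) = Th H c (X (w ⊗ₜ[K] h)) f := by
  suffices e : compTri H h f ∘ₗ ins c = LinearMap.applyₗ f ∘ₗ Th H c ∘ₗ X ∘ₗ
      (TensorProduct.mk K (Tens K V 2) (OT K N (Star 2))).flip h from LinearMap.congr_fun e w
  refine ext2 fun a b => ?_
  simp only [LinearMap.comp_apply, ins_t2, compTri, lift3_t3]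
  rfl

theorem exists_comp (H : M.OpS (-1 : K) X) : ∃ W : M.Src (Star 3) →ₗ[K] M.VNabla 3,
    ∀ (c : V) (w : Tens K V 2) (j : ℕ) (f : OT K N A3), W (ins c w ⊗ₜ[K] (OT.map id A3_star f * OT.u 0 1 s301 ^ j : OT K N (Star 3))) =
      Th H c (X (w ⊗ₜ[K] (OT.u 0 1 s01 ^ j))) f := by
  let G : ℕ → OT K N A3 →ₗ[K] (Tens K V 3 →ₗ[K] M.VNabla 3) := fun j =>
    { toFun := compTri H (OT.u 0 1 s01 ^ j)
      map_add' := fun f g => LinearMap.ext fun v => by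
        induction v using ins_induction with
        | h c w => simp only [LinearMap.add_apply, compTri_ins, map_add]
        | ha v w hv hw => rw [map_add, hv, hw, map_add]
      map_smul' := fun r f => LinearMap.ext fun v => by
        induction v using ins_induction with
        | h c w => simp only [LinearMap.smul_apply, compTri_ins, map_smul, RingHom.id_apply]
        | ha v w hv hw => rw [map_add, hv, hw, map_add] }
  have hG : ∀ j f c w, G j f (ins c w) = Th H c (X (w ⊗ₜ[K] (OT.u 0 1 s01 ^ j))) f :=
    fun j f c w => compTri_ins H _ f c w
  obtain ⟨F, hF⟩ := OT.exists_ext A3_star 0 1 s301 (fun h => h rfl) A3_cover G fun j f => by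
    refine LinearMap.ext fun v => ?_
    induction v using ins_induction with
    | h c w =>
      rw [hG, hG, ← Th_Zq01, ← H.zz, pow_succ', ← mul_assoc, OT.zz_u, one_mul]
    | ha v w hv hw => rw [map_add, hv, hw, map_add]
  refine ⟨TensorProduct.lift F.flip, fun c w j f => ?_⟩
  rw [TensorProduct.lift.tmul, LinearMap.flip_apply, hF, hG]

/-- The composition `X ∘_1 X`. -/
def comp (H : M.OpS (-1 : K) X) : M.Src (Star 3) →ₗ[K] M.VNabla 3 := (exists_comp H).choose

theorem comp_apply (c : V) (w : Tens K V 2) (j : ℕ) (f : OT K N A3) :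
    comp H (ins c w ⊗ₜ[K] (OT.map id A3_star f * OT.u 0 1 s301 ^ j : OT K N (Star 3))) =
      Th H c (X (w ⊗ₜ[K] (OT.u 0 1 s01 ^ j))) f := (exists_comp H).choose_spec c w j f

theorem rep3 (f : OT K N (Star 3)) :
    ∃ j, ∃ g : OT K N A3, f = OT.map id A3_star g * OT.u 0 1 s301 ^ j :=
  OT.exists_rep A3_star 0 1 s301 A3_cover f

theorem comp_opS (H : M.OpS (-1 : K) X) : M.OpS 1 (comp H) := by
  have hX : ∀ w (j : ℕ), M.Pq 2 (X (w ⊗ₜ[K] (OT.u 0 1 s01 ^ j))) =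
      -X (M.epsT 2 w ⊗ₜ[K] (OT.u 0 1 s01 ^ j)) := fun w j => by
    rw [← H.eps_neg, map_pow, OT.inv_u]
  have hmz : ∀ k l, (OT.zz k l : OT K N (Star 3)) = OT.map id A3_star (OT.zz k l) := fun k l => by
    rw [OT.map_zz]; rfl
  have hmt : ∀ k l i, (OT.zetaz k l i : OT K N (Star 3)) = OT.map id A3_star (OT.zetaz k l i) :=
    fun k l i => by rw [OT.map_zetaz]; rfl
  have hid : ∀ k : Fin 3, (Finset.univ.filter fun l : Fin 3 => id l = k) = {k} := fun k => by
    ext l; simp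
  have hdz : ∀ k (f : OT K N A3), OT.dz k (OT.map id A3_star f) = OT.map id A3_star (OT.dz k f) :=
    fun k f => by rw [OT.dz_map, hid, Finset.sum_singleton]
  have hdt : ∀ k i (f : OT K N A3),
      OT.dzeta k i (OT.map id A3_star f) = OT.map id A3_star (OT.dzeta k i f) :=
    fun k i f => by rw [OT.dzeta_map, hid, Finset.sum_singleton]
  refine ⟨fun k l v f => ?_, fun k l i v f => ?_, fun v f => ?_, fun k v f => ?_,
    fun k i v f => ?_⟩ <;> obtain ⟨j, f, rfl⟩ := rep3 f <;>
    induction v using ins_induction with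
    | ha v w hv hw => simp only [map_add, TensorProduct.add_tmul, hv, hw, smul_add]; try abel
    | h c w => ?_
  · rw [← mul_assoc, hmz, ← map_mul, comp_apply, comp_apply, Th_zz]
  · rw [← mul_assoc, hmt, ← map_mul, comp_apply, epsT_ins, comp_apply, Th_zetaz, hX, map_neg,
      LinearMap.neg_apply, map_neg, neg_neg, one_smul]
  · rw [epsT_ins, map_mul, map_pow, OT.inv_u, ← OT.map_inv, comp_apply, comp_apply, one_smul]
    have := Th_P H c (X (w ⊗ₜ[K] (OT.u 0 1 s01 ^ j))) (OT.inv f)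
    rw [OT.inv_inv, hX, map_neg, LinearMap.neg_apply, neg_neg] at this
    exact this.symm
  · induction k using Fin.lastCases with
    | last =>
      change comp H (M.TAt 2 _ ⊗ₜ[K] _) = comp H (_ ⊗ₜ[K] OT.dz 2 _) - (KPoly.lam 2 : KPoly K 3 N) • _
      rw [TAt2_ins, comp_apply, comp_apply, Th_T, OT.dz_mul, OT.dz_u_pow, hdz]
      simp only [KPoly.dl]
      simp [comp_apply]
    | cast k =>
      rw [TAt_ins, comp_apply, comp_apply, H.dz, OT.dz_u_pow, map_sub, LinearMap.sub_apply, Th_lam,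
        OT.dz_mul, OT.dz_u_pow, hdz, mul_smul_comm, TensorProduct.tmul_add,
        TensorProduct.tmul_smul, TensorProduct.tmul_smul, map_add, map_smul, map_smul, map_smul,
        LinearMap.smul_apply, comp_apply, comp_apply, ← dl_castSucc (K := K) 0 k,
        ← dl_castSucc (K := K) 1 k]
      simp only [Fin.castSucc_zero, Fin.castSucc_one]
      abel
  · induction k using Fin.lastCases with
    | last =>
      change comp H (M.SAt 2 i _ ⊗ₜ[K] _) =
        comp H (_ ⊗ₜ[K] OT.dzeta 2 i _) - (1 : K) • (KPoly.theta 2 i : KPoly K 3 N) • _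
      rw [SAt2_ins, comp_apply, comp_apply, Th_S, OT.dzeta_mul, OT.dzeta_u_pow, hdt, hX, epsT_epsT,
        epsT_ins]
      simp only [KPoly.dl]
      simp [comp_apply, sub_eq_add_neg]
    | cast k =>
      rw [SAt_ins, comp_apply, comp_apply, H.dzeta, OT.dzeta_u_pow, map_sub, LinearMap.sub_apply,
        map_smul (Th H c), LinearMap.smul_apply, Th_theta, hX,
        OT.dzeta_mul, OT.dzeta_u_pow, hdt, mul_smul_comm, TensorProduct.tmul_add,
        TensorProduct.tmul_smul, TensorProduct.tmul_smul, map_add, map_smul, map_smul, map_smul,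
        LinearMap.smul_apply, H.zetaz, epsT_epsT, ← mul_assoc, ← OT.map_inv, hmt, ← map_mul,
        ← OT.zetaz_mul, epsT_ins, comp_apply, comp_apply, ← dl_castSucc (K := K) 0 k,
        ← dl_castSucc (K := K) 1 k, map_smul (Th H c), LinearMap.smul_apply, Th_Ztq01, hX]
      simp only [Fin.castSucc_zero, Fin.castSucc_one, map_neg, LinearMap.neg_apply, smul_neg,
        neg_smul, one_smul, neg_neg]
      abel

end Comp

end HKMod

end

section
namespace HKMod

variable {K : Type*} [Field K] [CharZero K] {n m N : ℕ} {V : Type*} [AddCommGroup V] [Module K V]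
variable {M : HKMod K N V}

section Bridge
variable {X : M.Src (Star 2) →ₗ[K] M.VNabla 2}

/-- The space on which the operators `Λ_k - ∂_{Z_k}` act. -/
abbrev W3 (_ : HKMod K N V) : Type _ := KPoly K 3 N ⊗[K] (Tens K V 2 ⊗[K] OT K N A3)

/-- `a ⊗ w ⊗ g ↦ (-1)^{p(a)} a X(w ⊗ g')`. -/
def ctr (X : M.Src (Star 2) →ₗ[K] M.VNabla 2) : M.W3 →ₗ[K] M.VNabla 3 := M.contract 1 1 X

/-- `λ_1 - ∂_{z_1}`. -/
def wL (M : HKMod K N V) : Module.End K M.W3 := M.gLam 1 (0 : Fin 1)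

/-- `θ_1^i - D_{ζ_1^i}`. -/
def wT (M : HKMod K N V) (i : Fin N) : Module.End K M.W3 := M.gTheta 1 (0 : Fin 1) i

/-- An operator on functions, acting on the last factor. -/
def onF (M : HKMod K N V) (D : Module.End K (OT K N A3)) : Module.End K M.W3 :=
  TensorProduct.map LinearMap.id (TensorProduct.map LinearMap.id D)

theorem W3_induction {C : M.W3 → Prop} (h : ∀ a w g, C (a ⊗ₜ[K] (w ⊗ₜ[K] g)))
    (ha : ∀ x y, C x → C y → C (x + y)) (x) : C x := by
  induction x using TensorProduct.induction_on with
  | zero => simpa using h 0 0 0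
  | add x y hx hy => exact ha _ _ hx hy
  | tmul a y =>
    induction y using TensorProduct.induction_on with
    | zero => simpa using h a 0 0
    | add x y hx hy => rw [TensorProduct.tmul_add]; exact ha _ _ hx hy
    | tmul w g => exact h a w g

theorem ctr_tmul (a : KPoly K 3 N) (w : Tens K V 2) (g : OT K N A3) :
    ctr X (a ⊗ₜ[K] (w ⊗ₜ[K] g)) =
      KPoly.inv a • M.fibQ c3 (X (w ⊗ₜ[K] OT.map c3 A3_c3 g)) := rfl

theorem wL_tmul (a : KPoly K 3 N) (w : Tens K V 2) (g : OT K N A3) :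
    M.wL (a ⊗ₜ[K] (w ⊗ₜ[K] g)) = (KPoly.lam 0 * a) ⊗ₜ[K] (w ⊗ₜ[K] g) -
      a ⊗ₜ[K] (w ⊗ₜ[K] OT.dz 0 g) := rfl

theorem wT_tmul (i : Fin N) (a : KPoly K 3 N) (w : Tens K V 2) (g : OT K N A3) :
    M.wT i (a ⊗ₜ[K] (w ⊗ₜ[K] g)) = (KPoly.theta 0 i * a) ⊗ₜ[K] (w ⊗ₜ[K] g) -
      KPoly.inv a ⊗ₜ[K] (M.epsT 2 w ⊗ₜ[K] OT.dzeta 0 i g) := rfl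

theorem onF_tmul (D : Module.End K (OT K N A3)) (a : KPoly K 3 N) (w : Tens K V 2)
    (g : OT K N A3) : M.onF D (a ⊗ₜ[K] (w ⊗ₜ[K] g)) = a ⊗ₜ[K] (w ⊗ₜ[K] D g) := rfl

theorem ctr_wL (y : M.W3) : ctr X (M.wL y) =
    (KPoly.lam 0 : KPoly K 3 N) • ctr X y - ctr X (M.onF (OT.dz 0) y) := by
  induction y using W3_induction with
  | ha x y hx hy => simp only [map_add, hx, hy, smul_add]; abel
  | h a w g =>
    rw [wL_tmul, map_sub, onF_tmul, ctr_tmul, ctr_tmul, ctr_tmul, map_mul, inv_lam, mul_smul]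

theorem ctr_wT (H : M.OpS (-1 : K) X) (i : Fin N) (y : M.W3) :
    ctr X (M.wT i y) = M.Pq 3 (ctr X (M.onF (OT.inv.toLinearMap ∘ₗ OT.dzeta 0 i) y)) -
      (KPoly.theta 0 i : KPoly K 3 N) • ctr X y := by
  induction y using W3_induction with
  | ha x y hx hy => simp only [map_add, hx, hy, smul_add]; abel
  | h a w g =>
    rw [wT_tmul, map_sub, onF_tmul, ctr_tmul, ctr_tmul, ctr_tmul, ctr_tmul, map_mul, inv_theta,
      LinearMap.comp_apply, AlgHom.toLinearMap_apply, neg_mul, neg_smul, mul_smul, Pq_smul,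
      OT.map_inv, Pq_fibQ, KPoly.inv_inv, H.eps_neg, map_neg, smul_neg]
    abel

theorem onF_wL (D : Module.End K (OT K N A3)) (hD : ∀ g, D (OT.dz 0 g) = OT.dz 0 (D g))
    (y : M.W3) : M.onF D (M.wL y) = M.wL (M.onF D y) := by
  induction y using W3_induction with
  | ha x y hx hy => simp only [map_add, hx, hy]
  | h a w g => rw [wL_tmul, map_sub, onF_tmul, onF_tmul, onF_tmul, wL_tmul, hD]

theorem onF_wT (i : Fin N) (D : Module.End K (OT K N A3))
    (hD : ∀ g, D (OT.dzeta 0 i g) = OT.dzeta 0 i (D g)) (y : M.W3) :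
    M.onF D (M.wT i y) = M.wT i (M.onF D y) := by
  induction y using W3_induction with
  | ha x y hx hy => simp only [map_add, hx, hy]
  | h a w g => rw [wT_tmul, map_sub, onF_tmul, onF_tmul, onF_tmul, wT_tmul, hD]

theorem onF_prod (D : Module.End K (OT K N A3)) (L : List (Fin N))
    (hD : ∀ j ∈ L, ∀ g, D (OT.dzeta 0 j g) = OT.dzeta 0 j (D g)) (y : M.W3) :
    M.onF D ((L.map M.wT).prod y) = (L.map M.wT).prod (M.onF D y) := by
  induction L with
  | nil => rfl
  | cons j L ih =>
    rw [List.map_cons, List.prod_cons, Module.End.mul_apply, Module.End.mul_apply,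
      ← ih (fun j hj => hD j (List.mem_cons_of_mem _ hj)), onF_wT _ D (hD j List.mem_cons_self) _]

theorem ctr_prod (H : M.OpS (-1 : K) X) (L : List (Fin N)) (hL : L.Nodup)
    (c x : V) (g : OT K N A3) :
    ctr X ((L.map M.wT).prod (1 ⊗ₜ[K] (t2 K x c ⊗ₜ[K] g))) =
      (L.map (M.gt 0)).prod (phi X c x) g := by
  induction L generalizing g with
  | nil =>
    rw [List.map_nil, List.prod_nil, List.map_nil, List.prod_nil, Module.End.one_apply,
      Module.End.one_apply, ctr_tmul, map_one, one_smul, phi_apply]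
  | cons j L ih =>
    have hj := List.nodup_cons.1 hL
    rw [List.map_cons, List.prod_cons, Module.End.mul_apply, List.map_cons, List.prod_cons,
      Module.End.mul_apply, ctr_wT H, onF_prod _ _ fun l hl g => ?_, ih hj.2, gt_apply, onF_tmul,
      ih hj.2]
    · rfl
    · have hne : ¬((0 : Fin 3) = 0 ∧ j = l) := fun e => hj.1 (e.2 ▸ hl)
      have := OT.dzeta_dzeta (K := K) (E := A3) 0 0 j l g
      rw [if_neg hne, ← eq_neg_iff_add_eq_zero] at this
      rw [LinearMap.comp_apply, LinearMap.comp_apply, AlgHom.toLinearMap_apply,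
        AlgHom.toLinearMap_apply, this, map_neg, OT.inv_dzeta, neg_neg]

theorem ctr_mono (H : M.OpS (-1 : K) X) (L : List (Fin N)) (hL : L.Nodup) (k : ℕ)
    (c x : V) (g : OT K N A3) :
    ctr X ((M.wL ^ k * (L.map M.wT).prod) (1 ⊗ₜ[K] (t2 K x c ⊗ₜ[K] g))) =
      (M.gl 0 ^ k * (L.map (M.gt 0)).prod) (phi X c x) g := by
  have hc : ∀ k (y : M.W3), M.onF (OT.dz 0) ((M.wL ^ k) y) = (M.wL ^ k) (M.onF (OT.dz 0) y) := by
    intro k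
    induction k with
    | zero => intro y; rfl
    | succ k ih =>
      intro y
      rw [pow_succ', Module.End.mul_apply, onF_wL _ (fun _ => rfl), ih, Module.End.mul_apply]
  induction k generalizing g with
  | zero => rw [pow_zero, one_mul, pow_zero, one_mul, ctr_prod H L hL c x g]
  | succ k ih =>
    rw [pow_succ', mul_assoc, Module.End.mul_apply M.wL, pow_succ', mul_assoc,
      Module.End.mul_apply (M.gl 0), ctr_wL, ih, gl_apply,
      Module.End.mul_apply (M.wL ^ k), hc, onF_prod _ _ (fun l hl g => OT.dz_dzeta _ _ _ _),
      onF_tmul, ← ih (OT.dz 0 g)]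
    rfl

theorem insertFirst_eq (v : Fin 1 → V) (f : OT K N A3) (x : V) :
    M.insertFirst v f x = (1 ⊗ₜ[K] (t2 K x (v 0) ⊗ₜ[K] f) : M.W3) :=
  congrArg (fun w : Tens K V 2 => (1 ⊗ₜ[K] (w ⊗ₜ[K] f) : M.W3))
    (t2_eq (Fin.cons x v : Fin 2 → V))

theorem onMon_eq_Th (H : M.OpS (-1 : K) X) (v : Fin 1 → V) (f : OT K N (Apart 1 1))
    (x : KPoly K 1 N ⊗[K] V) :
    KPoly.onMon (fun μ : Mon 1 N => M.contract 1 1 X ∘ₗ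
            monoIn (M.gLam 1) (M.gTheta 1) μ ∘ₗ M.insertFirst v f) x =
      (Th H (v 0) (M.inc 1 x) : OT K N A3 →ₗ[K] M.VNabla 3) f := by
  let f' : OT K N A3 := f
  change _ = (Th H (v 0) (M.inc 1 x)) f'
  induction x with
  | zero => rw [map_zero, map_zero, map_zero]; rfl
  | add x y hx hy => rw [map_add, hx, hy, map_add, map_add, LinearMap.add_apply]
  | tmul a x =>
    induction a using KPoly.ind_mono with
    | hs r a h => rw [← TensorProduct.smul_tmul', map_smul, h, map_smul, map_smul]; rfl
    | ha a b ha hb =>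
      rw [TensorProduct.add_tmul, map_add, ha, hb, map_add, map_add, LinearMap.add_apply]
    | hm μ =>
      rw [KPoly.onMon_mono, inc_tmul, Th_smul]
      have e1 : M.gam (KPoly.up (KPoly.mono μ)) = M.gl 0 ^ μ.1 0 *
          ((μ.2.sort.map fun j => (ofLex j).2).map (M.gt 0)).prod := by
        rw [KPoly.mono, monoIn, map_mul, map_mul, map_list_prod, map_list_prod, map_list_prod,
          map_list_prod, List.map_map, List.map_map, List.ofFn_succ, List.ofFn_zero]
        congr 1
        · simp [gam]
        · congr 1
          rw [List.map_map, List.map_map]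
          refine List.map_congr_left fun j _ => ?_
          simp [gam, Fin.fin_one_eq_zero (ofLex j).1]
      have e2 : Th H (v 0) (M.iv 2 x) = phi X (v 0) x := LinearMap.ext fun g => Th_iv H _ _ _
      have hL : (μ.2.sort.map fun j => (ofLex j).2).Nodup := by
        refine List.Nodup.map ?_ (Finset.sort_nodup _ _)
        intro a b e
        exact ofLex.injective (Prod.ext (Subsingleton.elim _ _) e)
      have e3 : (μ.2.sort.map fun j => M.gTheta 1 (ofLex j).1 (ofLex j).2) =
          (μ.2.sort.map fun j => (ofLex j).2).map M.wT := by
        rw [List.map_map]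
        refine List.map_congr_left fun j _ => ?_
        rw [Fin.fin_one_eq_zero (ofLex j).1]
        rfl
      rw [e1, e2, ← ctr_mono H _ hL]
      have e4 : monoIn (M.gLam 1) (M.gTheta 1) μ = M.wL ^ μ.1 0 *
          ((μ.2.sort.map fun j => (ofLex j).2).map M.wT).prod := by
        rw [monoIn, e3, List.ofFn_succ, List.ofFn_zero, List.prod_singleton]
        rfl
      rw [← insertFirst_eq v f' x, ← e4]
      rfl

theorem fin2_cases (k : Fin 2) : k = 0 ∨ k = 1 := by revert k; decide

theorem closure_u (f : OT K N (Star 2))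
    (hf : f ∈ Submonoid.closure {f : OT K N (Star 2) | ∃ k l h, f = OT.u k l h}) :
    ∃ (r : K) (j : ℕ), f = r • OT.u 0 1 s01 ^ j := by
  induction hf using Submonoid.closure_induction with
  | mem x h =>
    obtain ⟨k, l, h, rfl⟩ := h
    rcases fin2_cases k with rfl | rfl <;> rcases fin2_cases l with rfl | rfl
    · exact absurd rfl h
    · exact ⟨1, 1, by simp⟩
    · exact ⟨-1, 1, by rw [OT.u_swap 0 1 s01 h]; simp⟩
    · exact absurd rfl h
  | one => exact ⟨1, 0, by simp⟩
  | mul x y _ _ hx hy =>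
    obtain ⟨r, j, rfl⟩ := hx
    obtain ⟨r', j', rfl⟩ := hy
    exact ⟨r * r', j + j', by rw [smul_mul_smul_comm, pow_add]⟩

theorem map_castAdd (hc : ∀ k l, Star 2 k l → Star 3 (Fin.castAdd 1 k) (Fin.castAdd 1 l))
    (j : ℕ) : OT.map (Fin.castAdd 1) hc (OT.u 0 1 s01 ^ j : OT K N (Star 2)) =
      OT.u 0 1 s301 ^ j := by
  rw [map_pow, OT.map_u]; rfl

theorem isInfComp_comp (H : M.OpS (-1 : K) X) : M.IsInfComp (n := 1) (m := 1) 1 X X (comp H) := by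
  intro w v f₀ f₁ hf
  obtain ⟨r, j, rfl⟩ := closure_u f₁ hf
  refine Eq.trans ?_ (onMon_eq_Th H v f₀ _).symm
  rw [inc_red]
  let f' : OT K N A3 := f₀
  have hc : ∀ k l, Star 2 k l → Star 3 (Fin.castAdd 1 k) (Fin.castAdd 1 l) :=
    fun _ _ h => (Fin.castAdd_injective 2 1).ne h
  suffices key : comp H (PiTensorProduct.tprod K (Fin.append w v : Fin 3 → V) ⊗ₜ[K]
    (OT.map (E' := Star 3) id A3_star f' * OT.map (E' := Star 3) (Fin.castAdd 1) hc (r • OT.u 0 1 s01 ^ j) :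
      OT K N (Star 3))) =
    Th H (v 0) (X (PiTensorProduct.tprod K w ⊗ₜ[K] (r • OT.u 0 1 s01 ^ j))) f' from key
  rw [map_smul, map_castAdd, mul_smul_comm, TensorProduct.tmul_smul, map_smul,
    TensorProduct.tmul_smul, map_smul, map_smul, LinearMap.smul_apply]
  congr 1
  rw [← comp_apply H (v 0) _ j f', t2_eq, ins_t2, t3_eq]
  rfl

theorem infComp_eq (H : M.OpS (-1 : K) X) : M.infComp (n := 1) (m := 1) 1 X X = comp H := by
  have hW : ∃ W, M.IsInfComp (n := 1) (m := 1) 1 X X W := ⟨_, isInfComp_comp H⟩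
  rw [infComp, dif_pos hW]
  have h1 := hW.choose_spec
  have h2 := isInfComp_comp H
  generalize hW.choose = W at h1
  change M.Src (Star 3) →ₗ[K] M.VNabla 3 at W
  refine TensorProduct.ext' fun v f => ?_
  obtain ⟨j, g, rfl⟩ := rep3 f
  have hc : ∀ k l, Star 2 k l → Star 3 (Fin.castAdd 1 k) (Fin.castAdd 1 l) :=
    fun _ _ h => (Fin.castAdd_injective 2 1).ne h
  induction v using PiTensorProduct.induction_on with
  | add x y hx hy => rw [TensorProduct.add_tmul, map_add, hx, hy, map_add]
  | smul_tprod r t =>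
    rw [← TensorProduct.smul_tmul', map_smul, map_smul]
    congr 1
    have hm : (OT.u 0 1 s01 ^ j : OT K N (Star 2)) ∈
        Submonoid.closure {f : OT K N (Star 2) | ∃ k l h, f = OT.u k l h} :=
      Submonoid.pow_mem _ (Submonoid.subset_closure (by exact ⟨0, 1, s01, rfl⟩)) j
    have e1 := h1 ![t 0, t 1] ![t 2] g _ hm
    have e2 := h2 ![t 0, t 1] ![t 2] g _ hm
    have e3 : (Fin.append ![t 0, t 1] ![t 2] : Fin (1 + 1 + 1) → V) = t := by
      funext i
      fin_cases i <;> rfl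
    rw [e3] at e1 e2
    rw [← map_castAdd hc j]
    exact e1.trans e2.symm

end Bridge

end HKMod

end

section
namespace OT

variable {K : Type*} [Field K] {N n m p : ℕ} {E : Fin n → Fin n → Prop}
  {E' : Fin m → Fin m → Prop} {E'' : Fin p → Fin p → Prop}

theorem map_map (c : Fin n → Fin m) (hc : ∀ k l, E k l → E' (c k) (c l)) (d : Fin m → Fin p)
    (hd : ∀ k l, E' k l → E'' (d k) (d l)) (e : Fin n → Fin p)
    (he : ∀ k l, E k l → E'' (e k) (e l)) (h : ∀ k, d (c k) = e k) (f : OT K N E) :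
    map d hd (map c hc f) = map e he f := by
  obtain rfl : e = fun k => d (c k) := (funext h).symm
  induction f using OT.induction with
  | h0 r => rw [AlgHom.commutes, AlgHom.commutes, AlgHom.commutes]
  | hz k l => rw [map_zz, map_zz, map_zz]
  | ht k l i => rw [map_zetaz, map_zetaz, map_zetaz]
  | hu k l h => rw [map_u, map_u, map_u]
  | hm a b ha hb => rw [map_mul, map_mul, map_mul, ha, hb]
  | ha a b ha hb => rw [map_add, map_add, map_add, ha, hb]

theorem map_id (h : ∀ k l, E k l → E k l) (f : OT K N E) : map id h f = f := by
  induction f using OT.induction with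
  | h0 r => rw [AlgHom.commutes]
  | hz k l => rw [map_zz]; rfl
  | ht k l i => rw [map_zetaz]; rfl
  | hu k l h => rw [map_u]; rfl
  | hm a b ha hb => rw [map_mul, ha, hb]
  | ha a b ha hb => rw [map_add, ha, hb]

end OT

namespace HKMod

variable {K : Type*} [Field K] [CharZero K] {n m N : ℕ} {V : Type*} [AddCommGroup V] [Module K V]
variable {M : HKMod K N V}

section Box
variable {X : M.Src (Star 2) →ₗ[K] M.VNabla 2}

theorem koszul_cube (v : Tens K V 3) :
    M.koszulPerm rot (M.koszulPerm rot (M.koszulPerm rot v)) = v := by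
  suffices M.koszulPerm rot ∘ₗ M.koszulPerm rot ∘ₗ M.koszulPerm rot = LinearMap.id from
    congrArg (fun φ : Tens K V 3 →ₗ[K] Tens K V 3 => φ v) this
  refine M.hext3 fun p q r a ha b hb c hc => ?_
  simp only [LinearMap.comp_apply, LinearMap.id_apply]
  rw [M.koszul_rot ha hb hc, map_smul, M.koszul_rot hb hc ha, map_smul, map_smul,
    M.koszul_rot hc ha hb, smul_smul, smul_smul, ← sg_add, ← sg_add]
  have : ∀ p q r : ZMod 2, p * q + p * r + (q * r + q * p) + (r * p + r * q) = 0 := by decide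
  rw [this, sg_zero, one_smul]

theorem koszul_swap12_eq (v : Tens K V 3) : M.koszulPerm (Equiv.swap 1 2) v =
    M.koszulPerm (Equiv.swap 0 1) (M.koszulPerm rot (M.koszulPerm rot v)) := by
  suffices M.koszulPerm (Equiv.swap 1 2) =
      M.koszulPerm (Equiv.swap 0 1) ∘ₗ M.koszulPerm rot ∘ₗ M.koszulPerm rot from
    congrArg (fun φ : Tens K V 3 →ₗ[K] Tens K V 3 => φ v) this
  refine M.hext3 fun p q r a ha b hb c hc => ?_
  simp only [LinearMap.comp_apply]
  rw [M.koszul_rot ha hb hc, map_smul, M.koszul_rot hb hc ha, map_smul, map_smul,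
    M.koszul_swap01 hc ha hb, M.koszul_swap12 ha hb hc, smul_smul, smul_smul, ← sg_add, ← sg_add]
  have : ∀ p q r : ZMod 2, p * q + p * r + (q * r + q * p) + r * p = q * r := by decide
  rw [this]

theorem koszul_one3 (v : Tens K V 3) : M.koszulPerm (1 : Equiv.Perm (Fin 3)) v = v := by
  suffices M.koszulPerm (1 : Equiv.Perm (Fin 3)) = LinearMap.id from
    congrArg (fun φ : Tens K V 3 →ₗ[K] Tens K V 3 => φ v) this
  refine M.hext3 fun p q r a ha b hb c hc => ?_
  rw [t3, M.koszulPerm_tprod 1 ![p, q, r] _ fun k => ?_]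
  · rw [Finset.prod_eq_one fun x _ => ?_, one_smul]
    · rfl
    · rw [if_neg]
      rintro ⟨h1, h2⟩
      exact lt_asymm h1 h2
  · fin_cases k <;> assumption

theorem symAct_one3 (W : M.Src (Star 3) →ₗ[K] M.VNabla 3) : M.symAct 1 W = W := by
  refine TensorProduct.ext' fun v f => ?_
  rw [symAct_tmul, koszul_one3]
  have e1 : OT.map (1 : Equiv.Perm (Fin 3)) (star_perm 1) f = f := OT.map_id _ f
  rw [e1]
  exact M.fibQ_id _

theorem symAct_cube (W : M.Src (Star 3) →ₗ[K] M.VNabla 3) :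
    M.symAct rot (M.symAct rot (M.symAct rot W)) = W := by
  refine TensorProduct.ext' fun v f => ?_
  rw [symAct_tmul, symAct_tmul, symAct_tmul, koszul_cube, fibQ_comp, fibQ_comp,
    OT.map_map _ _ _ _ (fun k => rot (rot k)) (fun k l h => star_perm _ _ _ (star_perm _ _ _ h))
      (fun _ => rfl), OT.map_map _ _ _ _ id (fun k l h => h) (by decide), OT.map_id]
  have : (rot : Fin 3 → Fin 3) ∘ rot ∘ rot = id := by decide
  rw [this, fibQ_id]

theorem symAct_swap12 (W : M.Src (Star 3) →ₗ[K] M.VNabla 3) :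
    M.symAct (Equiv.swap 1 2) W = M.symAct rot (M.symAct rot (M.symAct (Equiv.swap 0 1) W)) := by
  refine TensorProduct.ext' fun v f => ?_
  rw [symAct_tmul, symAct_tmul, symAct_tmul, symAct_tmul, ← koszul_swap12_eq, fibQ_comp, fibQ_comp,
    OT.map_map _ _ _ _ (fun k => rot (rot k)) (fun k l h => star_perm _ _ _ (star_perm _ _ _ h))
      (fun _ => rfl), OT.map_map _ _ _ _ (Equiv.swap 1 2) (star_perm _) (by decide)]
  have : (Equiv.swap 0 1 : Fin 3 → Fin 3) ∘ rot ∘ rot = Equiv.swap 1 2 := by decide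
  rw [this]

theorem box_eq (H : M.OpS (-1 : K) X) : M.box (n := 1) (m := 1) 1 X X =
    comp H + M.symAct rot (comp H) + M.symAct (Equiv.swap 1 2) (comp H) := by
  have e : (Finset.univ.filter fun σ : Equiv.Perm (Fin (1 + 1 + 1)) =>
      (∀ k l : Fin (1 + 1), k < l → σ (Fin.castAdd 1 k) < σ (Fin.castAdd 1 l)) ∧
      (∀ k l : Fin 1, k < l → σ (Fin.natAdd (1 + 1) k) < σ (Fin.natAdd (1 + 1) l))) =
      {1, rot⁻¹, Equiv.swap 1 2} := by decide +kernel
  rw [box, e, Finset.sum_insert (by decide +kernel), Finset.sum_insert (by decide +kernel),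
    Finset.sum_singleton, infComp_eq H, inv_one, inv_inv, Equiv.swap_inv, ← add_assoc]
  congr 2
  exact symAct_one3 _

theorem Th_swap (H : M.OpS (-1 : K) X) (c : V) (y : M.VNabla 2)
    (hs : ∀ k l, A3 k l → A3 (Equiv.swap 0 1 k) (Equiv.swap 0 1 l)) (g : OT K N A3) :
    M.fibQ (Equiv.swap 0 1) (Th H c (M.fibQ (Equiv.swap 0 1) y) (OT.map (Equiv.swap 0 1) hs g)) =
      Th H c y g := by
  have hc : ∀ k : Fin 3, c3 (Equiv.swap 0 1 k) = c3 k := by decide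
  have hk : ∀ k : Fin 2, (Finset.univ.filter fun l : Fin 2 => Equiv.swap 0 1 l = k) =
      {Equiv.swap 0 1 k} := by decide
  have hk' : ∀ k : Fin 3, (Finset.univ.filter fun l : Fin 3 => Equiv.swap 0 1 l = k) =
      {Equiv.swap 0 1 k} := by decide
  have hks : ∀ k : Fin 2, Equiv.swap 0 1 (Equiv.swap 0 1 k).castSucc = (k.castSucc : Fin 3) := by
    decide
  induction y using vn_induction_Pq generalizing c g with
  | h1 x =>
    rw [fibQ_iv, Th_iv, Th_iv, fibQ_comp, OT.map_map _ _ _ _ c3 A3_c3 hc]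
    rw [show c3 ∘ (Equiv.swap 0 1 : Fin 3 → Fin 3) = c3 from funext hc]
  | ha x y hx hy => simp only [map_add, LinearMap.add_apply, hx, hy]
  | hs r x hx => simp only [map_smul, LinearMap.smul_apply, hx]
  | hl k x hx =>
    rw [fibQ_lam, hk, Finset.sum_singleton, Th_lam, Th_lam, map_sub, fibQ_lam, hk',
      Finset.sum_singleton, hx, hks, OT.dz_map, hk', Finset.sum_singleton, hks, hx]
  | ht k i x hx hx' =>
    rw [fibQ_theta, hk, Finset.sum_singleton, Th_theta, Th_theta, map_sub, map_neg, fibQ_theta, hk',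
      Finset.sum_singleton, hx, hks, OT.dzeta_map, hk', Finset.sum_singleton, hks, Pq_fibQ, hx']

theorem src_ext3 {E : Fin 3 → Fin 3 → Prop} {W : Type*} [AddCommGroup W] [Module K W]
    {A B : M.Src E →ₗ[K] W} (h : ∀ p q r, ∀ a ∈ M.gr p, ∀ b ∈ M.gr q, ∀ c ∈ M.gr r, ∀ f,
      A (t3 K a b c ⊗ₜ[K] f) = B (t3 K a b c ⊗ₜ[K] f)) : A = B := by
  refine TensorProduct.ext ?_
  refine M.hext3 fun p q r a ha b hb c hc => ?_
  exact LinearMap.ext fun f => h p q r a ha b hb c hc f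

theorem comp_swap (H : M.OpS (-1 : K) X) (hX : M.symAct (Equiv.swap 0 1) X = X) :
    M.symAct (Equiv.swap 0 1) (comp H) = comp H := by
  refine src_ext3 fun p q r a ha b hb c hc f => ?_
  obtain ⟨j, g, rfl⟩ := rep3 f
  have hc3 : ∀ k : Fin 3, c3 (Equiv.swap 0 1 k) = c3 k := by decide
  have hs : ∀ k l, A3 k l → A3 (Equiv.swap 0 1 k) (Equiv.swap 0 1 l) := by
    intro k l h
    change c3 _ ≠ c3 _
    rw [hc3, hc3]
    exact h
  have e1 : OT.map (Equiv.swap 0 1) (star_perm _)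
      (OT.u 0 1 s301 ^ j : OT K N (Star 3)) = (-1 : K) ^ j • OT.u 0 1 s301 ^ j := by
    rw [map_pow, OT.map_u, ← smul_pow]
    congr 1
    rw [neg_one_smul]
    exact OT.u_swap _ _ _ _
  have e2 : OT.map (Equiv.swap 0 1) (star_perm _)
      (OT.u 0 1 s01 ^ j : OT K N (Star 2)) = (-1 : K) ^ j • OT.u 0 1 s01 ^ j := by
    rw [map_pow, OT.map_u, ← smul_pow]
    congr 1
    rw [neg_one_smul]
    exact OT.u_swap _ _ _ _
  have e3 : OT.map (E' := Star 3) (Equiv.swap 0 1) (star_perm _)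
      (OT.map id A3_star g : OT K N (Star 3)) =
      OT.map id A3_star (OT.map (E' := A3) (Equiv.swap 0 1) hs g) := by
    rw [OT.map_map id _ _ _ (Equiv.swap 0 1) (fun k l h => A3_star _ _ (hs k l h))
        (fun _ => by rfl),
      OT.map_map _ _ id _ (Equiv.swap 0 1) (fun k l h => A3_star _ _ (hs k l h)) (fun _ => by rfl)]
  have e4 : M.fibQ (Equiv.swap 0 1) (X (t2 K a b ⊗ₜ[K] (OT.u 0 1 s01 ^ j))) =
      (sg K (p * q) * (-1) ^ j) • X (t2 K b a ⊗ₜ[K] (OT.u 0 1 s01 ^ j)) := by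
    have := congrArg (fun Y : M.Src (Star 2) →ₗ[K] M.VNabla 2 =>
      M.fibQ (Equiv.swap 0 1) (Y (t2 K a b ⊗ₜ[K] (OT.u 0 1 s01 ^ j)))) hX
    simp only [symAct_tmul] at this
    rw [← this, fibQ_comp, M.koszul_swap ha hb, e2, ← TensorProduct.smul_tmul',
      TensorProduct.tmul_smul, smul_smul, map_smul, map_smul,
      show (Equiv.swap 0 1 : Fin 2 → Fin 2) ∘ Equiv.swap 0 1 = id by decide, fibQ_id]
  rw [symAct_tmul, M.koszul_swap01 ha hb hc, map_mul, e1, e3, mul_smul_comm,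
    ← TensorProduct.smul_tmul', TensorProduct.tmul_smul, smul_smul, map_smul, ← ins_t2, ← ins_t2,
    comp_apply, comp_apply, ← Th_swap H c _ hs g, e4, map_smul, map_smul, LinearMap.smul_apply,
    map_smul]

theorem comp_rot_rot (H : M.OpS (-1 : K) X) (hX : M.symAct (Equiv.swap 0 1) X = X) :
    M.symAct (Equiv.swap 1 2) (comp H) = M.symAct rot (M.symAct rot (comp H)) := by
  rw [symAct_swap12, comp_swap H hX]

theorem symAct_add (σ : Equiv.Perm (Fin n)) (X Y : M.Src (Star n) →ₗ[K] M.VNabla n) :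
    M.symAct σ (X + Y) = M.symAct σ X + M.symAct σ Y := by
  refine TensorProduct.ext' fun v f => ?_
  rw [symAct_tmul, LinearMap.add_apply, LinearMap.add_apply, map_add, symAct_tmul, symAct_tmul]

theorem box_rot (H : M.OpS (-1 : K) X) (hX : M.symAct (Equiv.swap 0 1) X = X) :
    M.symAct rot (M.box (n := 1) (m := 1) 1 X X) = M.box (n := 1) (m := 1) 1 X X := by
  rw [box_eq H, comp_rot_rot H hX, symAct_add, symAct_add, symAct_cube]
  abel

theorem box_opS (H : M.OpS (-1 : K) X) (hX : M.symAct (Equiv.swap 0 1) X = X) :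
    M.OpS 1 (M.box (n := 1) (m := 1) 1 X X : M.Src (Star 3) →ₗ[K] M.VNabla 3) := by
  rw [box_eq H, comp_rot_rot H hX]
  have h := comp_opS H
  have h1 := h.symAct M.koszulCompat_rot
  exact (h.add h1).add (h1.symAct M.koszulCompat_rot)

end Box

end HKMod

namespace OT

variable {K : Type*} [Field K] {N n m : ℕ} {E : Fin n → Fin n → Prop}
  {E' : Fin m → Fin m → Prop}

/-- The product of `ζ_{k,l}^i` over a list of `i`. -/
def zl (k l : Fin n) (L : List (Fin N)) : OT K N E := (L.map (zetaz k l)).prod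

theorem zl_nil (k l : Fin n) : (zl k l [] : OT K N E) = 1 := rfl

theorem zl_cons (k l : Fin n) (i : Fin N) (L : List (Fin N)) :
    (zl k l (i :: L) : OT K N E) = zetaz k l i * zl k l L := by
  rw [zl, zl, List.map_cons, List.prod_cons]

theorem map_zl (c : Fin n → Fin m) (hc : ∀ k l, E k l → E' (c k) (c l)) (k l : Fin n)
    (L : List (Fin N)) : map c hc (zl k l L : OT K N E) = zl (c k) (c l) L := by
  induction L with
  | nil => rw [zl_nil, zl_nil, map_one]
  | cons i L ih => rw [zl_cons, zl_cons, map_mul, ih, map_zetaz]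

theorem inv_zl (k l : Fin n) (L : List (Fin N)) :
    inv (zl k l L : OT K N E) = (-1 : K) ^ L.length • zl k l L := by
  induction L with
  | nil => rw [zl_nil, map_one, List.length_nil, pow_zero, one_smul]
  | cons i L ih =>
    rw [zl_cons, map_mul, ih, inv_zetaz, List.length_cons, pow_succ', mul_smul_comm, neg_mul,
      mul_smul, neg_one_smul, smul_neg]

theorem zetaz_mul_zl [CharZero K] (k l : Fin n) (i : Fin N) (L : List (Fin N)) (h : i ∈ L) :
    (zetaz k l i * zl k l L : OT K N E) = 0 := by
  induction L with
  | nil => cases h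
  | cons j L ih =>
    rw [zl_cons, ← mul_assoc]
    rcases List.mem_cons.1 h with rfl | h
    · rw [zetaz_sq, zero_mul]
    · rw [zetaz_anti, neg_mul, mul_assoc, ih h, mul_zero, neg_zero]

end OT

namespace HKMod

variable {K : Type*} [Field K] [CharZero K] {n m N : ℕ} {V : Type*} [AddCommGroup V] [Module K V]
variable {M : HKMod K N V} {X : M.Src (Star 2) →ₗ[K] M.VNabla 2}

theorem comp_zl (H : M.OpS (-1 : K) X) (L : List (Fin N)) (c : V) (w : Tens K V 2) (j : ℕ)
    (f : OT K N A3) :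
    comp H (ins c w ⊗ₜ[K] (OT.zl 0 1 L * (OT.map id A3_star f * OT.u 0 1 s301 ^ j) :
        OT K N (Star 3))) =
      Th H ((M.eps ^ L.length) c) (X (w ⊗ₜ[K] (OT.zl 0 1 L * OT.u 0 1 s01 ^ j))) f := by
  induction L generalizing c w with
  | nil =>
    rw [OT.zl_nil, OT.zl_nil, one_mul, one_mul, comp_apply]
    rfl
  | cons i L ih =>
    have h1 : ∀ c y g, M.Ztq 0 1 i (Th H c y g) = -Th H c (M.Ztq 0 1 i y) g := by
      intro c y g
      rw [Th_Ztq01, Th_zetaz, eps_eps, Pq_Pq, neg_neg]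
    rw [OT.zl_cons, OT.zl_cons, mul_assoc, mul_assoc, (comp_opS H).zetaz, one_smul, epsT_ins, ih,
      h1, H.zetaz, neg_one_smul, map_neg, LinearMap.neg_apply, List.length_cons, pow_succ,
      Module.End.mul_apply]

end HKMod

end

section
namespace OT

variable {K : Type*} [Field K] {N n : ℕ} {E : Fin n → Fin n → Prop}

theorem eq_top_of_monomials (S : Submodule K (OT K N E))
    (hz : ∀ k l, ∀ f ∈ S, zz k l * f ∈ S) (ht : ∀ k l i, ∀ f ∈ S, zetaz k l i * f ∈ S)
    (G : Set (OT K N E)) (h1 : 1 ∈ G)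
    (hu : ∀ k l h, ∀ m ∈ G, ∃ r : K, ∃ m' ∈ G, u k l h * m = r • m') (hG : ∀ m ∈ G, m ∈ S) (f) :
    f ∈ S := by
  suffices ∀ g h : OT K N E, (∀ m ∈ G, h * m ∈ S) → ∀ m ∈ G, g * h * m ∈ S by
    have := this f 1 (fun m hm => by rw [one_mul]; exact hG m hm) 1 h1
    rwa [mul_one, mul_one] at this
  intro g
  induction g using OT.induction with
  | h0 r =>
    intro h hh m hm
    rw [Algebra.algebraMap_eq_smul_one, smul_mul_assoc, one_mul, smul_mul_assoc]
    exact S.smul_mem r (hh m hm)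
  | hz k l => intro h hh m hm; rw [mul_assoc]; exact hz k l _ (hh m hm)
  | ht k l i => intro h hh m hm; rw [mul_assoc]; exact ht k l i _ (hh m hm)
  | hu k l h' =>
    intro h hh m hm
    obtain ⟨r, m', hm', e⟩ := hu k l h' m hm
    rw [u_comm, mul_assoc, e, mul_smul_comm]
    exact S.smul_mem r (hh m' hm')
  | hm a b ha hb =>
    intro h hh m hm
    rw [mul_assoc a b h]
    exact ha (b * h) (hb h hh) m hm
  | ha a b ha hb =>
    intro h hh m hm
    rw [add_mul, add_mul]
    exact S.add_mem (ha h hh m hm) (hb h hh m hm)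

theorem dz_zl_mul (j k l : Fin n) (L : List (Fin N)) (f : OT K N E) :
    dz j (zl k l L * f) = zl k l L * dz j f := by
  induction L generalizing f with
  | nil => rw [zl_nil, one_mul, one_mul]
  | cons i L ih => rw [zl_cons, mul_assoc, dz_zetaz_mul, ih, mul_assoc]

theorem dzeta_zl_mul (j k l : Fin n) (i : Fin N) (L : List (Fin N))
    (hL : ∀ i' ∈ L, KPoly.dl K i' i * (KPoly.dl K k j - KPoly.dl K l j) = 0) (f : OT K N E) :
    dzeta j i (zl k l L * f) = (-1 : K) ^ L.length • (zl k l L * dzeta j i f) := by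
  induction L generalizing f with
  | nil => rw [zl_nil, one_mul, one_mul, List.length_nil, pow_zero, one_smul]
  | cons i' L ih =>
    rw [zl_cons, mul_assoc, dzeta_zetaz_mul, hL i' List.mem_cons_self, zero_smul, zero_sub,
      ih fun i' h => hL i' (List.mem_cons_of_mem _ h), mul_smul_comm, List.length_cons, pow_succ',
      mul_smul, neg_one_smul, mul_assoc]

theorem zl_mul_zetaz (k l k' l' : Fin n) (i : Fin N) (L : List (Fin N)) (f : OT K N E) :
    zl k l L * (zetaz k' l' i * f) = (-1 : K) ^ L.length • (zetaz k' l' i * (zl k l L * f)) := by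
  induction L generalizing f with
  | nil => rw [zl_nil, one_mul, one_mul, List.length_nil, pow_zero, one_smul]
  | cons j L ih =>
    rw [zl_cons, mul_assoc, ih, mul_smul_comm, ← mul_assoc, zetaz_anti, List.length_cons, pow_succ',
      mul_smul, neg_one_smul, neg_mul, smul_neg, mul_assoc, mul_assoc]

theorem mem_of_zl_mul (S : Submodule K (OT K N E)) (j k l : Fin n)
    (hjk : KPoly.dl K k j - KPoly.dl K l j ≠ 0)
    (hD : ∀ i, ∀ f ∈ S, dzeta j i f ∈ S) (L : List (Fin N)) (hL : L.Nodup)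
    (h : ∀ f, zl k l L * f ∈ S) (f) : f ∈ S := by
  induction L generalizing f with
  | nil => simpa [zl_nil] using h f
  | cons i L ih =>
    have hi := List.nodup_cons.1 hL
    refine ih hi.2 (fun f => ?_) f
    have h1 := hD i _ (h f)
    rw [zl_cons, mul_assoc, dzeta_zetaz_mul, dzeta_zl_mul _ _ _ _ _ fun i' h' => ?_] at h1
    · have h2 := h (dzeta j i f)
      rw [zl_cons, mul_assoc] at h2
      rw [mul_smul_comm] at h1
      have h3 := S.add_mem h1 (S.smul_mem ((-1 : K) ^ L.length) h2)
      rw [sub_add_cancel, KPoly.dl, if_pos rfl, one_mul] at h3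
      exact (S.smul_mem_iff hjk).1 h3
    · have : i' ≠ i := fun e => hi.1 (e ▸ h')
      rw [KPoly.dl, if_neg this, zero_mul]

/-- The product of all `ζ_{k,l}^i`. -/
def zt (k l : Fin n) : OT K N E := zl k l (List.finRange N)

theorem zt_mul_zetaz [CharZero K] (k l : Fin n) (i : Fin N) (f : OT K N E) :
    zt k l * (zetaz k l i * f) = 0 := by
  rw [zt, zl_mul_zetaz, ← mul_assoc, zetaz_mul_zl _ _ _ _ (List.mem_finRange i), zero_mul, smul_zero]

theorem zl_zz (k l k' l' : Fin n) (L : List (Fin N)) (f : OT K N E) :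
    zl k l L * (zz k' l' * f) = zz k' l' * (zl k l L * f) := by
  rw [← mul_assoc, ← zz_comm, mul_assoc]

theorem eq_top_two [CharZero K] (S : Submodule K (OT K N (Star 2)))
    (hz : ∀ k l, ∀ f ∈ S, zz k l * f ∈ S) (ht : ∀ k l i, ∀ f ∈ S, zetaz k l i * f ∈ S)
    (hd : ∀ k, ∀ f ∈ S, dz k f ∈ S) (hD : ∀ k i, ∀ f ∈ S, dzeta k i f ∈ S)
    (h : zt 0 1 * u 0 1 HKMod.s01 ∈ S) (f) : f ∈ S := by
  refine mem_of_zl_mul S 0 0 1 (by simp [KPoly.dl]) (hD 0) (List.finRange N)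
    (List.nodup_finRange N) (fun f => ?_) f
  let S' : Submodule K (OT K N (Star 2)) := S.comap (LinearMap.mulLeft K (zt 0 1))
  have hm : ∀ f, f ∈ S' ↔ zt 0 1 * f ∈ S := fun f => Iff.rfl
  have h0 : ∀ j, u 0 1 HKMod.s01 ^ (j + 1) ∈ S' := by
    intro j
    induction j with
    | zero => rw [zero_add, pow_one]; exact h
    | succ j ih =>
      have := hd 0 _ ih
      rw [LinearMap.mulLeft_apply, zt, dz_zl_mul, dz_u_pow, mul_smul_comm] at this
      refine (S.smul_mem_iff ?_).1 this
      refine mul_ne_zero (by exact_mod_cast j.succ_ne_zero) (by simp [KPoly.dl])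
  refine eq_top_of_monomials S' ?_ ?_ {f | ∃ j : ℕ, f = u 0 1 HKMod.s01 ^ j} ⟨0, by rw [pow_zero]⟩
    ?_ ?_ f
  · intro k l f hf
    rw [hm] at hf ⊢
    rw [zt, zl_zz]
    exact hz k l _ hf
  · intro k l i f hf
    rw [hm] at hf ⊢
    rw [zt, zl_mul_zetaz]
    exact S.smul_mem _ (ht k l i _ hf)
  · rintro k l h _ ⟨j, rfl⟩
    rcases HKMod.fin2_cases k with rfl | rfl <;> rcases HKMod.fin2_cases l with rfl | rfl
    · exact absurd rfl h
    · exact ⟨1, _, ⟨j + 1, rfl⟩, by rw [one_smul, pow_succ']⟩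
    · exact ⟨-1, _, ⟨j + 1, rfl⟩, by
        rw [u_swap 0 1 HKMod.s01 h, neg_one_smul, pow_succ', neg_mul]⟩
    · exact absurd rfl h
  · rintro _ ⟨j, rfl⟩
    cases j with
    | zero =>
      have := hz 0 1 _ (h0 0)
      rw [hm, pow_zero]
      rwa [LinearMap.mulLeft_apply, zt, ← zl_zz, zero_add, pow_one, zz_u] at this
    | succ j => exact h0 j

theorem s302 : Star 3 0 2 := HKMod.s3 (by decide)
theorem s312 : Star 3 1 2 := HKMod.s3 (by decide)

theorem inv_u_pow (k l : Fin n) (h : E k l) (j : ℕ) : inv (u k l h ^ j : OT K N E) = u k l h ^ j := by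
  rw [map_pow, inv_u]

theorem zz_u_pow (k l : Fin n) (h : E k l) (j : ℕ) :
    (zz k l * u k l h ^ (j + 1) : OT K N E) = u k l h ^ j := by
  rw [pow_succ', ← mul_assoc, zz_u, one_mul]

/-- The monomials in the inverses of `z_{k,l}` for three variables. -/
def um (i j k : ℕ) : OT K N (Star 3) :=
  u 0 1 HKMod.s301 ^ i * (u 0 2 s302 ^ j * u 1 2 s312 ^ k)

theorem zz01_um (i j k : ℕ) : (zz 0 1 * um (i + 1) j k : OT K N (Star 3)) = um i j k := by
  rw [um, ← mul_assoc, zz_u_pow, um]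

theorem zz02_um (i j k : ℕ) : (zz 0 2 * um i (j + 1) k : OT K N (Star 3)) = um i j k := by
  rw [um, ← mul_assoc, zz_comm, mul_assoc, ← mul_assoc (zz 0 2), zz_u_pow, um]

theorem zz12_um (i j k : ℕ) : (zz 1 2 * um i j (k + 1) : OT K N (Star 3)) = um i j k := by
  rw [um, ← mul_assoc, zz_comm, mul_assoc, ← mul_assoc (zz 1 2), zz_comm, mul_assoc, zz_u_pow, um]

theorem dz1_um (i j : ℕ) : dz 1 (um i j 0 : OT K N (Star 3)) = (i : K) • um (i + 1) j 0 := by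
  rw [um, dz_mul, pow_zero, mul_one, dz_u_pow, dz_u_pow, um]
  simp [KPoly.dl]

theorem dz2_um (i j : ℕ) : dz 2 (um i j 0 : OT K N (Star 3)) = (j : K) • um i (j + 1) 0 := by
  rw [um, dz_mul, pow_zero, mul_one, dz_u_pow, dz_u_pow, um]
  simp [KPoly.dl]

theorem dz0_um (i k : ℕ) : dz 0 (um i 0 k : OT K N (Star 3)) = (-i : K) • um (i + 1) 0 k := by
  rw [um, dz_mul, pow_zero, one_mul, dz_u_pow, dz_u_pow, um]
  simp [KPoly.dl]

theorem dz2_um' (i k : ℕ) : dz 2 (um i 0 k : OT K N (Star 3)) = (k : K) • um i 0 (k + 1) := by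
  rw [um, dz_mul, pow_zero, one_mul, dz_u_pow, dz_u_pow, um]
  simp [KPoly.dl]

theorem dz0_um' (j k : ℕ) : dz 0 (um 0 j k : OT K N (Star 3)) = (-j : K) • um 0 (j + 1) k := by
  rw [um, pow_zero, one_mul, dz_mul, dz_u_pow, dz_u_pow, um]
  simp [KPoly.dl]

theorem dz1_um' (j k : ℕ) : dz 1 (um 0 j k : OT K N (Star 3)) = (-k : K) • um 0 j (k + 1) := by
  rw [um, pow_zero, one_mul, dz_mul, dz_u_pow, dz_u_pow, um]
  simp [KPoly.dl]

theorem two_poles [CharZero K] (S : Submodule K (OT K N (Star 3))) (m : ℕ → ℕ → OT K N (Star 3))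
    (z z' D D' : OT K N (Star 3) → OT K N (Star 3)) (hz : ∀ f ∈ S, z f ∈ S)
    (hz' : ∀ f ∈ S, z' f ∈ S) (hD : ∀ f ∈ S, D f ∈ S) (hD' : ∀ f ∈ S, D' f ∈ S) (s s' : K)
    (hs : s ≠ 0) (hs' : s' ≠ 0) (h1 : ∀ i j, z (m (i + 1) j) = m i j)
    (h2 : ∀ i j, z' (m i (j + 1)) = m i j) (h3 : ∀ i j, D (m i j) = (s * i : K) • m (i + 1) j)
    (h4 : ∀ i j, D' (m i j) = (s' * j : K) • m i (j + 1)) (h : m 1 1 ∈ S) (i j : ℕ) : m i j ∈ S := by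
  have e1 : ∀ i, m (i + 1) 1 ∈ S := by
    intro i
    induction i with
    | zero => exact h
    | succ i ih =>
      have := hD _ ih
      rw [h3] at this
      refine (S.smul_mem_iff (mul_ne_zero hs ?_)).1 this
      exact_mod_cast i.succ_ne_zero
  have e2 : ∀ i j, m (i + 1) (j + 1) ∈ S := by
    intro i j
    induction j with
    | zero => exact e1 i
    | succ j ih =>
      have := hD' _ ih
      rw [h4] at this
      refine (S.smul_mem_iff (mul_ne_zero hs' ?_)).1 this
      exact_mod_cast j.succ_ne_zero
  have := hz _ (hz' _ (e2 i j))
  rwa [h2, h1] at this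

theorem um_mem [CharZero K] (S : Submodule K (OT K N (Star 3)))
    (hz : ∀ k l, ∀ f ∈ S, zz k l * f ∈ S) (hd : ∀ k, ∀ f ∈ S, dz k f ∈ S)
    (hadd : ∀ f, zz 0 1 * f ∈ S → zz 1 2 * f ∈ S → zz 0 2 * f ∈ S)
    (h1 : um 1 1 0 ∈ S) (h2 : um 1 0 1 ∈ S) (h3 : um 0 1 1 ∈ S) (i j k : ℕ) : um i j k ∈ S := by
  have e1 : ∀ i j, um i j 0 ∈ S := two_poles S (fun i j => um i j 0) _ _ _ _ (hz 0 1) (hz 0 2)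
    (hd 1) (hd 2) 1 1 one_ne_zero one_ne_zero (fun i j => zz01_um i j 0) (fun i j => zz02_um i j 0)
    (fun i j => by rw [one_mul]; exact dz1_um i j) (fun i j => by rw [one_mul]; exact dz2_um i j) h1
  have e3 : ∀ j k, um 0 j k ∈ S := two_poles S (fun j k => um 0 j k) _ _ _ _ (hz 0 2) (hz 1 2)
    (hd 0) (hd 1) (-1) (-1) (neg_ne_zero.2 one_ne_zero) (neg_ne_zero.2 one_ne_zero) (fun i j => zz02_um 0 i j)
    (fun i j => zz12_um 0 i j) (fun i j => by rw [neg_one_mul]; exact dz0_um' i j)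
    (fun i j => by rw [neg_one_mul]; exact dz1_um' i j) h3
  have e2 : ∀ i k, um i 0 k ∈ S := two_poles S (fun i k => um i 0 k) _ _ _ _ (hz 0 1) (hz 1 2)
    (hd 0) (hd 2) (-1) 1 (neg_ne_zero.2 one_ne_zero) one_ne_zero (fun i j => zz01_um i 0 j)
    (fun i j => zz12_um i 0 j) (fun i j => by rw [neg_one_mul]; exact dz0_um i j)
    (fun i j => by rw [one_mul]; exact dz2_um' i j) h2
  suffices ∀ d i j k, i + k = d → um i j k ∈ S from this _ i j k rfl
  intro d
  induction d with
  | zero =>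
    intro i j k h
    obtain ⟨rfl, rfl⟩ : i = 0 ∧ k = 0 := by omega
    exact e1 0 j
  | succ d ih =>
    intro i j k h
    rcases i with _ | i
    · exact e3 j k
    rcases k with _ | k
    · exact e1 _ j
    rw [← zz02_um]
    refine hadd _ ?_ ?_
    · rw [zz01_um]; exact ih _ _ _ (by omega)
    · rw [zz12_um]; exact ih _ _ _ (by omega)

theorem eq_top_three [CharZero K] (S : Submodule K (OT K N (Star 3)))
    (hz : ∀ k l, ∀ f ∈ S, zz k l * f ∈ S) (ht : ∀ k l i, ∀ f ∈ S, zetaz k l i * f ∈ S)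
    (hd : ∀ k, ∀ f ∈ S, dz k f ∈ S) (hD : ∀ k i, ∀ f ∈ S, dzeta k i f ∈ S)
    (h1 : zt 1 2 * (zt 0 1 * um 1 1 0) ∈ S) (h2 : zt 1 2 * (zt 0 1 * um 1 0 1) ∈ S)
    (h3 : zt 1 2 * (zt 0 1 * um 0 1 1) ∈ S) (f) : f ∈ S := by
  refine mem_of_zl_mul S 1 1 2 (by simp [KPoly.dl]) (hD 1) (List.finRange N)
    (List.nodup_finRange N) (fun f => ?_) f
  refine mem_of_zl_mul (S.comap (LinearMap.mulLeft K (zt 1 2))) 0 0 1 (by simp [KPoly.dl])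
    (fun i f hf => ?_) (List.finRange N) (List.nodup_finRange N) (fun f => ?_) f
  · have := hD 0 i _ hf
    rw [LinearMap.mulLeft_apply, zt, dzeta_zl_mul _ _ _ _ _ (by simp [KPoly.dl])] at this
    exact (S.smul_mem_iff (pow_ne_zero _ (neg_ne_zero.2 one_ne_zero))).1 this
  let S' : Submodule K (OT K N (Star 3)) := (S.comap (LinearMap.mulLeft K (zt 1 2))).comap
    (LinearMap.mulLeft K (zt 0 1))
  have hm : ∀ f, f ∈ S' ↔ zt 1 2 * (zt 0 1 * f) ∈ S := fun f => Iff.rfl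
  have hz' : ∀ k l, ∀ f ∈ S', zz k l * f ∈ S' := by
    intro k l f hf
    rw [hm] at hf ⊢
    rw [zt, zt, zl_zz, zl_zz]
    exact hz k l _ hf
  refine eq_top_of_monomials S' hz' ?_ {f | ∃ i j k : ℕ, f = um i j k} ⟨0, 0, 0, by simp [um]⟩
    ?_ ?_ f
  · intro k l i f hf
    rw [hm] at hf ⊢
    rw [zt, zt, zl_mul_zetaz, mul_smul_comm, zl_mul_zetaz]
    exact S.smul_mem _ (S.smul_mem _ (ht k l i _ hf))
  · have c1 : ∀ i j k, u 0 1 HKMod.s301 * um i j k = (um (i + 1) j k : OT K N (Star 3)) :=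
      fun i j k => by rw [um, um, ← mul_assoc, ← pow_succ']
    have c2 : ∀ i j k, u 0 2 s302 * um i j k = (um i (j + 1) k : OT K N (Star 3)) :=
      fun i j k => by
        rw [um, um, ← mul_assoc, u_comm, mul_assoc, ← mul_assoc (u 0 2 s302), ← pow_succ']
    have c3 : ∀ i j k, u 1 2 s312 * um i j k = (um i j (k + 1) : OT K N (Star 3)) :=
      fun i j k => by
        rw [um, um, ← mul_assoc, u_comm, mul_assoc, ← mul_assoc (u 1 2 s312), u_comm, mul_assoc,
          ← pow_succ']
    rintro k l h _ ⟨i, j, m, rfl⟩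
    rcases HKMod.fin3_cases k with rfl | rfl | rfl <;> rcases HKMod.fin3_cases l with rfl | rfl | rfl
    · exact absurd rfl h
    · exact ⟨1, _, ⟨i + 1, j, m, rfl⟩, by rw [one_smul, c1]⟩
    · exact ⟨1, _, ⟨i, j + 1, m, rfl⟩, by rw [one_smul, c2]⟩
    · exact ⟨-1, _, ⟨i + 1, j, m, rfl⟩, by
        rw [u_swap 0 1 HKMod.s301 h, neg_one_smul, neg_mul, c1]⟩
    · exact absurd rfl h
    · exact ⟨1, _, ⟨i, j, m + 1, rfl⟩, by rw [one_smul, c3]⟩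
    · exact ⟨-1, _, ⟨i, j + 1, m, rfl⟩, by rw [u_swap 0 2 s302 h, neg_one_smul, neg_mul, c2]⟩
    · exact ⟨-1, _, ⟨i, j, m + 1, rfl⟩, by rw [u_swap 1 2 s312 h, neg_one_smul, neg_mul, c3]⟩
    · exact absurd rfl h
  · rintro _ ⟨i, j, k, rfl⟩
    refine um_mem S' hz' (fun k f hf => ?_) (fun f h h' => ?_) h1 h2 h3 i j k
    · rw [hm] at hf ⊢
      have := hd k _ hf
      rwa [zt, dz_zl_mul, zt, dz_zl_mul] at this
    · have e : zt 1 2 * (zt 0 1 * (zz 0 2 * f)) =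
          zt 1 2 * (zt 0 1 * (zz 0 1 * f + zz 1 2 * f)) := by
        rw [zz_add 0 1 2, sub_mul, add_mul, mul_sub (zt 0 1), Finset.sum_mul, Finset.mul_sum]
        rw [Finset.sum_eq_zero fun i _ => ?_, sub_zero]
        rw [mul_assoc, zt_mul_zetaz]
      rw [hm, e]
      exact S'.add_mem h h'

end OT

namespace HKMod

variable {K : Type*} [Field K] [CharZero K] {n m N : ℕ} {V : Type*} [AddCommGroup V] [Module K V]
variable {M : HKMod K N V}

/-- The functions `f` such that `W` vanishes on all `v ⊗ f`. -/
def killed (W : M.Src (Star n) →ₗ[K] M.VNabla n) : Submodule K (OT K N (Star n)) where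
  carrier := {f | ∀ v, W (v ⊗ₜ[K] f) = 0}
  add_mem' ha hb v := by rw [TensorProduct.tmul_add, map_add, ha v, hb v, add_zero]
  zero_mem' v := by rw [TensorProduct.tmul_zero, map_zero]
  smul_mem' r f hf v := by rw [TensorProduct.tmul_smul, map_smul, hf v, smul_zero]

section
variable {s : K} {W : M.Src (Star n) →ₗ[K] M.VNabla n}

theorem killed_zz (H : M.OpS s W) (k l : Fin n) : ∀ f ∈ killed W, OT.zz k l * f ∈ killed W :=
  fun f hf v => by rw [H.zz, hf v, map_zero]

theorem killed_zetaz (H : M.OpS s W) (k l : Fin n) (i : Fin N) :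
    ∀ f ∈ killed W, OT.zetaz k l i * f ∈ killed W :=
  fun f hf v => by rw [H.zetaz, hf, map_zero, smul_zero]

theorem killed_dz (H : M.OpS s W) (k : Fin n) : ∀ f ∈ killed W, OT.dz k f ∈ killed W :=
  fun f hf v => by
    have := H.dz k v f
    rwa [hf v, smul_zero, sub_zero, hf, eq_comm] at this

theorem killed_dzeta (H : M.OpS s W) (k : Fin n) (i : Fin N) :
    ∀ f ∈ killed W, OT.dzeta k i f ∈ killed W :=
  fun f hf v => by
    have := H.dzeta k i (M.epsT n v) f
    rwa [hf (M.SAt k i (M.epsT n v)), hf (M.epsT n v), smul_zero, smul_zero, sub_zero, epsT_epsT,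
      eq_comm] at this

end

theorem OpS.eq_zero_of_killed {W : M.Src (Star n) →ₗ[K] M.VNabla n} (h : ∀ f, f ∈ killed W) :
    W = 0 := TensorProduct.ext' fun v f => h f v

theorem OpS.eq_zero_two {s : K} {W : M.Src (Star 2) →ₗ[K] M.VNabla 2} (H : M.OpS s W)
    (h : ∀ v, W (v ⊗ₜ[K] (OT.zt 0 1 * OT.u 0 1 s01)) = 0) : W = 0 :=
  OpS.eq_zero_of_killed <| OT.eq_top_two _ (killed_zz H) (killed_zetaz H) (killed_dz H)
    (killed_dzeta H) h

theorem OpS.eq_zero_three {s : K} {W : M.Src (Star 3) →ₗ[K] M.VNabla 3} (H : M.OpS s W)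
    (h1 : ∀ v, W (v ⊗ₜ[K] (OT.zt 1 2 * (OT.zt 0 1 * OT.um 1 1 0))) = 0)
    (h2 : ∀ v, W (v ⊗ₜ[K] (OT.zt 1 2 * (OT.zt 0 1 * OT.um 1 0 1))) = 0)
    (h3 : ∀ v, W (v ⊗ₜ[K] (OT.zt 1 2 * (OT.zt 0 1 * OT.um 0 1 1))) = 0) : W = 0 :=
  OpS.eq_zero_of_killed <| OT.eq_top_three _ (killed_zz H) (killed_zetaz H) (killed_dz H)
    (killed_dzeta H) h1 h2 h3

end HKMod

end

section
/-- Operators on a vector space that satisfy the relations of `D_i`, `ζ^i`, `∂`, `z` and the parity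
operator acting on functions of two variables. -/
structure DMod (K : Type*) [Field K] (N : ℕ) (F : Type*) [AddCommGroup F] [Module K F] where
  A : Fin N → Module.End K F
  C : Fin N → Module.End K F
  B : Module.End K F
  Z : Module.End K F
  E : Module.End K F
  AA : ∀ i j x, A i (A j x) + A j (A i x) = if i = j then (-2 : K) • B x else 0
  AC : ∀ i j x, A i (C j x) + C j (A i x) = if i = j then x else 0
  CC : ∀ i j x, C i (C j x) + C j (C i x) = 0
  BZ : ∀ x, B (Z x) = Z (B x) + x
  AZ : ∀ i x, A i (Z x) = Z (A i x) - C i x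
  BA : ∀ i x, B (A i x) = A i (B x)
  BC : ∀ i x, B (C i x) = C i (B x)
  CZ : ∀ i x, C i (Z x) = Z (C i x)
  EA : ∀ i x, E (A i x) = -A i (E x)
  EC : ∀ i x, E (C i x) = -C i (E x)
  EB : ∀ x, E (B x) = B (E x)
  EZ : ∀ x, E (Z x) = Z (E x)

namespace DMod

variable {K : Type*} [Field K] [CharZero K] {N : ℕ} {F : Type*} [AddCommGroup F] [Module K F]
variable (D : DMod K N F)

/-- A subspace that is stable under the operators. -/
structure Stable (U : Submodule K F) : Prop where
  A : ∀ i, ∀ x ∈ U, D.A i x ∈ U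
  C : ∀ i, ∀ x ∈ U, D.C i x ∈ U
  B : ∀ x ∈ U, D.B x ∈ U
  Z : ∀ x ∈ U, D.Z x ∈ U

/-- No `z_{k,l}` is inverted. -/
def Bot (_ _ : Fin 2) : Prop := False

/-- The action of polynomial functions. -/
def alpha : OAlg K N Bot →ₐ[K] Module.End K F :=
  OAlg.lift ![D.Z, 0] ![D.C, 0] (fun _ _ h => h.elim)
    (fun k l => by fin_cases k <;> fin_cases l <;> simp)
    (fun k l i => by
      fin_cases k <;> fin_cases l <;> simp
      exact LinearMap.ext fun x => (D.CZ i x).symm)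
    (fun k l i j => by
      fin_cases k <;> fin_cases l <;> simp
      exact LinearMap.ext fun x => D.CC i j x)
    (fun _ _ h => h.elim) (fun _ _ h => h.elim) (fun _ _ h => h.elim) (fun _ _ h => h.elim)

theorem alpha_z0 : D.alpha (OAlg.z 0) = D.Z := by rw [alpha, OAlg.lift_z]; rfl
theorem alpha_z1 : D.alpha (OAlg.z 1) = 0 := by rw [alpha, OAlg.lift_z]; rfl
theorem alpha_zeta0 (i : Fin N) : D.alpha (OAlg.zeta 0 i) = D.C i := by
  rw [alpha, OAlg.lift_zeta]; rfl
theorem alpha_zeta1 (i : Fin N) : D.alpha (OAlg.zeta 1 i) = 0 := by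
  rw [alpha, OAlg.lift_zeta]; rfl

theorem alpha_zz : D.alpha (OAlg.zz 0 1) = D.Z := by
  rw [OAlg.zz, map_add, map_sub, map_sum, alpha_z0, alpha_z1]
  simp [alpha_zeta1]

theorem alpha_zetaz (i : Fin N) : D.alpha (OAlg.zetaz 0 1 i) = D.C i := by
  rw [OAlg.zetaz, map_sub, alpha_zeta0, alpha_zeta1, sub_zero]

theorem B_alpha (a : OAlg K N Bot) :
    D.B * D.alpha a = D.alpha (OAlg.dz 0 a) + D.alpha a * D.B := by
  let d : OAlg K N Bot →ₗ[K] Module.End K F :=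
    LinearMap.mulLeft K D.B ∘ₗ D.alpha.toLinearMap - D.alpha.toLinearMap ∘ₗ OAlg.dz 0 -
      LinearMap.mulRight K D.B ∘ₗ D.alpha.toLinearMap
  have hd : ∀ a, d a = D.B * D.alpha a - D.alpha (OAlg.dz 0 a) - D.alpha a * D.B := fun a => rfl
  have := OAlg.skew_zero D.alpha D.alpha d (fun a b => ?_) (fun k => ?_) (fun k i => ?_) a
  · rw [hd, sub_sub, sub_eq_zero] at this
    exact this
  · rw [hd, hd, hd, OAlg.dz_mul, map_mul, map_add, map_mul, map_mul]
    simp only [mul_sub, sub_mul, mul_assoc]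
    abel
  · rw [hd, OAlg.dz_z]
    rcases HKMod.fin2_cases k with rfl | rfl
    · rw [alpha_z0, if_pos rfl, map_one]
      refine LinearMap.ext fun x => ?_
      have := D.BZ x
      simp [this]
    · rw [alpha_z1]; simp
  · rw [hd, OAlg.dz_zeta]
    rcases HKMod.fin2_cases k with rfl | rfl
    · rw [alpha_zeta0]
      refine LinearMap.ext fun x => ?_
      simp [D.BC]
    · rw [alpha_zeta1]; simp

theorem A_alpha (i : Fin N) (a : OAlg K N Bot) :
    D.A i * D.alpha a = D.alpha (OAlg.dzeta 0 i a) + D.alpha (OAlg.inv a) * D.A i := by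
  let d : OAlg K N Bot →ₗ[K] Module.End K F :=
    LinearMap.mulLeft K (D.A i) ∘ₗ D.alpha.toLinearMap - D.alpha.toLinearMap ∘ₗ OAlg.dzeta 0 i -
      LinearMap.mulRight K (D.A i) ∘ₗ D.alpha.toLinearMap ∘ₗ OAlg.inv.toLinearMap
  have hd : ∀ a, d a = D.A i * D.alpha a - D.alpha (OAlg.dzeta 0 i a) -
    D.alpha (OAlg.inv a) * D.A i := fun a => rfl
  have := OAlg.skew_zero (D.alpha.comp OAlg.inv) D.alpha d (fun a b => ?_) (fun k => ?_)
    (fun k j => ?_) a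
  · rw [hd, sub_sub, sub_eq_zero] at this
    exact this
  · rw [hd, hd, hd, OAlg.dzeta_mul, map_mul, map_mul, map_add, map_mul, map_mul, map_mul]
    simp only [mul_sub, sub_mul, mul_assoc, AlgHom.comp_apply]
    abel
  · rw [hd, OAlg.dzeta_z, OAlg.inv_z]
    rcases HKMod.fin2_cases k with rfl | rfl
    · rw [alpha_z0, if_pos rfl, map_neg, alpha_zeta0]
      refine LinearMap.ext fun x => ?_
      simp [D.AZ]
    · rw [alpha_z1]; simp
  · rw [hd, OAlg.dzeta_zeta, OAlg.inv_zeta]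
    rcases HKMod.fin2_cases k with rfl | rfl
    · rw [map_neg, alpha_zeta0]
      refine LinearMap.ext fun x => ?_
      have := D.AC i j x
      by_cases h : i = j
      · subst h
        rw [if_pos rfl] at this
        simp only [if_true, true_and, and_self, map_one, LinearMap.sub_apply, neg_mul,
          LinearMap.neg_apply, Module.End.mul_apply, Module.End.one_apply, LinearMap.zero_apply,
          sub_neg_eq_add]
        rw [sub_add_eq_add_sub]
        exact sub_eq_zero.2 this
      · rw [if_neg h] at this
        simpa [Ne.symm h] using this
    · rw [map_neg, alpha_zeta1]; simp

theorem E_alpha (a : OAlg K N Bot) : D.E * D.alpha a = D.alpha (OAlg.inv a) * D.E := by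
  let d : OAlg K N Bot →ₗ[K] Module.End K F :=
    LinearMap.mulLeft K D.E ∘ₗ D.alpha.toLinearMap -
      LinearMap.mulRight K D.E ∘ₗ D.alpha.toLinearMap ∘ₗ OAlg.inv.toLinearMap
  have hd : ∀ a, d a = D.E * D.alpha a - D.alpha (OAlg.inv a) * D.E := fun a => rfl
  have := OAlg.skew_zero (D.alpha.comp OAlg.inv) D.alpha d (fun a b => ?_) (fun k => ?_)
    (fun k j => ?_) a
  · rw [hd, sub_eq_zero] at this
    exact this
  · rw [hd, hd, hd, map_mul, map_mul, map_mul]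
    simp only [mul_sub, sub_mul, mul_assoc, AlgHom.comp_apply]
    abel
  · rw [hd, OAlg.inv_z]
    rcases HKMod.fin2_cases k with rfl | rfl
    · rw [alpha_z0]
      refine LinearMap.ext fun x => ?_
      simp [D.EZ]
    · rw [alpha_z1]; simp
  · rw [hd, OAlg.inv_zeta]
    rcases HKMod.fin2_cases k with rfl | rfl
    · rw [map_neg, alpha_zeta0]
      refine LinearMap.ext fun x => ?_
      simp [D.EC]
    · rw [map_neg, alpha_zeta1]; simp

theorem alpha_mem {U : Submodule K F} (hU : D.Stable U) (a : OAlg K N Bot) :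
    ∀ x ∈ U, D.alpha a x ∈ U := by
  induction a using OAlg.induction with
  | h0 r =>
    intro x hx
    rw [AlgHom.commutes, Module.algebraMap_end_apply]
    exact U.smul_mem r hx
  | hz k =>
    intro x hx
    rcases HKMod.fin2_cases k with rfl | rfl
    · rw [alpha_z0]; exact hU.Z x hx
    · rw [alpha_z1]; exact U.zero_mem
  | ht k i =>
    intro x hx
    rcases HKMod.fin2_cases k with rfl | rfl
    · rw [alpha_zeta0]; exact hU.C i x hx
    · rw [alpha_zeta1]; exact U.zero_mem
  | hu k l h => exact h.elim
  | hm a b ha hb => intro x hx; rw [map_mul]; exact ha _ (hb x hx)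
  | ha a b ha hb => intro x hx; rw [map_add]; exact U.add_mem (ha x hx) (hb x hx)

/-- The product of the operators `C i` over a list. -/
def Cl (L : List (Fin N)) : Module.End K F := (L.map D.C).prod

theorem Cl_nil (x : F) : D.Cl [] x = x := rfl

theorem Cl_cons (i : Fin N) (L : List (Fin N)) (x : F) : D.Cl (i :: L) x = D.C i (D.Cl L x) := by
  rw [Cl, List.map_cons, List.prod_cons]; rfl

theorem A_Cl (i : Fin N) (L : List (Fin N)) (hi : i ∉ L) (x : F) :
    D.A i (D.Cl L x) = (-1 : K) ^ L.length • D.Cl L (D.A i x) := by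
  induction L with
  | nil => rw [Cl_nil, Cl_nil, List.length_nil, pow_zero, one_smul]
  | cons j L ih =>
    rw [List.mem_cons, not_or] at hi
    have := D.AC i j (D.Cl L x)
    rw [if_neg hi.1, add_eq_zero_iff_eq_neg] at this
    rw [Cl_cons, this, ih hi.2, Cl_cons, map_smul, List.length_cons, pow_succ', neg_one_mul,
      neg_smul]

theorem AA_self (i : Fin N) (x : F) : D.A i (D.A i x) = -D.B x := by
  have := D.AA i i x
  rw [if_pos rfl, ← two_smul K] at this
  have h2 : (2 : K) ≠ 0 := two_ne_zero
  refine smul_right_injective F h2 ?_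
  dsimp only
  rw [this, smul_neg, neg_smul]

theorem exists_strip {x0 : F} (hA0 : ∀ i, D.A i x0 = 0) (L : List (Fin N)) (hL : L.Nodup) (y : F)
    (h1 : ∀ j ∈ L, D.C j y = 0) (h2 : D.Z y = D.Cl L x0)
    (h3 : ∀ j, j ∉ L → D.A j y = -D.C j (D.B y)) (h4 : D.E y = (-1 : K) ^ L.length • y) :
    ∃ x, D.Cl L x = y ∧ D.Z x = x0 ∧ (∀ j, D.A j x = -D.C j (D.B x)) ∧ D.E x = x ∧
      ∀ U, D.Stable U → y ∈ U → x ∈ U := by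
  induction L generalizing y with
  | nil =>
    exact ⟨y, rfl, h2, fun j => h3 j List.not_mem_nil, by simpa using h4, fun _ _ h => h⟩
  | cons i L ih =>
    have hi := List.nodup_cons.1 hL
    have hCi : D.C i y = 0 := h1 i List.mem_cons_self
    have hCA : D.C i (D.A i y) = y := by
      have := D.AC i i y
      rwa [hCi, map_zero, zero_add, if_pos rfl] at this
    have key := ih hi.2 (D.A i y) (fun j hj => ?_) ?_ (fun j hj => ?_) ?_
    · obtain ⟨x, e1, e2, e3, e4, e5⟩ := key
      refine ⟨x, ?_, e2, e3, e4, fun U hU hy => e5 U hU (hU.A i y hy)⟩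
      rw [Cl_cons, e1, hCA]
    · have := D.AC i j y
      rwa [h1 j (List.mem_cons_of_mem _ hj), map_zero, zero_add,
        if_neg (fun e : i = j => hi.1 (e ▸ hj))] at this
    · have h5 := D.AZ i y
      have h6 := D.AC i i (D.Cl L x0)
      rw [A_Cl _ _ _ hi.1, hA0, map_zero, smul_zero, map_zero, add_zero, if_pos rfl] at h6
      rw [hCi, sub_zero, h2, Cl_cons, h6] at h5
      exact h5.symm
    · by_cases hij : j = i
      · subst hij
        rw [AA_self, D.BA]
        have := D.AC j j (D.B y)
        rw [← D.BC, hCi, map_zero, map_zero, zero_add, if_pos rfl] at this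
        rw [this]
      · have hj' : j ∉ i :: L := fun h => (List.mem_cons.1 h).elim hij hj
        have h5 := D.AA j i y
        rw [if_neg hij, add_eq_zero_iff_eq_neg, h3 j hj', map_neg, neg_neg] at h5
        have h6 := D.AC i j (D.B y)
        rw [if_neg (Ne.symm hij), add_eq_zero_iff_eq_neg] at h6
        rw [h5, h6, D.BA]
    · rw [D.EA, h4, map_smul, List.length_cons, pow_succ', neg_one_mul, neg_smul, neg_neg]

theorem exists_seq {x0 x1 : F} (h0 : D.Z x1 = x0) (hB : D.B x0 = 0) (hA : ∀ i, D.A i x0 = 0)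
    (hA1 : ∀ i, D.A i x1 = -D.C i (D.B x1)) (hE0 : D.E x0 = x0) (hE1 : D.E x1 = x1) :
    ∃ x : ℕ → F, x 0 = x0 ∧ x 1 = x1 ∧ (∀ k, D.Z (x (k + 1)) = x k) ∧
      (∀ k, D.B (x k) = -((k : K) • x (k + 1))) ∧
      (∀ k i, D.A i (x k) = (k : K) • D.C i (x (k + 1))) ∧ (∀ k, D.E (x k) = x k) ∧
      ∀ U, D.Stable U → x0 ∈ U → x1 ∈ U → ∀ k, x k ∈ U := by
  let y : ℕ → F := fun k => Nat.rec x1 (fun k z => -((k + 1 : K)⁻¹ • D.B z)) k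
  have y0 : y 0 = x1 := rfl
  have yS : ∀ k, y (k + 1) = -((k + 1 : K)⁻¹ • D.B (y k)) := fun k => rfl
  have hk : ∀ k : ℕ, (k + 1 : K) ≠ 0 := fun k => by exact_mod_cast k.succ_ne_zero
  have yB : ∀ k, D.B (y k) = -((k + 1 : K) • y (k + 1)) := fun k => by
    rw [yS, smul_neg, neg_neg, smul_inv_smul₀ (hk k)]
  let x : ℕ → F := fun k => Nat.casesOn k x0 y
  have xB : ∀ k, D.B (x k) = -((k : K) • x (k + 1)) := by
    intro k
    cases k with
    | zero => rw [Nat.cast_zero, zero_smul, neg_zero]; exact hB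
    | succ k => rw [Nat.cast_succ]; exact yB k
  have xS : ∀ k, x (k + 2) = -((k + 1 : K)⁻¹ • D.B (x (k + 1))) := fun k => rfl
  refine ⟨x, rfl, rfl, fun k => ?_, xB, fun k i => ?_, fun k => ?_, fun U hU hx0 hx1 k => ?_⟩
  · induction k with
    | zero => exact h0
    | succ k ih =>
      have := D.BZ (x (k + 1))
      rw [xS, map_neg, map_smul, ← sub_eq_iff_eq_add.2 this, ih, xB, ← neg_add', smul_neg, neg_neg]
      have e : (k : K) • x (k + 1) + x (k + 1) = (k + 1 : K) • x (k + 1) := by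
        rw [add_smul, one_smul]
      rw [e, inv_smul_smul₀ (hk k)]
  · induction k with
    | zero => rw [Nat.cast_zero, zero_smul]; exact hA i
    | succ k ih =>
      cases k with
      | zero =>
        have e : x (0 + 1 + 1) = -((0 + 1 : K)⁻¹ • D.B x1) := by
          rw [xS 0]; simp; rfl
        rw [e]
        simp
        exact hA1 i
      | succ k =>
        rw [xS k, map_neg, map_smul, ← D.BA, ih, map_smul, smul_smul, D.BC, xB (k + 1 + 1)]
        push_cast
        rw [inv_mul_cancel₀ (hk k), one_smul, map_neg, neg_neg, map_smul]
  · cases k with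
    | zero => exact hE0
    | succ k =>
      induction k with
      | zero => exact hE1
      | succ k ih => rw [xS, map_neg, map_smul, D.EB, ih]
  · cases k with
    | zero => exact hx0
    | succ k =>
      induction k with
      | zero => exact hx1
      | succ k ih => rw [xS]; exact U.neg_mem (U.smul_mem _ (hU.B _ ih))

/-- A map from functions of two variables is determined by compatible values at `1` and at
`ζ^1 ⋯ ζ^N z⁻¹`. -/
theorem exists_hom {x0 y : F} (hB : D.B x0 = 0) (hA : ∀ i, D.A i x0 = 0) (hE : D.E x0 = x0)
    (hC : ∀ i, D.C i y = 0) (hZ : D.Z y = D.Cl (List.finRange N) x0)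
    (hEy : D.E y = (-1 : K) ^ N • y) :
    ∃ Φ : OT K N (Star 2) →ₗ[K] F, Φ 1 = x0 ∧ Φ (OT.zt 0 1 * OT.u 0 1 HKMod.s01) = y ∧
      (∀ f, Φ (OT.zz 0 1 * f) = D.Z (Φ f)) ∧ (∀ i f, Φ (OT.zetaz 0 1 i * f) = D.C i (Φ f)) ∧
      (∀ f, Φ (OT.dz 0 f) = D.B (Φ f)) ∧ (∀ i f, Φ (OT.dzeta 0 i f) = D.A i (Φ f)) ∧
      (∀ f, Φ (OT.inv f) = D.E (Φ f)) ∧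
      ∀ U, D.Stable U → x0 ∈ U → y ∈ U → ∀ f, Φ f ∈ U := by
  obtain ⟨x1, a1, a2, a3, a4, a5⟩ := D.exists_strip hA (List.finRange N) (List.nodup_finRange N) y
    (fun j _ => hC j) hZ (fun j hj => absurd (List.mem_finRange j) hj)
    (by rw [List.length_finRange]; exact hEy)
  obtain ⟨x, b1, b2, b3, b4, b5, b6, b7⟩ := D.exists_seq a2 hB hA a3 hE a4
  have hb : ∀ k l, Bot k l → Star 2 k l := fun _ _ h => h.elim
  let G : ℕ → OT K N Bot →ₗ[K] F := fun j =>
    LinearMap.applyₗ (x j) ∘ₗ D.alpha.toLinearMap ∘ₗ (OAlg.tSub K N Bot).val.toLinearMap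
  have hG : ∀ j f, G j f = D.alpha f.1 (x j) := fun j f => rfl
  have hcov : ∀ k l : Fin 2, Star 2 k l → Bot k l ∨ (k = 0 ∧ l = 1) ∨ (k = 1 ∧ l = 0) := by
    intro k l h
    rcases HKMod.fin2_cases k with rfl | rfl <;> rcases HKMod.fin2_cases l with rfl | rfl
    · exact absurd rfl h
    · exact Or.inr (Or.inl ⟨rfl, rfl⟩)
    · exact Or.inr (Or.inr ⟨rfl, rfl⟩)
    · exact absurd rfl h
  obtain ⟨Φ, hΦ⟩ := OT.exists_ext hb 0 1 HKMod.s01 (fun h => h) hcov G fun j f => by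
    rw [OT.zz_comm, hG, hG]
    change D.alpha (f.1 * OAlg.zz 0 1) _ = _
    rw [map_mul, alpha_zz, Module.End.mul_apply, b3]
  have hrep := OT.exists_rep (K := K) (N := N) hb 0 1 HKMod.s01 hcov
  have hz : ∀ f, Φ (OT.zz 0 1 * f) = D.Z (Φ f) := by
    intro f
    obtain ⟨j, g, rfl⟩ := hrep f
    have e : (OT.zz 0 1 : OT K N (Star 2)) = OT.map id hb (OT.zz 0 1) := by rw [OT.map_zz]; rfl
    rw [e, ← mul_assoc, ← map_mul, hΦ, hΦ, hG, hG]
    change D.alpha (OAlg.zz 0 1 * g.1) _ = _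
    rw [map_mul, alpha_zz]; rfl
  have ht : ∀ i f, Φ (OT.zetaz 0 1 i * f) = D.C i (Φ f) := by
    intro i f
    obtain ⟨j, g, rfl⟩ := hrep f
    have e : (OT.zetaz 0 1 i : OT K N (Star 2)) = OT.map id hb (OT.zetaz 0 1 i) := by
      rw [OT.map_zetaz]; rfl
    rw [e, ← mul_assoc, ← map_mul, hΦ, hΦ, hG, hG]
    change D.alpha (OAlg.zetaz 0 1 i * g.1) _ = _
    rw [map_mul, alpha_zetaz]; rfl
  have hpow : ∀ j, Φ (OT.u 0 1 HKMod.s01 ^ j) = x j := by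
    intro j
    have := hΦ j 1
    rwa [map_one, one_mul, hG, OneMemClass.coe_one, map_one, Module.End.one_apply] at this
  have hfil : (Finset.univ.filter fun k : Fin 2 => id k = 0) = {0} := by decide
  refine ⟨Φ, ?_, ?_, hz, ht, fun f => ?_, fun i f => ?_, fun f => ?_, fun U hU hx hy f => ?_⟩
  · rw [← b1, ← hpow 0, pow_zero]
  · rw [← a1, ← b2, ← hpow 1, pow_one, OT.zt]
    generalize List.finRange N = L
    induction L with
    | nil => rw [OT.zl_nil, one_mul, Cl_nil]
    | cons i L ih => rw [OT.zl_cons, mul_assoc, ht, ih, Cl_cons]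
  · obtain ⟨j, g, rfl⟩ := hrep f
    rw [OT.dz_mul, OT.dz_map, hfil, Finset.sum_singleton, OT.dz_u_pow, mul_smul_comm, map_add,
      map_smul, hΦ, hΦ, hΦ, hG, hG, hG]
    have := LinearMap.congr_fun (D.B_alpha g.1) (x j)
    rw [Module.End.mul_apply, LinearMap.add_apply, Module.End.mul_apply, b4] at this
    rw [this, map_neg, map_smul]
    simp [KPoly.dl]
    rw [add_comm]
    rfl
  · obtain ⟨j, g, rfl⟩ := hrep f
    rw [OT.dzeta_mul, OT.dzeta_map, hfil, Finset.sum_singleton, OT.dzeta_u_pow, mul_smul_comm,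
      map_add, map_smul, ← mul_assoc, ← OT.zetaz_mul, mul_assoc, ht, hΦ, hΦ, hΦ, hG, hG, hG]
    have := LinearMap.congr_fun (D.A_alpha i g.1) (x j)
    rw [Module.End.mul_apply, LinearMap.add_apply, Module.End.mul_apply, b5] at this
    rw [this, map_smul]
    have e : D.alpha (OAlg.inv g.1) (D.C i (x (j + 1))) = D.C i (D.alpha g.1 (x (j + 1))) := by
      have h1 : OAlg.zetaz 0 1 i * g.1 = OAlg.inv g.1 * OAlg.zetaz 0 1 i :=
        congrArg Subtype.val (OT.zetaz_mul 0 1 i g)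
      have := congrArg D.alpha h1
      rw [map_mul, map_mul, alpha_zetaz] at this
      exact (LinearMap.congr_fun this (x (j + 1))).symm
    rw [e]
    simp [KPoly.dl]
    rw [add_comm]
    rfl
  · obtain ⟨j, g, rfl⟩ := hrep f
    rw [map_mul, OT.inv_u_pow, ← OT.map_inv, hΦ, hΦ, hG, hG]
    have := LinearMap.congr_fun (D.E_alpha g.1) (x j)
    rw [Module.End.mul_apply, Module.End.mul_apply, b6] at this
    rw [this]
    rfl
  · obtain ⟨j, g, rfl⟩ := hrep f
    rw [hΦ, hG]
    exact D.alpha_mem hU _ _ (b7 U hU hx (a5 U hU hy) j)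

end DMod

end

section
theorem eq_neg_of_double {K : Type*} [Field K] [CharZero K] {F : Type*} [AddCommGroup F]
    [Module K F] {a b : F} (h : a + a = (-2 : K) • b) : b = -a := by
  refine smul_right_injective F (two_ne_zero : (2 : K) ≠ 0) ?_
  dsimp only
  rw [smul_neg, two_smul K a, h, neg_smul, neg_neg]

namespace HKMod

variable {K : Type*} [Field K] [CharZero K] {n m N : ℕ} {V : Type*} [AddCommGroup V] [Module K V]
variable (M : HKMod K N V)

theorem Ztq_self (k : Fin n) (i : Fin N) (x : M.VNabla n) : M.Ztq k k i x = 0 := by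
  induction x using M.vn_induction with
  | h1 v => simp
  | ha x y hx hy => rw [map_add, hx, hy, add_zero]
  | hs r x hx => rw [map_smul, hx, smul_zero]
  | hl a x hx => rw [Ztq_lam, hx, smul_zero]
  | ht a b x hx => rw [Ztq_theta, hx, smul_zero, sub_self, mul_zero, zero_smul, sub_zero]

theorem Zq_self (k : Fin n) (x : M.VNabla n) : M.Zq k k x = 0 := by
  induction x using M.vn_induction with
  | h1 v => simp
  | ha x y hx hy => rw [map_add, hx, hy, add_zero]
  | hs r x hx => rw [map_smul, hx, smul_zero]
  | hl a x hx => rw [Zq_lam, hx, smul_zero, sub_self, zero_smul, zero_add]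
  | ht a b x hx => rw [Zq_theta, hx, smul_zero, Ztq_self, smul_zero, zero_add]

theorem Ztq_swap (k l : Fin n) (i : Fin N) (x : M.VNabla n) : M.Ztq l k i x = -M.Ztq k l i x := by
  induction x using M.vn_induction with
  | h1 v => simp
  | ha x y hx hy => rw [map_add, map_add, hx, hy]; abel
  | hs r x hx => rw [map_smul, map_smul, hx, smul_neg]
  | hl a x hx => rw [Ztq_lam, Ztq_lam, hx, smul_neg]
  | ht a b x hx =>
    rw [Ztq_theta, Ztq_theta, hx, smul_neg, mul_sub, mul_sub, sub_smul, sub_smul]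
    abel

theorem Zq_swap (k l : Fin n) (x : M.VNabla n) : M.Zq l k x = -M.Zq k l x := by
  induction x using M.vn_induction with
  | h1 v => simp
  | ha x y hx hy => rw [map_add, map_add, hx, hy]; abel
  | hs r x hx => rw [map_smul, map_smul, hx, smul_neg]
  | hl a x hx => rw [Zq_lam, Zq_lam, hx, smul_neg, sub_smul, sub_smul]; abel
  | ht a b x hx =>
    rw [Zq_theta, Zq_theta, hx, smul_neg, M.Ztq_swap k l, add_comm (KPoly.dl K l a), smul_neg]
    abel

theorem Ztq_Ztq (k l : Fin n) (i j : Fin N) (x : M.VNabla n) :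
    M.Ztq k l i (M.Ztq k l j x) + M.Ztq k l j (M.Ztq k l i x) = 0 := by
  induction x using M.vn_induction with
  | h1 v => simp
  | ha x y hx hy =>
    simp only [map_add]
    rw [add_add_add_comm, hx, hy, add_zero]
  | hs r x hx => simp only [map_smul]; rw [← smul_add, hx, smul_zero]
  | hl a x hx => simp only [Ztq_lam]; rw [← smul_add, hx, smul_zero]
  | ht a b x hx =>
    have e : (KPoly.theta a b : KPoly K n N) • M.Ztq k l i (M.Ztq k l j x) +
      (KPoly.theta a b : KPoly K n N) • M.Ztq k l j (M.Ztq k l i x) = 0 := by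
      rw [← smul_add, hx, smul_zero]
    simp only [Ztq_theta, map_sub, map_smul]
    rw [← e]
    abel

theorem Zq_Ztq (k l : Fin n) (i : Fin N) (x : M.VNabla n) :
    M.Zq k l (M.Ztq k l i x) = M.Ztq k l i (M.Zq k l x) := by
  induction x using M.vn_induction with
  | h1 v => simp
  | ha x y hx hy => simp only [map_add, hx, hy]
  | hs r x hx => simp only [map_smul, hx]
  | hl a x hx => simp only [Ztq_lam, Zq_lam, hx, map_add, map_smul]
  | ht a b x hx =>
    have e := M.Ztq_Ztq k l i b x
    simp only [Ztq_theta, Zq_theta, map_sub, map_add, map_smul, hx]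
    rw [eq_neg_of_add_eq_zero_left e, smul_neg]
    abel

theorem epsT_SAt (k : Fin 2) (i : Fin N) (v : Tens K V 2) :
    M.epsT 2 (M.SAt k i v) = -M.SAt k i (M.epsT 2 v) := by
  suffices h : M.epsT 2 ∘ₗ M.SAt k i = -(M.SAt k i ∘ₗ M.epsT 2) from LinearMap.congr_fun h v
  refine ext2 fun a b => ?_
  rcases fin2_cases k with rfl | rfl
  · simp only [LinearMap.comp_apply, LinearMap.neg_apply, epsT_t2, SAt0_t2, eps_S]
    rw [← neg_one_smul K, t2_smul_left, neg_one_smul]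
  · simp only [LinearMap.comp_apply, LinearMap.neg_apply, epsT_t2, SAt1_t2, eps_S]
    rw [← neg_one_smul K, t2_smul_right, neg_one_smul]

theorem epsT_TAt (k : Fin 2) (v : Tens K V 2) :
    M.epsT 2 (M.TAt k v) = M.TAt k (M.epsT 2 v) := by
  suffices h : M.epsT 2 ∘ₗ M.TAt k = M.TAt k ∘ₗ M.epsT 2 from LinearMap.congr_fun h v
  refine ext2 fun a b => ?_
  rcases fin2_cases k with rfl | rfl
  · simp only [LinearMap.comp_apply, epsT_t2, TAt0_t2, eps_T]
  · simp only [LinearMap.comp_apply, epsT_t2, TAt1_t2, eps_T]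

theorem T_S_apply (i : Fin N) (v : V) : M.T (M.S i v) = M.S i (M.T v) :=
  LinearMap.congr_fun (M.T_S i) v

theorem S_S_apply (i j : Fin N) (v : V) :
    M.S i (M.S j v) + M.S j (M.S i v) = if i = j then (2 : K) • M.T v else 0 := by
  have := LinearMap.congr_fun (M.S_S i j) v
  split_ifs at this ⊢ <;> exact this

theorem TAt_SAt (k l : Fin 2) (i : Fin N) (v : Tens K V 2) :
    M.TAt k (M.SAt l i v) = M.SAt l i (M.TAt k v) := by
  suffices h : M.TAt k ∘ₗ M.SAt l i = M.SAt l i ∘ₗ M.TAt k from LinearMap.congr_fun h v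
  refine ext2 fun a b => ?_
  rcases fin2_cases k with rfl | rfl <;> rcases fin2_cases l with rfl | rfl <;>
  simp only [LinearMap.comp_apply, TAt0_t2, TAt1_t2, SAt0_t2, SAt1_t2, eps_T, T_S_apply]

theorem SAt_SAt (k l : Fin 2) (i j : Fin N) (v : Tens K V 2) :
    M.SAt k i (M.SAt l j v) + M.SAt l j (M.SAt k i v) =
      if k = l ∧ i = j then (2 : K) • M.TAt k v else 0 := by
  suffices h : M.SAt k i ∘ₗ M.SAt l j + M.SAt l j ∘ₗ M.SAt k i =
      if k = l ∧ i = j then (2 : K) • M.TAt k else 0 by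
    have := LinearMap.congr_fun h v
    split_ifs at this ⊢ <;> exact this
  refine ext2 fun a b => ?_
  have ha := M.S_S_apply i j a
  have hb := M.S_S_apply i j b
  have hs : ∀ i a b, t2 K (M.eps (M.S i a)) b = -t2 K (M.S i (M.eps a)) b := fun i a b => by
    rw [eps_S, ← neg_one_smul K, t2_smul_left, neg_one_smul]
  rcases fin2_cases k with rfl | rfl <;> rcases fin2_cases l with rfl | rfl
  · simp only [LinearMap.add_apply, LinearMap.comp_apply, SAt0_t2, true_and]
    rw [← t2_add_left, ha]
    split_ifs
    · rw [LinearMap.smul_apply, TAt0_t2, t2_smul_left]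
    · rw [LinearMap.zero_apply, ← zero_smul K (0 : V), t2_smul_left, zero_smul]
  · rw [if_neg (by simp)]
    simp only [LinearMap.add_apply, LinearMap.comp_apply, SAt0_t2, SAt1_t2]
    rw [hs, add_neg_cancel, LinearMap.zero_apply]
  · rw [if_neg (by simp)]
    simp only [LinearMap.add_apply, LinearMap.comp_apply, SAt0_t2, SAt1_t2]
    rw [hs, neg_add_cancel, LinearMap.zero_apply]
  · simp only [LinearMap.add_apply, LinearMap.comp_apply, SAt1_t2, true_and, eps_eps]
    rw [← t2_add_right, hb]
    split_ifs
    · rw [LinearMap.smul_apply, TAt1_t2, t2_smul_right]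
    · rw [LinearMap.zero_apply, ← zero_smul K (0 : V), t2_smul_right, zero_smul]

/-- The space of values of binary operations at a function. -/
abbrev Fm : Type _ := Tens K V 2 →ₗ[K] M.VNabla 2

/-- The operator that corresponds to `D_{ζ_k^i}`. -/
def opA (k : Fin 2) (i : Fin N) : Module.End K M.Fm where
  toFun φ := φ ∘ₗ M.SAt k i ∘ₗ M.epsT 2 -
    Algebra.lsmul K K (M.VNabla 2) (KPoly.theta k i : KPoly K 2 N) ∘ₗ φ ∘ₗ M.epsT 2
  map_add' φ ψ := LinearMap.ext fun g => by simp; abel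
  map_smul' r φ := LinearMap.ext fun g => by simp [smul_sub, smul_comm r]

theorem opA_apply (k : Fin 2) (i : Fin N) (φ : M.Fm) (v) : M.opA k i φ v =
    φ (M.SAt k i (M.epsT 2 v)) - (KPoly.theta k i : KPoly K 2 N) • φ (M.epsT 2 v) := rfl

/-- The operator that corresponds to `∂_{z_k}`. -/
def opB (k : Fin 2) : Module.End K M.Fm where
  toFun φ := φ ∘ₗ M.TAt k + Algebra.lsmul K K (M.VNabla 2) (KPoly.lam k : KPoly K 2 N) ∘ₗ φ
  map_add' φ ψ := LinearMap.ext fun g => by simp; abel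
  map_smul' r φ := LinearMap.ext fun g => by simp [smul_comm r]

theorem opB_apply (k : Fin 2) (φ : M.Fm) (v) : M.opB k φ v =
    φ (M.TAt k v) + (KPoly.lam k : KPoly K 2 N) • φ v := rfl

/-- The operator that corresponds to the multiplication by `ζ_{1,2}^i`. -/
def opC (i : Fin N) : Module.End K M.Fm where
  toFun φ := -(M.Ztq 0 1 i ∘ₗ φ ∘ₗ M.epsT 2)
  map_add' φ ψ := LinearMap.ext fun g => by simp; abel
  map_smul' r φ := LinearMap.ext fun g => by simp

theorem opC_apply (i : Fin N) (φ : M.Fm) (v) : M.opC i φ v = -M.Ztq 0 1 i (φ (M.epsT 2 v)) := rfl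

/-- The operator that corresponds to the multiplication by `z_{1,2}`. -/
def opZ : Module.End K M.Fm where
  toFun φ := M.Zq 0 1 ∘ₗ φ
  map_add' φ ψ := LinearMap.ext fun g => by simp
  map_smul' r φ := LinearMap.ext fun g => by simp

theorem opZ_apply (φ : M.Fm) (v) : M.opZ φ v = M.Zq 0 1 (φ v) := rfl

/-- The operator that corresponds to the parity operator. -/
def opE : Module.End K M.Fm where
  toFun φ := -(M.Pq 2 ∘ₗ φ ∘ₗ M.epsT 2)
  map_add' φ ψ := LinearMap.ext fun g => by simp; abel
  map_smul' r φ := LinearMap.ext fun g => by simp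

theorem opE_apply (φ : M.Fm) (v) : M.opE φ v = -M.Pq 2 (φ (M.epsT 2 v)) := rfl

theorem opA_opA (k l : Fin 2) (i j : Fin N) (φ : M.Fm) :
    M.opA k i (M.opA l j φ) + M.opA l j (M.opA k i φ) =
      if k = l ∧ i = j then (-2 : K) • M.opB k φ else 0 := by
  refine LinearMap.ext fun v => ?_
  have hS := congrArg φ (M.SAt_SAt k l i j v)
  have ht := congrArg (· • φ v) (KPoly.theta_theta (K := K) k l i j)
  have e : (M.opA k i (M.opA l j φ) + M.opA l j (M.opA k i φ)) v =
      (KPoly.theta k i * KPoly.theta l j + KPoly.theta l j * KPoly.theta k i : KPoly K 2 N) • φ v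
        - φ (M.SAt k i (M.SAt l j v) + M.SAt l j (M.SAt k i v)) := by
    simp only [LinearMap.add_apply, opA_apply, epsT_SAt, epsT_epsT, map_neg, smul_sub, add_smul,
      mul_smul, map_add, smul_neg]
    abel
  rw [e, hS, ht]
  split_ifs with h
  · rw [LinearMap.smul_apply, opB_apply, map_smul, smul_add, smul_assoc, neg_smul, neg_smul]
    abel
  · simp

theorem opA_opC (k : Fin 2) (i j : Fin N) (φ : M.Fm) :
    M.opA k i (M.opC j φ) + M.opC j (M.opA k i φ) =
      (KPoly.dl K j i * (KPoly.dl K 0 k - KPoly.dl K 1 k)) • φ := by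
  refine LinearMap.ext fun v => ?_
  simp only [LinearMap.add_apply, opA_apply, opC_apply, epsT_SAt, epsT_epsT, map_neg, map_sub,
    Ztq_theta, smul_neg, LinearMap.smul_apply]
  abel

theorem opC_opC (i j : Fin N) (φ : M.Fm) : M.opC i (M.opC j φ) + M.opC j (M.opC i φ) = 0 := by
  refine LinearMap.ext fun v => ?_
  simp only [LinearMap.add_apply, opC_apply, epsT_epsT, map_neg, neg_neg, LinearMap.zero_apply]
  exact M.Ztq_Ztq _ _ _ _ _

theorem opA_opZ (k : Fin 2) (i : Fin N) (φ : M.Fm) :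
    M.opA k i (M.opZ φ) = M.opZ (M.opA k i φ) - (KPoly.dl K 0 k + KPoly.dl K 1 k) • M.opC i φ := by
  refine LinearMap.ext fun v => ?_
  simp only [LinearMap.sub_apply, opA_apply, opC_apply, opZ_apply, map_sub, Zq_theta, smul_neg,
    LinearMap.smul_apply]
  abel

theorem opB_opA (k l : Fin 2) (i : Fin N) (φ : M.Fm) :
    M.opB k (M.opA l i φ) = M.opA l i (M.opB k φ) := by
  refine LinearMap.ext fun v => ?_
  simp only [opA_apply, opB_apply, epsT_TAt, TAt_SAt, smul_sub, smul_add, ← mul_smul,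
    KPoly.lam_theta k l]
  abel

theorem opB_opC (k : Fin 2) (i : Fin N) (φ : M.Fm) :
    M.opB k (M.opC i φ) = M.opC i (M.opB k φ) := by
  refine LinearMap.ext fun v => ?_
  simp only [opC_apply, opB_apply, epsT_TAt, map_add, Ztq_lam, smul_neg]
  abel

theorem opB_opZ (k : Fin 2) (φ : M.Fm) :
    M.opB k (M.opZ φ) = M.opZ (M.opB k φ) + (KPoly.dl K 0 k - KPoly.dl K 1 k) • φ := by
  refine LinearMap.ext fun v => ?_
  simp only [opZ_apply, opB_apply, map_add, Zq_lam, LinearMap.add_apply, LinearMap.smul_apply,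
    sub_smul]
  abel

/-- The operators on the space of values of binary operations. -/
def opD : DMod K N M.Fm where
  A := M.opA 0
  C := M.opC
  B := M.opB 0
  Z := M.opZ
  E := M.opE
  AA i j φ := by rw [opA_opA]; simp only [true_and]
  AC i j φ := by
    rw [opA_opC]
    by_cases h : i = j
    · simp [KPoly.dl, h]
    · simp [KPoly.dl, h, Ne.symm h]
  CC := M.opC_opC
  BZ φ := by rw [opB_opZ]; simp [KPoly.dl]
  AZ i φ := by rw [opA_opZ]; simp [KPoly.dl]
  BA i φ := M.opB_opA _ _ _ _
  BC i φ := M.opB_opC _ _ _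
  CZ i φ := LinearMap.ext fun v => by rw [opC_apply, opZ_apply, opZ_apply, opC_apply, map_neg, Zq_Ztq]
  EA i φ := LinearMap.ext fun v => by
    simp only [LinearMap.neg_apply, opA_apply, opE_apply, epsT_SAt, epsT_epsT, map_neg, map_sub,
      Pq_theta, smul_neg]
    abel
  EC i φ := LinearMap.ext fun v => by
    simp only [LinearMap.neg_apply, opC_apply, opE_apply, epsT_epsT, map_neg, Pq_Ztq]
  EB φ := LinearMap.ext fun v => by
    simp only [opB_apply, opE_apply, epsT_TAt, map_add, Pq_lam, smul_neg]
    abel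
  EZ φ := LinearMap.ext fun v => by
    simp only [opZ_apply, opE_apply, map_neg, Pq_Zq]

/-- The operator that vanishes on the values of a binary operation since
`D_{ζ_1^i} + D_{ζ_2^i} + 2 ζ_{1,2}^i ∂_{z_1}` vanishes on functions of two variables. -/
def opN (i : Fin N) : Module.End K M.Fm := M.opA 0 i + M.opA 1 i + (2 : K) • (M.opC i * M.opB 0)

theorem opN_apply (i : Fin N) (φ : M.Fm) :
    M.opN i φ = M.opA 0 i φ + M.opA 1 i φ + (2 : K) • M.opC i (M.opB 0 φ) := rfl

theorem opN_stable (i : Fin N) : M.opD.Stable (LinearMap.ker (M.opN i)) where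
  A j φ hφ := by
    rw [LinearMap.mem_ker] at hφ ⊢
    have e : M.opN i (M.opA 0 j φ) = -M.opA 0 j (M.opN i φ) := by
      have h1 := M.opA_opA 0 0 i j φ
      have h2 := M.opA_opA 1 0 i j φ
      have h3 := M.opA_opC 0 j i (M.opB 0 φ)
      rw [if_neg (by simp), add_eq_zero_iff_eq_neg] at h2
      rw [opN_apply, opN_apply, map_add, map_add, map_smul, opB_opA, h2,
        eq_sub_of_add_eq h1, eq_sub_of_add_eq' h3]
      by_cases h : i = j
      · subst h
        rw [if_pos ⟨rfl, rfl⟩, KPoly.dl, KPoly.dl, KPoly.dl, if_pos rfl, if_pos rfl,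
          if_neg (by decide), sub_zero, one_mul, one_smul, smul_sub]
        generalize M.opB 0 φ = z
        have e : (-2 : K) • z = -((2 : K) • z) := LinearMap.ext fun v => by
          rw [LinearMap.smul_apply, LinearMap.neg_apply, LinearMap.smul_apply, neg_smul]
        rw [e]
        abel
      · rw [if_neg fun e => h e.2, KPoly.dl, if_neg h, zero_mul, zero_smul, smul_sub, smul_zero]
        abel
    change M.opN i (M.opA 0 j φ) = 0
    rw [e, hφ, map_zero, neg_zero]
  C j φ hφ := by
    rw [LinearMap.mem_ker] at hφ ⊢
    have e : M.opN i (M.opC j φ) = -M.opC j (M.opN i φ) := by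
      obtain ⟨y, h1, h2⟩ : ∃ y : M.Fm, M.opA 0 i (M.opC j φ) + M.opC j (M.opA 0 i φ) = y ∧
          M.opA 1 i (M.opC j φ) + M.opC j (M.opA 1 i φ) = -y := by
        refine ⟨_, rfl, ?_⟩
        rw [opA_opC, opA_opC]
        refine LinearMap.ext fun v => ?_
        rw [LinearMap.smul_apply, LinearMap.neg_apply, LinearMap.smul_apply, ← neg_smul]
        congr 1
        simp [KPoly.dl]
      have h3 := M.opC_opC i j (M.opB 0 φ)
      rw [opN_apply, opN_apply, map_add, map_add, map_smul, opB_opC,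
        eq_sub_of_add_eq h1, eq_sub_of_add_eq h2, eq_neg_of_add_eq_zero_left h3]
      rw [smul_neg]
      abel
    change M.opN i (M.opC j φ) = 0
    rw [e, hφ, map_zero, neg_zero]
  B φ hφ := by
    rw [LinearMap.mem_ker] at hφ ⊢
    change M.opN i (M.opB 0 φ) = 0
    have e : M.opN i (M.opB 0 φ) = M.opB 0 (M.opN i φ) := by
      rw [opN_apply, opN_apply, map_add, map_add, map_smul, opB_opA, opB_opA, opB_opC]
    rw [e, hφ, map_zero]
  Z φ hφ := by
    rw [LinearMap.mem_ker] at hφ ⊢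
    have e : M.opN i (M.opZ φ) = M.opZ (M.opN i φ) := by
      have h : M.opC i (M.opZ (M.opB 0 φ)) = M.opZ (M.opC i (M.opB 0 φ)) := M.opD.CZ i _
      rw [opN_apply, opN_apply, map_add, map_add, map_smul, opA_opZ, opA_opZ, opB_opZ, map_add, h]
      simp [KPoly.dl, two_smul]
      abel
    change M.opN i (M.opZ φ) = 0
    rw [e, hφ, map_zero]

/-- A binary operation is determined by compatible values at `1` and at `ζ^1 ⋯ ζ^N z⁻¹`. -/
theorem exists_op (hN : 0 < N) (x0 y : M.Fm)
    (hS0 : ∀ k i v, x0 (M.SAt k i v) = (KPoly.theta k i : KPoly K 2 N) • x0 v)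
    (hE0 : ∀ v, x0 (M.epsT 2 v) = -M.Pq 2 (x0 v)) (hyC : ∀ i v, M.Ztq 0 1 i (y v) = 0)
    (hyZ : M.opZ y = M.opD.Cl (List.finRange N) x0)
    (hyS : ∀ i v, y (M.SAt 0 i v) + y (M.SAt 1 i v) =
      (KPoly.theta 0 i : KPoly K 2 N) • y v + (KPoly.theta 1 i : KPoly K 2 N) • y v)
    (hEy : ∀ v, y (M.epsT 2 v) = -((-1 : K) ^ N • M.Pq 2 (y v))) :
    ∃ X : M.Src (Star 2) →ₗ[K] M.VNabla 2, M.OpS (-1) X ∧ (∀ v, X (v ⊗ₜ[K] 1) = x0 v) ∧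
      ∀ v, X (v ⊗ₜ[K] (OT.zt 0 1 * OT.u 0 1 s01)) = y v := by
  have hA0 : ∀ k i, M.opA k i x0 = 0 := fun k i => LinearMap.ext fun v => by
    rw [opA_apply, hS0, sub_self, LinearMap.zero_apply]
  let i0 : Fin N := ⟨0, hN⟩
  have hAA : ∀ k (φ : M.Fm), M.opB k φ = -M.opA k i0 (M.opA k i0 φ) := by
    intro k φ
    have := M.opA_opA k k i0 i0 φ
    rw [if_pos ⟨rfl, rfl⟩] at this
    exact eq_neg_of_double this
  have hB0 : M.opB 0 x0 = 0 := by rw [hAA, hA0, map_zero, neg_zero]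
  have hC : ∀ i, M.opC i y = 0 := fun i => LinearMap.ext fun v => by
    rw [opC_apply, hyC, neg_zero, LinearMap.zero_apply]
  obtain ⟨Φ, f1, f2, f3, f4, f5, f6, f7, f8⟩ := M.opD.exists_hom (x0 := x0) (y := y) hB0 (hA0 0)
    (LinearMap.ext fun v => by
      change M.opE x0 v = _
      rw [opE_apply, hE0, map_neg, Pq_Pq, neg_neg]) hC hyZ
    (LinearMap.ext fun v => by
      change M.opE y v = _
      rw [opE_apply, hEy, map_neg, map_smul, Pq_Pq, neg_neg, LinearMap.smul_apply])
  have hN : ∀ i f, M.opN i (Φ f) = 0 := by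
    intro i f
    refine LinearMap.mem_ker.1 (f8 _ (M.opN_stable i) ?_ ?_ f)
    · rw [LinearMap.mem_ker, opN_apply, hA0, hA0, hB0, map_zero, smul_zero, add_zero, add_zero]
    · rw [LinearMap.mem_ker, opN_apply, ← opB_opC, hC, map_zero, smul_zero, add_zero]
      refine LinearMap.ext fun v => ?_
      rw [LinearMap.add_apply, opA_apply, opA_apply, sub_add_sub_comm, hyS, sub_self,
        LinearMap.zero_apply]
  change ∀ f, Φ (OT.zz 0 1 * f) = M.opZ (Φ f) at f3
  change ∀ i f, Φ (OT.zetaz 0 1 i * f) = M.opC i (Φ f) at f4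
  change ∀ f, Φ (OT.dz 0 f) = M.opB 0 (Φ f) at f5
  change ∀ i f, Φ (OT.dzeta 0 i f) = M.opA 0 i (Φ f) at f6
  change ∀ f, Φ (OT.inv f) = M.opE (Φ f) at f7
  have f6' : ∀ k i f, Φ (OT.dzeta k i f) = M.opA k i (Φ f) := by
    intro k i f
    rcases fin2_cases k with rfl | rfl
    · exact f6 i f
    · have := hN i f
      rw [OT.dzeta_one_eq, map_sub, map_neg, map_smul, f4, f5, f6]
      rw [opN_apply] at this
      rw [← sub_eq_zero, ← neg_eq_zero, ← this]
      abel
  have f5' : ∀ k f, Φ (OT.dz k f) = M.opB k (Φ f) := by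
    intro k f
    rw [hAA, ← f6', ← f6', ← map_neg]
    congr 1
    have := OT.dzeta_dzeta k k i0 i0 f
    rw [if_pos ⟨rfl, rfl⟩] at this
    exact eq_neg_of_double this
  refine ⟨TensorProduct.lift Φ.flip, ⟨fun k l v f => ?_, fun k l i v f => ?_, fun v f => ?_,
    fun k v f => ?_, fun k i v f => ?_⟩, fun v => ?_, fun v => ?_⟩
  · simp only [TensorProduct.lift.tmul, LinearMap.flip_apply]
    rcases fin2_cases k with rfl | rfl <;> rcases fin2_cases l with rfl | rfl
    · rw [zz_self, zero_mul, map_zero, Zq_self, LinearMap.zero_apply]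
    · rw [f3, opZ_apply]
    · rw [OT.zz_swap 0 1, neg_mul, map_neg, f3, M.Zq_swap 0 1, LinearMap.neg_apply, opZ_apply]
    · rw [zz_self, zero_mul, map_zero, Zq_self, LinearMap.zero_apply]
  · simp only [TensorProduct.lift.tmul, LinearMap.flip_apply, neg_one_smul]
    rcases fin2_cases k with rfl | rfl <;> rcases fin2_cases l with rfl | rfl
    · rw [OT.zetaz_self, zero_mul, map_zero, Ztq_self, LinearMap.zero_apply, neg_zero]
    · rw [f4, opC_apply]
    · rw [OT.zetaz_swap 0 1, neg_mul, map_neg, f4, M.Ztq_swap 0 1, LinearMap.neg_apply, opC_apply]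
    · rw [OT.zetaz_self, zero_mul, map_zero, Ztq_self, LinearMap.zero_apply, neg_zero]
  · simp only [TensorProduct.lift.tmul, LinearMap.flip_apply, neg_one_smul]
    rw [f7, opE_apply, epsT_epsT]
  · simp only [TensorProduct.lift.tmul, LinearMap.flip_apply]
    rw [f5', opB_apply, add_sub_cancel_right]
  · simp only [TensorProduct.lift.tmul, LinearMap.flip_apply, neg_one_smul]
    rw [f6', opA_apply, epsT_epsT, sub_neg_eq_add, sub_add_cancel]
  · rw [TensorProduct.lift.tmul, LinearMap.flip_apply, f1]
  · rw [TensorProduct.lift.tmul, LinearMap.flip_apply, f2]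

end HKMod

end

section
namespace KPoly

variable {K : Type*} [Field K] [CharZero K] {n m N : ℕ} {V W : Type*} [AddCommGroup V] [Module K V]
  [AddCommGroup W] [Module K W]

/-- `∂_{λ_k}` on polynomials with coefficients in `V`. -/
def dLV (k : Fin n) : Module.End K (KPoly K n N ⊗[K] V) :=
  TensorProduct.map (dLam k) LinearMap.id

/-- `∂_{θ_k^i}` on polynomials with coefficients in `V`. -/
def dTV (k : Fin n) (i : Fin N) : Module.End K (KPoly K n N ⊗[K] V) :=
  TensorProduct.map (dTheta k i) LinearMap.id

theorem dLV_tmul (k : Fin n) (a : KPoly K n N) (v : V) : dLV k (a ⊗ₜ[K] v) = dLam k a ⊗ₜ[K] v := rfl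

theorem dTV_tmul (k : Fin n) (i : Fin N) (a : KPoly K n N) (v : V) :
    dTV k i (a ⊗ₜ[K] v) = dTheta k i a ⊗ₜ[K] v := rfl

theorem hom_ext {f g : KPoly K n N ⊗[K] V →ₗ[K] W}
    (h : ∀ μ v, f (mono μ ⊗ₜ[K] v) = g (mono μ ⊗ₜ[K] v)) : f = g := by
  refine TensorProduct.ext' fun a v => ?_
  induction a using ind_mono with
  | hm μ => exact h μ v
  | hs r a ha => rw [← TensorProduct.smul_tmul', map_smul, ha, map_smul]
  | ha a b ha hb => rw [TensorProduct.add_tmul, map_add, ha, hb, map_add]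

/-- The coefficients of a polynomial with coefficients in `V`. -/
def coef : KPoly K n N ⊗[K] V →ₗ[K] (Mon n N →₀ V) := onMon fun μ => Finsupp.lsingle μ

theorem coef_mono (μ : Mon n N) (v : V) : coef (mono μ ⊗ₜ[K] v) = Finsupp.single μ v := by
  rw [coef, onMon_mono]; rfl

theorem eq_sum_coef (f : KPoly K n N ⊗[K] V →ₗ[K] W) (x : KPoly K n N ⊗[K] V) :
    f x = (coef x).sum fun μ v => f (mono μ ⊗ₜ[K] v) := by
  have : f = Finsupp.lsum K (fun μ => f ∘ₗ TensorProduct.mk K _ V (mono μ)) ∘ₗ coef := by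
    refine hom_ext fun μ v => ?_
    rw [LinearMap.comp_apply, coef_mono, Finsupp.lsum_single]
    rfl
  conv_lhs => rw [this]
  rfl

theorem coef_dLV (k : Fin n) (x : KPoly K n N ⊗[K] V) (μ : Mon n N) :
    coef (dLV k x) μ = (μ.1 k + 1 : K) • coef x (μ.1 + Pi.single k 1, μ.2) := by
  suffices h : Finsupp.lapply μ ∘ₗ coef ∘ₗ dLV k = (μ.1 k + 1 : K) •
      (Finsupp.lapply (μ.1 + Pi.single k 1, μ.2) ∘ₗ coef :
        KPoly K n N ⊗[K] V →ₗ[K] V) from LinearMap.congr_fun h x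
  refine hom_ext fun ν v => ?_
  simp only [LinearMap.comp_apply, LinearMap.smul_apply, Finsupp.lapply_apply, dLV_tmul, dLam_mono,
    ← TensorProduct.smul_tmul', map_smul, coef_mono, Finsupp.smul_apply, Finsupp.single_apply]
  by_cases h : ν = (μ.1 + Pi.single k 1, μ.2)
  · subst h
    simp
  · rw [if_neg h, smul_zero]
    by_cases hk : ν.1 k = 0
    · rw [hk, Nat.cast_zero, zero_smul]
    · rw [if_neg, smul_zero]
      rintro rfl
      apply h
      refine Prod.ext (funext fun j => ?_) rfl
      by_cases hj : j = k
      · subst hj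
        simp only [Pi.add_apply, Pi.sub_apply, Pi.single_eq_same]
        omega
      · simp [hj]

theorem coef_dTV (k : Fin n) (i : Fin N) (x : KPoly K n N ⊗[K] V) (μ : Mon n N)
    (hμ : toLex (k, i) ∉ μ.2) : coef (dTV k i x) μ =
      posSign K (toLex (k, i)) (insert (toLex (k, i)) μ.2) •
        coef x (μ.1, insert (toLex (k, i)) μ.2) := by
  suffices h : Finsupp.lapply μ ∘ₗ coef ∘ₗ dTV k i =
      posSign K (toLex (k, i)) (insert (toLex (k, i)) μ.2) •
      (Finsupp.lapply (μ.1, insert (toLex (k, i)) μ.2) ∘ₗ coef :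
        KPoly K n N ⊗[K] V →ₗ[K] V) from LinearMap.congr_fun h x
  refine hom_ext fun ν v => ?_
  simp only [LinearMap.comp_apply, LinearMap.smul_apply, Finsupp.lapply_apply, dTV_tmul, dTheta_mono,
    coef_mono, Finsupp.single_apply]
  by_cases h : ν = (μ.1, insert (toLex (k, i)) μ.2)
  · subst h
    rw [if_pos (Finset.mem_insert_self _ _), if_pos rfl, ← TensorProduct.smul_tmul', map_smul,
      Finset.erase_insert hμ, Finsupp.smul_apply, coef_mono, Finsupp.single_eq_same]
  · rw [if_neg h, smul_zero]
    split_ifs with h1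
    · rw [← TensorProduct.smul_tmul', map_smul, Finsupp.smul_apply, coef_mono, Finsupp.single_apply,
        if_neg, smul_zero]
      rintro rfl
      exact h (Prod.ext rfl (Finset.insert_erase h1).symm)
    · rw [TensorProduct.zero_tmul, map_zero]; rfl

/-- A polynomial whose derivatives by some of the variables vanish contains only monomials without
these variables. -/
theorem eq_of_free {A : Set (Fin n)} {x : KPoly K n N ⊗[K] V} (hl : ∀ k ∈ A, dLV k x = 0)
    (ht : ∀ k ∈ A, ∀ i, dTV k i x = 0) (f g : KPoly K n N ⊗[K] V →ₗ[K] W)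
    (h : ∀ μ : Mon n N, (∀ k ∈ A, μ.1 k = 0 ∧ ∀ i, toLex (k, i) ∉ μ.2) →
      ∀ v, f (mono μ ⊗ₜ[K] v) = g (mono μ ⊗ₜ[K] v)) : f x = g x := by
  rw [eq_sum_coef f, eq_sum_coef g]
  refine Finset.sum_congr rfl fun μ hμ => h μ (fun k hk => ?_) _
  rw [Finsupp.mem_support_iff] at hμ
  refine ⟨by_contra fun h0 => hμ ?_, fun i hi => hμ ?_⟩
  · have := coef_dLV k x (μ.1 - Pi.single k 1, μ.2)
    rw [hl k hk, map_zero, Finsupp.zero_apply] at this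
    have e : (μ.1 - Pi.single k 1 + Pi.single k 1, μ.2) = μ := by
      refine Prod.ext (funext fun j => ?_) rfl
      by_cases hj : j = k
      · subst hj
        simp only [Pi.add_apply, Pi.sub_apply, Pi.single_eq_same]
        omega
      · simp [hj]
    dsimp only at this
    rw [e] at this
    refine (smul_eq_zero.1 this.symm).resolve_left ?_
    exact Nat.cast_add_one_ne_zero _
  · have := coef_dTV k i x (μ.1, μ.2.erase (toLex (k, i))) (Finset.notMem_erase _ _)
    rw [ht k hk, map_zero, Finsupp.zero_apply] at this
    dsimp only at this
    rw [Finset.insert_erase hi] at this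
    refine (smul_eq_zero.1 this.symm).resolve_left ?_
    exact pow_ne_zero _ (neg_ne_zero.2 one_ne_zero)

theorem up_mono (μ : Mon n N) :
    up (mono μ : KPoly K n N) = monoIn (fun k => lam k.castSucc) (fun k i => theta k.castSucc i) μ := by
  rw [mono, monoIn, monoIn, map_mul, map_list_prod, map_list_prod, List.map_ofFn, List.map_map]
  congr 2
  · congr 1
    funext k
    rw [Function.comp_apply, map_pow, up_lam]
  · exact List.map_congr_left fun j hj => by rw [Function.comp_apply, up_theta]

theorem map_monoIn {A B : Type*} [Ring A] [Algebra K A] [Ring B] [Algebra K B] (φ : A →ₐ[K] B)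
    (l : Fin n → A) (t : Fin n → Fin N → A) (μ : Mon n N) :
    φ (monoIn l t μ) = monoIn (fun k => φ (l k)) (fun k i => φ (t k i)) μ := by
  rw [monoIn, monoIn, map_mul, map_list_prod, map_list_prod, List.map_ofFn, List.map_map]
  congr 2
  congr 1
  funext k
  rw [Function.comp_apply, map_pow]

theorem monoIn_congr {A : Type*} [Monoid A] {l l' : Fin n → A} {t t' : Fin n → Fin N → A}
    (μ : Mon n N) (h : ∀ k, (μ.1 k = 0 ∧ ∀ i, toLex (k, i) ∉ μ.2) ∨ (l k = l' k ∧ ∀ i, t k i = t' k i)) :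
    monoIn l t μ = monoIn l' t' μ := by
  rw [monoIn, monoIn]
  congr 2
  · congr 1
    funext k
    rcases h k with h | h
    · rw [h.1, pow_zero, pow_zero]
    · rw [h.1]
  · refine List.map_congr_left fun j hj => ?_
    rcases h (ofLex j).1 with h | h
    · exact absurd ((Finset.mem_sort _).1 hj) (h.2 _)
    · exact h.2 _

end KPoly

namespace HKMod

variable {K : Type*} [Field K] [CharZero K] {n m N : ℕ} {V W : Type*} [AddCommGroup V] [Module K V]
  [AddCommGroup W] [Module K W]
variable (M : HKMod K N V)

theorem Z_inc (k : Fin n) (x : KPoly K n N ⊗[K] V) :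
    M.Zq k.castSucc (Fin.last n) (M.inc n x) = -M.inc n (KPoly.dLV k x) ∧
    ∀ i, M.Ztq k.castSucc (Fin.last n) i (M.inc n x) = M.inc n (KPoly.dTV k i x) := by
  induction x with
  | zero => simp
  | add x y hx hy =>
    simp only [map_add, hx.1, hy.1, hx.2, hy.2]
    exact ⟨by abel, fun _ => trivial⟩
  | tmul a v =>
    have h1 : ∀ l : Fin n, KPoly.dl K (Fin.last n) l.castSucc = 0 := fun l =>
      if_neg (Fin.castSucc_lt_last l).ne'
    have h2 : ∀ k l : Fin n, KPoly.dl K k.castSucc l.castSucc = KPoly.dl K k l := fun k l =>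
      dl_castSucc _ _
    simp only [KPoly.dLV_tmul, KPoly.dTV_tmul, inc_tmul]
    induction a using KPoly.ind_left with
    | h1 => simp [KPoly.dLam_one, KPoly.dTheta_one]
    | hs r a h =>
      simp only [map_smul, smul_assoc, h.1, h.2, smul_neg, and_self, implies_true]
    | ha a b ha hb =>
      simp only [map_add, add_smul, ha.1, ha.2, hb.1, hb.2]
      exact ⟨by abel, fun _ => trivial⟩
    | hl l a h =>
      simp only [map_mul, KPoly.up_lam, mul_smul, Zq_lam, Ztq_lam, h.1, h.2, KPoly.dLam_lam,
        KPoly.dTheta_lam, map_add, add_smul, h1, h2]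
      refine ⟨?_, fun _ => trivial⟩
      by_cases hh : k = l
      · simp [KPoly.dl, hh]
        abel
      · simp [KPoly.dl, hh]
    | ht l j a h =>
      simp only [map_mul, KPoly.up_theta, mul_smul, Zq_theta, Ztq_theta, h.1, h.2, KPoly.dLam_theta,
        KPoly.dTheta_theta, map_sub, sub_smul, h1, h2]
      refine ⟨?_, fun i => ?_⟩
      · by_cases hh : k = l
        · simp [KPoly.dl, hh]
          abel
        · simp [KPoly.dl, hh]
      · by_cases hh : k = l <;> by_cases hi : i = j <;> simp [KPoly.dl, hh, hi]

theorem fibQ_fixed (A : Set (Fin n)) (y : M.VNabla (n + 1))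
    (hz : ∀ k ∈ A, M.Zq k.castSucc (Fin.last n) y = 0)
    (ht : ∀ k ∈ A, ∀ i, M.Ztq k.castSucc (Fin.last n) i y = 0) (c : Fin (n + 1) → Fin (n + 1))
    (hc : ∀ k, k ∉ A → ∀ l, c l = k.castSucc ↔ l = k.castSucc) : M.fibQ c y = y := by
  obtain ⟨x, rfl⟩ : ∃ x, M.inc n x = y := ⟨M.red n y, M.inc_red y⟩
  refine KPoly.eq_of_free (A := A) (fun k hk => ?_) (fun k hk i => ?_) (M.fibQ c ∘ₗ M.inc n)
    (M.inc n) fun μ hμ v => ?_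
  · have := hz k hk
    rw [(M.Z_inc k x).1, neg_eq_zero] at this
    exact M.inc_injective (this.trans (map_zero _).symm)
  · have := ht k hk i
    rw [(M.Z_inc k x).2] at this
    exact M.inc_injective (this.trans (map_zero _).symm)
  · rw [LinearMap.comp_apply, inc_tmul, fibQ_smul, fibQ_iv, KPoly.up_mono, KPoly.map_monoIn]
    congr 1
    refine KPoly.monoIn_congr μ fun k => ?_
    by_cases hk : k ∈ A
    · exact Or.inl (hμ k hk)
    · have hf : (Finset.univ.filter fun l => c l = k.castSucc) = {k.castSucc} := by
        ext l; simp [hc k hk]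
      exact Or.inr ⟨by rw [KPoly.fib_lam, hf, Finset.sum_singleton],
        fun i => by rw [KPoly.fib_theta, hf, Finset.sum_singleton]⟩

end HKMod

end

section
namespace KPoly

variable {K : Type*} [Field K] [CharZero K] {n m N : ℕ} {V W : Type*} [AddCommGroup V] [Module K V]
  [AddCommGroup W] [Module K W]

/-- The iterated derivative by a list of odd variables. -/
def dP (L : List (Fin N)) : Module.End K (KPoly K 1 N ⊗[K] V) := (L.map (dTV 0)).prod

theorem dP_cons (i : Fin N) (L : List (Fin N)) (x : KPoly K 1 N ⊗[K] V) :
    dP (i :: L) x = dTV 0 i (dP L x) := by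
  rw [dP, List.map_cons, List.prod_cons]; rfl

theorem dP_mono (L : List (Fin N)) (I : Finset (Fin 1 ×ₗ Fin N)) :
    (L.Nodup → (∀ i ∈ L, toLex (0, i) ∈ I) → ∃ r : K, r * r = 1 ∧ ∀ (c : Fin 1 → ℕ) (v : V),
      dP L ((mono (c, I) : KPoly K 1 N) ⊗ₜ[K] v) =
        r • (mono (c, I.filter fun j => (ofLex j).2 ∉ L) ⊗ₜ[K] v)) ∧
    (L.Nodup → ∀ i ∈ L, toLex (0, i) ∉ I → ∀ (c : Fin 1 → ℕ) (v : V),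
      dP L ((mono (c, I) : KPoly K 1 N) ⊗ₜ[K] v) = 0) := by
  induction L with
  | nil => exact ⟨fun _ _ => ⟨1, one_mul 1, fun c v => by simp [dP]⟩, fun _ i h => by simp at h⟩
  | cons i L ih =>
    refine ⟨fun hL h => ?_, fun hL j hj hI c v => ?_⟩
    · obtain ⟨hi, hL⟩ := List.nodup_cons.1 hL
      obtain ⟨r, hr, e⟩ := ih.1 hL fun j hj => h j (List.mem_cons_of_mem _ hj)
      refine ⟨r * posSign K (toLex (0, i)) (I.filter fun j => (ofLex j).2 ∉ L), ?_, fun c v => ?_⟩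
      · rw [mul_mul_mul_comm, hr, posSign_mul_self, one_mul]
      · rw [dP_cons, e, map_smul, dTV_tmul, dTheta_mono, if_pos, ← TensorProduct.smul_tmul',
          smul_smul]
        · congr 4
          ext j
          have hj : j = toLex (0, (ofLex j).2) := by
            rw [← Subsingleton.elim (ofLex j).1 0]; rfl
          rw [hj]
          simp
          tauto
        · exact Finset.mem_filter.2 ⟨h i List.mem_cons_self, hi⟩
    · obtain ⟨hi, hL⟩ := List.nodup_cons.1 hL
      rw [dP_cons]
      by_cases h : ∀ j ∈ L, toLex (0, j) ∈ I
      · obtain ⟨r, hr, e⟩ := ih.1 hL h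
        have : i = j := by
          rcases List.mem_cons.1 hj with h' | h'
          · exact h'.symm
          · exact absurd (h j h') hI
        subst this
        rw [e, map_smul, dTV_tmul, dTheta_mono, if_neg, TensorProduct.zero_tmul, smul_zero]
        exact fun h' => hI (Finset.mem_filter.1 h').1
      · push Not at h
        obtain ⟨j, hj, hI⟩ := h
        rw [ih.2 hL j hj hI, map_zero]

/-- The coefficient of `θ^1 ⋯ θ^N`. -/
def topc : Module.End K (KPoly K 1 N ⊗[K] V) := onMon fun μ => if μ.2 = Finset.univ then
  TensorProduct.mk K (KPoly K 1 N) V (mono (μ.1, ∅)) else 0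

/-- The constant term. -/
def cst : KPoly K 1 N ⊗[K] V →ₗ[K] V := onMon fun μ => if μ = (0, ∅) then LinearMap.id else 0

theorem topc_mono (μ : Mon 1 N) (v : V) : topc ((mono μ : KPoly K 1 N) ⊗ₜ[K] v) =
    if μ.2 = Finset.univ then mono (μ.1, ∅) ⊗ₜ[K] v else 0 := by
  rw [topc, onMon_mono]; split_ifs <;> rfl

theorem cst_mono (μ : Mon 1 N) (v : V) : cst ((mono μ : KPoly K 1 N) ⊗ₜ[K] v) =
    if μ = (0, ∅) then v else 0 := by
  rw [cst, onMon_mono]; split_ifs <;> rfl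

theorem cst_one (v : V) : cst ((1 : KPoly K 1 N) ⊗ₜ[K] v) = v := by
  rw [← mono_zero, cst_mono, if_pos rfl]

theorem exists_dP : ∃ r : K, r * r = 1 ∧ ∀ x : KPoly K 1 N ⊗[K] V,
    dP (List.finRange N) x = r • topc x := by
  obtain ⟨r, hr, e⟩ := (dP_mono (K := K) (V := V) (List.finRange N) Finset.univ).1
    (List.nodup_finRange N) fun _ _ => Finset.mem_univ _
  refine ⟨r, hr, fun x => LinearMap.congr_fun (hom_ext (g := r • topc) fun μ v => ?_) x⟩
  rw [LinearMap.smul_apply, topc_mono]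
  by_cases h : μ.2 = Finset.univ
  · rw [if_pos h, ← Prod.mk.eta (p := μ), h, e]
    congr 4
    ext; simp
  · obtain ⟨j, hj⟩ : ∃ j, j ∉ μ.2 := by
      by_contra! h'
      exact h (Finset.eq_univ_of_forall h')
    rw [if_neg h, smul_zero, ← Prod.mk.eta (p := μ)]
    refine (dP_mono _ μ.2).2 (List.nodup_finRange N) (ofLex j).2 (List.mem_finRange _) ?_ _ _
    have : j = toLex (0, (ofLex j).2) := by
      rw [← Subsingleton.elim (ofLex j).1 0]; rfl
    rwa [← this]

variable (K N) in
theorem lam_pow_eq (k : ℕ) : (lam 0 ^ k : KPoly K 1 N) = mono (fun _ => k, ∅) := by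
  simp [mono, monoIn]

theorem integralLam_mono (μ : Mon 1 N) (v : V) :
    HKMod.integralLam ((mono μ : KPoly K 1 N) ⊗ₜ[K] v) = if μ.2 = Finset.univ then
      ((μ.1 0 : K) + 1)⁻¹ • (mono (fun _ => μ.1 0 + 1, ∅) ⊗ₜ[K] v) else 0 := by
  rw [HKMod.integralLam, onMon_mono, lam_pow_eq]; split_ifs <;> rfl

theorem integralLam_props (x : KPoly K 1 N ⊗[K] V) : (∀ i, dTV 0 i (HKMod.integralLam x) = 0) ∧
    dLV 0 (HKMod.integralLam x) = topc x ∧ cst (HKMod.integralLam x) = 0 := by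
  refine ⟨fun i => LinearMap.congr_fun (hom_ext (f := dTV 0 i ∘ₗ HKMod.integralLam) (g := 0)
    fun μ v => ?_) x, LinearMap.congr_fun (hom_ext (f := dLV 0 ∘ₗ HKMod.integralLam) fun μ v => ?_) x,
    LinearMap.congr_fun (hom_ext (f := cst ∘ₗ HKMod.integralLam) (g := 0) fun μ v => ?_) x⟩
  all_goals rw [LinearMap.comp_apply, integralLam_mono]
  · split_ifs
    · rw [map_smul, dTV_tmul, dTheta_mono]; simp
    · simp
  · rw [topc_mono]
    split_ifs
    · rw [map_smul, dLV_tmul, dLam_mono, ← TensorProduct.smul_tmul', smul_smul]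
      have : (μ.1 0 : K) + 1 ≠ 0 := Nat.cast_add_one_ne_zero _
      dsimp only
      rw [Nat.cast_add, Nat.cast_one, inv_mul_cancel₀ this, one_smul]
      congr 3
      ext j
      rw [Subsingleton.elim j 0]
      simp
    · simp
  · split_ifs
    · rw [map_smul, cst_mono, if_neg]
      · simp
      · intro h
        simpa using congrFun (congrArg Prod.fst h) 0
    · simp

theorem eq_cst_of_d {x : KPoly K 1 N ⊗[K] V} (hl : dLV 0 x = 0) (ht : ∀ i, dTV 0 i x = 0) :
    x = 1 ⊗ₜ[K] cst x := by
  refine eq_of_free (A := Set.univ) (fun k _ => ?_) (fun k _ i => ?_) LinearMap.id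
    (TensorProduct.mk K _ V 1 ∘ₗ cst) fun μ hμ v => ?_
  · rwa [Subsingleton.elim k 0]
  · rw [Subsingleton.elim k 0, ht]
  · have : μ = (0, ∅) := by
      refine Prod.ext (funext fun k => (hμ k trivial).1) (Finset.eq_empty_of_forall_notMem ?_)
      exact fun j => (hμ (ofLex j).1 trivial).2 (ofLex j).2
    rw [this, LinearMap.comp_apply, cst_mono, if_pos rfl, mono_zero]; rfl

theorem eq_of_cst {x y : KPoly K 1 N ⊗[K] V} (hl : dLV 0 x = dLV 0 y)
    (ht : ∀ i, dTV 0 i x = dTV 0 i y) (hc : cst x = cst y) : x = y := by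
  rw [← sub_eq_zero, eq_cst_of_d (x := x - y), map_sub, hc, sub_self, TensorProduct.tmul_zero]
  · rw [map_sub, hl, sub_self]
  · intro i; rw [map_sub, ht, sub_self]

theorem eq_cst (F : KPoly K 1 N ⊗[K] V →ₗ[K] W) (hl : ∀ x, F ((lam 0 : KPoly K 1 N) • x) = 0)
    (ht : ∀ i x, F ((theta 0 i : KPoly K 1 N) • x) = 0) (x) : F x = F (1 ⊗ₜ[K] cst x) := by
  refine LinearMap.congr_fun (hom_ext (g := F ∘ₗ TensorProduct.mk K _ V 1 ∘ₗ cst) fun μ v => ?_) x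
  rw [LinearMap.comp_apply, LinearMap.comp_apply, cst_mono]
  split_ifs with h
  · rw [h, mono_zero]; rfl
  rw [map_zero, map_zero]
  by_cases h0 : μ.1 0 = 0
  · have h1 : μ.1 = 0 := funext fun k => by rw [Subsingleton.elim k 0]; exact h0
    have h2 : μ.2.Nonempty := by
      rw [Finset.nonempty_iff_ne_empty]
      exact fun h2 => h (Prod.ext h1 h2)
    have h3 : (mono μ : KPoly K 1 N) = theta 0 (ofLex (μ.2.min' h2)).2 *
        thetaPart (μ.2.erase (μ.2.min' h2)) := by
      have := thetaPart_insert (K := K) (h := μ.2.min' h2) (t := μ.2.erase (μ.2.min' h2))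
        fun x hx => μ.2.min'_lt_of_mem_erase_min' h2 hx
      rw [Finset.insert_erase (μ.2.min'_mem h2),
        Subsingleton.elim (ofLex (μ.2.min' h2)).1 0] at this
      rw [mono_eq, h1, lamPart_zero, one_mul, this]
    rw [h3]
    exact ht _ (_ ⊗ₜ v)
  · have h1 : μ = ((μ.1 - Pi.single 0 1) + Pi.single 0 1, μ.2) := by
      refine Prod.ext (funext fun k => ?_) rfl
      rw [Subsingleton.elim k 0]
      simp only [Pi.add_apply, Pi.sub_apply, Pi.single_eq_same]
      omega
    rw [h1, ← lam_mul_mono 0 (μ.1 - Pi.single 0 1, μ.2)]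
    exact hl (_ ⊗ₜ v)

end KPoly

end

section
section Involutions

variable {K : Type*} [Field K] {V : Type*} [AddCommGroup V] [Module K V] {f : Module.End K V}

theorem pow_val_add (h : f * f = 1) (p q : ZMod 2) : f ^ (p + q).val = f ^ p.val * f ^ q.val := by
  rcases zmod2_cases p with rfl | rfl <;> rcases zmod2_cases q with rfl | rfl <;>
    simp [h, ZMod.val_one, show (1 + 1 : ZMod 2) = 0 from rfl]

theorem pow_val_natCast (h : f * f = 1) (n : ℕ) : f ^ (n : ZMod 2).val = f ^ n := by
  induction n with
  | zero => simp
  | succ n ih => rw [Nat.cast_add, pow_val_add h, ih, pow_succ, Nat.cast_one, ZMod.val_one, pow_one]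

end Involutions

namespace KPoly

variable {K : Type*} [Field K] {n N : ℕ}

/-- `a ↦ (-1)^{q p(a)} a`. -/
def ivp (q : ZMod 2) : Module.End K (KPoly K n N) := inv.toLinearMap ^ q.val

theorem inv_sq : (inv.toLinearMap * inv.toLinearMap : Module.End K (KPoly K n N)) = 1 :=
  LinearMap.ext inv_inv

theorem ivp_add (p q : ZMod 2) (a : KPoly K n N) : ivp (p + q) a = ivp p (ivp q a) := by
  rw [ivp, pow_val_add inv_sq]; rfl

theorem ivp_zero (a : KPoly K n N) : ivp 0 a = a := by simp [ivp]

theorem ivp_one (a : KPoly K n N) : ivp 1 a = inv a := by simp [ivp, ZMod.val_one]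

theorem ivp_mul (q : ZMod 2) (a b : KPoly K n N) : ivp q (a * b) = ivp q a * ivp q b := by
  rcases zmod2_cases q with rfl | rfl <;> simp [ivp_zero, ivp_one]

end KPoly

namespace HKMod

variable {K : Type*} [Field K] [CharZero K] {n m N : ℕ} {V W : Type*} [AddCommGroup V] [Module K V]
  [AddCommGroup W] [Module K W]
variable (M : HKMod K N V)

/-- `a ↦ (-1)^{q p(a)} a`. -/
def ep (q : ZMod 2) : Module.End K V := M.eps ^ q.val

theorem eps_sq : M.eps * M.eps = 1 := LinearMap.ext M.eps_eps

theorem ep_add (p q : ZMod 2) (a : V) : M.ep (p + q) a = M.ep p (M.ep q a) := by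
  rw [ep, pow_val_add M.eps_sq]; rfl

theorem ep_zero (a : V) : M.ep 0 a = a := by simp [ep]

theorem ep_one (a : V) : M.ep 1 a = M.eps a := by simp [ep, ZMod.val_one]

theorem ep_of_mem {p : ZMod 2} {a : V} (h : a ∈ M.gr p) (q : ZMod 2) :
    M.ep q a = sg K (q * p) • a := by
  rcases zmod2_cases q with rfl | rfl
  · simp [ep_zero, sg_zero]
  · rw [ep_one, M.eps_of_mem h, one_mul]

theorem ep_self (q : ZMod 2) (a : V) : M.ep q (M.ep q a) = a := by
  rw [← ep_add, CharTwo.add_self_eq_zero, ep_zero]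

/-- The supermodule with the parity shifted by `N + 1`. -/
abbrev sh : HKMod K N V := M.shift (N + 1)

theorem mem_sh {p : ZMod 2} {a : V} (h : a ∈ M.gr p) : a ∈ M.sh.gr (p + (N + 1)) := by
  suffices key : a ∈ M.gr (p + (N + 1) + (N + 1)) from key
  rwa [add_assoc, CharTwo.add_self_eq_zero, add_zero]

theorem sh_eps (a : V) : M.sh.eps a = sg K (N + 1) • M.eps a := by
  refine M.hom_induction (C := fun a => M.sh.eps a = sg K (N + 1) • M.eps a) (fun p a h => ?_)
    (fun a b ha hb => by rw [map_add, map_add, smul_add, ha, hb]) a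
  rw [M.eps_of_mem h, M.sh.eps_of_mem (M.mem_sh h), smul_smul, ← sg_add, add_comm]

theorem sh_epsT (a b : V) : M.sh.epsT 2 (t2 K a b) = t2 K (M.eps a) (M.eps b) := by
  rw [epsT_t2, sh_eps, sh_eps, t2_smul_left, t2_smul_right, smul_smul, sg_mul_self, one_smul]

theorem sh_epsT_pow (k : ℕ) (a b : V) :
    (M.sh.epsT 2 ^ k) (t2 K a b) = t2 K (M.ep k a) (M.ep k b) := by
  rw [ep, pow_val_natCast M.eps_sq]
  induction k with
  | zero => rfl
  | succ k ih => rw [pow_succ', Module.End.mul_apply, ih, sh_epsT, pow_succ']; rfl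

/-- The function `ζ_{1,2}^1 ⋯ ζ_{1,2}^N / z_{1,2}`. -/
def e01 : OT K N (Star 2) := OT.zt 0 1 * OT.u 0 1 s01

/-- `∫ [a_Λ b] + a b`. -/
def J (br : V →ₗ[K] V →ₗ[K] KPoly K 1 N ⊗[K] V) (mu : V →ₗ[K] V →ₗ[K] V) :
    V →ₗ[K] V →ₗ[K] KPoly K 1 N ⊗[K] V :=
  mu.compr₂ (TensorProduct.mk K _ V 1) + br.compr₂ integralLam

theorem J_apply (br : V →ₗ[K] V →ₗ[K] KPoly K 1 N ⊗[K] V) (mu : V →ₗ[K] V →ₗ[K] V) (a b : V) :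
    J br mu a b = 1 ⊗ₜ[K] mu a b + integralLam (br a b) := rfl

section J
variable {br : V →ₗ[K] V →ₗ[K] KPoly K 1 N ⊗[K] V} {mu : V →ₗ[K] V →ₗ[K] V}

theorem dTV_J (i : Fin N) (a b : V) : KPoly.dTV 0 i (J br mu a b) = 0 := by
  rw [J_apply, map_add, (KPoly.integralLam_props _).1, KPoly.dTV_tmul, KPoly.dTheta_one]
  simp

theorem dLV_J (a b : V) : KPoly.dLV 0 (J br mu a b) = KPoly.topc (br a b) := by
  rw [J_apply, map_add, (KPoly.integralLam_props _).2.1, KPoly.dLV_tmul, KPoly.dLam_one]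
  simp

theorem cst_J (a b : V) : KPoly.cst (J br mu a b) = mu a b := by
  rw [J_apply, map_add, (KPoly.integralLam_props _).2.2, KPoly.cst_one, add_zero]

end J

/-- The odd binary operation `X` is encoded by the bracket `br` and the product `mu`; `r` is a
sign. -/
structure Enc (r : K) (X : M.sh.Src (Star 2) →ₗ[K] M.sh.VNabla 2)
    (br : V →ₗ[K] V →ₗ[K] KPoly K 1 N ⊗[K] V) (mu : V →ₗ[K] V →ₗ[K] V) : Prop where
  op : M.sh.OpS (-1) X
  sq : r * r = 1
  one : ∀ a b, X (t2 K a b ⊗ₜ[K] 1) = M.sh.inc 1 (br (M.ep (N + 1) a) b)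
  pole : ∀ a b, X (t2 K a b ⊗ₜ[K] e01) = r • M.sh.inc 1 (J br mu (M.ep 1 a) (M.ep N b))

variable {M}

theorem OpS.zl {X : M.Src (Star 2) →ₗ[K] M.VNabla 2} (H : M.OpS (-1 : K) X) (L : List (Fin N))
    (v : Tens K V 2) (f : OT K N (Star 2)) : X (v ⊗ₜ[K] (OT.zl 0 1 L * f)) =
      (-1 : K) ^ L.length • M.inc 1 (KPoly.dP L (M.red 1 (X ((M.epsT 2 ^ L.length) v ⊗ₜ[K] f)))) := by
  induction L generalizing v with
  | nil => simp [OT.zl_nil, KPoly.dP, inc_red]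
  | cons i L ih =>
    have := fun x => (M.Z_inc (0 : Fin 1) x).2 i
    rw [OT.zl_cons, mul_assoc, H.zetaz, ih, map_smul, smul_smul, List.length_cons, pow_succ',
      pow_succ, KPoly.dP_cons]
    exact congrArg _ (this _)

variable (M) in
/-- The operators `∂_{θ^1} ⋯ ∂_{θ^N}` and the extraction of the coefficient of `θ^1 ⋯ θ^N` differ by
a sign. -/
theorem exists_sign : ∃ r : K, r * r = 1 ∧ ∀ x : KPoly K 1 N ⊗[K] V,
    -((-1 : K) ^ N • KPoly.dP (List.finRange N) x) = r • KPoly.topc x := by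
  obtain ⟨r, hr, h⟩ := KPoly.exists_dP (K := K) (N := N) (V := V)
  refine ⟨-((-1) ^ N * r), ?_, fun x => ?_⟩
  · rw [neg_mul_neg, mul_mul_mul_comm, hr, mul_one, ← mul_pow]; simp
  · rw [h, smul_smul]
    exact (neg_smul _ _).symm

theorem resLam_eq (x : KPoly K 1 N ⊗[K] V) : resLam x = KPoly.cst (KPoly.topc x) := by
  refine LinearMap.congr_fun (KPoly.hom_ext (g := KPoly.cst ∘ₗ KPoly.topc) fun μ v => ?_) x
  rw [LinearMap.comp_apply, KPoly.topc_mono, resLam, KPoly.onMon_mono]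
  have h : μ.1 0 = 0 ↔ μ.1 = 0 := ⟨fun h => funext fun k => by rwa [Subsingleton.elim k 0],
    fun h => by rw [h]; rfl⟩
  by_cases h2 : μ.2 = Finset.univ
  · rw [if_pos h2, KPoly.cst_mono]
    by_cases h1 : μ.1 = 0 <;> simp [h, h1, h2]
  · simp [h2]

theorem exists_enc {X : M.sh.Src (Star 2) →ₗ[K] M.sh.VNabla 2} (H : M.sh.OpS (-1) X) {r : K}
    (hr : r * r = 1) (h : ∀ x : KPoly K 1 N ⊗[K] V,
      -((-1 : K) ^ N • KPoly.dP (List.finRange N) x) = r • KPoly.topc x) :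
    M.Enc r X (M.bracketOf X) (M.mulOf X) := by
  have h1 : ∀ a b, M.bracketOf X a b = M.sh.red 1 (X (t2 K (M.ep (N + 1) a) b ⊗ₜ[K] 1)) := by
    intro a b
    have : M.ep ((N : ZMod 2) + 1) = M.eps ^ (N + 1) := by
      rw [ep, ← Nat.cast_add_one, pow_val_natCast M.eps_sq]
    rw [this]
    rfl
  have h2 : ∀ a b, M.mulOf X a b =
      -resLam (M.sh.red 1 (X (t2 K (M.ep (N + 1) a) b ⊗ₜ[K] OT.u 0 1 s01))) := by
    intro a b
    have : M.ep ((N : ZMod 2) + 1) = M.eps ^ (N + 1) := by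
      rw [ep, ← Nat.cast_add_one, pow_val_natCast M.eps_sq]
    rw [this]
    rfl
  have h3 : ∀ v f, X (v ⊗ₜ[K] (OT.zt 0 1 * f)) =
      -(r • M.sh.inc 1 (KPoly.topc (M.sh.red 1 (X ((M.sh.epsT 2 ^ N) v ⊗ₜ[K] f))))) := by
    intro v f
    have := H.zl (List.finRange N) v f
    rw [List.length_finRange] at this
    rw [← map_smul, ← h, map_neg, map_smul, neg_neg]
    exact this
  have hep : ∀ a : V, M.ep (N + 1) (M.ep 1 a) = M.ep N a := fun a => by
    rw [← ep_add, add_assoc, CharTwo.add_self_eq_zero, add_zero]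
  refine ⟨H, hr, fun a b => ?_, fun a b => ?_⟩
  · rw [h1, inc_red, ep_self]
  · rw [← map_smul, ← M.sh.inc_red (X _)]
    congr 1
    have e : ∀ i x, KPoly.dTV 0 i x = M.sh.red 1 (M.sh.Ztq 0 1 i (M.sh.inc 1 x)) := fun i x => by
      rw [← M.sh.red_inc (KPoly.dTV 0 i x), ← (M.sh.Z_inc (0 : Fin 1) x).2 i]; rfl
    have e' : ∀ x, KPoly.dLV 0 x = -M.sh.red 1 (M.sh.Zq 0 1 (M.sh.inc 1 x)) := fun x => by
      rw [← M.sh.red_inc (KPoly.dLV 0 x), ← neg_neg (M.sh.inc 1 _), ← (M.sh.Z_inc (0 : Fin 1) x).1,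
        map_neg]; rfl
    refine KPoly.eq_of_cst ?_ (fun i => ?_) ?_
    · rw [map_smul, dLV_J, e', inc_red, ← H.zz, e01, OT.zt, ← OT.zl_zz, OT.zz_u, ← OT.zt, h3, sh_epsT_pow, map_neg,
        neg_neg, map_smul, red_inc, h1, hep]
    · rw [map_smul, dTV_J, e, inc_red, smul_zero]
      have := H.zetaz 0 1 i (M.sh.epsT 2 (t2 K a b)) e01
      rw [epsT_epsT, neg_one_smul] at this
      rw [← neg_neg (M.sh.Ztq _ _ _ _), ← this, e01, OT.zt, ← mul_assoc, OT.zetaz_mul_zl _ _ _ _ (List.mem_finRange i)]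
      simp
    · rw [map_smul, cst_J, e01, h3, map_neg, map_smul, red_inc, map_neg, map_smul, ← resLam_eq, h2,
        sh_epsT_pow, hep, smul_neg]

end HKMod

end

section
namespace KPoly

variable {K : Type*} [Field K] [CharZero K] {n m N : ℕ} {V W : Type*} [AddCommGroup V] [Module K V]
  [AddCommGroup W] [Module K W]

theorem super_theta (i : Fin N) (a : KPoly K 1 N) :
    inv a * theta 0 i - theta 0 i * a = (2 : K) • (lam 0 * dTheta 0 i a) := by
  induction a using ind_left with
  | h1 => simp [dTheta_one]
  | hs r a h => rw [map_smul, map_smul, smul_mul_assoc, mul_smul_comm, ← smul_sub, h, mul_smul_comm,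
      smul_comm]
  | ha a b ha hb => rw [map_add, map_add, add_mul, mul_add, add_sub_add_comm, ha, hb, mul_add, smul_add]
  | hl k a h =>
    rw [Subsingleton.elim k 0, inv_mul_lam, dTheta_lam, mul_assoc, ← mul_assoc (theta 0 i), ← lam_theta, mul_assoc,
      ← mul_sub, h, mul_smul_comm]
  | ht k j a h =>
    rw [Subsingleton.elim k 0, inv_mul_theta, dTheta_theta, neg_mul, mul_assoc, eq_add_of_sub_eq h, mul_add, mul_smul_comm]
    have e : ∀ b : KPoly K 1 N, theta 0 j * (lam 0 * b) = lam 0 * (theta 0 j * b) := fun b => by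
      rw [← mul_assoc, ← lam_theta, mul_assoc]
    rw [e, ← mul_assoc (theta 0 j) (theta 0 i), ← mul_assoc (theta 0 i) (theta 0 j)]
    by_cases hij : i = j
    · subst hij
      rw [theta_sq, if_pos ⟨rfl, rfl⟩, mul_sub, neg_mul]
      module
    · rw [theta_anti (fun h => hij h.2), if_neg (fun h => hij h.2), neg_mul, zero_sub, mul_neg]
      module

theorem inv_mono (μ : Mon n N) : inv (mono μ : KPoly K n N) = (-1 : K) ^ μ.2.card • mono μ := by
  have h : ∀ L : List (Fin n ×ₗ Fin N),
      inv (L.map fun j => theta (ofLex j).1 (ofLex j).2).prod = (-1 : K) ^ L.length •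
        ((L.map fun j => theta (ofLex j).1 (ofLex j).2).prod : KPoly K n N) := fun L => by
    induction L with
    | nil => simp
    | cons j L ih =>
      rw [List.map_cons, List.prod_cons, inv_mul_theta, ih, List.length_cons, pow_succ', mul_smul_comm,
        neg_one_mul]
      exact (neg_smul _ _).symm
  have h' : ∀ L : List (KPoly K n N), (∀ x ∈ L, inv x = x) → inv L.prod = L.prod := fun L hL => by
    rw [map_list_prod]
    congr 1
    exact (List.map_congr_left hL).trans (List.map_id _)
  rw [mono, monoIn, map_mul, h, h', mul_smul_comm, Finset.length_sort]
  intro x hx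
  obtain ⟨k, rfl⟩ := List.mem_ofFn.1 hx
  rw [map_pow]
  congr 1
  simp [inv]

end KPoly

namespace OT

variable {K : Type*} [Field K] [CharZero K] {N : ℕ}

theorem dzeta_e01 (i : Fin N) : dzeta 0 i (HKMod.e01 : OT K N (Star 2)) + dzeta 1 i HKMod.e01 = 0 := by
  have h : ∀ (L : List (Fin N)) (f : OT K N (Star 2)), dzeta 0 i (zl 0 1 L * f) + dzeta 1 i (zl 0 1 L * f) =
      (-1 : K) ^ L.length • (zl 0 1 L * (dzeta 0 i f + dzeta 1 i f)) := fun L f => by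
    induction L with
    | nil => simp [zl_nil]
    | cons j L ih =>
      have e : -(zetaz 0 1 j * (dzeta 0 i (zl 0 1 L * f) + dzeta 1 i (zl 0 1 L * f))) =
          (-1 : K) ^ (L.length + 1) • (zl 0 1 (j :: L) * (dzeta 0 i f + dzeta 1 i f)) := by
        rw [ih, mul_smul_comm, pow_succ', neg_one_mul, zl_cons, mul_assoc]
        exact (neg_smul _ _).symm
      rw [List.length_cons, ← e, zl_cons, mul_assoc, dzeta_zetaz_mul, dzeta_zetaz_mul, mul_add]
      simp only [KPoly.dl, if_true, if_neg zero_ne_one, if_neg one_ne_zero]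
      module
  have h1 := dzeta_u_pow (K := K) 0 0 1 i HKMod.s01 1
  have h2 := dzeta_u_pow (K := K) 1 0 1 i HKMod.s01 1
  rw [pow_one] at h1 h2
  rw [HKMod.e01, zt, h, h1, h2, mul_add, mul_smul_comm, mul_smul_comm, ← zt, zt_mul_zetaz]
  simp

end OT

namespace HKMod

variable {K : Type*} [Field K] [CharZero K] {n m N : ℕ} {V W : Type*} [AddCommGroup V] [Module K V]
  [AddCommGroup W] [Module K W]
variable (M : HKMod K N V)

theorem SL_eq (i : Fin N) (x : KPoly K 1 N ⊗[K] V) : M.SL i x =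
    (2 : K) • (KPoly.lam 0 : KPoly K 1 N) • KPoly.dTV 0 i x +
      TensorProduct.map KPoly.inv.toLinearMap (M.S i) x := by
  induction x with
  | zero => simp
  | add x y hx hy => rw [map_add, hx, hy, map_add, map_add, smul_add, smul_add]; abel
  | tmul a v =>
    rw [SL, LinearMap.add_apply]
    congr 1
    rw [KPoly.dTV_tmul, TensorProduct.smul_tmul', TensorProduct.smul_tmul', smul_eq_mul, ← KPoly.super_theta,
      Fin.sum_univ_one]
    rfl

theorem cst_map (f : V →ₗ[K] W) (x : KPoly K 1 N ⊗[K] V) :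
    KPoly.cst (TensorProduct.map KPoly.inv.toLinearMap f x) = f (KPoly.cst x) := by
  refine LinearMap.congr_fun (KPoly.hom_ext
    (f := KPoly.cst ∘ₗ TensorProduct.map KPoly.inv.toLinearMap f) (g := f ∘ₗ KPoly.cst)
    fun μ v => ?_) x
  rw [LinearMap.comp_apply, LinearMap.comp_apply, TensorProduct.map_tmul, AlgHom.toLinearMap_apply,
    KPoly.inv_mono, ← TensorProduct.smul_tmul', map_smul, KPoly.cst_mono, KPoly.cst_mono]
  split_ifs with h
  · simp [h]
  · simp

theorem cst_lam (x : KPoly K 1 N ⊗[K] V) :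
    KPoly.cst ((KPoly.lam 0 : KPoly K 1 N) • x) = 0 := by
  refine LinearMap.congr_fun (KPoly.hom_ext (f := KPoly.cst ∘ₗ lmul (KPoly.lam 0)) (g := 0)
    fun μ v => ?_) x
  rw [LinearMap.comp_apply, lmul_tmul, KPoly.lam_mul_mono, KPoly.cst_mono, if_neg]
  · rfl
  · intro h
    simpa using congrFun (congrArg Prod.fst h) 0

theorem cst_SL (i : Fin N) (x : KPoly K 1 N ⊗[K] V) :
    KPoly.cst (M.SL i x) = M.S i (KPoly.cst x) := by
  rw [SL_eq, map_add, map_smul, cst_lam, smul_zero, zero_add, cst_map]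

theorem card_univ_lex : (Finset.univ : Finset (Fin 1 ×ₗ Fin N)).card = N := by
  rw [Finset.card_univ]
  simp [Fintype.card_lex]

theorem integralLam_map (f : V →ₗ[K] W) (x : KPoly K 1 N ⊗[K] V) :
    integralLam (TensorProduct.map KPoly.inv.toLinearMap f x) =
      (-1 : K) ^ N • TensorProduct.map KPoly.inv.toLinearMap f (integralLam x) := by
  refine LinearMap.congr_fun (KPoly.hom_ext
    (f := integralLam ∘ₗ TensorProduct.map KPoly.inv.toLinearMap f)
    (g := (-1 : K) ^ N • TensorProduct.map KPoly.inv.toLinearMap f ∘ₗ integralLam)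
    fun μ v => ?_) x
  rw [LinearMap.comp_apply, LinearMap.smul_apply, LinearMap.comp_apply, TensorProduct.map_tmul,
    AlgHom.toLinearMap_apply, KPoly.inv_mono, ← TensorProduct.smul_tmul', map_smul,
    KPoly.integralLam_mono, KPoly.integralLam_mono]
  split_ifs with h
  · rw [h, card_univ_lex, map_smul, TensorProduct.map_tmul, AlgHom.toLinearMap_apply, KPoly.inv_mono]
    simp
  · simp

theorem SL_integralLam (i : Fin N) (x : KPoly K 1 N ⊗[K] V) :
    integralLam (M.SL i x) = (-1 : K) ^ N • M.SL i (integralLam x) := by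
  rw [SL_eq, SL_eq, map_add, integralLam_map, (KPoly.integralLam_props x).1, smul_zero, smul_zero,
    zero_add, map_smul]
  convert zero_add _
  rw [smul_eq_zero]
  right
  refine LinearMap.congr_fun (KPoly.hom_ext (f := integralLam ∘ₗ lmul (KPoly.lam 0) ∘ₗ KPoly.dTV 0 i) (g := 0)
    fun μ v => ?_) x
  rw [LinearMap.comp_apply, LinearMap.comp_apply, KPoly.dTV_tmul, KPoly.dTheta_mono]
  split_ifs with h
  · rw [← TensorProduct.smul_tmul', map_smul, map_smul, lmul_tmul, KPoly.lam_mul_mono,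
      KPoly.integralLam_mono, if_neg]
    · simp
    · intro h'
      exact Finset.notMem_erase (toLex (0, i)) μ.2 (by
        have h' : μ.2.erase (toLex (0, i)) = Finset.univ := h'
        rw [h']; exact Finset.mem_univ _)
  · simp

theorem SL_one (i : Fin N) (v : V) : M.SL i ((1 : KPoly K 1 N) ⊗ₜ[K] v) = 1 ⊗ₜ[K] M.S i v := by
  rw [SL_eq, KPoly.dTV_tmul, KPoly.dTheta_one]
  simp

/-- The conditions on a bracket and a product that do not involve compositions. -/
structure Base (br : V →ₗ[K] V →ₗ[K] KPoly K 1 N ⊗[K] V) (mu : V →ₗ[K] V →ₗ[K] V) : Prop where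
  par : ∀ a b, M.epsL (br a b) = sg K N • br (M.eps a) (M.eps b)
  left : ∀ i a b, br (M.S i a) b = -(sg K N • (KPoly.theta 0 i : KPoly K 1 N) • br a b)
  right : ∀ i a b, br (M.eps a) (M.S i b) =
    sg K N • ((KPoly.theta 0 i : KPoly K 1 N) • br a b + M.SL i (br a b))
  mul : ∀ a b, M.eps (mu a b) = mu (M.eps a) (M.eps b)
  der : ∀ i a b, M.S i (mu a b) = mu (M.S i a) b + mu (M.eps a) (M.S i b)

variable {M}
variable {br br' : V →ₗ[K] V →ₗ[K] KPoly K 1 N ⊗[K] V} {mu mu' : V →ₗ[K] V →ₗ[K] V} {r : K}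
  {X X' : M.sh.Src (Star 2) →ₗ[K] M.sh.VNabla 2}

theorem sh_epsL (x : KPoly K n N ⊗[K] V) : M.sh.epsL x = sg K (N + 1) • M.epsL x := by
  induction x with
  | zero => simp
  | add x y hx hy => rw [map_add, map_add, hx, hy, smul_add]
  | tmul a v => rw [epsL_tmul, epsL_tmul, sh_eps, TensorProduct.tmul_smul]

theorem ep_S (q : ZMod 2) (i : Fin N) (a : V) : M.ep q (M.S i a) = sg K q • M.S i (M.ep q a) := by
  rcases zmod2_cases q with rfl | rfl
  · simp [ep_zero, sg_zero]
  · simp [ep_one, eps_S, sg_one]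

theorem ep_eps (q : ZMod 2) (a : V) : M.ep q (M.eps a) = M.eps (M.ep q a) := by
  rw [← ep_one, ← ep_one, ← ep_add, ← ep_add, add_comm]

theorem sh_S : M.sh.S = M.S := rfl

theorem sh_SL : M.sh.SL (n := n) = M.SL := rfl

theorem sg_N1 : sg K (N + 1 : ZMod 2) = -sg K N := by
  rw [sg_add, sg_one, mul_neg_one]

theorem sgN : sg K (N : ZMod 2) * sg K (N : ZMod 2) = 1 := sg_mul_self K _

theorem theta_sum_inc (i : Fin N) (x : KPoly K 1 N ⊗[K] V) :
    (KPoly.theta 0 i : KPoly K 2 N) • M.inc 1 x + (KPoly.theta 1 i : KPoly K 2 N) • M.inc 1 x =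
      -M.inc 1 (M.SL i x) := by
  have h1 := M.inc_lastTheta i x
  have h2 := M.inc_smul (KPoly.theta 0 i) x
  rw [KPoly.up_theta] at h2
  rw [lastTheta, LinearMap.sub_apply, LinearMap.neg_apply, Fin.sum_univ_one, map_sub, map_neg] at h1
  refine (congrArg₂ (· + ·) h2.symm h1.symm).trans ?_
  rw [add_sub_assoc', add_neg_eq_zero.2, zero_sub]
  rfl

theorem theta1_inc (i : Fin N) (x : KPoly K 1 N ⊗[K] V) :
    (KPoly.theta 1 i : KPoly K 2 N) • M.inc 1 x =
      -M.inc 1 ((KPoly.theta 0 i : KPoly K 1 N) • x + M.SL i x) := by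
  have h2 := M.inc_smul (KPoly.theta 0 i) x
  rw [KPoly.up_theta] at h2
  rw [map_add, h2, neg_add, ← theta_sum_inc]
  simp

theorem theta0_inc (i : Fin N) (x : KPoly K 1 N ⊗[K] V) :
    (KPoly.theta 0 i : KPoly K 2 N) • M.inc 1 x = M.inc 1 ((KPoly.theta 0 i : KPoly K 1 N) • x) := by
  rw [M.inc_smul, KPoly.up_theta]; rfl

theorem Enc.base (E : M.Enc r X br mu) : M.Base br mu := by
  have inj := M.sh.inc_injective (n := 1)
  have hr : r ≠ 0 := fun h => by simpa [h] using E.sq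
  have p1 : ∀ a b, br (M.eps a) (M.eps b) = sg K N • M.epsL (br a b) := fun a b => by
    have := E.op.eps (t2 K (M.ep (N + 1) a) b) 1
    rw [sh_epsT, map_one, E.one, E.one, Pq_inc, ep_eps, ep_self, ← map_smul] at this
    rw [inj this, sh_epsL, sg_N1]
    module
  have p4 : ∀ a b, M.epsL (J br mu a b) = J br mu (M.eps a) (M.eps b) := fun a b => by
    have := E.op.eps (t2 K (M.ep 1 a) (M.ep N b)) e01
    have hi : OT.inv (e01 : OT K N (Star 2)) = (-1 : K) ^ N • e01 := by
      rw [e01, map_mul, OT.zt, OT.inv_zl, OT.inv_u, smul_mul_assoc, List.length_finRange]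
    rw [sh_epsT, hi, TensorProduct.tmul_smul, map_smul, E.pole, E.pole, map_smul, Pq_inc, ep_eps,
      ep_eps, ep_self, ep_self, smul_comm _ r, smul_comm _ r] at this
    have := smul_right_injective _ hr this
    rw [← map_smul (M.sh.inc 1), ← map_smul (M.sh.inc 1)] at this
    have := inj this
    rw [sh_epsL, sg_N1, ← sg_natCast] at this
    replace this := congrArg (sg K (N : ZMod 2) • ·) this
    simp only [smul_smul, sgN, one_smul] at this
    rw [this, neg_one_mul, neg_neg, sgN, one_smul]
  have p5 : ∀ i a b, M.SL i (J br mu a b) = J br mu (M.S i a) b + J br mu (M.eps a) (M.S i b) :=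
      fun i a b => by
    have h0 := E.op.dzeta 0 i (t2 K (M.ep 1 a) (M.ep N b)) e01
    have h1 := E.op.dzeta 1 i (t2 K (M.ep 1 a) (M.ep N b)) e01
    have h := congrArg₂ (· + ·) h0 h1
    simp only [neg_one_smul, sub_neg_eq_add] at h
    have hs : ∀ v : Tens K V 2, X (v ⊗ₜ[K] OT.dzeta 0 i e01) + X (v ⊗ₜ[K] OT.dzeta 1 i e01) = 0 :=
      fun v => by
        rw [← map_add, ← TensorProduct.tmul_add, OT.dzeta_e01, TensorProduct.tmul_zero, map_zero]
    rw [add_add_add_comm, hs, zero_add, SAt0_t2, SAt1_t2, sh_eps, ← ep_one, ep_self, t2_smul_left,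
      ← TensorProduct.smul_tmul', map_smul, E.pole, E.pole, E.pole, sh_S, ep_S, ep_S, ep_self, ep_self,
      smul_comm _ r, smul_comm _ r, smul_comm _ r, ← smul_add, ← smul_add, theta_sum_inc, sh_SL] at h
    have := smul_right_injective _ hr h
    rw [← map_smul (M.sh.inc 1), ← map_add, ← map_neg (M.sh.inc 1)] at this
    have := inj this
    rw [sg_one, map_smul, map_smul, LinearMap.smul_apply, sg_N1, smul_smul, neg_mul, sgN, ep_one] at this
    rw [← neg_eq_iff_eq_neg.2 this]
    module
  refine ⟨fun a b => ?_, fun i a b => ?_, fun i a b => ?_, fun a b => ?_, fun i a b => ?_⟩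
  · rw [p1, smul_smul, sgN, one_smul]
  · have := E.op.dzeta 0 i (t2 K (M.ep (N + 1) a) b) 1
    rw [OT.dzeta_one, TensorProduct.tmul_zero, map_zero, zero_sub, neg_one_smul, neg_neg, E.one,
      SAt0_t2, E.one, ep_self, theta0_inc] at this
    have := inj this
    rw [sh_S, ep_S, ep_self, map_smul, LinearMap.smul_apply, sg_N1] at this
    rw [← this, smul_smul, mul_neg, sgN]
    module
  · have := E.op.dzeta 1 i (t2 K (M.ep (N + 1) a) b) 1
    rw [OT.dzeta_one, TensorProduct.tmul_zero, map_zero, zero_sub, neg_one_smul, neg_neg, E.one,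
      SAt1_t2, E.one, ep_self, theta1_inc, ← map_neg] at this
    have := inj this
    rw [sh_S, sh_SL, sh_eps, map_smul, ep_eps, ep_self, map_smul, LinearMap.smul_apply, sg_N1] at this
    rw [neg_eq_iff_eq_neg.1 this.symm, smul_neg, smul_smul, mul_neg, sgN]
    module
  · have := congrArg KPoly.cst (p4 a b)
    rwa [epsL, cst_map, cst_J, cst_J] at this
  · have := congrArg KPoly.cst (p5 i a b)
    rwa [cst_SL, map_add, cst_J, cst_J, cst_J] at this

end HKMod

end

section
namespace HKMod

variable {K : Type*} [Field K] [CharZero K] {n m N : ℕ} {V W : Type*} [AddCommGroup V] [Module K V]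
  [AddCommGroup W] [Module K W]
variable {M : HKMod K N V}
variable {br br' : V →ₗ[K] V →ₗ[K] KPoly K 1 N ⊗[K] V} {mu mu' : V →ₗ[K] V →ₗ[K] V} {r : K}
  {X X' : M.sh.Src (Star 2) →ₗ[K] M.sh.VNabla 2}

theorem t2_induction {C : Tens K V 2 → Prop} (h : ∀ a b, C (t2 K a b))
    (ha : ∀ v w, C v → C w → C (v + w)) (v) : C v := by
  induction v using PiTensorProduct.induction_on with
  | smul_tprod s v => rw [t2_eq, ← t2_smul_left]; exact h _ _
  | add v w hv hw => exact ha v w hv hw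

theorem Enc.unique (E : M.Enc r X br mu) (E' : M.Enc r X br' mu') : br = br' ∧ mu = mu' := by
  have hr : r ≠ 0 := fun h => by simpa [h] using E.sq
  have h1 : br = br' := LinearMap.ext₂ fun a b => M.sh.inc_injective (by
    have := (E.one (M.ep (N + 1) a) b).symm.trans (E'.one (M.ep (N + 1) a) b)
    rwa [ep_self] at this)
  refine ⟨h1, LinearMap.ext₂ fun a b => ?_⟩
  have := (E.pole (M.ep 1 a) (M.ep N b)).symm.trans (E'.pole (M.ep 1 a) (M.ep N b))
  have := congrArg KPoly.cst (M.sh.inc_injective (smul_right_injective _ hr this))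
  rwa [cst_J, cst_J, ep_self, ep_self] at this

theorem Enc.ext (E : M.Enc r X br mu) (E' : M.Enc r X' br mu) : X = X' := by
  have := (E.op.add E'.op.neg).eq_zero_two (t2_induction (fun a b => ?_) fun v w hv hw => ?_)
  · rwa [← sub_eq_add_neg, sub_eq_zero] at this
  · have := (E.pole a b).trans (E'.pole a b).symm
    rw [e01] at this
    rw [LinearMap.add_apply, this, LinearMap.neg_apply, add_neg_cancel]
  · rw [TensorProduct.add_tmul, map_add, hv, hw, add_zero]

theorem Cl_apply (x0 : M.Fm) (L : List (Fin N)) (v : Tens K V 2) : M.opD.Cl L x0 v =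
    (-1 : K) ^ L.length • M.inc 1 (KPoly.dP L (M.red 1 (x0 ((M.epsT 2 ^ L.length) v)))) := by
  induction L generalizing v with
  | nil => simp [DMod.Cl_nil, KPoly.dP, inc_red]
  | cons i L ih =>
    have := fun x => (M.Z_inc (0 : Fin 1) x).2 i
    rw [DMod.Cl_cons]
    refine (M.opC_apply i _ v).trans ?_
    rw [ih, map_smul, List.length_cons, pow_succ', pow_succ, KPoly.dP_cons, mul_smul, neg_one_smul]
    congr 2
    exact this _

theorem Base.J_S (B : M.Base br mu) (i : Fin N) (a b : V) :
    M.SL i (J br mu a b) = J br mu (M.S i a) b + J br mu (M.eps a) (M.S i b) := by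
  rw [J_apply, J_apply, J_apply, map_add, SL_one, B.der, TensorProduct.tmul_add, B.left, B.right,
    smul_add, map_add, map_neg, map_smul integralLam _ (M.SL i _), SL_integralLam, sg_natCast, smul_smul,
    ← mul_pow, neg_one_mul, neg_neg, one_pow, one_smul]
  abel

theorem Base.J_eps (B : M.Base br mu) (a b : V) :
    M.epsL (J br mu a b) = J br mu (M.eps a) (M.eps b) := by
  have h : br (M.eps a) (M.eps b) = (-1 : K) ^ N • M.epsL (br a b) := by
    rw [B.par, sg_natCast, smul_smul, ← mul_pow, neg_one_mul, neg_neg, one_pow, one_smul]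
  rw [J_apply, J_apply, map_add, epsL_tmul, map_one, B.mul, h, map_smul, epsL, integralLam_map,
    smul_smul, ← mul_pow, neg_one_mul, neg_neg, one_pow, one_smul]

theorem Base.exists_op (hN : 0 < N) (B : M.Base br mu) (hr : r * r = 1)
    (h : ∀ x : KPoly K 1 N ⊗[K] V,
      -((-1 : K) ^ N • KPoly.dP (List.finRange N) x) = r • KPoly.topc x) :
    ∃ X, M.Enc r X br mu := by
  let x0 : M.sh.Fm := lift2 (br.compr₂ (M.sh.inc 1) ∘ₗ M.ep (N + 1))
  let y : M.sh.Fm := lift2 (r • ((J br mu).compr₂ (M.sh.inc 1)).compl₁₂ (M.ep 1) (M.ep N))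
  have hx : ∀ a b, x0 (t2 K a b) = M.sh.inc 1 (br (M.ep (N + 1) a) b) := fun a b => lift2_t2 _ _ _
  have hy : ∀ a b, y (t2 K a b) = r • M.sh.inc 1 (J br mu (M.ep 1 a) (M.ep N b)) :=
    fun a b => lift2_t2 _ _ _
  have hk : ∀ k : Fin 2, k = 0 ∨ k = 1 := by decide
  refine Exists.elim (M.sh.exists_op hN x0 y ?_ ?_ ?_ ?_ ?_ ?_) fun X hX =>
    ⟨X, hX.1, hr, fun a b => (hX.2.1 _).trans (hx a b), fun a b => (hX.2.2 _).trans (hy a b)⟩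
  · intro k i v
    induction v using t2_induction with
    | ha v w hv hw => rw [map_add, map_add, hv, hw, map_add, smul_add]
    | h a b =>
      rcases hk k with rfl | rfl
      · rw [SAt0_t2, hx, hx, theta0_inc, sh_S, ep_S, map_smul, LinearMap.smul_apply, B.left, sg_N1]
        congr 1
        rw [smul_neg, smul_smul, neg_mul, sgN]
        simp
      · rw [SAt1_t2, hx, hx, theta1_inc, sh_S, sh_SL, sh_eps, map_smul, ep_eps, map_smul,
          LinearMap.smul_apply, B.right, sg_N1, ← map_neg]
        congr 1
        rw [smul_smul, neg_mul, sgN]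
        simp [add_comm]
  · intro v
    induction v using t2_induction with
    | ha v w hv hw => rw [map_add, map_add, hv, hw, map_add, map_add, neg_add]
    | h a b =>
      rw [sh_epsT, hx, hx, Pq_inc, sh_epsL, B.par, sg_N1, ep_eps, ← map_neg]
      congr 1
      rw [smul_smul, neg_mul, sgN]
      module
  · intro i v
    induction v using t2_induction with
    | ha v w hv hw => rw [map_add, map_add, hv, hw, add_zero]
    | h a b =>
      have := fun x => (M.sh.Z_inc (0 : Fin 1) x).2 i
      rw [hy, map_smul]
      refine (congrArg _ (this _)).trans ?_
      rw [dTV_J, map_zero, smul_zero]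
  · refine ext2 fun a b => ?_
    have := fun x => (M.sh.Z_inc (0 : Fin 1) x).1
    rw [Cl_apply, List.length_finRange, sh_epsT_pow, hx, red_inc, ← ep_add, opZ_apply, hy, map_smul]
    refine (congrArg _ (this _)).trans ?_
    rw [dLV_J, smul_neg, ← map_smul (M.sh.inc 1), ← map_smul (M.sh.inc 1), ← h, ← map_neg, neg_neg, add_right_comm (N : ZMod 2),
      CharTwo.add_self_eq_zero (N : ZMod 2), zero_add (1 : ZMod 2)]
  · intro i v
    induction v using t2_induction with
    | ha v w hv hw =>
      rw [map_add, map_add, map_add, map_add, add_add_add_comm, hv, hw, map_add, smul_add, smul_add]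
      abel
    | h a b =>
      rw [SAt0_t2, SAt1_t2, hy, hy, hy, smul_comm _ r, smul_comm _ r, ← smul_add, ← smul_add,
        theta_sum_inc, sh_SL, B.J_S, ← map_add, ← map_neg (M.sh.inc 1), sh_S, sh_eps, ep_S, ep_S, map_smul (M.ep 1)]
      congr 2
      rw [ep_eps, sg_N1, sg_one]
      simp only [map_smul, LinearMap.smul_apply]
      match_scalars
      · ring
      · linear_combination -sgN (K := K) (N := N)
  · intro v
    induction v using t2_induction with
    | ha v w hv hw => rw [map_add, map_add, hv, hw, map_add, map_add, smul_add, neg_add]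
    | h a b =>
      rw [sh_epsT, hy, hy, map_smul, Pq_inc, sh_epsL, B.J_eps, ep_eps, ep_eps, ← sg_natCast, sg_N1,
        map_smul (M.sh.inc 1)]
      match_scalars
      linear_combination -r * sgN (K := K) (N := N)

end HKMod

end

section
namespace KPoly

variable {K : Type*} [Field K] [CharZero K] {n m N : ℕ} {V W W' : Type*} [AddCommGroup V] [Module K V]

theorem algHom_ext_one {A : Type*} [Ring A] [Algebra K A] {f g : KPoly K 1 N →ₐ[K] A}
    (hl : f (lam 0) = g (lam 0)) (ht : ∀ i, f (theta 0 i) = g (theta 0 i)) : f = g := by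
  refine AlgHom.ext fun a => ?_
  induction a using ind_left with
  | h1 => rw [map_one, map_one]
  | hs r a h => rw [map_smul, map_smul, h]
  | ha a b ha hb => rw [map_add, map_add, ha, hb]
  | hl k a h => rw [Subsingleton.elim k 0, map_mul, map_mul, hl, h]
  | ht k i a h => rw [Subsingleton.elim k 0, map_mul, map_mul, ht, h]

theorem up_eq_var : (up : KPoly K 1 N →ₐ[K] KPoly K 2 N) = var 0 :=
  algHom_ext_one (by rw [up_lam, var_lam]; rfl) fun i => by rw [up_theta, var_theta]; rfl

theorem fib_comp_var (c : Fin n → Fin m) (k : Fin m) (l : Fin n) (h : ∀ j, c j = k ↔ j = l) :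
    (fib c).comp (var k) = (var l : KPoly K 1 N →ₐ[K] KPoly K n N) := by
  have hf : (Finset.univ.filter fun j => c j = k) = {l} := by ext; simp [h]
  refine algHom_ext_one ?_ fun i => ?_
  · rw [AlgHom.comp_apply, var_lam, fib_lam, hf, Finset.sum_singleton, var_lam]
  · rw [AlgHom.comp_apply, var_theta, fib_theta, hf, Finset.sum_singleton, var_theta]

variable [AddCommGroup W] [Module K W] [Module (KPoly K m N) W] [IsScalarTower K (KPoly K m N) W]
  [AddCommGroup W'] [Module K W'] [Module (KPoly K n N) W'] [IsScalarTower K (KPoly K n N) W']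

/-- `a v ↦ (-1)^{q p(a)} φ(a) f(v)`. -/
def ext (q : ZMod 2) (φ : KPoly K 1 N →ₐ[K] KPoly K m N) (f : V →ₗ[K] W) :
    KPoly K 1 N ⊗[K] V →ₗ[K] W :=
  TensorProduct.lift (LinearMap.lcomp K _ f ∘ₗ (Algebra.lsmul K K W).toLinearMap ∘ₗ
    φ.toLinearMap ∘ₗ ivp q)

theorem ext_tmul (q : ZMod 2) (φ : KPoly K 1 N →ₐ[K] KPoly K m N) (f : V →ₗ[K] W)
    (a : KPoly K 1 N) (v : V) : ext q φ f (a ⊗ₜ[K] v) = φ (ivp q a) • f v := rfl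

theorem ext_comp (q : ZMod 2) (φ : KPoly K 1 N →ₐ[K] KPoly K m N) (f : V →ₗ[K] W)
    (F : W →ₗ[K] W') (η : KPoly K m N →ₐ[K] KPoly K n N) (h : ∀ a w, F (a • w) = η a • F w) (x) :
    F (ext q φ f x) = ext q (η.comp φ) (F ∘ₗ f) x := by
  induction x with
  | zero => simp
  | add x y hx hy => rw [map_add, map_add, hx, hy, map_add]
  | tmul a v => rw [ext_tmul, h, ext_tmul]; rfl

theorem ext_smul (q : ZMod 2) (φ : KPoly K 1 N →ₐ[K] KPoly K m N) (f : V →ₗ[K] W) (a : KPoly K 1 N)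
    (x) : ext q φ f (a • x) = φ (ivp q a) • ext q φ f x := by
  induction x with
  | zero => simp
  | add x y hx hy => rw [smul_add, map_add, map_add, hx, hy, smul_add]
  | tmul b v => rw [TensorProduct.smul_tmul', smul_eq_mul, ext_tmul, ext_tmul, ivp_mul, map_mul, mul_smul]

theorem ext_map (q e : ZMod 2) (φ : KPoly K 1 N →ₐ[K] KPoly K m N) (f : V →ₗ[K] W) (x) :
    ext q φ f (TensorProduct.map (ivp e) LinearMap.id x) = ext (q + e) φ f x := by
  induction x with
  | zero => simp
  | add x y hx hy => rw [map_add, map_add, hx, hy, map_add]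
  | tmul b v => rw [TensorProduct.map_tmul, ext_tmul, ext_tmul, ivp_add]; rfl

theorem extPoly_var (q : ZMod 2) (k : Fin 2) (f : V →ₗ[K] KPoly K 2 N ⊗[K] V) (x) :
    HKMod.extPoly q f (HKMod.inVar k x) = ext q (var k) f x := by
  have h : ∀ a : KPoly K 1 N, ivp q (var k a) = var k (ivp q a) := fun a => by
    rcases zmod2_cases q with rfl | rfl
    · rw [ivp_zero, ivp_zero]
    · rw [ivp_one, ivp_one]
      refine AlgHom.congr_fun (algHom_ext_one (f := inv.comp (var k)) (g := (var k).comp inv) ?_ fun i => ?_) a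
      · simp [var_lam, inv]
      · simp [var_theta, inv]
  induction x with
  | zero => simp
  | add x y hx hy => rw [map_add, map_add, hx, hy, map_add]
  | tmul b v => rw [ext_tmul, ← h]; rfl

end KPoly

namespace HKMod

variable {K : Type*} [Field K] [CharZero K] {n m N : ℕ} {V W : Type*} [AddCommGroup V] [Module K V]
  [AddCommGroup W] [Module K W] [Module (KPoly K m N) W] [IsScalarTower K (KPoly K m N) W]
variable {M : HKMod K N V}
variable {br br' : V →ₗ[K] V →ₗ[K] KPoly K 1 N ⊗[K] V} {mu mu' : V →ₗ[K] V →ₗ[K] V} {r : K}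
  {X X' : M.sh.Src (Star 2) →ₗ[K] M.sh.VNabla 2}

theorem map_ep {P : ZMod 2} {x : KPoly K 1 N ⊗[K] V} (hx : M.epsL x = sg K P • x) (e : ZMod 2) :
    TensorProduct.map LinearMap.id (M.ep e) x =
      sg K (e * P) • TensorProduct.map (KPoly.ivp e) LinearMap.id x := by
  rcases zmod2_cases e with rfl | rfl
  · have h1 : M.ep 0 = LinearMap.id := LinearMap.ext M.ep_zero
    have h2 : (KPoly.ivp 0 : Module.End K (KPoly K 1 N)) = LinearMap.id := LinearMap.ext KPoly.ivp_zero
    rw [h1, h2, zero_mul, sg_zero, one_smul]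
  · rw [one_mul, ← map_smul, ← hx]
    clear hx
    induction x with
    | zero => simp
    | add x y hx hy => rw [map_add, hx, hy, map_add, map_add]
    | tmul a v => rw [epsL_tmul, TensorProduct.map_tmul, TensorProduct.map_tmul, KPoly.ivp_one,
        KPoly.inv_inv, ep_one]; rfl

theorem ext_ep {P : ZMod 2} {x : KPoly K 1 N ⊗[K] V} (hx : M.epsL x = sg K P • x) (q e : ZMod 2)
    (φ : KPoly K 1 N →ₐ[K] KPoly K m N) (f : V →ₗ[K] W) :
    KPoly.ext q φ (f ∘ₗ M.ep e) x = sg K (e * P) • KPoly.ext (q + e) φ f x := by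
  rw [← KPoly.ext_map, ← map_smul, ← map_ep hx]
  clear hx
  induction x with
  | zero => simp
  | add x y hx hy => rw [map_add, hx, hy, map_add, map_add]
  | tmul a v => rfl

theorem fibQ_swap_inc (x : KPoly K 1 N ⊗[K] V) :
    M.fibQ (Equiv.swap (0 : Fin 2) 1) (M.inc 1 x) = M.inc 1 (M.negSubst x) := by
  induction x with
  | zero => simp
  | add x y hx hy => rw [map_add, map_add, hx, hy, map_add, map_add]
  | tmul a v =>
    have h1 : M.negSubst (a ⊗ₜ[K] v) = M.redHom (KPoly.var (Fin.last 1) a) (1 ⊗ₜ[K] v) := rfl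
    have h2 := AlgHom.congr_fun (KPoly.fib_comp_var (K := K) (N := N) (Equiv.swap (0 : Fin 2) 1) 0 1
      (by decide)) a
    rw [h1, inc_redHom, inc_tmul, inc_tmul, fibQ_smul, fibQ_iv, map_one, one_smul, KPoly.up_eq_var]
    exact congrArg (· • _) h2

theorem cst_negSubst_integralLam (x : KPoly K 1 N ⊗[K] V) :
    KPoly.cst (M.negSubst (integralLam x)) = -integral (-M.T) 0 x := by
  have h : ∀ k v, KPoly.cst (M.negSubst ((KPoly.lam 0 ^ k : KPoly K 1 N) ⊗ₜ[K] v)) =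
      ((-M.T) ^ k) v := fun k v => by
    have h1 : ∀ y : KPoly K 1 N ⊗[K] V, KPoly.cst (M.lastLam y) = -M.T (KPoly.cst y) := fun y => by
      have h0 : KPoly.cst (M.TL y) = M.T (KPoly.cst y) := LinearMap.congr_fun (KPoly.hom_ext
        (f := KPoly.cst ∘ₗ M.TL) (g := M.T ∘ₗ KPoly.cst) fun μ v => by
          rw [LinearMap.comp_apply, LinearMap.comp_apply, TL, TensorProduct.map_tmul,
            LinearMap.id_apply, KPoly.cst_mono, KPoly.cst_mono]
          split_ifs <;> simp) y
      rw [lastLam, LinearMap.sub_apply, LinearMap.neg_apply, Fin.sum_univ_one, map_sub, map_neg]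
      have e : KPoly.cst (lmul (KPoly.lam 0 : KPoly K 1 N) y) = 0 := cst_lam y
      rw [e, neg_zero, zero_sub, h0]
    have h2 : M.negSubst ((KPoly.lam 0 ^ k : KPoly K 1 N) ⊗ₜ[K] v) = (M.lastLam ^ k) (1 ⊗ₜ[K] v) := by
      have : M.negSubst ((KPoly.lam 0 ^ k : KPoly K 1 N) ⊗ₜ[K] v) =
        M.redHom (KPoly.var (Fin.last 1) (KPoly.lam 0 ^ k)) (1 ⊗ₜ[K] v) := rfl
      rw [this, map_pow, KPoly.var_lam, map_pow, redHom, KPoly.lift_lam, Fin.snoc_last]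
    rw [h2]
    clear h2
    induction k with
    | zero => exact KPoly.cst_one v
    | succ k ih => rw [pow_succ', Module.End.mul_apply, h1, ih, pow_succ']; rfl
  refine LinearMap.congr_fun (KPoly.hom_ext (f := KPoly.cst ∘ₗ M.negSubst ∘ₗ integralLam)
    (g := -integral (-M.T) 0) fun μ v => ?_) x
  rw [LinearMap.comp_apply, LinearMap.comp_apply, KPoly.integralLam_mono, LinearMap.neg_apply, integral,
    KPoly.onMon_mono]
  split_ifs
  · rw [map_smul, map_smul, ← KPoly.lam_pow_eq, h, zero_pow (Nat.succ_ne_zero _), zero_sub, smul_neg,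
      LinearMap.neg_apply, neg_neg]; rfl
  · simp

theorem OT_map_swap_e01 : OT.map (Equiv.swap (0 : Fin 2) 1) (star_perm _) (e01 : OT K N (Star 2)) =
    sg K (N + 1) • e01 := by
  have h : ∀ L : List (Fin N), (OT.zl 1 0 L : OT K N (Star 2)) = (-1 : K) ^ L.length • OT.zl 0 1 L :=
    fun L => by
      induction L with
      | nil => simp [OT.zl_nil]
      | cons i L ih =>
        rw [OT.zl_cons, ih, OT.zetaz_swap, OT.zl_cons, List.length_cons, pow_succ', mul_smul_comm,
          neg_one_mul, neg_mul, smul_neg]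
        exact (neg_smul _ _).symm
  rw [e01, map_mul, OT.zt, OT.map_zl, OT.map_u]
  have h1 := h (List.finRange N)
  rw [List.length_finRange, ← sg_natCast] at h1
  have h2 := OT.u_swap (K := K) (N := N) (E := Star 2) 0 1 s01 s01.symm
  refine (congrArg₂ (· * ·) h1 h2).trans ?_
  rw [mul_neg, smul_mul_assoc, sg_N1]
  exact (neg_smul _ _).symm

end HKMod

end

section
namespace HKMod

variable {K : Type*} [Field K] [CharZero K] {n m N : ℕ} {V W : Type*} [AddCommGroup V] [Module K V]
  [AddCommGroup W] [Module K W] [Module (KPoly K m N) W] [IsScalarTower K (KPoly K m N) W]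
variable {M : HKMod K N V}
variable {br br' : V →ₗ[K] V →ₗ[K] KPoly K 1 N ⊗[K] V} {mu mu' : V →ₗ[K] V →ₗ[K] V} {r : K}
  {X X' : M.sh.Src (Star 2) →ₗ[K] M.sh.VNabla 2}

section
variable {p q : ZMod 2} {a b : V}

theorem Enc.one_of_mem (E : M.Enc r X br mu) (ha : a ∈ M.gr p) (b : V) :
    X (t2 K a b ⊗ₜ[K] 1) = sg K ((N + 1) * p) • M.sh.inc 1 (br a b) := by
  rw [E.one, M.ep_of_mem ha, map_smul, LinearMap.smul_apply, map_smul]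

theorem Enc.pole_of_mem (E : M.Enc r X br mu) (ha : a ∈ M.gr p) (hb : b ∈ M.gr q) :
    X (t2 K a b ⊗ₜ[K] e01) = (r * sg K (p + N * q)) • M.sh.inc 1 (J br mu a b) := by
  rw [E.pole, M.ep_of_mem ha, M.ep_of_mem hb, LinearMap.map_smul₂, map_smul (J br mu a),
    smul_smul, ← sg_add, map_smul, one_mul, smul_smul]

theorem Enc.symAct_one (E : M.Enc r X br mu) (ha : a ∈ M.gr p) (hb : b ∈ M.gr q) :
    M.sh.symAct (Equiv.swap 0 1) X (t2 K a b ⊗ₜ[K] 1) =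
      sg K ((N + 1) * p) • M.sh.inc 1 (-(sg K (p * q + N) • M.negSubst (br b a))) := by
  have e : ∀ n p q : ZMod 2, (p + (n + 1)) * (q + (n + 1)) + (n + 1) * q =
    (n + 1) * p + (p * q + n + 1) := by decide
  rw [symAct_tmul, M.sh.koszul_swap (M.mem_sh ha) (M.mem_sh hb), map_one, ← TensorProduct.smul_tmul',
    map_smul, map_smul, E.one_of_mem hb, map_smul, smul_smul, ← sg_add, e, sg_add, mul_smul,
    sg_add _ (p * q + _), sg_one, mul_neg_one, fibQ_swap_inc, ← map_smul (M.sh.inc 1)]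
  congr 2
  exact neg_smul _ _

theorem Enc.symAct_pole (E : M.Enc r X br mu) (ha : a ∈ M.gr p) (hb : b ∈ M.gr q) :
    M.sh.symAct (Equiv.swap 0 1) X (t2 K a b ⊗ₜ[K] e01) =
      (r * sg K (p + N * q)) • M.sh.inc 1 (sg K (p * q) • M.negSubst (J br mu b a)) := by
  have e : ∀ n p q : ZMod 2, (p + (n + 1)) * (q + (n + 1)) + (n + 1) + (q + n * p) =
    p + n * q + p * q := by decide
  rw [symAct_tmul, M.sh.koszul_swap (M.mem_sh ha) (M.mem_sh hb), OT_map_swap_e01, ← TensorProduct.smul_tmul',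
    TensorProduct.tmul_smul, map_smul, map_smul, map_smul, map_smul, E.pole_of_mem hb ha, map_smul,
    fibQ_swap_inc, map_smul (M.sh.inc 1), mul_comm r, mul_comm r, mul_smul, mul_smul, smul_smul, smul_smul,
    smul_smul, smul_smul, smul_smul, ← sg_add, ← sg_add, e, mul_right_comm,
    ← sg_add]
  rfl

end

/-- The symmetry of a binary operation is equivalent to skew-symmetry of the bracket and
quasi-commutativity of the product. -/
theorem Enc.sym_iff (E : M.Enc r X br mu) : M.sh.symAct (Equiv.swap 0 1) X = X ↔
    (∀ p q, ∀ a ∈ M.gr p, ∀ b ∈ M.gr q, br b a = -(sg K (p * q + N) • M.negSubst (br a b))) ∧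
    ∀ p q, ∀ a ∈ M.gr p, ∀ b ∈ M.gr q,
      mu a b - sg K (p * q) • mu b a = integral (-M.T) 0 (br a b) := by
  have inj := M.sh.inc_injective (n := 1)
  have hr : r ≠ 0 := fun h => by simpa [h] using E.sq
  have hs : ∀ p : ZMod 2, sg K p ≠ 0 := fun p h => by simpa [h] using sg_mul_self K p
  have hcst : ∀ a b, KPoly.cst (M.negSubst (J br mu a b)) = mu a b - integral (-M.T) 0 (br a b) := by
    intro a b
    have : M.negSubst ((1 : KPoly K 1 N) ⊗ₜ[K] mu a b) =
        M.redHom (KPoly.var (Fin.last 1) 1) (1 ⊗ₜ[K] mu a b) := rfl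
    rw [J_apply, map_add, map_add, cst_negSubst_integralLam, this, map_one, map_one,
      Module.End.one_apply, KPoly.cst_one, sub_eq_add_neg]
  refine ⟨fun h => ⟨fun p q a ha b hb => ?_, fun p q a ha b hb => ?_⟩, fun ⟨h1, h2⟩ => ?_⟩
  · have := (E.symAct_one hb ha).symm.trans ((LinearMap.congr_fun h _).trans (E.one_of_mem hb a))
    rw [← inj (smul_right_injective _ (hs _) this), mul_comm]
  · have := (E.symAct_pole hb ha).symm.trans ((LinearMap.congr_fun h _).trans (E.pole_of_mem hb ha))
    have := congrArg KPoly.cst (inj (smul_right_injective _ (mul_ne_zero hr (hs _)) this))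
    rw [map_smul, hcst, cst_J, mul_comm q] at this
    rw [← this, smul_smul, sg_mul_self, one_smul, sub_sub_cancel]
  · have Hs : M.sh.OpS (-1) (M.sh.symAct (Equiv.swap 0 1) X + -X) :=
      (E.op.symAct M.sh.koszulCompat_swap).add E.op.neg
    have key : M.sh.symAct (Equiv.swap 0 1) X + -X = 0 := by
      have z1 : ∀ v : Tens K V 2, (M.sh.symAct (Equiv.swap 0 1) X + -X) (v ⊗ₜ[K] 1) = 0 := by
        intro v
        refine LinearMap.congr_fun (M.hext2 (f := (M.sh.symAct (Equiv.swap 0 1) X + -X) ∘ₗ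
          (TensorProduct.mk K _ _).flip 1) (g := 0) fun p q a ha b hb => ?_) v
        rw [LinearMap.comp_apply, LinearMap.flip_apply, TensorProduct.mk_apply, LinearMap.add_apply,
          E.symAct_one ha hb, LinearMap.neg_apply, E.one_of_mem ha, h1 q p b hb a ha, mul_comm q,
          add_neg_cancel]; rfl
      refine Hs.eq_zero_two fun v => ?_
      refine LinearMap.congr_fun (M.hext2 (f := (M.sh.symAct (Equiv.swap 0 1) X + -X) ∘ₗ
          (TensorProduct.mk K _ _).flip (OT.zt 0 1 * OT.u 0 1 s01)) (g := 0)
          fun p q a ha b hb => ?_) v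
      suffices ky : (M.sh.symAct (Equiv.swap 0 1) X + -X) (t2 K a b ⊗ₜ[K] e01) = 0 from ky
      rw [← M.sh.inc_red ((M.sh.symAct (Equiv.swap 0 1) X + -X) (t2 K a b ⊗ₜ[K] e01)),
        KPoly.eq_cst_of_d (x := M.sh.red 1 _), LinearMap.add_apply,
        E.symAct_pole ha hb, LinearMap.neg_apply, E.pole_of_mem ha hb]
      · simp only [map_add, map_neg, map_smul, red_inc, hcst, cst_J]
        rw [← h2 q p b hb a ha, sub_sub_cancel, mul_comm q, smul_smul (sg K _), sg_mul_self, one_smul,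
          add_neg_cancel, TensorProduct.tmul_zero, map_zero]
      · have := (M.sh.Z_inc (0 : Fin 1) (M.sh.red 1
          ((M.sh.symAct (Equiv.swap 0 1) X + -X) (t2 K a b ⊗ₜ[K] e01)))).1
        rw [inc_red] at this
        apply inj
        rw [map_zero, ← neg_eq_zero]
        refine this.symm.trans ((Hs.zz 0 1 _ _).symm.trans ?_)
        have e := Hs.zl (List.finRange N) (t2 K a b) 1
        rw [z1] at e
        rw [e01, OT.zt, ← OT.zl_zz, OT.zz_u, e]
        simp
      · intro i
        have := (M.sh.Z_inc (0 : Fin 1) (M.sh.red 1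
          ((M.sh.symAct (Equiv.swap 0 1) X + -X) (t2 K a b ⊗ₜ[K] e01)))).2 i
        rw [inc_red] at this
        apply inj
        rw [map_zero]
        refine this.symm.trans ?_
        have := Hs.zetaz 0 1 i (M.sh.epsT 2 (t2 K a b)) e01
        rw [epsT_epsT, neg_one_smul] at this
        refine (neg_eq_iff_eq_neg.1 this.symm).trans ?_
        rw [e01, OT.zt, ← mul_assoc, OT.zetaz_mul_zl _ _ _ _ (List.mem_finRange i)]
        simp
    rwa [← sub_eq_add_neg, sub_eq_zero] at key

end HKMod

end

section
namespace HKMod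

variable {K : Type*} [Field K] [CharZero K] {n m N : ℕ} {V W : Type*} [AddCommGroup V] [Module K V]
  [AddCommGroup W] [Module K W] [Module (KPoly K m N) W] [IsScalarTower K (KPoly K m N) W]
variable {M : HKMod K N V}

section Fibres

theorem fibQ_inc_var (d : Fin 3 → Fin 2) (l : Fin 2) (h : ∀ j, d j = 0 ↔ j = l.castSucc)
    (x : KPoly K 1 N ⊗[K] V) : M.fibQ d (M.inc 1 x) = M.inc 2 (inVar l x) := by
  induction x with
  | zero => simp
  | add x y hx hy => rw [map_add, map_add, hx, hy, map_add, map_add]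
  | tmul a v =>
    have h1 : inVar l (a ⊗ₜ[K] v) = KPoly.var l a ⊗ₜ[K] v := rfl
    have h2 : (KPoly.up.comp (KPoly.var l) : KPoly K 1 N →ₐ[K] KPoly K 3 N) = KPoly.var l.castSucc :=
      KPoly.algHom_ext_one (by rw [AlgHom.comp_apply, KPoly.var_lam, KPoly.up_lam, KPoly.var_lam])
        fun i => by rw [AlgHom.comp_apply, KPoly.var_theta, KPoly.up_theta, KPoly.var_theta]
    rw [h1, inc_tmul, inc_tmul, fibQ_smul, fibQ_iv, KPoly.up_eq_var, ← AlgHom.comp_apply, ← AlgHom.comp_apply,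
      KPoly.fib_comp_var d 0 l.castSucc h, h2]

theorem fibQ_inc_sum (x : KPoly K 1 N ⊗[K] V) : M.fibQ c3 (M.inc 1 x) = M.inc 2 (inSum x) := by
  induction x with
  | zero => simp
  | add x y hx hy => rw [map_add, map_add, hx, hy, map_add, map_add]
  | tmul a v =>
    have h1 : inSum (a ⊗ₜ[K] v) = KPoly.fib (fun _ : Fin 2 => 0) a ⊗ₜ[K] v := rfl
    have h2 : (KPoly.up.comp (KPoly.fib fun _ : Fin 2 => 0) : KPoly K 1 N →ₐ[K] KPoly K 3 N) =
        (KPoly.fib c3).comp KPoly.up := by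
      have e0 : (Finset.univ.filter fun k => c3 k = Fin.castSucc (0 : Fin 1)) = {0, 1} := by decide
      refine KPoly.algHom_ext_one ?_ fun i => ?_
      · rw [AlgHom.comp_apply, AlgHom.comp_apply, KPoly.fib_lam, KPoly.up_lam, KPoly.fib_lam, e0]
        simp [Fin.sum_univ_two, KPoly.up_lam]
      · rw [AlgHom.comp_apply, AlgHom.comp_apply, KPoly.fib_theta, KPoly.up_theta, KPoly.fib_theta, e0]
        simp [Fin.sum_univ_two, KPoly.up_theta]
    rw [h1, inc_tmul, inc_tmul, fibQ_smul, fibQ_iv, ← AlgHom.comp_apply, ← h2]; rfl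

theorem fibQ_inc_cst (d : Fin n → Fin 2) (h : ∀ j, d j ≠ 0) (x : KPoly K 1 N ⊗[K] V) :
    M.fibQ d (M.inc 1 x) = M.iv n (KPoly.cst x) := by
  have hf : (Finset.univ.filter fun k => d k = Fin.castSucc (0 : Fin 1)) = ∅ :=
    Finset.filter_eq_empty_iff.2 fun j _ => h j
  refine (KPoly.eq_cst (M.fibQ d ∘ₗ M.inc 1) (fun x => ?_) (fun i x => ?_) x).trans ?_
  · rw [LinearMap.comp_apply, inc_smul, KPoly.up_lam, fibQ_smul, KPoly.fib_lam, hf, Finset.sum_empty, zero_smul]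
  · rw [LinearMap.comp_apply, inc_smul, KPoly.up_theta, fibQ_smul, KPoly.fib_theta, hf, Finset.sum_empty, zero_smul]
  · rw [LinearMap.comp_apply, inc_tmul, map_one, one_smul, fibQ_iv]

end Fibres

section Outer
variable {X : M.Src (Star 2) →ₗ[K] M.VNabla 2} (H : M.OpS (-1 : K) X) {g : OT K N A3}

theorem Th_inc_lam (c : V) (x : KPoly K 1 N ⊗[K] V) (g : OT K N A3) :
    Th H c (M.inc 1 ((KPoly.lam 0 : KPoly K 1 N) • x)) g =
      (KPoly.lam 0 : KPoly K 3 N) • Th H c (M.inc 1 x) g - Th H c (M.inc 1 x) (OT.dz 0 g) := by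
  rw [inc_smul, KPoly.up_lam]
  exact Th_lam H c 0 _ g

theorem Th_inc_theta (h : ∀ i, OT.dzeta 0 i g = 0) (c : V) (i : Fin N) (x : KPoly K 1 N ⊗[K] V) :
    Th H c (M.inc 1 ((KPoly.theta 0 i : KPoly K 1 N) • x)) g =
      -((KPoly.theta 0 i : KPoly K 3 N) • Th H c (M.inc 1 x) g) := by
  have := Th_theta' H c 0 i (M.inc 1 x) g
  rw [Fin.castSucc_zero, h, map_zero, map_zero, map_zero, zero_sub] at this
  rw [inc_smul, KPoly.up_theta]
  exact this

/-- The value of an outer operation on a function that does not depend on the first variable. -/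
theorem Th_ext (h0 : OT.dz 0 g = 0) (h : ∀ i, OT.dzeta 0 i g = 0) (c : V) (x : KPoly K 1 N ⊗[K] V) :
    Th H c (M.inc 1 x) g =
      KPoly.ext 1 (KPoly.var (0 : Fin 3)) (LinearMap.applyₗ g ∘ₗ phi X c) x := by
  induction x with
  | zero => simp
  | add x y hx hy => rw [map_add, map_add, map_add, LinearMap.add_apply, hx, hy]
  | tmul a v =>
    induction a using KPoly.ind_left with
    | h1 =>
      rw [inc_tmul, map_one, one_smul, Th_iv, KPoly.ext_tmul, KPoly.ivp_one, map_one, map_one, one_smul]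
      exact (phi_apply X c v g).symm
    | hs s a ha => rw [← TensorProduct.smul_tmul', map_smul, map_smul, map_smul, LinearMap.smul_apply, ha]
    | ha a b ha hb => rw [TensorProduct.add_tmul, map_add, map_add, map_add, LinearMap.add_apply, ha, hb]
    | hl k a ha =>
      have := Th_inc_lam H c (a ⊗ₜ[K] v) g
      rw [h0, map_zero, sub_zero, ha] at this
      rw [Subsingleton.elim k 0]
      refine this.trans ?_
      have e := KPoly.ext_smul 1 (KPoly.var (0 : Fin 3)) (LinearMap.applyₗ g ∘ₗ phi X c) (KPoly.lam 0) (a ⊗ₜ[K] v)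
      rw [KPoly.ivp_one, ← mul_one (KPoly.lam 0 : KPoly K 1 N), KPoly.inv_mul_lam, map_one, mul_one, KPoly.var_lam] at e
      exact e.symm
    | ht k i a ha =>
      have := Th_inc_theta H h c i (a ⊗ₜ[K] v)
      rw [ha] at this
      rw [Subsingleton.elim k 0]
      refine this.trans ?_
      have e := KPoly.ext_smul 1 (KPoly.var (0 : Fin 3)) (LinearMap.applyₗ g ∘ₗ phi X c) (KPoly.theta 0 i) (a ⊗ₜ[K] v)
      rw [KPoly.ivp_one, ← mul_one (KPoly.theta 0 i : KPoly K 1 N), KPoly.inv_mul_theta, map_one, mul_one, map_neg,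
        KPoly.var_theta] at e
      refine Eq.trans ?_ e.symm
      exact (neg_smul _ _).symm

/-- Only the constant term matters if the first variable is put to zero. -/
theorem fibQ_Th_cst (h0 : OT.dz 0 g = 0) (h : ∀ i, OT.dzeta 0 i g = 0) (e : Fin n → Fin 3)
    (he : ∀ j, e j ≠ 0) (c : V) (x : KPoly K 1 N ⊗[K] V) : M.fibQ e (Th H c (M.inc 1 x) g) =
      M.fibQ (c3 ∘ e) (X (t2 K (KPoly.cst x) c ⊗ₜ[K] OT.map c3 A3_c3 g)) := by
  have hf : (Finset.univ.filter fun k => e k = 0) = ∅ :=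
    Finset.filter_eq_empty_iff.2 fun j _ => he j
  refine (KPoly.eq_cst (M.fibQ e ∘ₗ LinearMap.applyₗ g ∘ₗ Th H c ∘ₗ M.inc 1)
    (fun x => ?_) (fun i x => ?_) x).trans ?_
  · refine (congrArg (M.fibQ e) (Th_inc_lam H c x g)).trans ?_
    rw [h0, map_zero, sub_zero, fibQ_smul, KPoly.fib_lam, hf, Finset.sum_empty, zero_smul]
  · refine (congrArg (M.fibQ e) (Th_inc_theta H h c i x)).trans ?_
    rw [map_neg, fibQ_smul, KPoly.fib_theta, hf, Finset.sum_empty, zero_smul, neg_zero]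
  · suffices key : M.fibQ e (Th H c (M.inc 1 (1 ⊗ₜ[K] KPoly.cst x)) g) =
      M.fibQ (c3 ∘ e) (X (t2 K (KPoly.cst x) c ⊗ₜ[K] OT.map c3 A3_c3 g)) from key
    rw [inc_tmul, map_one, one_smul, Th_iv, fibQ_comp]

/-- The powers of `λ` become derivatives if the first variable is put to zero. -/
theorem fibQ_Th_lam (e : Fin n → Fin 3) (he : ∀ j, e j ≠ 0) (c x : V) (k : ℕ) (g : OT K N A3) :
    M.fibQ e (Th H c (M.inc 1 ((KPoly.lam 0 ^ k : KPoly K 1 N) ⊗ₜ[K] x)) g) =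
      (-1 : K) ^ k • M.fibQ (c3 ∘ e)
        (X (t2 K x c ⊗ₜ[K] OT.map c3 A3_c3 ((OT.dz 0 ^ k) g))) := by
  have hf : (Finset.univ.filter fun k => e k = 0) = ∅ :=
    Finset.filter_eq_empty_iff.2 fun j _ => he j
  induction k generalizing g with
  | zero => rw [pow_zero, inc_tmul, map_one, one_smul, Th_iv, fibQ_comp, pow_zero, one_smul]; rfl
  | succ k ih =>
    have := Th_inc_lam H c ((KPoly.lam 0 ^ k : KPoly K 1 N) ⊗ₜ[K] x) g
    rw [TensorProduct.smul_tmul', smul_eq_mul, ← pow_succ'] at this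
    rw [this, map_sub, ih, fibQ_smul, KPoly.fib_lam, hf, Finset.sum_empty, zero_smul, zero_sub, pow_succ,
      mul_neg_one, pow_succ (OT.dz 0)]
    exact (neg_smul _ _).symm

end Outer

variable {br : V →ₗ[K] V →ₗ[K] KPoly K 1 N ⊗[K] V} {mu : V →ₗ[K] V →ₗ[K] V} {r : K}
  {X : M.sh.Src (Star 2) →ₗ[K] M.sh.VNabla 2}

theorem swap_left (hX : M.sh.symAct (Equiv.swap 0 1) X = X) {p : ZMod 2} {a : V} (ha : a ∈ M.gr p)
    (x : V) (f : OT K N (Star 2)) : X (t2 K x a ⊗ₜ[K] f) =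
      sg K ((p + (N + 1)) * (N + 1)) • M.sh.fibQ (Equiv.swap (0 : Fin 2) 1)
        (X (t2 K a (M.ep (p + (N + 1)) x) ⊗ₜ[K] OT.map (Equiv.swap (0 : Fin 2) 1) (star_perm _) f)) := by
  induction x using M.hom_induction with
  | ha x y hx hy =>
    rw [t2_add_left, TensorProduct.add_tmul, map_add, hx, hy, map_add, t2_add_right, TensorProduct.add_tmul,
      map_add, map_add, smul_add]
  | h s x hx =>
    have e : ∀ n p s : ZMod 2, (s + (n + 1)) * (p + (n + 1)) =
      (p + (n + 1)) * (n + 1) + (p + (n + 1)) * s := by decide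
    conv_lhs => rw [← hX]
    rw [symAct_tmul, M.sh.koszul_swap (M.mem_sh hx) (M.mem_sh ha), M.ep_of_mem hx, t2_smul_right,
      ← TensorProduct.smul_tmul', ← TensorProduct.smul_tmul', map_smul, map_smul, map_smul, map_smul,
      smul_smul, ← sg_add, e]

theorem box_t3 (H : M.sh.OpS (-1 : K) X) {p q s : ZMod 2} {a b c : V} (ha : a ∈ M.gr p) (hb : b ∈ M.gr q)
    (hc : c ∈ M.gr s) (f : OT K N (Star 3)) :
    M.sh.box (n := 1) (m := 1) 1 X X (t3 K a b c ⊗ₜ[K] f) =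
      comp H (ins c (t2 K a b) ⊗ₜ[K] f) +
      sg K ((p + (N + 1)) * (q + s)) • M.sh.fibQ rot (comp H (ins a (t2 K b c) ⊗ₜ[K] OT.map rot (star_perm _) f)) +
      sg K ((q + (N + 1)) * (s + (N + 1))) •
        M.sh.fibQ (Equiv.swap (1 : Fin 3) 2) (comp H (ins b (t2 K a c) ⊗ₜ[K]
          OT.map (Equiv.swap (1 : Fin 3) 2) (star_perm _) f)) := by
  have e : ∀ n p q s : ZMod 2, (p + (n + 1)) * (q + (n + 1)) + (p + (n + 1)) * (s + (n + 1)) =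
    (p + (n + 1)) * (q + s) := by decide
  rw [box_eq H, LinearMap.add_apply, LinearMap.add_apply, symAct_tmul, symAct_tmul,
    M.sh.koszul_rot (M.mem_sh ha) (M.mem_sh hb) (M.mem_sh hc),
    M.sh.koszul_swap12 (M.mem_sh ha) (M.mem_sh hb) (M.mem_sh hc), e]
  simp only [← TensorProduct.smul_tmul', map_smul, ins_t2]

theorem comp_one (H : M.sh.OpS (-1 : K) X) (c : V) (w : Tens K V 2) (f : OT K N A3) :
    comp H (ins c w ⊗ₜ[K] OT.map id A3_star f) = Th H c (X (w ⊗ₜ[K] 1)) f := by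
  have := comp_apply H c w 0 f
  rwa [pow_zero, mul_one, pow_zero] at this

end HKMod

end

section
namespace HKMod

variable {K : Type*} [Field K] [CharZero K] {n m N : ℕ} {V : Type*} [AddCommGroup V] [Module K V]
variable {M : HKMod K N V} {br : V →ₗ[K] V →ₗ[K] KPoly K 1 N ⊗[K] V} {mu : V →ₗ[K] V →ₗ[K] V} {r : K}
  {X : M.sh.Src (Star 2) →ₗ[K] M.sh.VNabla 2} {p q s P : ZMod 2} {a b c : V}
  {x : KPoly K 1 N ⊗[K] V}

theorem up_comp_var (l : Fin n) :
    (KPoly.up.comp (KPoly.var l) : KPoly K 1 N →ₐ[K] KPoly K (n + 1) N) = KPoly.var l.castSucc :=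
  KPoly.algHom_ext_one (by rw [AlgHom.comp_apply, KPoly.var_lam, KPoly.up_lam, KPoly.var_lam])
    fun i => by rw [AlgHom.comp_apply, KPoly.var_theta, KPoly.up_theta, KPoly.var_theta]

theorem inc_ext (e : ZMod 2) (l : Fin n) (f : V →ₗ[K] KPoly K n N ⊗[K] V) (x : KPoly K 1 N ⊗[K] V) :
    M.inc n (KPoly.ext e (KPoly.var l) f x) = KPoly.ext e (KPoly.var l.castSucc) (M.inc n ∘ₗ f) x := by
  rw [← up_comp_var]
  exact KPoly.ext_comp e (KPoly.var l) f (M.inc n) KPoly.up M.inc_smul x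

theorem fibQ_ext (e : ZMod 2) (d : Fin m → Fin n) (k : Fin n) (l : Fin m) (h : ∀ j, d j = k ↔ j = l)
    (f : V →ₗ[K] M.VNabla n) (x : KPoly K 1 N ⊗[K] V) :
    M.fibQ d (KPoly.ext e (KPoly.var k) f x) = KPoly.ext e (KPoly.var l) (M.fibQ d ∘ₗ f) x := by
  rw [← KPoly.fib_comp_var d k l h]
  exact KPoly.ext_comp e (KPoly.var k) f (M.fibQ d) (KPoly.fib d) (M.fibQ_smul d) x

theorem Base.par_of_mem (B : M.Base br mu) (ha : a ∈ M.gr p) (hb : b ∈ M.gr q) :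
    M.epsL (br a b) = sg K (p + q + N) • br a b := by
  rw [B.par, M.eps_of_mem ha, M.eps_of_mem hb, LinearMap.map_smul₂, map_smul (br a), smul_smul, smul_smul,
    ← sg_add, ← sg_add]
  congr 2
  ring

theorem Base.mul_mem (B : M.Base br mu) (ha : a ∈ M.gr p) (hb : b ∈ M.gr q) :
    mu a b ∈ M.gr (p + q) := by
  refine M.mem_gr_of_eps ?_
  rw [B.mul, M.eps_of_mem ha, M.eps_of_mem hb, LinearMap.map_smul₂, map_smul (mu a), smul_smul, ← sg_add]

theorem Enc.Th_one (E : M.Enc r X br mu) (hx : M.epsL x = sg K P • x) (c : V) :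
    Th E.op c (M.sh.inc 1 x) 1 = sg K ((N + 1) * P) •
      M.sh.inc 2 (extPoly N (inSum ∘ₗ br.flip c) (inVar 0 x)) := by
  have h : LinearMap.applyₗ (1 : OT K N A3) ∘ₗ phi X c =
      (M.sh.inc 2 ∘ₗ inSum ∘ₗ br.flip c) ∘ₗ M.ep (N + 1) := LinearMap.ext fun y => by
    refine (phi_apply X c y 1).trans ?_
    rw [map_one, E.one, fibQ_inc_sum]; rfl
  have e : ∀ n : ZMod 2, 1 + (n + 1) = n := by decide
  rw [Th_ext E.op (OT.dz_one _) (fun i => OT.dzeta_one _ _), h, ext_ep hx, e, KPoly.extPoly_var, inc_ext]; rfl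

theorem Enc.Th_one' (E : M.Enc r X br mu) (hX : M.sh.symAct (Equiv.swap 0 1) X = X)
    (hx : M.epsL x = sg K P • x) (hc : c ∈ M.gr s) (d : Fin 3 → Fin 3) (k l : Fin 2)
    (hd : ∀ j, d j = 0 ↔ j = k.castSucc) (hl : ∀ j, d j = 2 ↔ j = l.castSucc) :
    M.sh.fibQ d (Th E.op c (M.sh.inc 1 x) 1) =
      sg K ((s + (N + 1)) * (N + 1) + (N + 1) * s + (s + (N + 1)) * P) •
      M.sh.inc 2 (extPoly (s + N) (inVar l ∘ₗ br c) (inVar k x)) := by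
  have h : LinearMap.applyₗ (1 : OT K N A3) ∘ₗ phi X c =
      sg K ((s + (N + 1)) * (N + 1) + (N + 1) * s) •
        ((M.sh.fibQ c3 ∘ₗ M.sh.fibQ (Equiv.swap (0 : Fin 2) 1) ∘ₗ M.sh.inc 1 ∘ₗ br c) ∘ₗ
          M.ep (s + (N + 1))) := LinearMap.ext fun y => by
    refine (phi_apply X c y 1).trans ?_
    rw [map_one, swap_left hX hc, map_one, E.one_of_mem hc, map_smul, map_smul, map_smul, smul_smul,
      ← sg_add]; rfl
  have e : ∀ n s : ZMod 2, 1 + (s + (n + 1)) = s + n := by decide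
  have hsm : ∀ (t : K) (f : V →ₗ[K] M.sh.VNabla 3),
      KPoly.ext 1 (KPoly.var (0 : Fin 3)) (t • f) x = t • KPoly.ext 1 (KPoly.var (0 : Fin 3)) f x := by
    intro t f
    clear hx
    induction x with
    | zero => simp
    | add x y hx hy => rw [map_add, map_add, hx, hy, smul_add]
    | tmul b v => rw [KPoly.ext_tmul, KPoly.ext_tmul, LinearMap.smul_apply, smul_comm]
  rw [Th_ext E.op (OT.dz_one _) (fun i => OT.dzeta_one _ _), h, hsm, ext_ep hx, smul_smul, ← sg_add, map_smul,
    e, fibQ_ext _ d 0 k.castSucc hd, KPoly.extPoly_var, inc_ext]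
  congr 3
  refine LinearMap.ext fun y => ?_
  have hc3 : ∀ j : Fin 3, Equiv.swap (0 : Fin 2) 1 (c3 j) = 0 ↔ j = 2 := by decide
  rw [LinearMap.comp_apply, LinearMap.comp_apply, LinearMap.comp_apply, LinearMap.comp_apply, fibQ_comp,
    fibQ_comp]
  exact fibQ_inc_var _ l (fun j => (hc3 _).trans (hl j)) _

/-- The value on a function without poles gives the Jacobi identity. -/
theorem Enc.box_one (E : M.Enc r X br mu) (hX : M.sh.symAct (Equiv.swap 0 1) X = X)
    (ha : a ∈ M.gr p) (hb : b ∈ M.gr q) (hc : c ∈ M.gr s) :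
    M.sh.box (n := 1) (m := 1) 1 X X (t3 K a b c ⊗ₜ[K] 1) =
      sg K ((N + 1) * q + N * p + N) • M.sh.inc 2 (
        sg K (p * N + N) • extPoly N (inSum ∘ₗ br.flip c) (inVar 0 (br a b)) +
        sg K ((p + N) * (q + N)) • extPoly (q + N) (inVar 1 ∘ₗ br b) (inVar 0 (br a c)) -
        extPoly (p + N) (inVar 0 ∘ₗ br a) (inVar 1 (br b c))) := by
  have B := E.base
  have h1 : ∀ c' w, comp E.op (ins c' w ⊗ₜ[K] (1 : OT K N (Star 3))) =
      Th E.op c' (X (w ⊗ₜ[K] 1)) 1 := fun c' w => by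
    have := comp_one E.op c' w 1
    rwa [map_one] at this
  rw [box_t3 E.op ha hb hc, map_one, map_one, h1, h1, h1, E.one_of_mem ha, E.one_of_mem ha, E.one_of_mem hb]
  simp only [map_smul, LinearMap.smul_apply]
  rw [E.Th_one (B.par_of_mem ha hb), E.Th_one' hX (B.par_of_mem hb hc) ha rot 1 0 (by decide) (by decide),
    E.Th_one' hX (B.par_of_mem ha hc) hb (Equiv.swap 1 2) 0 1 (by decide) (by decide),
    map_sub, map_add, map_smul, map_smul, smul_sub, smul_add, smul_smul, smul_smul, smul_smul, smul_smul,
    smul_smul, smul_smul, smul_smul, ← sg_add, ← sg_add, ← sg_add, ← sg_add, ← sg_add, ← sg_add, ← sg_add]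
  have e1 : ∀ n p q : ZMod 2, (n + 1) * p + (n + 1) * (p + q + n) =
    (n + 1) * q + n * p + n + (p * n + n) := by decide
  have e2 : ∀ n p q s : ZMod 2, (p + (n + 1)) * (q + s) + (n + 1) * q + ((p + (n + 1)) * (n + 1) + (n + 1) * p +
    (p + (n + 1)) * (q + s + n)) = (n + 1) * q + n * p + n + 1 := by decide
  have e3 : ∀ n p q s : ZMod 2, (q + (n + 1)) * (s + (n + 1)) + (n + 1) * p + ((q + (n + 1)) * (n + 1) + (n + 1) * q +
    (q + (n + 1)) * (p + s + n)) = (n + 1) * q + n * p + n + ((p + n) * (q + n)) := by decide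
  rw [e1, e2, e3, sg_add _ _ 1, sg_one, mul_neg_one]
  module

end HKMod

end

section
theorem sg_cancel {K : Type*} [Field K] (p : ZMod 2) (t : K) : sg K p * (sg K p * t) = t := by
  rw [← mul_assoc, sg_mul_self, one_mul]

namespace OT

variable {K : Type*} [Field K] [CharZero K] {N n m : ℕ} {E : Fin n → Fin n → Prop}
  {E' : Fin m → Fin m → Prop}

/-- The function `ζ_{k,l}^1 ⋯ ζ_{k,l}^N / z_{k,l}`. -/
def ez (k l : Fin n) (h : E k l) : OT K N E := zt k l * u k l h

theorem map_zt (c : Fin n → Fin m) (hc : ∀ k l, E k l → E' (c k) (c l)) (k l : Fin n) :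
    map c hc (zt k l : OT K N E) = zt (c k) (c l) := map_zl c hc k l _

theorem map_ez (c : Fin n → Fin m) (hc : ∀ k l, E k l → E' (c k) (c l)) (k l : Fin n) (h : E k l) :
    map c hc (ez k l h : OT K N E) = ez (c k) (c l) (hc k l h) := by
  rw [ez, map_mul, map_zt, map_u]; rfl

theorem dz_ez (j k l : Fin n) (h : E k l) (hk : k ≠ j) (hl : l ≠ j) : dz j (ez k l h : OT K N E) = 0 := by
  have := dz_u_pow (K := K) (N := N) j k l h 1
  rw [pow_one] at this
  rw [ez, zt, dz_zl_mul, this]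
  simp [KPoly.dl, hk, hl]

theorem dzeta_ez (j k l : Fin n) (i : Fin N) (h : E k l) (hk : k ≠ j) (hl : l ≠ j) :
    dzeta j i (ez k l h : OT K N E) = 0 := by
  have := dzeta_u_pow (K := K) (N := N) j k l i h 1
  rw [pow_one] at this
  rw [ez, zt, dzeta_zl_mul, this]
  · simp [KPoly.dl, hk, hl]
  · simp [KPoly.dl, hk, hl]

end OT

namespace HKMod

variable {K : Type*} [Field K] [CharZero K] {n m N : ℕ} {V : Type*} [AddCommGroup V] [Module K V]
variable {M : HKMod K N V} {br : V →ₗ[K] V →ₗ[K] KPoly K 1 N ⊗[K] V} {mu : V →ₗ[K] V →ₗ[K] V} {r : K}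
  {X : M.sh.Src (Star 2) →ₗ[K] M.sh.VNabla 2} {p q s P : ZMod 2} {a b c : V}
  {x : KPoly K 1 N ⊗[K] V}

theorem a312 : A3 1 2 := fun h => absurd (show (0 : Fin 2) = 1 from h) (by decide)
theorem a321 : A3 2 1 := fun h => absurd (show (1 : Fin 2) = 0 from h) (by decide)
theorem s10 : Star 2 1 0 := fun h => absurd (show (1 : Fin 2) = 0 from h) (by decide)

theorem inc_ext_id (e : ZMod 2) (f : V →ₗ[K] KPoly K 1 N ⊗[K] V) (x : KPoly K 1 N ⊗[K] V) :
    M.inc 1 (KPoly.ext e (AlgHom.id K _) f x) = KPoly.ext e (KPoly.var (0 : Fin 2)) (M.inc 1 ∘ₗ f) x := by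
  rw [← KPoly.up_eq_var, ← AlgHom.comp_id KPoly.up]
  exact KPoly.ext_comp e (AlgHom.id K _) f (M.inc 1) KPoly.up M.inc_smul x

theorem ext_smul_right (e : ZMod 2) (φ : KPoly K 1 N →ₐ[K] KPoly K m N) (t : K) (f : V →ₗ[K] M.VNabla m)
    (x : KPoly K 1 N ⊗[K] V) : KPoly.ext e φ (t • f) x = t • KPoly.ext e φ f x := by
  induction x with
  | zero => simp
  | add x y hx hy => rw [map_add, map_add, hx, hy, smul_add]
  | tmul b v => rw [KPoly.ext_tmul, KPoly.ext_tmul, LinearMap.smul_apply, smul_comm]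

theorem sh_eps_pow (ha : a ∈ M.gr p) : (M.sh.eps ^ N) a = sg K (N * p) • a := by
  have h : ∀ k : ℕ, (M.sh.eps ^ k) a = sg K (k * (p + (N + 1))) • a := fun k => by
    induction k with
    | zero => simp [sg_zero]
    | succ k ih =>
      rw [pow_succ', Module.End.mul_apply, ih, map_smul, M.sh.eps_of_mem (M.mem_sh ha), smul_smul, ← sg_add]
      congr 2
      push_cast
      ring
  have e : ∀ n p : ZMod 2, n * (p + (n + 1)) = n * p := by decide
  rw [h, e]

theorem comp_pole (H : M.sh.OpS (-1 : K) X) (hc : c ∈ M.gr s) (w : Tens K V 2) (f : OT K N A3) :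
    comp H (ins c w ⊗ₜ[K] (OT.zt 0 1 * (OT.map id A3_star f * OT.u 0 1 s301) : OT K N (Star 3))) =
      sg K (N * s) • Th H c (X (w ⊗ₜ[K] e01)) f := by
  have := comp_zl H (List.finRange N) c w 1 f
  rw [pow_one, pow_one, List.length_finRange, sh_eps_pow hc] at this
  refine this.trans ?_
  rw [← ThL_apply, map_smul]
  rfl

theorem ext_J (c : V) (x : KPoly K 1 N ⊗[K] V) : KPoly.ext 0 (AlgHom.id K _) ((J br mu).flip c) x =
    TensorProduct.map LinearMap.id (mu.flip c) x + extPoly 0 (integralLam ∘ₗ br.flip c) x := by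
  induction x with
  | zero => simp
  | add x y hx hy => rw [map_add, map_add, map_add, hx, hy]; abel
  | tmul a v =>
    rw [KPoly.ext_tmul, LinearMap.flip_apply, J_apply, smul_add, TensorProduct.smul_tmul', smul_eq_mul, mul_one,
      KPoly.ivp_zero]
    congr 1

theorem swap_pole (E : M.Enc r X br mu) (hX : M.sh.symAct (Equiv.swap 0 1) X = X) (hb : b ∈ M.gr q) (y : V)
    (d : Fin n → Fin 2) (hd : ∀ j, d j ≠ 1) :
    M.sh.fibQ d (X (t2 K y b ⊗ₜ[K] OT.ez 1 0 s10)) =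
      (r * sg K ((q + (N + 1)) * (N + 1) + q)) • M.sh.iv n (mu b (M.ep (q + 1) y)) := by
  have h1 : OT.map (Equiv.swap (0 : Fin 2) 1) (star_perm _) (OT.ez 1 0 s10 : OT K N (Star 2)) = e01 := by
    rw [OT.map_ez]; rfl
  have h2 : ∀ j : Fin 2, j ≠ 1 → Equiv.swap (0 : Fin 2) 1 j ≠ 0 := by decide
  have e : ∀ n q : ZMod 2, n + (q + (n + 1)) = q + 1 := by decide
  rw [swap_left hX hb, h1, E.pole, map_smul, map_smul, map_smul, fibQ_comp,
    fibQ_inc_cst (Equiv.swap (0 : Fin 2) 1 ∘ d) (fun j => h2 _ (hd j)), cst_J, M.ep_of_mem hb, one_mul,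
    LinearMap.map_smul₂, ← ep_add, e, map_smul, smul_smul, smul_smul, sg_add]
  congr 1
  ring

/-- The value on a function with one pole gives the Wick formula. -/
theorem Enc.box_pole (E : M.Enc r X br mu) (hX : M.sh.symAct (Equiv.swap 0 1) X = X)
    (ha : a ∈ M.gr p) (hb : b ∈ M.gr q) (hc : c ∈ M.gr s) :
    M.sh.fibQ ![0, 2] (M.sh.box (n := 1) (m := 1) 1 X X (t3 K a b c ⊗ₜ[K] OT.ez 1 2 OT.s312)) =
      (r * sg K (N * p + N * s + q + N)) • M.sh.inc 1 (
        TensorProduct.map LinearMap.id (mu.flip c) (br a b) +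
        sg K ((p + N) * q) • TensorProduct.map (KPoly.inv.toLinearMap ^ q.val) (mu b) (br a c) +
        extPoly 0 (integralLam ∘ₗ br.flip c) (br a b) - br a (mu b c)) := by
  have B := E.base
  have W1 : M.sh.fibQ ![0, 2] (comp E.op (ins c (t2 K a b) ⊗ₜ[K] (OT.ez 1 2 OT.s312 : OT K N (Star 3)))) =
      (r * sg K (N * p + N * s + q + N)) • M.sh.inc 1 (
        TensorProduct.map LinearMap.id (mu.flip c) (br a b) +
        extPoly 0 (integralLam ∘ₗ br.flip c) (br a b)) := by
    have h1 := comp_one E.op c (t2 K a b) (OT.ez 1 2 a312)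
    rw [OT.map_ez] at h1
    have h2 : M.sh.fibQ ![0, 2] ∘ₗ LinearMap.applyₗ (OT.ez 1 2 a312 : OT K N A3) ∘ₗ phi X c =
      (r * sg K (N * s)) • ((M.sh.inc 1 ∘ₗ (J br mu).flip c) ∘ₗ M.ep 1) := LinearMap.ext fun y => by
      refine (congrArg (M.sh.fibQ ![0, 2]) (phi_apply X c y _)).trans ?_
      have h3 : (c3 ∘ ![0, 2] : Fin 2 → Fin 2) = id := by decide
      rw [OT.map_ez, fibQ_comp, h3, fibQ_id]
      refine (E.pole y c).trans ?_
      rw [M.ep_of_mem hc, map_smul, map_smul, smul_smul]; rfl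
    refine (congrArg (M.sh.fibQ ![0, 2]) h1).trans ?_
    rw [E.one_of_mem ha, map_smul, LinearMap.smul_apply, map_smul,
      Th_ext E.op (OT.dz_ez _ _ _ _ (by decide) (by decide)) (fun i => OT.dzeta_ez _ _ _ _ _ (by decide) (by decide)),
      fibQ_ext _ ![0, 2] 0 0 (by decide), h2, ext_smul_right, ext_ep (B.par_of_mem ha hb),
      show (1 + 1 : ZMod 2) = 0 from rfl, ← inc_ext_id, ext_J, smul_smul, smul_smul, mul_left_comm, ← sg_add,
      mul_assoc, ← sg_add]
    congr 3
    have e : ∀ n p q s : ZMod 2, (n + 1) * p + n * s + 1 * (p + q + n) = n * p + n * s + q + n := by decide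
    first | exact e _ _ _ _ | (have := e N p q s; rw [← this]; ring)
  have W2 : M.sh.fibQ ![0, 2] (M.sh.fibQ rot (comp E.op (ins a (t2 K b c) ⊗ₜ[K]
      (OT.ez 0 1 s301 : OT K N (Star 3))))) =
      (sg K ((p + (N + 1)) * (q + s)) * (r * sg K (N * p + N * s + q + N + 1))) • M.sh.inc 1 (br a (mu b c)) := by
    have h1 := comp_pole E.op ha (t2 K b c) 1
    rw [map_one, one_mul] at h1
    have h2 : (Equiv.swap (0 : Fin 2) 1 ∘ c3 ∘ rot ∘ ![0, 2] : Fin 2 → Fin 2) = id := by decide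
    rw [OT.ez, h1, map_smul, map_smul, E.pole_of_mem hb hc, map_smul, LinearMap.smul_apply, map_smul, map_smul,
      fibQ_comp, fibQ_Th_cst E.op (OT.dz_one _) (fun i => OT.dzeta_one _ _) (rot ∘ ![0, 2]) (by decide), cst_J, map_one,
      swap_left hX ha, map_one, M.ep_of_mem (B.mul_mem hb hc), E.one_of_mem ha, map_smul (br a), map_smul (M.sh.inc 1),
      map_smul, map_smul, map_smul, map_smul, map_smul, fibQ_comp, h2, fibQ_id, smul_smul, smul_smul, smul_smul,
      smul_smul]
    congr 1
    have e : ∀ n p q s : ZMod 2, n * p + (q + n * s) + (p + (n + 1)) * (n + 1) + (n + 1) * p  =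
      n * p + n * s + q + n + 1 := by decide
    rw [← e N p q s]
    simp only [sg_add]
    ring
  have W3 : M.sh.fibQ ![0, 2] (M.sh.fibQ (Equiv.swap (1 : Fin 3) 2) (comp E.op (ins b (t2 K a c) ⊗ₜ[K]
      (OT.ez 2 1 (s3 (by decide)) : OT K N (Star 3))))) =
      (sg K ((q + (N + 1)) * (s + (N + 1))) * (r * sg K (N * p + N * s + q + N + (p + N) * q))) • M.sh.inc 1
        (TensorProduct.map (KPoly.inv.toLinearMap ^ q.val) (mu b) (br a c)) := by
    have h1 := comp_one E.op b (t2 K a c) (OT.ez 2 1 a321)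
    rw [OT.map_ez] at h1
    have h2 : M.sh.fibQ (Equiv.swap (1 : Fin 3) 2 ∘ ![0, 2]) ∘ₗ
        LinearMap.applyₗ (OT.ez 2 1 a321 : OT K N A3) ∘ₗ phi X b =
      (r * sg K ((q + (N + 1)) * (N + 1) + q)) •
        ((M.sh.inc 1 ∘ₗ TensorProduct.mk K _ _ 1 ∘ₗ mu b) ∘ₗ M.ep (q + 1)) := LinearMap.ext fun y => by
      refine (congrArg (M.sh.fibQ _) (phi_apply X b y _)).trans ?_
      rw [OT.map_ez, fibQ_comp]
      refine (swap_pole E hX hb y _ (by decide)).trans ?_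
      rw [LinearMap.smul_apply]
      congr 1
      refine Eq.symm ((M.sh.inc_tmul _ _).trans ?_)
      rw [map_one, one_smul]
    have h3 : KPoly.ext q (AlgHom.id K _) (TensorProduct.mk K (KPoly K 1 N) V 1 ∘ₗ mu b) (br a c) =
        TensorProduct.map (KPoly.inv.toLinearMap ^ q.val) (mu b) (br a c) := by
      induction br a c with
      | zero => simp
      | add x y hx hy => rw [map_add, map_add, hx, hy]
      | tmul x v =>
        rw [KPoly.ext_tmul, LinearMap.comp_apply, TensorProduct.mk_apply, TensorProduct.smul_tmul', smul_eq_mul,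
          mul_one]; rfl
    have e : ∀ q : ZMod 2, 1 + (q + 1) = q := by decide
    rw [fibQ_comp]
    refine (congrArg (M.sh.fibQ _) h1).trans ?_
    rw [E.one_of_mem ha, map_smul, LinearMap.smul_apply, map_smul,
      Th_ext E.op (OT.dz_ez _ _ _ _ (by decide) (by decide)) (fun i => OT.dzeta_ez _ _ _ _ _ (by decide) (by decide)),
      fibQ_ext _ _ 0 0 (by decide), h2, ext_smul_right, ext_ep (B.par_of_mem ha hc), e, ← inc_ext_id, h3, smul_smul,
      smul_smul]
    congr 1
    have e : ∀ n p q s : ZMod 2, (q + (n + 1)) * (s + (n + 1)) + (n * p + n * s + q + n + (p + n) * q) =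
      (n + 1) * p + ((q + (n + 1)) * (n + 1) + q) + (q + 1) * (p + s + n) := by decide
    rw [mul_left_comm (sg K ((q + (N + 1)) * (s + (N + 1)))), ← sg_add, e]
    simp only [sg_add]
    ring
  have m2 : OT.map rot (star_perm _) (OT.ez 1 2 OT.s312 : OT K N (Star 3)) = OT.ez 0 1 s301 := by
    rw [OT.map_ez]; rfl
  have m3 : OT.map (Equiv.swap (1 : Fin 3) 2) (star_perm _) (OT.ez 1 2 OT.s312 : OT K N (Star 3)) =
    OT.ez 2 1 (s3 (by decide)) := by rw [OT.map_ez]; rfl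
  rw [box_t3 E.op ha hb hc, m2, m3, map_add, map_add, map_smul, map_smul, W1, W2, W3, smul_smul, smul_smul,
    sg_cancel, sg_cancel, map_sub, map_add, map_add, map_add, map_smul, sg_add _ _ 1,
    sg_one, sg_add _ _ ((p + N) * q)]
  module

end HKMod

end

section
namespace OT

variable {K : Type*} [Field K] [CharZero K] {N n m : ℕ} {E : Fin n → Fin n → Prop}

theorem zl_zl (k l k' l' : Fin n) (L L' : List (Fin N)) (f : OT K N E) :
    zl k l L * (zl k' l' L' * f) = (-1 : K) ^ (L.length * L'.length) • (zl k' l' L' * (zl k l L * f)) := by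
  induction L' with
  | nil => simp [zl_nil]
  | cons i L' ih =>
    rw [zl_cons, mul_assoc, zl_mul_zetaz, ih, mul_smul_comm, smul_smul, ← pow_add, List.length_cons, mul_assoc]
    congr 2
    ring

theorem zt_zt (k l k' l' : Fin n) (f : OT K N E) :
    zt k l * (zt k' l' * f) = sg K N • (zt k' l' * (zt k l * f)) := by
  rw [zt, zt, zl_zl, List.length_finRange, pow_mul, ← sg_natCast, sg_pow]
  have e : ∀ n : ZMod 2, n * n = n := by decide
  rw [e]

theorem zt_congr {k l a b a' b' : Fin n}
    (h : ∀ (i : Fin N) (f : OT K N E), zt k l * (zetaz a b i * f) = zt k l * (zetaz a' b' i * f)) (f : OT K N E) :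
    zt k l * (zt a b * f) = zt k l * (zt a' b' * f) := by
  suffices key : ∀ L : List (Fin N), zt k l * (zl a b L * f) = zt k l * (zl a' b' L * f) from key _
  intro L
  induction L with
  | nil => rw [zl_nil, zl_nil]
  | cons i L ih =>
    rw [zl_cons, zl_cons, mul_assoc, mul_assoc, h]
    exact (zl_mul_zetaz k l a' b' i _ _).trans ((congrArg _ (congrArg _ ih)).trans (zl_mul_zetaz k l a' b' i _ _).symm)

theorem zz_ez (k l : Fin n) (h : E k l) : (zz k l * ez k l h : OT K N E) = zt k l := by
  rw [ez, zt, ← zl_zz, zz_u, mul_one]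

theorem pow_apply_pole {W : Type*} [AddCommGroup W] [Module K W] (D : Module.End K W) (f : ℕ → W)
    (h : ∀ j, D (f (j + 1)) = (-(j + 1) : K) • f (j + 2)) (m : ℕ) :
    (D ^ m) (f 1) = ((-1) ^ m * m.factorial : K) • f (m + 1) := by
  induction m with
  | zero => simp
  | succ m ih =>
    rw [pow_succ', Module.End.mul_apply, ih, map_smul, h, smul_smul, Nat.factorial_succ]
    congr 1
    push_cast
    ring

end OT

namespace HKMod

variable {K : Type*} [Field K] [CharZero K] {n m N : ℕ} {V : Type*} [AddCommGroup V] [Module K V]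
variable {M : HKMod K N V} {br : V →ₗ[K] V →ₗ[K] KPoly K 1 N ⊗[K] V} {mu : V →ₗ[K] V →ₗ[K] V} {r : K}
  {X : M.sh.Src (Star 2) →ₗ[K] M.sh.VNabla 2} {p q s P : ZMod 2} {a b c : V}
  {x : KPoly K 1 N ⊗[K] V}

theorem a320 : A3 2 0 := fun h => absurd (show (1 : Fin 2) = 0 from h) (by decide)
theorem a302 : A3 0 2 := fun h => absurd (show (0 : Fin 2) = 1 from h) (by decide)

theorem integralMul_mono (a : V) (μ : Mon 1 N) (v : V) :
    M.integralMul mu a ((KPoly.mono μ : KPoly K 1 N) ⊗ₜ[K] v) = if μ.2 = Finset.univ then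
      ((μ.1 0 : K) + 1)⁻¹ • mu ((M.T ^ (μ.1 0 + 1)) a) v else 0 := by
  rw [integralMul, KPoly.onMon_mono, integral, KPoly.onMon_mono]
  split_ifs
  · simp
  · simp

theorem integralMul_ep (a : V) (hx : M.epsL x = sg K (P + N) • x) (e : ZMod 2) :
    M.integralMul mu a (TensorProduct.map LinearMap.id (M.ep e) x) = sg K (e * P) • M.integralMul mu a x := by
  have h1 : M.integralMul mu a ∘ₗ TensorProduct.map KPoly.inv.toLinearMap LinearMap.id =
      sg K N • M.integralMul mu a := KPoly.hom_ext fun μ v => by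
    rw [LinearMap.comp_apply, TensorProduct.map_tmul, AlgHom.toLinearMap_apply, KPoly.inv_mono,
      ← TensorProduct.smul_tmul', map_smul, LinearMap.smul_apply, LinearMap.id_apply, integralMul_mono]
    split_ifs with h
    · rw [h, card_univ_lex, sg_natCast]
    · simp
  have h2 : M.integralMul mu a (TensorProduct.map (KPoly.ivp e) LinearMap.id x) =
      sg K (e * N) • M.integralMul mu a x := by
    rcases zmod2_cases e with rfl | rfl
    · rw [zero_mul, sg_zero, one_smul]
      congr 1
      exact LinearMap.congr_fun TensorProduct.map_id x
    · rw [one_mul]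
      exact LinearMap.congr_fun h1 x
  have e2 : ∀ e n p : ZMod 2, e * (p + n) + e * n = e * p := by decide
  rw [map_ep hx, map_smul, h2, smul_smul, ← sg_add, e2]

theorem fibQ_dz_pow (H : M.sh.OpS (-1 : K) X) (d : Fin n → Fin 2) (hd : ∀ j, d j ≠ 1) (k : ℕ) (y a : V)
    (f : OT K N (Star 2)) : M.sh.fibQ d (X (t2 K y a ⊗ₜ[K] (OT.dz 1 ^ k) f)) =
      M.sh.fibQ d (X (t2 K y ((M.T ^ k) a) ⊗ₜ[K] f)) := by
  induction k generalizing a with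
  | zero => rfl
  | succ k ih =>
    have h := H.dz 1 (t2 K y ((M.T ^ k) a)) f
    rw [TAt1_t2] at h
    have h' := H.dz 1 (t2 K y a) ((OT.dz 1 ^ k) f)
    rw [TAt1_t2] at h'
    have h0 : ∀ z : M.sh.VNabla 2, M.sh.fibQ d ((KPoly.lam 1 : KPoly K 2 N) • z) = 0 := fun z => by
      rw [fibQ_lam, Finset.sum_eq_zero]
      intro j hj
      exact absurd (Finset.mem_filter.1 hj).2 (hd j)
    have h2 := congrArg (M.sh.fibQ d) h'
    rw [map_sub, h0, sub_zero] at h2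
    rw [pow_succ', Module.End.mul_apply, ← h2, pow_succ]
    exact ih (M.T a)

theorem T_pow_mem (ha : a ∈ M.gr p) (k : ℕ) : (M.T ^ k) a ∈ M.gr p := by
  induction k with
  | zero => exact ha
  | succ k ih => rw [pow_succ', Module.End.mul_apply]; exact M.T_mem _ _ ih

/-- The common scalar in the value of the composition on two poles. -/
def polSign (r : K) (N : ℕ) (p : ZMod 2) : K := r * sg K ((p + (N + 1)) * (N + 1) + p)

theorem fibQ_Th_pole (E : M.Enc r X br mu) (hX : M.sh.symAct (Equiv.swap 0 1) X = X) (ha : a ∈ M.gr p)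
    (e : Fin n → Fin 3) (he : ∀ j, e j = 1) (k : ℕ) (y : V) :
    M.sh.fibQ e (Th E.op a (M.sh.inc 1 ((KPoly.lam 0 ^ k : KPoly K 1 N) ⊗ₜ[K] y)) (OT.ez 2 0 a320)) =
      polSign r N p • M.sh.iv n (mu ((M.T ^ k) a) (M.ep (p + 1) y)) := by
  have h : ∀ k, OT.map c3 A3_c3 ((OT.dz 0 ^ k) (OT.ez 2 0 a320 : OT K N A3)) =
      (-1 : K) ^ k • (OT.dz 1 ^ k) (OT.ez 1 0 s10) ∧ OT.dz 1 ((OT.dz 0 ^ k) (OT.ez 2 0 a320 : OT K N A3)) = 0 := by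
    intro k
    induction k with
    | zero => exact ⟨by rw [pow_zero, pow_zero, pow_zero, one_smul]; exact OT.map_ez _ _ _ _ _,
        OT.dz_ez _ _ _ _ (by decide) (by decide)⟩
    | succ k ih =>
      have h1 := OT.dz_map c3 A3_c3 0 ((OT.dz 0 ^ k) (OT.ez 2 0 a320 : OT K N A3))
      have h2 : (Finset.univ.filter fun k : Fin 3 => c3 k = 0) = {0, 1} := by decide
      rw [h2, Finset.sum_pair (by decide), ih.2, map_zero, add_zero] at h1
      refine ⟨?_, ?_⟩
      · rw [pow_succ', Module.End.mul_apply, ← h1, ih.1, map_smul, pow_succ', mul_smul, neg_one_smul, ← smul_neg]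
        have h3 := OT.dz_sum ((OT.dz 1 ^ k) (OT.ez 1 0 s10 : OT K N (Star 2)))
        rw [Fin.sum_univ_two] at h3
        rw [eq_neg_of_add_eq_zero_left h3, pow_succ', Module.End.mul_apply, smul_neg]
      · rw [pow_succ', Module.End.mul_apply, OT.dz_dz, ih.2, map_zero]
  rw [fibQ_Th_lam E.op e (fun j => by rw [he]; decide), (h k).1, TensorProduct.tmul_smul, map_smul, map_smul, smul_smul,
    ← mul_pow, neg_one_mul, neg_neg, one_pow, one_smul, fibQ_dz_pow E.op (c3 ∘ e) (fun j => by rw [Function.comp, he]; decide),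
    swap_pole E hX (T_pow_mem ha k) y _ (fun j => by rw [Function.comp, he]; decide)]
  rfl

theorem fibQ_Th_pole' (E : M.Enc r X br mu) (hX : M.sh.symAct (Equiv.swap 0 1) X = X) (ha : a ∈ M.gr p)
    (e : Fin n → Fin 3) (he : ∀ j, e j = 1) (k : ℕ) (y : V) :
    M.sh.fibQ e (Th E.op a (M.sh.inc 1 ((KPoly.lam 0 ^ k : KPoly K 1 N) ⊗ₜ[K] y))
        (OT.zt 2 1 * (OT.u 0 2 a302 * OT.u 2 1 a321))) =
      polSign r N p • M.sh.iv n ((k + 1 : K)⁻¹ • mu ((M.T ^ (k + 1)) a) (M.ep (p + 1) y)) := by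
  have h1 := OT.pow_apply_pole (OT.dz 0) (fun j => (OT.zt 2 1 * (OT.u 0 2 a302 ^ j * OT.u 2 1 a321) : OT K N A3))
    (fun j => by
      have := OT.dz_u_pow (K := K) (N := N) 0 2 1 a321 1
      rw [pow_one] at this
      rw [OT.zt, OT.dz_zl_mul, OT.dz_mul, this, OT.dz_u_pow]
      simp [KPoly.dl]) k
  have h2 := OT.pow_apply_pole (OT.dz 1) (fun j => (OT.zt 1 0 * OT.u 1 0 s10 ^ j : OT K N (Star 2)))
    (fun j => by
      rw [OT.zt, OT.dz_zl_mul, OT.dz_u_pow]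
      simp [KPoly.dl]) (k + 1)
  have h3 : OT.map c3 A3_c3 ((OT.dz 0 ^ k) (OT.zt 2 1 * (OT.u 0 2 a302 * OT.u 2 1 a321) : OT K N A3)) =
      ((-1) ^ k * (k + 1 : K)⁻¹) • (OT.dz 1 ^ (k + 1)) (OT.ez 1 0 s10) := by
    simp only [pow_one] at h1 h2
    rw [h1, OT.ez, h2, map_smul, map_mul, map_mul, map_pow, OT.map_zt, OT.map_u, OT.map_u, smul_smul]
    have h4 : (OT.u (c3 0) (c3 2) (A3_c3 _ _ a302) : OT K N (Star 2)) = -OT.u 1 0 s10 := OT.u_swap _ _ _ _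
    have h5 : (OT.u (c3 2) (c3 1) (A3_c3 _ _ a321) : OT K N (Star 2)) = OT.u 1 0 s10 := rfl
    have h6 : (OT.zt (c3 2) (c3 1) : OT K N (Star 2)) = OT.zt 1 0 := rfl
    rw [h4, h5, h6, ← neg_one_smul K (OT.u 1 0 s10 : OT K N (Star 2)), smul_pow, smul_mul_assoc, ← pow_succ,
      mul_smul_comm, smul_smul, Nat.factorial_succ]
    congr 1
    have : (k + 1 : K) ≠ 0 := by exact_mod_cast k.succ_ne_zero
    push_cast
    field_simp
  rw [fibQ_Th_lam E.op e (fun j => by rw [he]; decide), h3, TensorProduct.tmul_smul, map_smul, map_smul, smul_smul,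
    ← mul_assoc, ← mul_pow, neg_one_mul, neg_neg, one_pow, one_mul,
    fibQ_dz_pow E.op (c3 ∘ e) (fun j => by rw [Function.comp, he]; decide),
    swap_pole E hX (T_pow_mem ha _) y _ (fun j => by rw [Function.comp, he]; decide), map_smul, smul_comm]
  rfl

theorem fibQ_Th_J (E : M.Enc r X br mu) (hX : M.sh.symAct (Equiv.swap 0 1) X = X)
    (ha : a ∈ M.gr p) (hb : b ∈ M.gr q) (hc : c ∈ M.gr s) (e : Fin n → Fin 3) (he : ∀ j, e j = 1) :
    M.sh.fibQ e (Th E.op a (M.sh.inc 1 (J br mu b c)) (OT.ez 2 0 a320)) =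
      (polSign r N p * sg K ((p + 1) * (q + s))) •
        M.sh.iv n (mu a (mu b c) + M.integralMul mu a (br b c)) := by
  have h := LinearMap.congr_fun (KPoly.hom_ext
    (f := M.sh.fibQ e ∘ₗ LinearMap.applyₗ (OT.ez 2 0 a320 : OT K N A3) ∘ₗ Th E.op a ∘ₗ M.sh.inc 1 ∘ₗ integralLam)
    (g := polSign r N p • (M.sh.iv n ∘ₗ M.integralMul mu a ∘ₗ TensorProduct.map LinearMap.id (M.ep (p + 1))))
    fun μ v => by
      simp only [LinearMap.comp_apply, LinearMap.smul_apply, TensorProduct.map_tmul, LinearMap.id_apply]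
      rw [KPoly.integralLam_mono, integralMul_mono]
      split_ifs
      · rw [← KPoly.lam_pow_eq, map_smul, map_smul, map_smul, map_smul, map_smul, smul_comm]
        congr 1
        exact fibQ_Th_pole E hX ha e he _ v
      · simp) (br b c)
  have h0 := fibQ_Th_pole E hX ha e he 0 (mu b c)
  rw [M.ep_of_mem (E.base.mul_mem hb hc), map_smul, map_smul, pow_zero, pow_zero, Module.End.one_apply] at h0
  simp only [LinearMap.comp_apply, LinearMap.smul_apply] at h
  rw [integralMul_ep a (E.base.par_of_mem hb hc), map_smul] at h
  rw [J_apply, map_add, map_add, LinearMap.add_apply, map_add, map_add, mul_smul, smul_add, smul_add]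
  exact congrArg₂ (· + ·) h0 h

theorem fibQ_Th_topc (E : M.Enc r X br mu) (hX : M.sh.symAct (Equiv.swap 0 1) X = X)
    (ha : a ∈ M.gr p) (hb : b ∈ M.gr q) (hc : c ∈ M.gr s) (e : Fin n → Fin 3) (he : ∀ j, e j = 1) :
    M.sh.fibQ e (Th E.op b (M.sh.inc 1 (KPoly.topc (br a c))) (OT.zt 2 1 * (OT.u 0 2 a302 * OT.u 2 1 a321))) =
      (polSign r N q * sg K ((q + 1) * (p + s))) • M.sh.iv n (M.integralMul mu b (br a c)) := by
  have h := LinearMap.congr_fun (KPoly.hom_ext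
    (f := M.sh.fibQ e ∘ₗ LinearMap.applyₗ (OT.zt 2 1 * (OT.u 0 2 a302 * OT.u 2 1 a321) : OT K N A3) ∘ₗ
      Th E.op b ∘ₗ M.sh.inc 1 ∘ₗ KPoly.topc)
    (g := polSign r N q • (M.sh.iv n ∘ₗ M.integralMul mu b ∘ₗ TensorProduct.map LinearMap.id (M.ep (q + 1))))
    fun μ v => by
      simp only [LinearMap.comp_apply, LinearMap.smul_apply, TensorProduct.map_tmul, LinearMap.id_apply]
      rw [KPoly.topc_mono, integralMul_mono]
      split_ifs
      · have h1 : (KPoly.mono (μ.1, ∅) : KPoly K 1 N) = KPoly.lam 0 ^ μ.1 0 := by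
          rw [KPoly.lam_pow_eq]; congr 2; funext j; rw [Subsingleton.elim j 0]
        rw [h1]
        exact fibQ_Th_pole' E hX hb e he _ v
      · simp) (br a c)
  simp only [LinearMap.comp_apply, LinearMap.smul_apply] at h
  rw [integralMul_ep b (E.base.par_of_mem ha hc), map_smul, smul_smul] at h
  exact h

/-- The value on a function with two poles gives the associativity up to quantum corrections. -/
theorem Enc.box_two_poles (E : M.Enc r X br mu) (hX : M.sh.symAct (Equiv.swap 0 1) X = X)
    (ha : a ∈ M.gr p) (hb : b ∈ M.gr q) (hc : c ∈ M.gr s) :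
    M.sh.fibQ ![2] (M.sh.box (n := 1) (m := 1) 1 X X
        (t3 K a b c ⊗ₜ[K] (OT.zt 1 2 * (OT.zt 0 1 * OT.um 1 0 1)))) =
      sg K (N + (N + 1) * q) • M.sh.iv 1 (mu (mu a b) c - mu a (mu b c) -
        (M.integralMul mu a (br b c) + sg K (p * q) • M.integralMul mu b (br a c))) := by
  have B := E.base
  have W1 : M.sh.fibQ ![2] (comp E.op (ins c (t2 K a b) ⊗ₜ[K]
      (OT.zt 1 2 * (OT.zt 0 1 * OT.um 1 0 1) : OT K N (Star 3)))) =
      sg K (N + (N + 1) * q) • M.sh.iv 1 (mu (mu a b) c) := by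
    have h0 : (OT.zt 1 2 * (OT.zt 0 1 * OT.um 1 0 1) : OT K N (Star 3)) =
        sg K N • (OT.zt 0 1 * (OT.map id A3_star (OT.ez 1 2 a312) * OT.u 0 1 s301)) := by
      rw [OT.zt_zt, OT.map_ez, OT.ez, OT.um, pow_one, pow_one, pow_zero, one_mul, OT.u_comm 0 1, mul_assoc]; rfl
    have h1 : (OT.map c3 A3_c3 (OT.ez 1 2 a312) : OT K N (Star 2)) = e01 := by rw [OT.map_ez]; rfl
    rw [h0, TensorProduct.tmul_smul, map_smul, map_smul, comp_pole E.op hc, map_smul, E.pole_of_mem ha hb, map_smul,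
      LinearMap.smul_apply, map_smul, fibQ_Th_cst E.op (OT.dz_ez _ _ _ _ (by decide) (by decide))
        (fun i => OT.dzeta_ez _ _ _ _ _ (by decide) (by decide)) ![2] (by decide), cst_J, h1,
      E.pole_of_mem (B.mul_mem ha hb) hc, map_smul, fibQ_inc_cst (c3 ∘ ![2]) (by decide), cst_J, smul_smul, smul_smul,
      smul_smul]
    congr 1
    have e : ∀ n p q s : ZMod 2, n + (n + 1) * q = n + n * s + (p + n * q) + (p + q + n * s) := by decide
    rw [e N p q s]
    simp only [sg_add]
    linear_combination (sg K N * sg K (N * s) * (sg K p * sg K (N * q)) * (sg K p * sg K q * sg K (N * s))) * E.sq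
  have W2 : M.sh.fibQ ![2] (M.sh.fibQ rot (comp E.op (ins a (t2 K b c) ⊗ₜ[K]
      OT.map rot (star_perm _) (OT.zt 1 2 * (OT.zt 0 1 * OT.um 1 0 1) : OT K N (Star 3))))) =
      (sg K ((p + (N + 1)) * (q + s)) * sg K (N + (N + 1) * q + 1)) •
        M.sh.iv 1 (mu a (mu b c) + M.integralMul mu a (br b c)) := by
    have h0 : OT.map rot (star_perm _) (OT.zt 1 2 * (OT.zt 0 1 * OT.um 1 0 1) : OT K N (Star 3)) =
        OT.zt 0 1 * (OT.map id A3_star (OT.ez 2 0 a320) * OT.u 0 1 s301) := by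
      rw [OT.map_ez, OT.ez, OT.um, pow_one, pow_one, pow_zero, one_mul, map_mul, map_mul, map_mul, OT.map_zt, OT.map_zt,
        OT.map_u, OT.map_u, mul_assoc]; rfl
    rw [fibQ_comp, h0, comp_pole E.op ha, map_smul, E.pole_of_mem hb hc, map_smul, LinearMap.smul_apply, map_smul,
      fibQ_Th_J E hX ha hb hc (rot ∘ ![2]) (by decide), smul_smul, smul_smul, polSign]
    congr 1
    have e : ∀ n p q s : ZMod 2, (p + (n + 1)) * (q + s) + (n + (n + 1) * q + 1) =
      n * p + (q + n * s) + ((p + (n + 1)) * (n + 1) + p) + (p + 1) * (q + s) := by decide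
    rw [← sg_add, e]
    simp only [sg_add K _ ((p + 1) * (q + s)), sg_add K _ ((p + (N + 1)) * (N + 1) + p), sg_add K _ (q + N * s)]
    linear_combination (sg K (N * p) * sg K (q + N * s) * sg K ((p + (N + 1)) * (N + 1) + p) *
      sg K ((p + 1) * (q + s))) * E.sq
  have W3 : M.sh.fibQ ![2] (M.sh.fibQ (Equiv.swap (1 : Fin 3) 2) (comp E.op (ins b (t2 K a c) ⊗ₜ[K]
      OT.map (Equiv.swap (1 : Fin 3) 2) (star_perm _) (OT.zt 1 2 * (OT.zt 0 1 * OT.um 1 0 1) : OT K N (Star 3))))) =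
      (sg K ((q + (N + 1)) * (s + (N + 1))) * sg K (N + (N + 1) * q + p * q + 1)) •
        M.sh.iv 1 (M.integralMul mu b (br a c)) := by
    have h0 : OT.map (Equiv.swap (1 : Fin 3) 2) (star_perm _) (OT.zt 1 2 * (OT.zt 0 1 * OT.um 1 0 1) : OT K N (Star 3)) =
        sg K N • (OT.zt 0 1 *
          (OT.map id A3_star (OT.zt 2 1 * (OT.u 0 2 a302 * OT.u 2 1 a321)) * OT.u 0 1 s301 ^ 0)) := by
      rw [OT.um, pow_one, pow_one, pow_zero, pow_zero, one_mul, mul_one, map_mul, map_mul, map_mul, map_mul, map_mul,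
        OT.map_zt, OT.map_zt, OT.map_zt, OT.map_u, OT.map_u, OT.map_u, OT.map_u, ← OT.zt_zt]
      refine OT.zt_congr (k := 2) (l := 1) (a := 0) (b := 2) (a' := 0) (b' := 1) (fun i f => ?_) _
      rw [← OT.zetaz_add 0 1 2, add_mul, mul_add, OT.zetaz_swap 2 1, neg_mul, mul_neg, OT.zt_mul_zetaz, neg_zero, add_zero]
    have h1 := comp_zl E.op (List.finRange N) b (t2 K a c) 0
      (OT.zt 2 1 * (OT.u 0 2 a302 * OT.u 2 1 a321))
    rw [List.length_finRange, sh_eps_pow hb, pow_zero (OT.u 0 1 s01), mul_one] at h1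
    have h2 : X (t2 K a c ⊗ₜ[K] OT.zl 0 1 (List.finRange N)) =
        -((r * sg K (p + N * s)) • M.sh.inc 1 (KPoly.topc (br a c))) := by
      have := E.op.zz 0 1 (t2 K a c) e01
      rw [E.pole_of_mem ha hc, map_smul] at this
      refine ((congrArg (fun f => X (t2 K a c ⊗ₜ[K] f)) (OT.zz_ez 0 1 s01).symm).trans this).trans ?_
      rw [← smul_neg, ← dLV_J (mu := mu)]
      exact congrArg _ (M.sh.Z_inc (0 : Fin 1) _).1
    rw [fibQ_comp, h0, TensorProduct.tmul_smul, map_smul, map_smul]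
    refine (congrArg (fun y => sg K N • M.sh.fibQ (Equiv.swap (1 : Fin 3) 2 ∘ ![2]) y) h1).trans ?_
    have h3 := fibQ_Th_topc E hX ha hb hc (Equiv.swap (1 : Fin 3) 2 ∘ ![2]) (by decide)
    have h4 : Th E.op (sg K (N * q) • b) = sg K (N * q) • Th E.op b := by
      rw [← ThL_apply, ← ThL_apply, map_smul]
    rw [h2, h4, map_neg, LinearMap.smul_apply, map_smul, LinearMap.neg_apply, LinearMap.smul_apply, LinearMap.smul_apply,
      map_neg, map_smul, map_smul, h3, smul_smul, smul_smul, polSign, smul_neg, smul_smul, ← neg_smul]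
    congr 1
    have e : ∀ n p q s : ZMod 2, (q + (n + 1)) * (s + (n + 1)) + (n + (n + 1) * q + p * q + 1) =
      n + n * q + (p + n * s) + ((q + (n + 1)) * (n + 1) + q) + (q + 1) * (p + s) + 1 := by decide
    rw [← sg_add, e]
    simp only [sg_add K _ ((q + 1) * (p + s)), sg_add K _ ((q + (N + 1)) * (N + 1) + q), sg_add K _ (p + N * s),
      sg_add K _ 1, sg_one, sg_add K _ (N * q)]
    linear_combination -(sg K N * sg K (N * q) * sg K (p + N * s) * sg K ((q + (N + 1)) * (N + 1) + q) *
      sg K ((q + 1) * (p + s))) * E.sq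
  rw [box_t3 E.op ha hb hc, map_add, map_add, map_smul, map_smul, W1, W2, W3, smul_smul, smul_smul, sg_cancel, sg_cancel,
    sg_add _ _ 1, sg_add _ _ 1, sg_add _ _ (p * q), sg_one, map_sub, map_sub, map_add, map_add, map_smul]
  module

end HKMod

end

section
namespace OT

variable {K : Type*} [Field K] [CharZero K] {N n : ℕ} {E : Fin n → Fin n → Prop}

theorem zt_swap (k l : Fin n) : (zt l k : OT K N E) = sg K N • zt k l := by
  suffices key : ∀ L : List (Fin N), (zl l k L : OT K N E) = (-1 : K) ^ L.length • zl k l L by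
    rw [zt, key, List.length_finRange, sg_natCast]; rfl
  intro L
  induction L with
  | nil => simp [zl_nil]
  | cons i L ih => rw [zl_cons, zl_cons, ih, zetaz_swap, List.length_cons, pow_succ, mul_smul_comm, mul_smul,
      neg_one_smul, neg_mul]

theorem zetaz_ez (k l : Fin n) (h : E k l) (i : Fin N) : (zetaz k l i * ez k l h : OT K N E) = 0 := by
  rw [ez, zt, ← mul_assoc, zetaz_mul_zl _ _ _ _ (List.mem_finRange i), zero_mul]

theorem map_rot_poles (i j k : ℕ) : map HKMod.rot (HKMod.star_perm _)
    (zt 1 2 * (zt 0 1 * um i j k) : OT K N (Star 3)) = ((-1) ^ i * (-1) ^ j : K) • (zt 1 2 * (zt 0 1 * um k i j)) := by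
  have h1 : ∀ f : OT K N (Star 3), zt 0 1 * (zt 2 0 * f) = zt 1 2 * (zt 0 1 * f) := fun f => by
    rw [zt_congr (a' := 2) (b' := 1), zt_swap 1 2, smul_mul_assoc, mul_smul_comm, ← zt_zt]
    intro i f
    rw [← zetaz_add 2 1 0, add_mul, mul_add, zetaz_swap 0 1, neg_mul, mul_neg, zt_mul_zetaz, neg_zero, add_zero]
  have h2 : map HKMod.rot (HKMod.star_perm _) (um i j k : OT K N (Star 3)) = ((-1) ^ i * (-1) ^ j : K) • um k i j := by
    have e : ∀ (k l : Fin 3) (h : Star 3 k l) (h' : Star 3 l k) (m : ℕ),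
        (u l k h' ^ m : OT K N (Star 3)) = (-1 : K) ^ m • u k l h ^ m := fun k l h h' m => by
      rw [u_swap k l h h', ← neg_one_smul K (u k l h), smul_pow]
    rw [um, map_mul, map_mul, map_pow, map_pow, map_pow, map_u, map_u, map_u]
    refine (congrArg₂ (· * ·) (e 0 2 s302 _ i) (congrArg (· * _) (e 1 2 s312 _ j))).trans ?_
    suffices key : (-1 : K) ^ i • u 0 2 s302 ^ i * ((-1 : K) ^ j • u 1 2 s312 ^ j * u 0 1 HKMod.s301 ^ k) =
      ((-1) ^ i * (-1) ^ j : K) • (um k i j : OT K N (Star 3)) from key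
    rw [smul_mul_assoc, smul_mul_assoc, mul_smul_comm, smul_smul, um, u_pow_comm 0 1, mul_assoc]
  rw [map_mul, map_mul, map_zt, map_zt, h2, mul_smul_comm, mul_smul_comm]
  exact congrArg _ (h1 _)

end OT

namespace HKMod

variable {K : Type*} [Field K] [CharZero K] {n m N : ℕ} {V : Type*} [AddCommGroup V] [Module K V]
variable {M : HKMod K N V}

section Vanishing

variable {W : M.Src (Star 3) →ₗ[K] M.VNabla 3}

theorem killed_rot (hW : M.symAct rot W = W) {f : OT K N (Star 3)}
    (h : OT.map rot (star_perm _) f ∈ killed W) : f ∈ killed W := fun v => by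
  rw [← hW, symAct_tmul, h, map_zero]

theorem killed_zl {s : K} {W : M.Src (Star n) →ₗ[K] M.VNabla n} (H : M.OpS s W) (k l : Fin n)
    (L : List (Fin N)) {f : OT K N (Star n)} (hf : f ∈ killed W) : OT.zl k l L * f ∈ killed W := by
  induction L with
  | nil => rwa [OT.zl_nil, one_mul]
  | cons i L ih => rw [OT.zl_cons, mul_assoc]; exact killed_zetaz H k l i _ ih

/-- A ternary operation invariant under rotations is determined by its values on the functions
without poles, with one pole and with two poles, the latter on the diagonals. -/
theorem OpS.eq_zero_of_values (H : M.OpS (1 : K) W) (hW : M.symAct rot W = W) (h1 : 1 ∈ killed W)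
    (hp : ∀ v, M.fibQ ![0, 2] (W (v ⊗ₜ[K] OT.ez 1 2 OT.s312)) = 0)
    (hq : ∀ v, M.fibQ ![2] (W (v ⊗ₜ[K] (OT.zt 1 2 * (OT.zt 0 1 * OT.um 1 0 1)))) = 0) : W = 0 := by
  have Z : ∀ k l f, OT.zz k l * f ∈ killed W → ∀ v, M.Zq k l (W (v ⊗ₜ[K] f)) = 0 := fun k l f h v => by
    rw [← H.zz, h]
  have Y : ∀ k l i f, OT.zetaz k l i * f ∈ killed W → ∀ v, M.Ztq k l i (W (v ⊗ₜ[K] f)) = 0 := fun k l i f h v => by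
    have := H.zetaz k l i (M.epsT 3 v) f
    rw [epsT_epsT, one_smul] at this
    rw [← this, h]
  have p12 : (OT.ez 1 2 OT.s312 : OT K N (Star 3)) ∈ killed W := fun v => by
    have := M.fibQ_fixed {1} (W (v ⊗ₜ[K] OT.ez 1 2 OT.s312))
      (fun k hk => by
        rw [Set.mem_singleton_iff] at hk
        subst hk
        refine Z 1 2 _ ?_ v
        rw [OT.zz_ez, ← mul_one (OT.zt 1 2)]
        exact killed_zl H _ _ _ h1)
      (fun k hk i => by
        rw [Set.mem_singleton_iff] at hk
        subst hk
        refine Y 1 2 i _ ?_ v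
        rw [OT.zetaz_ez]
        exact Submodule.zero_mem _)
      (![0, 2] ∘ ![0, 1, 1]) (by decide)
    rw [← this, ← fibQ_comp, hp, map_zero]
  have p20 : (OT.ez 2 0 (s3 (by decide)) : OT K N (Star 3)) ∈ killed W :=
    killed_rot hW (by rw [OT.map_ez]; exact p12)
  have p01 : (OT.ez 0 1 s301 : OT K N (Star 3)) ∈ killed W := killed_rot hW (by rw [OT.map_ez]; exact p20)
  have q2 : (OT.zt 1 2 * (OT.zt 0 1 * OT.um 1 0 1) : OT K N (Star 3)) ∈ killed W := by
    have y12 : ∀ i, (OT.zetaz 1 2 i * (OT.zt 1 2 * (OT.zt 0 1 * OT.um 1 0 1)) : OT K N (Star 3)) = 0 := fun i => by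
      rw [OT.zt, ← mul_assoc, OT.zetaz_mul_zl _ _ _ _ (List.mem_finRange i), zero_mul]
    have y02 : ∀ i, (OT.zetaz 0 2 i * (OT.zt 1 2 * (OT.zt 0 1 * OT.um 1 0 1)) : OT K N (Star 3)) = 0 := fun i => by
      rw [← OT.zetaz_add 0 1 2, add_mul, y12, add_zero, OT.zt_zt, mul_smul_comm, OT.zt, ← mul_assoc,
        OT.zetaz_mul_zl _ _ _ _ (List.mem_finRange i), zero_mul, smul_zero]
    have z12 : (OT.zz 1 2 * (OT.zt 1 2 * (OT.zt 0 1 * OT.um 1 0 1)) : OT K N (Star 3)) ∈ killed W := by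
      rw [OT.zt, OT.zt, ← OT.zl_zz, ← OT.zl_zz, OT.zz12_um]
      refine killed_zl H _ _ _ ?_
      rw [OT.um, pow_one, pow_zero, pow_zero, mul_one, mul_one]
      exact p01
    have z01 : (OT.zz 0 1 * (OT.zt 1 2 * (OT.zt 0 1 * OT.um 1 0 1)) : OT K N (Star 3)) ∈ killed W := by
      rw [OT.zt_zt, mul_smul_comm, OT.zt, OT.zt, ← OT.zl_zz, ← OT.zl_zz, OT.zz01_um]
      refine Submodule.smul_mem _ _ (killed_zl H _ _ _ ?_)
      rw [OT.um, pow_one, pow_zero, pow_zero, one_mul, one_mul]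
      exact p12
    have z02 : (OT.zz 0 2 * (OT.zt 1 2 * (OT.zt 0 1 * OT.um 1 0 1)) : OT K N (Star 3)) ∈ killed W := by
      rw [OT.zz_add 0 1 2, sub_mul, add_mul, Finset.sum_mul, Finset.sum_eq_zero, sub_zero]
      · exact Submodule.add_mem _ z01 z12
      · intro i _
        rw [mul_assoc, y12, mul_zero]
    intro v
    have := M.fibQ_fixed Set.univ (W (v ⊗ₜ[K] (OT.zt 1 2 * (OT.zt 0 1 * OT.um 1 0 1))))
      (fun k _ => by
        rcases fin2_cases k with rfl | rfl
        · exact Z 0 2 _ z02 v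
        · exact Z 1 2 _ z12 v)
      (fun k _ i => by
        rcases fin2_cases k with rfl | rfl
        · exact Y 0 2 i _ (by rw [y02]; exact Submodule.zero_mem _) v
        · exact Y 1 2 i _ (by rw [y12]; exact Submodule.zero_mem _) v)
      (![2] ∘ fun _ => 0) (fun k hk => absurd (Set.mem_univ k) hk)
    rw [← this, ← fibQ_comp, hq, map_zero]
  have q3 : (OT.zt 1 2 * (OT.zt 0 1 * OT.um 0 1 1) : OT K N (Star 3)) ∈ killed W :=
    killed_rot hW (by rw [OT.map_rot_poles]; exact Submodule.smul_mem _ _ q2)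
  have q1 : (OT.zt 1 2 * (OT.zt 0 1 * OT.um 1 1 0) : OT K N (Star 3)) ∈ killed W :=
    killed_rot hW (by rw [OT.map_rot_poles]; exact Submodule.smul_mem _ _ q3)
  exact H.eq_zero_three q1 q2 q3

end Vanishing

variable {br : V →ₗ[K] V →ₗ[K] KPoly K 1 N ⊗[K] V} {mu : V →ₗ[K] V →ₗ[K] V} {r : K}
  {X : M.sh.Src (Star 2) →ₗ[K] M.sh.VNabla 2}

theorem extPoly_add (q : ZMod 2) (f g : V →ₗ[K] KPoly K n N ⊗[K] V) :
    extPoly q (f + g) = extPoly q f + extPoly q g := TensorProduct.ext' fun a v => by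
  simp [extPoly]

theorem iv_eq_zero {v : V} (h : M.iv 1 v = 0) : v = 0 := by
  have h1 : M.iv 2 v = M.inc 1 (1 ⊗ₜ[K] v) := by rw [inc_tmul, map_one, one_smul]
  have h2 := M.fibQ_iv (fun _ : Fin 2 => (0 : Fin 1)) v
  rw [h, map_zero, h1] at h2
  rw [← KPoly.cst_one (K := K) (N := N) v, M.inc_injective (h2.symm.trans (map_zero _).symm), map_zero]

theorem Enc.mem_MCodd_iff (E : M.Enc r X br mu) : X ∈ M.sh.MCodd ↔ M.IsNonunitalVA br mu := by
  have B := E.base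
  have hr : r ≠ 0 := fun h => by simpa [h] using E.sq
  have hs : ∀ p : ZMod 2, sg K p ≠ 0 := fun p h => by simpa [h] using sg_mul_self K p
  have hop := (M.sh.opS_iff 1 X).1 (by rw [sg_one]; exact E.op)
  constructor
  · rintro ⟨-, -, hX, h⟩
    have hX := (M.sh.symAct_eq_iff X).1 hX
    have sy := E.sym_iff.1 hX
    exact
      { lie :=
        { parity := fun p q a ha b hb => B.par_of_mem ha hb
          sesq_left := B.left
          sesq_right := fun i p a ha b => by
            have := B.right i a b
            rw [M.eps_of_mem ha, LinearMap.map_smul₂] at this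
            rw [sg_add, mul_smul]
            refine Eq.trans ?_ (congrArg (sg K p • ·) this)
            beta_reduce
            rw [smul_smul, sg_mul_self, one_smul]
          skew := sy.1
          jacobi := fun p q a ha b hb => by
            refine M.hom_induction (fun s c hc => ?_) fun c c' h1 h2 => ?_
            · have := E.box_one hX ha hb hc
              rw [h, LinearMap.zero_apply] at this
              have := M.sh.inc_injective (((smul_eq_zero.1 this.symm).resolve_left (hs _)).trans (map_zero _).symm)
              exact (sub_eq_zero.1 this).symm
            · simp only [map_add, LinearMap.comp_add, extPoly_add, LinearMap.add_apply, h1, h2, smul_add]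
              abel }
        mul_mem := fun p q a ha b hb => B.mul_mem ha hb
        der := fun i p a ha b => by
          rw [B.der, M.eps_of_mem ha, LinearMap.map_smul₂]
        quasi_comm := sy.2
        quasi_assoc := fun p q a ha b hb => by
          refine M.hom_induction (fun s c hc => ?_) fun c c' h1 h2 => ?_
          · have := E.box_two_poles hX ha hb hc
            rw [h, LinearMap.zero_apply, map_zero] at this
            exact sub_eq_zero.1 (iv_eq_zero ((smul_eq_zero.1 this.symm).resolve_left (hs _)))
          · simp only [map_add, smul_add, add_sub_add_comm, h1, h2]
            abel
        wick := fun p q a ha b hb => by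
          refine M.hom_induction (fun s c hc => ?_) fun c c' h1 h2 => ?_
          · have := E.box_pole hX ha hb hc
            rw [h, LinearMap.zero_apply, map_zero] at this
            have := M.sh.inc_injective (((smul_eq_zero.1 this.symm).resolve_left (mul_ne_zero hr (hs _))).trans
              (map_zero _).symm)
            exact (sub_eq_zero.1 this).symm
          · simp only [map_add, LinearMap.comp_add, extPoly_add, LinearMap.add_apply, h1, h2, smul_add,
              TensorProduct.map_add_right]
            abel }
  · intro A
    have hX := E.sym_iff.2 ⟨A.lie.skew, A.quasi_comm⟩
    refine ⟨hop.1, hop.2, (M.sh.symAct_eq_iff X).2 hX, ?_⟩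
    refine (box_opS E.op hX).eq_zero_of_values (box_rot E.op hX) (fun v => ?_) (fun v => ?_) (fun v => ?_)
    · refine LinearMap.congr_fun (M.hext3 (f := M.sh.box (n := 1) (m := 1) 1 X X ∘ₗ
        (TensorProduct.mk K _ _).flip 1) (g := 0) fun p q s a ha b hb c hc => ?_) v
      refine (E.box_one hX ha hb hc).trans ?_
      rw [sub_eq_zero.2 (A.lie.jacobi p q a ha b hb c).symm, map_zero, smul_zero]; rfl
    · refine LinearMap.congr_fun (M.hext3 (f := M.sh.fibQ ![0, 2] ∘ₗ M.sh.box (n := 1) (m := 1) 1 X X ∘ₗ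
        (TensorProduct.mk K _ _).flip (OT.ez 1 2 OT.s312)) (g := 0) fun p q s a ha b hb c hc => ?_) v
      refine (E.box_pole hX ha hb hc).trans ?_
      rw [sub_eq_zero.2 (A.wick p q a ha b hb c).symm, map_zero, smul_zero]; rfl
    · refine LinearMap.congr_fun (M.hext3 (f := M.sh.fibQ ![2] ∘ₗ M.sh.box (n := 1) (m := 1) 1 X X ∘ₗ
        (TensorProduct.mk K _ _).flip (OT.zt 1 2 * (OT.zt 0 1 * OT.um 1 0 1))) (g := 0)
        fun p q s a ha b hb c hc => ?_) v
      refine (E.box_two_poles hX ha hb hc).trans ?_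
      rw [sub_eq_zero.2 (A.quasi_assoc p q a ha b hb c), map_zero, smul_zero]; rfl

theorem IsNonunitalVA.base (A : M.IsNonunitalVA br mu) : M.Base br mu where
  par a b := by
    induction a using M.hom_induction with
    | ha a a' h h' => simp only [map_add, LinearMap.add_apply, h, h', smul_add]
    | h p a ha =>
      induction b using M.hom_induction with
      | ha b b' h h' => simp only [map_add, h, h', smul_add]
      | h q b hb =>
        rw [A.lie.parity p q a ha b hb, M.eps_of_mem ha, M.eps_of_mem hb, LinearMap.map_smul₂, map_smul, smul_smul,
          smul_smul, ← sg_add, ← sg_add]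
        congr 2
        ring
  left := A.lie.sesq_left
  right i a b := by
    induction a using M.hom_induction with
    | ha a a' h h' => simp only [map_add, LinearMap.add_apply, h, h', smul_add]; abel
    | h p a ha =>
      rw [M.eps_of_mem ha, LinearMap.map_smul₂, A.lie.sesq_right i p a ha b, sg_add, mul_smul, smul_smul (sg K p),
        sg_mul_self, one_smul]; rfl
  mul a b := by
    induction a using M.hom_induction with
    | ha a a' h h' => simp only [map_add, LinearMap.add_apply, h, h']
    | h p a ha =>
      induction b using M.hom_induction with
      | ha b b' h h' => simp only [map_add, h, h']
      | h q b hb =>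
        rw [M.eps_of_mem (A.mul_mem p q a ha b hb), M.eps_of_mem ha, M.eps_of_mem hb, LinearMap.map_smul₂, map_smul,
          smul_smul, ← sg_add]
  der i a b := by
    induction a using M.hom_induction with
    | ha a a' h h' => simp only [map_add, LinearMap.add_apply, h, h']; abel
    | h p a ha => rw [A.der i p a ha, M.eps_of_mem ha, LinearMap.map_smul₂]

end HKMod

end

end

end SusyK

theorem mainTheorem2 {K : Type*} [Field K] [CharZero K] {N : ℕ} (hN : 0 < N)
    {V : Type*} [AddCommGroup V] [Module K V] (M : SusyK.HKMod K N V) :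
    (∀ X ∈ (M.shift (N + 1)).MCodd, M.IsNonunitalVA (M.bracketOf X) (M.mulOf X)) ∧
    Set.BijOn (fun X => (M.bracketOf X, M.mulOf X)) (M.shift (N + 1)).MCodd
      {q | M.IsNonunitalVA q.1 q.2} := by
  obtain ⟨r, hr, h⟩ := SusyK.HKMod.exists_sign (K := K) (N := N) (V := V)
  have enc : ∀ X ∈ (M.shift (N + 1)).MCodd, M.Enc r X (M.bracketOf X) (M.mulOf X) := fun X hX =>
    SusyK.HKMod.exists_enc (by
      have := (M.sh.opS_iff 1 X).2 ⟨hX.1, hX.2.1⟩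
      rwa [SusyK.sg_one] at this) hr h
  have va : ∀ X ∈ (M.shift (N + 1)).MCodd, M.IsNonunitalVA (M.bracketOf X) (M.mulOf X) :=
    fun X hX => (enc X hX).mem_MCodd_iff.1 hX
  refine ⟨va, va, fun X hX Y hY hXY => ?_, fun q hq => ?_⟩
  · have e := enc X hX
    rw [show M.bracketOf X = M.bracketOf Y from congrArg Prod.fst hXY,
      show M.mulOf X = M.mulOf Y from congrArg Prod.snd hXY] at e
    exact e.ext (enc Y hY)
  · obtain ⟨X, E⟩ := hq.base.exists_op hN hr h
    have e := (SusyK.HKMod.exists_enc E.op hr h).unique E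
    exact ⟨X, E.mem_MCodd_iff.2 hq, Prod.ext e.1 e.2⟩
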